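/- \textbf{Model.} There are $n$ processors $1,\dots,n$ with a channel from each processor to every processor; messages may be arbitrarily delayed and reordered but are not corrupted. An execution is a sequence of delivery steps (one message in transit is put into the recipient's inbox) and computation steps; in a computation step a processor receives all messages delivered since its last one, replies to requests, and, if possible, goes on with its local computation (with random choices) and sends new messages. A call $\mathrm{communicate}(m)$ sends $m$ to all $n$ processors and waits for more than $n/2$ acknowledgements. On $(\mathrm{propagate},v)$ the recipient updates its view of the variable (a value never overwrites a newer one of the same variable) and acknowledges; on $(\mathrm{collect},v)$ it acknowledges with its view of $v$, and the call returns all views received. Processors answer requests also after they have returned. The strong adaptive adversary chooses each next step, and the time that passes before it, as a function of the whole history of system states, including the outcomes of all coin flips. A processor is non-faulty if it takes computation steps infinitely often and all its messages are eventually delivered; at most $\lceil n/2\rceil-1$ processors are faulty. For given $t_1,t_2\ge 0$, unknown to the algorithm, the adversary must, almost surely, deliver every message of a non-faulty processor within time $t_1$ and schedule its first step, and each subsequent one, within time $t_2$. \textbf{Renaming algorithm} (processor $i$; names $1,\dots,n$; all entries of $\mathrm{Contended}$ are initially false). Repeat: collect $\mathrm{Contended}$ and set to true in one's own array every entry that is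 true in some received view; propagate the set $S$ of all entries of one's array that are now true; choose a name $u\notin S$ uniformly at random and set one's own $\mathrm{Contended}[u]$ to true; run $\mathrm{LeaderElect}_u$; propagate $\mathrm{Contended}[u]=$ true; if the outcome was WIN, return the name $u$. $\mathrm{LeaderElect}_u$ (one instance of all variables for each name $u$). \emph{Doorway:} collect $\mathrm{door}$ (initially false) and return LOSE if some received value is true; otherwise set $\mathrm{door}$ to true and propagate it. Then for $r=1,2,\dots$: \emph{Pre-round:} set $\mathrm{Round}[i]=r$ (initially all entries are $0$), propagate it, collect $\mathrm{Round}$, and let $R$ be the largest entry $\mathrm{Round}[j]$, $j\ne i$, in the received views; return LOSE if $R>r$ and WIN if $R<r-1$. \emph{Heterogeneous PoisonPill} (a separate array $\mathrm{Status}$, initially $\bot$, for each $r$): set $\mathrm{Status}[i]=(\mathrm{Commit},\emptyset)$ and propagate it; collect $\mathrm{Status}$ and let $\ell$ be the set of $j$ with a non-$\bot$ entry in some received view; with probability $1$ if $|\ell|=1$, and $\log_2|\ell|/|\ell|$ otherwise, set $\mathrm{Status}[i]=(\mathrm{High},\ell)$, else $\mathrm{Status}[i]=(\mathrm{Low},\ell)$;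 propagate $\mathrm{Status}[i]$; collect $\mathrm{Status}$. If $i$ has low priority, let $L$ be the set of all $j$ with a non-$\bot$ entry in some received view together with all members of the lists in the received entries; if for some $j\in L$ no received view shows $j$ with low priority, return LOSE. Otherwise continue with round $r+1$. \textbf{Theorem.} The time complexity of this renaming algorithm is $O(\log^2 n)$: there is a constant $C>0$ such that for all $n\ge 2$, all $t_1,t_2\ge0$ and every adversary as above, when all $n$ processors run the algorithm from time $0$, the expected time before all non-faulty processors have returned a name is at most $C\,\log^2 n\,(t_1+t_2)$. -/

import Mathlib

open scoped NNReal ENNReal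
open MeasureTheory

noncomputable section

namespace Renaming

open scoped Classical

/-! ## Shared variables and the communicate primitive

Processors and names are both indexed by `Fin n`. -/

/-- The three kinds of status used in the heterogeneous PoisonPill. -/
inductive Stat
  | commit
  | low
  | high

/-- A (non-`⊥`) entry of a `Status` array: a state together with a list of processors. -/
structure Status (n : ℕ) where
  stat : Stat
  list : Finset (Fin n)

/-- A processor's local view of all the variables of the protocol. `contended` belongs to the
renaming loop (the set of `j` with `Contended[j] = true`). The others belong to the leader elections:
`door u` and `round u` (an array indexed by processors) to the one for the name `u`, and `status u r`
(an array, `none` being `⊥`) to the PoisonPill of round `r` of the one for the name `u`. -/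
structure View (n : ℕ) where
  contended : Finset (Fin n)
  door : Fin n → Bool
  round : Fin n → Fin n → ℕ
  status : Fin n → ℕ → Fin n → Option (Status n)

/-- The initial values. -/
def View.initial (n : ℕ) : View n where
  contended := ∅
  door := fun _ => false
  round := fun _ _ => 0
  status := fun _ _ _ => none

/-- Local assignment `Round_u[i] ← r`. -/
def View.setRound {n : ℕ} (V : View n) (u i : Fin n) (r : ℕ) : View n :=
  { V with round := Function.update V.round u (Function.update (V.round u) i r) }

/-- Local assignment `Status_{u,r}[i] ← s`. -/
def View.setStatus {n : ℕ} (V : View n) (u : Fin n) (r : ℕ) (i : Fin n) (s : Status n) : View n :=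
  { V with
    status := Function.update V.status u
      (Function.update (V.status u) r (Function.update (V.status u r) i (some s))) }

/-- Local assignment `door_u ← true`. -/
def View.closeDoor {n : ℕ} (V : View n) (u : Fin n) : View n :=
  { V with door := Function.update V.door u true }

/-- The arguments of `communicate`: a propagated value or a variable to collect. -/
inductive Call (n : ℕ)
  | propContended (S : Finset (Fin n))
  | colContended
  | propDoor (u : Fin n)
  | colDoor (u : Fin n)
  | propRound (u i : Fin n) (r : ℕ)
  | colRound (u : Fin n)
  | propStatus (u : Fin n) (r : ℕ) (i : Fin n) (s : Status n)
  | colStatus (u : Fin n) (r : ℕ)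

/-- The recipient's update of its view. Channels may reorder messages, so a propagated value that
is older than the one in the view (a smaller round, or `Commit` once the priority of the same
processor is known) does not overwrite it. -/
def Call.update {n : ℕ} : Call n → View n → View n
  | .propContended S, V => { V with contended := V.contended ∪ S }
  | .propDoor u, V => V.closeDoor u
  | .propRound u i r, V => V.setRound u i (max (V.round u i) r)
  | .propStatus u r i s, V =>
      if s.stat = Stat.commit ∧ V.status u r i ≠ none then V else V.setStatus u r i s
  | _, V => V

/-- The content of the acknowledgement: the recipient's view of the collected variable,
everything else being blank; for a propagated value there is no content. -/
def Call.answer {n : ℕ} : Call n → View n → View n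
  | .colContended, V => { View.initial n with contended := V.contended }
  | .colDoor u, V => { View.initial n with door := Function.update (fun _ => false) u (V.door u) }
  | .colRound u, V =>
      { View.initial n with round := Function.update (fun _ _ => 0) u (V.round u) }
  | .colStatus u r, V =>
      { View.initial n with
        status := Function.update (fun _ _ _ => none) u
          (Function.update (fun _ _ => none) r (V.status u r)) }
  | _, _ => View.initial n

/-! ## The algorithm -/

/-- Control state of a processor: which `communicate` call it is waiting for, or that it has not
started, or that it has returned a name. `S` is the set of names known to be contended, as
propagated before picking a name, `u` is the current `spot`, `r` the current round of the
leader election for `u`, and `s` the priority status after the coin flip of the PoisonPill. -/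
inductive PC (n : ℕ)
  | start
  | colContended
  | propContended (S : Finset (Fin n))
  | doorCol (u : Fin n)
  | doorProp (u : Fin n)
  | roundProp (u : Fin n) (r : ℕ)
  | roundCol (u : Fin n) (r : ℕ)
  | commitProp (u : Fin n) (r : ℕ)
  | statusCol (u : Fin n) (r : ℕ)
  | prioProp (u : Fin n) (r : ℕ) (s : Status n)
  | prioCol (u : Fin n) (r : ℕ) (s : Status n)
  | outcomeProp (u : Fin n) (win : Bool)
  | returned (u : Fin n)

/-- The `communicate` call that processor `p` makes on entering a state. -/
def PC.call {n : ℕ} (p : Fin n) : PC n → Option (Call n)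
  | .start => none
  | .colContended => some .colContended
  | .propContended S => some (.propContended S)
  | .doorCol u => some (.colDoor u)
  | .doorProp u => some (.propDoor u)
  | .roundProp u r => some (.propRound u p r)
  | .roundCol u _ => some (.colRound u)
  | .commitProp u r => some (.propStatus u r p ⟨Stat.commit, ∅⟩)
  | .statusCol u r => some (.colStatus u r)
  | .prioProp u r s => some (.propStatus u r p s)
  | .prioCol u r _ => some (.colStatus u r)
  | .outcomeProp u _ => some (.propContended {u})
  | .returned _ => none

/-- A uniformly random element of `S`, computed from a uniform `c ∈ [0,1]` (`none` if `S = ∅`). -/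
def pickUniform {n : ℕ} (S : Finset (Fin n)) (c : unitInterval) : Option (Fin n) :=
  (S.sort (· ≤ ·))[min ⌊(c : ℝ) * S.card⌋₊ (S.card - 1)]?

/-- The bias of the PoisonPill coin: `1` if `|ℓ| = 1`, and `log₂ |ℓ| / |ℓ|` otherwise. -/
def bias (k : ℕ) : ℝ := if k = 1 then 1 else Real.logb 2 k / k

/-- The views that were received. -/
def received {n : ℕ} (views : Fin n → Option (View n)) : Set (View n) :=
  {W | ∃ k, views k = some W}

/-- The processors that have a non-`⊥` status in some received view. -/
def participants {n : ℕ} (views : Fin n → Option (View n)) (u : Fin n) (r : ℕ) : Finset (Fin n) :=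
  {j | ∃ W ∈ received views, W.status u r j ≠ none}

/-- The set `L` of the PoisonPill: all observed participants and all members of observed lists. -/
def learned {n : ℕ} (views : Fin n → Option (View n)) (u : Fin n) (r : ℕ) : Finset (Fin n) :=
  ({j | ∃ W ∈ received views, ∃ i s, W.status u r i = some s ∧ j ∈ s.list} : Finset (Fin n)) ∪
    participants views u r

/-- The largest round of a processor other than `p` in the received views. -/
def maxRound {n : ℕ} (p : Fin n) (views : Fin n → Option (View n)) (u : Fin n) : ℕ :=
  Finset.univ.sup fun k => (Finset.univ.erase p).sup fun j =>
    match views k with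
    | some W => W.round u j
    | none => 0

/-- The local computation of processor `p` between the completion of one `communicate` call
(with received `views`) and the next one. `V` is `p`'s own view, and `c` is uniform in `[0,1]`. -/
def next {n : ℕ} (p : Fin n) (V : View n) (views : Fin n → Option (View n)) (c : unitInterval) :
    PC n → View n × PC n
  | .start => (V, .colContended)
  -- mark the names that became contended
  | .colContended =>
      let S := V.contended ∪ ({j | ∃ W ∈ received views, j ∈ W.contended} : Finset (Fin n))
      ({ V with contended := S }, .propContended S)
  -- once the known contended names are propagated, pick a random other name and contend for it
  -- (`Sᶜ` is never empty in an execution)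
  | .propContended S =>
      match pickUniform Sᶜ c with
      | some u => ({ V with contended := insert u V.contended }, .doorCol u)
      | none => (V, .colContended)
  -- doorway
  | .doorCol u =>
      if ∃ W ∈ received views, W.door u = true then (V, .outcomeProp u false)
      else (V.closeDoor u, .doorProp u)
  | .doorProp u => (V.setRound u p 1, .roundProp u 1)
  -- pre-round of round `r`
  | .roundProp u r => (V, .roundCol u r)
  | .roundCol u r =>
      if r < maxRound p views u then (V, .outcomeProp u false)
      else if maxRound p views u + 1 < r then (V, .outcomeProp u true)
      else (V.setStatus u r p ⟨Stat.commit, ∅⟩, .commitProp u r)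
  -- heterogeneous PoisonPill of round `r`
  | .commitProp u r => (V, .statusCol u r)
  | .statusCol u r =>
      let ℓ := participants views u r
      let s : Status n := if (c : ℝ) ≤ bias ℓ.card then ⟨Stat.high, ℓ⟩ else ⟨Stat.low, ℓ⟩
      (V.setStatus u r p s, .prioProp u r s)
  | .prioProp u r s => (V, .prioCol u r s)
  | .prioCol u r s =>
      if s.stat = Stat.low ∧ ∃ j ∈ learned views u r, ∀ W ∈ received views,
          ∀ s', W.status u r j = some s' → s'.stat ≠ Stat.low
      then (V, .outcomeProp u false)
      else (V.setRound u p (r + 1), .roundProp u (r + 1))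
  -- return the name if the leader election was won, else start the next loop iteration
  | .outcomeProp u win => if win then (V, .returned u) else (V, .colContended)
  | .returned u => (V, .returned u)

/-! ## The asynchronous message-passing system -/

/-- Messages: the request of a `communicate` call, tagged with the sender's call number, and the
acknowledgement carrying the same number. -/
inductive Body (n : ℕ)
  | request (id : ℕ) (call : Call n)
  | ack (id : ℕ) (W : View n)

structure Packet (n : ℕ) where
  src : Fin n
  dst : Fin n
  body : Body n

/-- State of one processor. `callId` numbers its `communicate` calls, `replies` holds the
acknowledgements of the current call received so far, and `inbox` the messages delivered since its
last computation step. -/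
structure Local (n : ℕ) where
  pc : PC n
  view : View n
  callId : ℕ
  replies : Fin n → Option (View n)
  inbox : List (Packet n)

/-- Global state: the processors, all messages ever sent (in order of sending), and the positions
in that list of the messages already delivered. -/
structure Config (n : ℕ) where
  procs : Fin n → Local n
  packets : List (Packet n)
  delivered : Finset ℕ

def Config.initial (n : ℕ) : Config n where
  procs := fun _ => ⟨.start, View.initial n, 0, fun _ => none, []⟩
  packets := []
  delivered := ∅

/-- Processor `p` receives one message: it updates its view and answers a request, or records an
acknowledgement of its current call. Returns the new state and the messages sent. -/
def receive {n : ℕ} (p : Fin n) (L : Local n) (m : Packet n) : Local n × List (Packet n) :=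
  match m.body with
  | .request id call =>
      let V := call.update L.view
      ({ L with view := V }, [⟨p, m.src, .ack id (call.answer V)⟩])
  | .ack id W =>
      (if id = L.callId then { L with replies := Function.update L.replies m.src (some W) } else L,
        [])

/-- Processor `p` receives the messages of a list, in order. -/
def receiveAll {n : ℕ} (p : Fin n) : Local n → List (Packet n) → Local n × List (Packet n)
  | L, [] => (L, [])
  | L, m :: ms =>
      let R := receive p L m
      let R' := receiveAll p R.1 ms
      (R'.1, R.2 ++ R'.2)

/-- The processor can go on with its protocol: it has yet to start, or more than `n / 2` processors
have acknowledged its current call. -/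
def Local.ready {n : ℕ} (L : Local n) : Prop :=
  match L.pc with
  | .start => True
  | .returned _ => False
  | _ => n < 2 * (Finset.univ.filter fun k => (L.replies k).isSome).card

/-- Go on with the protocol up to the next `communicate` call, whose message goes to all `n`
processors. -/
def advance {n : ℕ} (p : Fin n) (L : Local n) (c : unitInterval) : Local n × List (Packet n) :=
  let N := next p L.view L.replies c L.pc
  ({ L with pc := N.2, view := N.1, callId := L.callId + 1, replies := fun _ => none },
    match N.2.call p with
    | some call => (List.finRange n).map fun j => ⟨p, j, .request (L.callId + 1) call⟩
    | none => [])

/-- A computation step of `p`: it receives all messages delivered since its last step (and replies,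
even after having returned), and then goes on with its protocol if it can. -/
def compute {n : ℕ} (p : Fin n) (L : Local n) (c : unitInterval) : Local n × List (Packet n) :=
  let R := receiveAll p { L with inbox := [] } L.inbox
  if R.1.ready then
    let R' := advance p R.1 c
    (R'.1, R.2 ++ R'.2)
  else R

/-- What the adversary schedules: the delivery of the `i`-th message ever sent, or a computation
step of a processor. -/
inductive Move (n : ℕ)
  | deliver (i : ℕ)
  | step (p : Fin n)

/-- Effect of a move; `c` is the random number used by a computation step. A message is delivered
at most once; the delivery of a message that is not in transit has no effect. -/
def Config.apply {n : ℕ} (K : Config n) (c : unitInterval) : Move n → Config n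
  | .deliver i =>
      if i ∈ K.delivered then K
      else match K.packets[i]? with
        | some m =>
            { K with
              procs := Function.update K.procs m.dst
                { K.procs m.dst with inbox := (K.procs m.dst).inbox ++ [m] }
              delivered := insert i K.delivered }
        | none => K
  | .step p =>
      let R := compute p (K.procs p) c
      { K with procs := Function.update K.procs p R.1, packets := K.packets ++ R.2 }

/-! ## Adversaries, executions and time complexity -/

/-- A strong adaptive adversary: from the complete history of global states (latest first, with
the outcomes of all coin flips) it chooses the next move and the time that passes before it. -/
abbrev Adversary (n : ℕ) := List (Config n) → Move n × ℝ≥0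

/-- Sequences of random numbers; the `k`-th one is used in the `k`-th move. -/
abbrev Coins := ℕ → unitInterval

/-- Independent uniform random numbers in `[0,1]`. -/
def coinMeasure : Measure Coins := Measure.infinitePi fun _ => (volume : Measure unitInterval)

variable {n : ℕ}

/-- The current global state and the earlier ones (latest first) after `k` moves. -/
def run (A : Adversary n) (ω : Coins) : ℕ → Config n × List (Config n)
  | 0 => (Config.initial n, [])
  | k + 1 =>
      let H := run A ω k
      (H.1.apply (ω k) (A (H.1 :: H.2)).1, H.1 :: H.2)

/-- The global state before the `k`-th move (moves are counted from `0`). -/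
def config (A : Adversary n) (ω : Coins) (k : ℕ) : Config n := (run A ω k).1

/-- The `k`-th choice of the adversary. -/
def choice (A : Adversary n) (ω : Coins) (k : ℕ) : Move n × ℝ≥0 :=
  A ((run A ω k).1 :: (run A ω k).2)

/-- The `k`-th move is a computation step of `p`. -/
def StepsAt (A : Adversary n) (ω : Coins) (p : Fin n) (k : ℕ) : Prop :=
  (choice A ω k).1 = .step p

/-- The time at which the `k`-th move takes place; the execution starts at time `0`. -/
def time (A : Adversary n) (ω : Coins) (k : ℕ) : ℝ≥0 :=
  ∑ i ∈ Finset.range (k + 1), (choice A ω i).2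

/-- Processor `p` sends the `i`-th message in the `k`-th move. -/
def Sends (A : Adversary n) (ω : Coins) (p : Fin n) (k i : ℕ) : Prop :=
  (config A ω k).packets.length ≤ i ∧
    ∃ m, (config A ω (k + 1)).packets[i]? = some m ∧ m.src = p

/-- The `i`-th message has been delivered once the `k`-th move is done. -/
def DeliveredBy (A : Adversary n) (ω : Coins) (k i : ℕ) : Prop :=
  i ∈ (config A ω (k + 1)).delivered

/-- `p` performs computation steps infinitely often, and all its messages are eventually
delivered. -/
def NonFaulty (A : Adversary n) (ω : Coins) (p : Fin n) : Prop :=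
  (∀ K, ∃ k ≥ K, StepsAt A ω p k) ∧ ∀ k i, Sends A ω p k i → ∃ k', DeliveredBy A ω k' i

/-- The messages of `p` are delivered within time `t₁`, and the first step of `p` and each
subsequent one are scheduled within time `t₂`. -/
def Timely (A : Adversary n) (ω : Coins) (t₁ t₂ : ℝ≥0) (p : Fin n) : Prop :=
  (∀ k i, Sends A ω p k i → ∃ k', DeliveredBy A ω k' i ∧ time A ω k' ≤ time A ω k + t₁) ∧
    (∃ k, StepsAt A ω p k ∧ time A ω k ≤ t₂) ∧
    ∀ k, StepsAt A ω p k → ∃ k' > k, StepsAt A ω p k' ∧ time A ω k' ≤ time A ω k + t₂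

/-- An admissible execution: at most `⌈n/2⌉ - 1` processors (that is, fewer than `n/2`) are faulty,
and the non-faulty ones are served within the time bounds `t₁` and `t₂`. -/
def Admissible (A : Adversary n) (ω : Coins) (t₁ t₂ : ℝ≥0) : Prop :=
  2 * (Finset.univ.filter fun p => ¬ NonFaulty A ω p).card < n ∧
    ∀ p, NonFaulty A ω p → Timely A ω t₁ t₂ p

/-- The time at which `p` returns a name (`∞` if it never does). -/
def returnTime (A : Adversary n) (ω : Coins) (p : Fin n) : ℝ≥0∞ :=
  ⨅ (k : ℕ) (_ : ∃ u, ((config A ω (k + 1)).procs p).pc = .returned u), (time A ω k : ℝ≥0∞)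

/-- The time before all non-faulty processors return. -/
def completionTime (A : Adversary n) (ω : Coins) : ℝ≥0∞ :=
  ⨆ (p : Fin n) (_ : NonFaulty A ω p), returnTime A ω p

/-- The renaming algorithm for `n` processors has time complexity at most `T`: for all `t₁`, `t₂`,
no adversary that respects them achieves an expected completion time above `T * (t₁ + t₂)`. -/
def TimeComplexityAtMost (n : ℕ) (T : ℝ) : Prop :=
  ∀ (t₁ t₂ : ℝ≥0) (A : Adversary n), (∀ᵐ ω ∂coinMeasure, Admissible A ω t₁ t₂) →
    ∫⁻ ω, completionTime A ω ∂coinMeasure ≤ ENNReal.ofReal (T * (t₁ + t₂))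

end Renaming

end

/-! A call of a non-faulty processor is completed within 2(t₁ + t₂): the request travels, the
recipient takes a step, the acknowledgement travels, the caller takes a step. Hence
(`returnTime_le`) it suffices to bound the number of calls of each processor by O(log² n), with
tails light enough for expectations. That number is at most a constant times the number of names
picked plus the number of rounds played in leader elections (`State.Bounded`).

Safety. Majorities intersect, so a collect sees everything that a majority knew when it started
(`Comm.exists_reply`). This yields an invariant `Sound` of the execution enriched by history
variables. Two consequences matter. First, the processors that pick a name cannot all lose its
election (`Sound.exists_notMem_lost`); as there are n names for n processors, the number f of names
never picked equals the number of processors without a name plus the total excess of holders over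
one per name (`Sound.card_free`). Second, once somebody has committed in round r ≥ 2 of an election,
only the processors that had reached round r - 1 by then can play in the rounds r - 1 and r
(`CapOk`).

Probability. The adversary is arbitrary, so each random quantity is controlled by a nonnegative
potential of the state that does not increase on average, whichever transition is scheduled
(`Super`); Ville's inequality bounds the probability that it ever becomes large
(`Super.measure_le`). There are four of them. `popularity`: a name is picked by O(log n) processors.
`singles`: the names picked once and not yet known to be contended number O(log n)(f + 1). With the
count of free names this leaves O(log n) f unknown names (`Sound.card_unknown_le`), so a pick finds
a free name with probability of order 1/log n, unless f was halved since the iteration began, which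
happens O(log n) times. `collisions`: the sum of these probabilities over the picks of one processor
is O(log n), and so is the number of its encounters with other processors. Hence it picks O(log² n)
names and meets O(log² n) competitors in all. `duration`: the total number of rounds is O(log n)
plus a constant times the number of competitors met. The reason is that in each round of the
PoisonPill some processor drops out with probability at least a positive constant: `roundValue`
starts at 249/250, does not increase on average, and is at least 1 if all survive
(`roundValue_flip`, `one_le_roundValue`).

Outside an event of probability at most 6/16^m, the number of calls is at most 8^m times O(log² n)
(`callId_le`), and summation over m bounds the expectation (`lintegral_le_of_tail`). -/

noncomputable section

namespace Renaming

open scoped Classical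

variable {n : ℕ}

/-! ## Processes driven by independent uniform coins -/

/-- A map on `[0,1]` that factors through a measurable map to a countable set. -/
def CountablyValued {σ : Type*} (g : unitInterval → σ) : Prop :=
  ∃ (s : unitInterval → ℕ) (F : ℕ → σ), Measurable s ∧ ∀ c, g c = F (s c)

/-- The state after `k` steps. -/
def trajectory {σ : Type*} (step : σ → unitInterval → σ) (x₀ : σ) (ω : Coins) : ℕ → σ
  | 0 => x₀
  | k + 1 => step (trajectory step x₀ ω k) (ω k)

lemma CountablyValued.const {σ : Type*} (x : σ) : CountablyValued (fun _ => x) :=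
  ⟨fun _ => 0, fun _ => x, measurable_const, fun _ => rfl⟩

lemma CountablyValued.comp {σ τ : Type*} {g : unitInterval → σ} (h : CountablyValued g)
    (f : σ → τ) : CountablyValued (fun c => f (g c)) := by
  obtain ⟨s, F, hs, hF⟩ := h
  exact ⟨s, fun m => f (F m), hs, fun c => by simp only [hF]⟩

/-- The states carry no σ-algebra and the adversary is an arbitrary function. Measurability is
recovered from discreteness: the state depends on the coins only through an integer, which codes by
`Nat.pair` the code of the previous state and the outcome of the last step. -/
lemma trajectory_factor {σ : Type*} {step : σ → unitInterval → σ}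
    (hstep : ∀ x, CountablyValued (step x)) (x₀ : σ) (k : ℕ) :
    ∃ (s : ((i : Finset.range k) → unitInterval) → ℕ) (F : ℕ → σ), Measurable s ∧
      ∀ ω : Coins, trajectory step x₀ ω k = F (s (fun i => ω i)) := by
  induction k with
  | zero => exact ⟨fun _ => 0, fun _ => x₀, measurable_const, fun _ => rfl⟩
  | succ k ih =>
    obtain ⟨s, F, hs, hF⟩ := ih
    choose t G ht hG using hstep
    let res : ((i : Finset.range (k + 1)) → unitInterval) → ((i : Finset.range k) → unitInterval) :=
      fun w i => w ⟨i.1, by have := Finset.mem_range.1 i.2; simp; omega⟩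
    have hres : Measurable res := by
      rw [measurable_pi_iff]; intro i; exact measurable_pi_apply _
    let last : ((i : Finset.range (k + 1)) → unitInterval) → unitInterval :=
      fun w => w ⟨k, by simp⟩
    have hlast : Measurable last := measurable_pi_apply _
    have h2 : Measurable (fun q : ℕ × unitInterval => t (F q.1) q.2) :=
      measurable_from_prod_countable_right fun m => ht (F m)
    refine ⟨fun w => Nat.pair (s (res w)) (t (F (s (res w))) (last w)),
      fun m => G (F (Nat.unpair m).1) (Nat.unpair m).2, ?_, ?_⟩
    · have h3 : Measurable (fun w => (s (res w), t (F (s (res w))) (last w))) :=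
        (hs.comp hres).prodMk (h2.comp ((hs.comp hres).prodMk hlast))
      exact (Measurable.of_discrete (f := fun q : ℕ × ℕ => Nat.pair q.1 q.2)).comp h3
    · intro ω
      simp only [trajectory, Nat.unpair_pair]
      rw [hF ω, hG]

instance : IsProbabilityMeasure coinMeasure := by
  unfold coinMeasure; infer_instance

/-- Conditional expectation by hand: the past splits into countably many events, on each of which
its code is a fixed m and the state is `F m`; the coin with index k is independent of them. -/
lemma lintegral_trajectory_succ_le {σ : Type*} {step : σ → unitInterval → σ}
    (hstep : ∀ x, CountablyValued (step x)) {x₀ : σ} {good : σ → Prop}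
    (hgood : ∀ ω k, good (trajectory step x₀ ω k)) {φ : σ → ℝ≥0∞}
    (hφ : ∀ x, good x → ∫⁻ c, φ (step x c) ≤ φ x) (k : ℕ) :
    ∫⁻ ω, φ (trajectory step x₀ ω (k + 1)) ∂coinMeasure ≤
      ∫⁻ ω, φ (trajectory step x₀ ω k) ∂coinMeasure := by
  obtain ⟨s, F, hs, hF⟩ := trajectory_factor hstep x₀ k
  have hsm : Measurable (fun ω : Coins => s (fun i => ω i)) := by
    apply hs.comp; rw [measurable_pi_iff]; intro i; exact measurable_pi_apply _
  have hind : ProbabilityTheory.iIndepFun (fun (i : ℕ) (ω : Coins) => ω i) coinMeasure :=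
    ProbabilityTheory.iIndepFun_infinitePi (X := fun _ => id) (fun _ => measurable_id)
  have hind2 := hind.indepFun_finset (Finset.range k) {k} (by simp) (fun i => measurable_pi_apply i)
  choose t G ht hG using hstep
  have hint : ∀ m, ∫⁻ ω, φ (step (F m) (ω k)) ∂coinMeasure = ∫⁻ c, φ (step (F m) c) := by
    intro m
    have hm : Measurable (fun c => φ (step (F m) c)) := by
      have : (fun c => φ (step (F m) c)) = (fun j => φ (G (F m) j)) ∘ (t (F m)) := by
        ext c; simp [hG]
      rw [this]; exact measurable_from_top.comp (ht _)
    have := (measurePreserving_eval_infinitePi (fun _ : ℕ => (volume : Measure unitInterval)) k)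
    exact this.lintegral_comp hm
  have hmeas : ∀ m, Measurable (fun ω : Coins => φ (step (F m) (ω k))) := by
    intro m
    have : (fun ω : Coins => φ (step (F m) (ω k))) = (fun j => φ (G (F m) j)) ∘ (t (F m)) ∘ (fun ω => ω k) := by
      ext c; simp [hG]
    rw [this]; exact measurable_from_top.comp ((ht _).comp (measurable_pi_apply k))
  have key : ∀ m, ∫⁻ ω, (if s (fun i => ω i) = m then 1 else 0) * φ (step (F m) (ω k)) ∂coinMeasure
      ≤ ∫⁻ ω, (if s (fun i => ω i) = m then 1 else 0) * φ (F m) ∂coinMeasure := by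
    intro m
    by_cases hgm : good (F m)
    · have h1 : Measurable (fun j : ℕ => if j = m then (1 : ℝ≥0∞) else 0) := measurable_from_top
      have hI : ProbabilityTheory.IndepFun (fun ω : Coins => if s (fun i => ω i) = m then (1 : ℝ≥0∞) else 0)
          (fun ω : Coins => φ (step (F m) (ω k))) coinMeasure := by
        have := hind2.comp (φ := fun w => if s w = m then (1 : ℝ≥0∞) else 0)
          (ψ := fun w : (({k} : Finset ℕ) → unitInterval) => φ (step (F m) (w ⟨k, by simp⟩)))
          (h1.comp hs) (by
            have h : (fun w : (({k} : Finset ℕ) → unitInterval) => φ (step (F m) (w ⟨k, by simp⟩))) =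
              (fun j => φ (G (F m) j)) ∘ (t (F m)) ∘ (fun w => w ⟨k, by simp⟩) := by
              ext c; simp [hG]
            rw [h]; exact measurable_from_top.comp ((ht _).comp (measurable_pi_apply _)))
        exact this
      have hprod := ProbabilityTheory.lintegral_mul_eq_lintegral_mul_lintegral_of_indepFun
        (h1.comp hsm) (hmeas m) hI
      simp only [Pi.mul_apply] at hprod
      rw [show (fun ω : Coins => (if s (fun i => ω i) = m then (1:ℝ≥0∞) else 0) * φ (step (F m) (ω k))) =
        (((fun j : ℕ => if j = m then (1 : ℝ≥0∞) else 0) ∘ fun ω : Coins => s (fun i => ω i)) * fun ω => φ (step (F m) (ω k))) from rfl]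
      refine hprod.le.trans ?_
      rw [hint]
      have hc := lintegral_mul_const (μ := coinMeasure) (φ (F m)) (h1.comp hsm)
      simp only [Function.comp_apply] at hc ⊢
      rw [hc]
      gcongr
      exact hφ _ hgm
    -- Reached states are good, so if `F m` is not good, the event that the code is m is empty.
    · apply lintegral_mono
      intro ω
      by_cases h : s (fun i => ω i) = m
      · exact absurd (by rw [← h, ← hF]; exact hgood ω k) hgm
      · simp [h]
  have e1 : ∀ (H : ℕ → Coins → ℝ≥0∞) (ω : Coins), H (s (fun i => ω i)) ω =
      ∑' m, (if s (fun i => ω i) = m then 1 else 0) * H m ω := by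
    intro H ω
    rw [tsum_eq_single (s (fun i => ω i))]
    · simp
    · intro b hb; simp [hb.symm]
  have m1 : ∀ m, Measurable (fun ω : Coins => if s (fun i => ω i) = m then (1 : ℝ≥0∞) else 0) :=
    fun m => (measurable_from_top (f := fun j : ℕ => if j = m then (1 : ℝ≥0∞) else 0)).comp hsm
  calc ∫⁻ ω, φ (trajectory step x₀ ω (k + 1)) ∂coinMeasure
      = ∫⁻ ω, ∑' m, (if s (fun i => ω i) = m then 1 else 0) * φ (step (F m) (ω k)) ∂coinMeasure := by
        apply lintegral_congr; intro ω
        rw [← e1 (fun m ω => φ (step (F m) (ω k))) ω]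
        simp only [trajectory]; rw [hF]
    _ = ∑' m, ∫⁻ ω, (if s (fun i => ω i) = m then 1 else 0) * φ (step (F m) (ω k)) ∂coinMeasure :=
        lintegral_tsum fun m => ((m1 m).mul (hmeas m)).aemeasurable
    _ ≤ ∑' m, ∫⁻ ω, (if s (fun i => ω i) = m then 1 else 0) * φ (F m) ∂coinMeasure :=
        ENNReal.tsum_le_tsum key
    _ = ∫⁻ ω, ∑' m, (if s (fun i => ω i) = m then 1 else 0) * φ (F m) ∂coinMeasure :=
        (lintegral_tsum fun m => ((m1 m).mul_const _).aemeasurable).symm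
    _ = ∫⁻ ω, φ (trajectory step x₀ ω k) ∂coinMeasure := by
        apply lintegral_congr; intro ω
        rw [← e1 (fun m ω => φ (F m)) ω, hF]

lemma lintegral_trajectory_le {σ : Type*} {step : σ → unitInterval → σ}
    (hstep : ∀ x, CountablyValued (step x)) {x₀ : σ} {good : σ → Prop}
    (hgood : ∀ ω k, good (trajectory step x₀ ω k)) {φ : σ → ℝ≥0∞}
    (hφ : ∀ x, good x → ∫⁻ c, φ (step x c) ≤ φ x) (k : ℕ) :
    ∫⁻ ω, φ (trajectory step x₀ ω k) ∂coinMeasure ≤ φ x₀ := by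
  induction k with
  | zero => simp [trajectory]
  | succ k ih => exact (lintegral_trajectory_succ_le hstep hgood hφ k).trans ih

/-- Ville's inequality for a nonnegative function of the state that does not increase on average. -/
theorem measure_exists_ge_le {σ : Type*} {step : σ → unitInterval → σ}
    (hstep : ∀ x, CountablyValued (step x)) {x₀ : σ} {good : σ → Prop}
    (hgood : ∀ ω k, good (trajectory step x₀ ω k)) {φ : σ → ℝ≥0∞}
    (hφ : ∀ x, good x → ∫⁻ c, φ (step x c) ≤ φ x) {a : ℝ≥0∞} (ha : a ≠ 0) (ha' : a ≠ ∞) :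
    coinMeasure {ω | ∃ k, a ≤ φ (trajectory step x₀ ω k)} ≤ φ x₀ / a := by
  -- Stopping: the flag records that φ was at least a at an earlier step, and from then on φ' is
  -- frozen at a. Markov's inequality at time N bounds the probability of a crossing before N.
  let step' : σ × Bool → unitInterval → σ × Bool := fun x c => (step x.1 c, x.2 || decide (a ≤ φ x.1))
  let φ' : σ × Bool → ℝ≥0∞ := fun x => if x.2 then a else φ x.1
  have htr : ∀ ω k, trajectory step' (x₀, false) ω k = (trajectory step x₀ ω k,
      decide (∃ j < k, a ≤ φ (trajectory step x₀ ω j))) := by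
    intro ω k
    induction k with
    | zero => simp [trajectory]
    | succ k ih =>
      simp only [trajectory, step', ih, Prod.mk.injEq, true_and]
      rw [Bool.eq_iff_iff]
      simp only [Bool.or_eq_true, decide_eq_true_eq]
      constructor
      · rintro (⟨j, hj, h⟩ | h)
        · exact ⟨j, by omega, h⟩
        · exact ⟨k, by omega, h⟩
      · rintro ⟨j, hj, h⟩
        rcases Nat.lt_succ_iff_lt_or_eq.1 hj with h' | rfl
        · exact Or.inl ⟨j, h', h⟩
        · exact Or.inr h
  have hstep' : ∀ x, CountablyValued (step' x) := fun x =>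
    (hstep x.1).comp (fun y => (y, x.2 || decide (a ≤ φ x.1)))
  have hφ' : ∀ x : σ × Bool, good x.1 → ∫⁻ c, φ' (step' x c) ≤ φ' x := by
    rintro ⟨x, b⟩ hx
    cases b
    · by_cases h : a ≤ φ x
      · simp [φ', step', h]
      · simpa [φ', step', h] using hφ x hx
    · simp [φ', step']
  have hgood' : ∀ ω k, good (trajectory step' (x₀, false) ω k).1 := by
    intro ω k; rw [htr]; exact hgood ω k
  have hN : ∀ N, coinMeasure {ω | ∃ j < N, a ≤ φ (trajectory step x₀ ω j)} ≤ φ x₀ / a := by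
    intro N
    have h1 := lintegral_trajectory_le (good := fun x => good x.1) hstep' hgood' hφ' N
    rw [ENNReal.le_div_iff_mul_le (Or.inl ha) (Or.inl ha'), mul_comm]
    refine le_trans ?_ h1
    refine le_trans ?_ (mul_meas_ge_le_lintegral₀ ?_ a)
    · gcongr a * ?_
      apply measure_mono
      intro ω hω
      change ∃ j < N, a ≤ φ (trajectory step x₀ ω j) at hω
      change a ≤ φ' (trajectory step' (x₀, false) ω N)
      rw [htr]
      simp [φ', hω]
    · obtain ⟨s, F, hs, hF⟩ := trajectory_factor hstep' (x₀, false) N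
      have : (fun ω => φ' (trajectory step' (x₀, false) ω N)) =
          (fun m => φ' (F m)) ∘ s ∘ (fun ω i => ω i) := by
        ext ω; simp [hF]
      rw [this]
      refine (measurable_from_top.comp (hs.comp ?_)).aemeasurable
      rw [measurable_pi_iff]; intro i; exact measurable_pi_apply _
  have hU : {ω | ∃ k, a ≤ φ (trajectory step x₀ ω k)} =
      ⋃ N, {ω | ∃ j < N, a ≤ φ (trajectory step x₀ ω j)} := by
    ext ω
    simp only [Set.mem_ofPred_eq, Set.mem_iUnion]
    exact ⟨fun ⟨k, h⟩ => ⟨k + 1, k, by omega, h⟩, fun ⟨_, j, _, h⟩ => ⟨j, h⟩⟩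
  rw [hU, Monotone.measure_iUnion]
  · exact iSup_le hN
  · intro M N hMN ω
    rintro ⟨j, hj, h⟩
    exact ⟨j, by omega, h⟩

/-! ## The two kinds of random choices -/

lemma lintegral_bernoulli {b : ℝ} (hb0 : 0 ≤ b) (hb1 : b ≤ 1) (x y : ℝ≥0∞) :
    ∫⁻ c : unitInterval, (if (c : ℝ) ≤ b then x else y) =
      ENNReal.ofReal b * x + ENNReal.ofReal (1 - b) * y := by
  have hS : MeasurableSet {c : unitInterval | (c : ℝ) ≤ b} :=
    measurableSet_le measurable_subtype_coe measurable_const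
  have hvol : (volume : Measure unitInterval) {c | (c : ℝ) ≤ b} = ENNReal.ofReal b := by
    have : {c : unitInterval | (c : ℝ) ≤ b} = Set.Iic ⟨b, hb0, hb1⟩ := rfl
    rw [this]; simp
  have hvol' : (volume : Measure unitInterval) {c | (c : ℝ) ≤ b}ᶜ = ENNReal.ofReal (1 - b) := by
    rw [prob_compl_eq_one_sub hS, hvol, ENNReal.ofReal_sub _ hb0, ENNReal.ofReal_one]
  have := lintegral_add_compl (μ := (volume : Measure unitInterval))
    (fun c : unitInterval => if (c : ℝ) ≤ b then x else y) hS
  rw [← this, setLIntegral_congr_fun (g := fun _ => x) hS, setLIntegral_congr_fun (g := fun _ => y) hS.compl]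
  · simp [hvol, hvol', mul_comm]
  · intro c hc; simp at hc; simp [hc]
  · intro c hc; simp at hc; simp [hc]

lemma measurable_pickIndex (m : ℕ) :
    Measurable (fun c : unitInterval => min ⌊(c : ℝ) * m⌋₊ (m - 1)) :=
  ((Nat.measurable_floor.comp (measurable_subtype_coe.mul_const _))).min measurable_const

/-- The preimage of i lies between the half-open interval [i/m, (i+1)/m) and its closure. The
truncation at m - 1 only matters at c = 1. -/
lemma volume_pickIndex {m i : ℕ} (hi : i < m) :
    (volume : Measure unitInterval) {c | min ⌊(c : ℝ) * m⌋₊ (m - 1) = i} = (m : ℝ≥0∞)⁻¹ := by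
  have hm : (0 : ℝ) < m := by exact_mod_cast (by omega : 0 < m)
  have him : (i : ℝ) + 1 ≤ m := by exact_mod_cast hi
  have h0 : (0:ℝ) ≤ i / m := by positivity
  have h1 : ((i : ℝ) + 1) / m ≤ 1 := by rw [div_le_one hm]; exact him
  have h01 : (i : ℝ) / m ≤ (i + 1) / m := by gcongr; linarith
  let a : unitInterval := ⟨i / m, h0, h01.trans h1⟩
  let b : unitInterval := ⟨(i + 1) / m, h0.trans h01, h1⟩
  have hle : (volume : Measure unitInterval) (Set.Ico a b) = (m : ℝ≥0∞)⁻¹ := by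
    rw [unitInterval.volume_Ico]
    have : ((b : ℝ) - a) = (m : ℝ)⁻¹ := by simp only [a, b]; field_simp; ring
    rw [this, ENNReal.ofReal_inv_of_pos hm, ENNReal.ofReal_natCast]
  have hcc : (volume : Measure unitInterval) (Set.Icc a b) = (m : ℝ≥0∞)⁻¹ := by
    rw [unitInterval.volume_Icc]
    have : ((b : ℝ) - a) = (m : ℝ)⁻¹ := by simp only [a, b]; field_simp; ring
    rw [this, ENNReal.ofReal_inv_of_pos hm, ENNReal.ofReal_natCast]
  apply le_antisymm
  · rw [← hcc]
    apply measure_mono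
    rintro c hc
    simp only [Set.mem_ofPred_eq] at hc
    have hfl : ((⌊(c : ℝ) * m⌋₊ : ℕ) : ℝ) ≤ c * m := Nat.floor_le (mul_nonneg c.2.1 hm.le)
    have hi' : i ≤ ⌊(c : ℝ) * m⌋₊ := by omega
    constructor
    · change (i : ℝ) / m ≤ c
      rw [div_le_iff₀ hm]
      exact le_trans (by exact_mod_cast hi') hfl
    · change (c : ℝ) ≤ (i + 1) / m
      rw [le_div_iff₀ hm]
      by_cases h : i = m - 1
      · have : (i : ℝ) + 1 = m := by
          rw [h]; push_cast [Nat.cast_sub (by omega : 1 ≤ m)]; ring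
        rw [this]
        nlinarith [c.2.2]
      · have : ⌊(c : ℝ) * m⌋₊ = i := by omega
        have h2 := Nat.lt_floor_add_one ((c : ℝ) * m)
        rw [this] at h2
        exact h2.le
  · rw [← hle]
    apply measure_mono
    rintro c ⟨hc1, hc2⟩
    change (i : ℝ) / m ≤ c at hc1
    change (c : ℝ) < (i + 1) / m at hc2
    rw [div_le_iff₀ hm] at hc1
    rw [lt_div_iff₀ hm] at hc2
    have : ⌊(c : ℝ) * m⌋₊ = i := by
      rw [Nat.floor_eq_iff (mul_nonneg c.2.1 hm.le)]; exact ⟨hc1, hc2⟩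
    simp only [Set.mem_ofPred_eq]
    omega

lemma pickUniform_eq {n : ℕ} {S : Finset (Fin n)} (hS : S.Nonempty) (c : unitInterval) :
    ∃ h : min ⌊(c : ℝ) * S.card⌋₊ (S.card - 1) < (S.sort (· ≤ ·)).length,
      pickUniform S c = some ((S.sort (· ≤ ·))[min ⌊(c : ℝ) * S.card⌋₊ (S.card - 1)]) := by
  have h : min ⌊(c : ℝ) * S.card⌋₊ (S.card - 1) < (S.sort (· ≤ ·)).length := by
    have := hS.card_pos
    rw [Finset.length_sort]; omega
  exact ⟨h, by unfold pickUniform; exact List.getElem?_eq_getElem h⟩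

lemma pickUniform_mem {n : ℕ} {S : Finset (Fin n)} {c : unitInterval} {u : Fin n}
    (h : pickUniform S c = some u) : u ∈ S := by
  unfold pickUniform at h
  have := List.mem_of_getElem? h
  simpa using this

lemma pickUniform_countablyValued {n : ℕ} (S : Finset (Fin n)) :
    CountablyValued (pickUniform S) :=
  ⟨_, fun m => (S.sort (· ≤ ·))[m]?, measurable_pickIndex S.card, fun _ => rfl⟩

lemma lintegral_pickUniform {n : ℕ} {S : Finset (Fin n)} (hS : S.Nonempty)
    (F : Option (Fin n) → ℝ≥0∞) :
    ∫⁻ c, F (pickUniform S c) = (S.card : ℝ≥0∞)⁻¹ * ∑ u ∈ S, F (some u) := by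
  set m := S.card with hm
  have hmpos : 0 < m := hS.card_pos
  set l := S.sort (· ≤ ·) with hl
  have hlen : l.length = m := Finset.length_sort _
  let ι : unitInterval → ℕ := fun c => min ⌊(c : ℝ) * m⌋₊ (m - 1)
  have hι : Measurable ι := measurable_pickIndex m
  have hlt : ∀ c, ι c < m := fun c => by simp only [ι]; omega
  have h1 : ∀ c, F (pickUniform S c) = ∑ i ∈ Finset.range m, Set.indicator {c | ι c = i} (fun _ => F l[i]?) c := by
    intro c
    rw [Finset.sum_eq_single (ι c)]
    · simp [Set.indicator, pickUniform, ι, hl, hm]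
    · intro j _ hj; simp [Set.indicator, hj.symm]
    · intro h; exact absurd (Finset.mem_range.2 (hlt c)) h
  have hms : ∀ i, MeasurableSet {c | ι c = i} := fun i => hι (measurableSet_singleton i)
  simp_rw [h1]
  rw [lintegral_finsetSum _ (fun i _ => (measurable_const.indicator (hms i)))]
  have h2 : ∀ i ∈ Finset.range m, ∫⁻ c, Set.indicator {c | ι c = i} (fun _ => F l[i]?) c = (m : ℝ≥0∞)⁻¹ * F l[i]? := by
    intro i hi
    rw [lintegral_indicator_const (hms i), volume_pickIndex (Finset.mem_range.1 hi), mul_comm]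
  rw [Finset.sum_congr rfl h2, ← Finset.mul_sum]
  congr 1
  have h3 : ∑ u ∈ S, F (some u) = (l.map (fun u => F (some u))).sum := by
    rw [hl]
    conv_lhs => rw [← Finset.sort_toFinset S (· ≤ ·)]
    rw [List.sum_toFinset _ (Finset.sort_nodup _ _)]
  rw [h3, ← Fin.sum_univ_getElem, Finset.sum_range]
  have hlm : (l.map (fun u => F (some u))).length = m := by simp [hlen]
  refine Fintype.sum_equiv (finCongr hlm.symm) _ _ ?_
  intro i
  simp [hlen]

/-! ## Majorities -/

/-- More than half of the processors satisfy `P`. -/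
def Maj (P : Fin n → Prop) : Prop := n < 2 * (Finset.univ.filter P).card

lemma Maj.mono {P Q : Fin n → Prop} (h : Maj P) (hPQ : ∀ k, P k → Q k) : Maj Q := by
  unfold Maj at *
  have := Finset.card_le_card (Finset.monotone_filter_right Finset.univ (fun k _ => hPQ k))
  omega

lemma Maj.inter {P Q : Fin n → Prop} (hP : Maj P) (hQ : Maj Q) : ∃ k, P k ∧ Q k := by
  unfold Maj at *
  by_contra! h
  have hd : Disjoint (Finset.univ.filter P) (Finset.univ.filter Q) := by
    rw [Finset.disjoint_filter]; intro k _ hk; exact h k hk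
  have h1 := Finset.card_union_of_disjoint hd
  have h2 := Finset.card_le_univ (Finset.univ.filter P ∪ Finset.univ.filter Q)
  rw [Fintype.card_fin] at h2
  omega

/-! ## The order of views -/

/-- `⊥ ≤ Commit ≤` any entry. -/
def EntryLe (a b : Option (Status n)) : Prop :=
  a = none ∨ a = b ∨ (a = some ⟨Stat.commit, ∅⟩ ∧ b ≠ none)

lemma EntryLe.refl (a : Option (Status n)) : EntryLe a a := Or.inr (Or.inl rfl)

lemma EntryLe.ne_none {a b : Option (Status n)} (h : EntryLe a b) (ha : a ≠ none) : b ≠ none := by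
  rcases h with h | h | h
  · exact absurd h ha
  · rwa [← h]
  · exact h.2

lemma EntryLe.trans {a b c : Option (Status n)} (h : EntryLe a b) (h' : EntryLe b c) :
    EntryLe a c := by
  rcases h with h | h | h
  · exact Or.inl h
  · rwa [h]
  · exact Or.inr (Or.inr ⟨h.1, h'.ne_none h.2⟩)

/-- Priorities are maximal entries: once known they are final, so any view that shows one shows the
true one. -/
lemma EntryLe.eq_of_prio {s : Status n} {b : Option (Status n)} (h : EntryLe (some s) b)
    (hs : s.stat ≠ Stat.commit) : b = some s := by
  rcases h with h | h | ⟨h, _⟩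
  · cases h
  · exact h.symm
  · cases h; exact absurd rfl hs

/-- `W` contains all the information in `V`. -/
structure View.Le (V W : View n) : Prop where
  contended : V.contended ⊆ W.contended
  door : ∀ u, V.door u = true → W.door u = true
  round : ∀ u i, V.round u i ≤ W.round u i
  status : ∀ u r i, EntryLe (V.status u r i) (W.status u r i)

lemma View.Le.refl (V : View n) : V.Le V :=
  ⟨subset_rfl, fun _ h => h, fun _ _ => le_rfl, fun _ _ _ => EntryLe.refl _⟩

lemma View.Le.trans {U V W : View n} (h : U.Le V) (h' : V.Le W) : U.Le W :=
  ⟨h.contended.trans h'.contended, fun u hu => h'.door u (h.door u hu),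
    fun u i => (h.round u i).trans (h'.round u i),
    fun u r i => (h.status u r i).trans (h'.status u r i)⟩

lemma View.initial_le (V : View n) : (View.initial n).Le V :=
  ⟨by simp [View.initial], by simp [View.initial], by simp [View.initial],
    fun _ _ _ => Or.inl rfl⟩

@[simp] lemma View.setRound_contended (V : View n) (u i r) : (V.setRound u i r).contended = V.contended := rfl
@[simp] lemma View.setRound_door (V : View n) (u i r) : (V.setRound u i r).door = V.door := rfl
@[simp] lemma View.setRound_status (V : View n) (u i r) : (V.setRound u i r).status = V.status := rfl
lemma View.setRound_round (V : View n) (u i r u' i') :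
    (V.setRound u i r).round u' i' = if u' = u ∧ i' = i then r else V.round u' i' := by
  unfold View.setRound; simp only [Function.update_apply]
  by_cases h : u' = u
  · subst h; by_cases h2 : i' = i <;> simp [h2]
  · simp [h]
@[simp] lemma View.setStatus_contended (V : View n) (u r i s) : (V.setStatus u r i s).contended = V.contended := rfl
@[simp] lemma View.setStatus_door (V : View n) (u r i s) : (V.setStatus u r i s).door = V.door := rfl
@[simp] lemma View.setStatus_round (V : View n) (u r i s) : (V.setStatus u r i s).round = V.round := rfl
lemma View.setStatus_status (V : View n) (u r i s u' r' i') :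
    (V.setStatus u r i s).status u' r' i' =
      if u' = u ∧ r' = r ∧ i' = i then some s else V.status u' r' i' := by
  unfold View.setStatus; simp only [Function.update_apply]
  by_cases h : u' = u
  · subst h
    by_cases h2 : r' = r
    · subst h2; by_cases h3 : i' = i <;> simp [h3]
    · simp [h2]
  · simp [h]
@[simp] lemma View.closeDoor_contended (V : View n) (u) : (V.closeDoor u).contended = V.contended := rfl
@[simp] lemma View.closeDoor_round (V : View n) (u) : (V.closeDoor u).round = V.round := rfl
@[simp] lemma View.closeDoor_status (V : View n) (u) : (V.closeDoor u).status = V.status := rfl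
lemma View.closeDoor_door (V : View n) (u u') :
    (V.closeDoor u).door u' = if u' = u then true else V.door u' := by
  unfold View.closeDoor; simp only [Function.update_apply]

/-- The view contains the propagated value. -/
def Call.Has : Call n → View n → Prop
  | .propContended S, W => S ⊆ W.contended
  | .propDoor u, W => W.door u = true
  | .propRound u i r, W => r ≤ W.round u i
  | .propStatus u r i s, W =>
      (s.stat = Stat.commit → s.list = ∅) ∧ EntryLe (some s) (W.status u r i)
  | _, _ => True

lemma Call.Has.mono {c : Call n} {V W : View n} (h : c.Has V) (hVW : V.Le W) : c.Has W := by
  cases c <;> simp only [Call.Has] at *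
  · exact h.trans hVW.contended
  · exact hVW.door _ h
  · exact h.trans (hVW.round _ _)
  · exact ⟨h.1, h.2.trans (hVW.status _ _ _)⟩

lemma Call.answer_mono (c : Call n) {V W : View n} (h : V.Le W) : (c.answer V).Le (c.answer W) := by
  cases c <;> simp only [Call.answer] <;> try exact View.Le.refl _
  · exact ⟨h.contended, by simp [View.initial], by simp [View.initial], fun _ _ _ => Or.inl rfl⟩
  · refine ⟨by simp [View.initial], ?_, by simp [View.initial], fun _ _ _ => Or.inl rfl⟩
    intro u; simp only [Function.update_apply]; split_ifs with hu
    · exact h.door _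
    · exact fun h => h
  · refine ⟨by simp [View.initial], by simp [View.initial], ?_, fun _ _ _ => Or.inl rfl⟩
    intro u i; simp only [Function.update_apply]; split_ifs with hu
    · exact h.round _ _
    · exact le_rfl
  · rename_i u₀ r₀
    refine ⟨by simp [View.initial], by simp [View.initial], by simp [View.initial], ?_⟩
    intro u r i
    by_cases hu : u = u₀
    · subst hu
      by_cases hr : r = r₀
      · subst hr; simpa using h.status _ _ _
      · simp [hr, EntryLe]
    · simp [hu, EntryLe]

lemma Call.answer_le (c : Call n) (V : View n) : (c.answer V).Le V := by
  cases c <;> simp only [Call.answer] <;> try exact View.initial_le _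
  · exact ⟨subset_rfl, by simp [View.initial], by simp [View.initial], fun _ _ _ => Or.inl rfl⟩
  · refine ⟨by simp [View.initial], ?_, by simp [View.initial], fun _ _ _ => Or.inl rfl⟩
    intro u; simp only [Function.update_apply]; split_ifs with hu
    · subst hu; exact fun h => h
    · simp
  · refine ⟨by simp [View.initial], by simp [View.initial], ?_, fun _ _ _ => Or.inl rfl⟩
    intro u i; simp only [Function.update_apply]; split_ifs with hu
    · subst hu; exact le_rfl
    · simp
  · rename_i u₀ r₀
    refine ⟨by simp [View.initial], by simp [View.initial], by simp [View.initial], ?_⟩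
    intro u r i
    by_cases hu : u = u₀
    · subst hu
      by_cases hr : r = r₀
      · subst hr; simp [EntryLe.refl]
      · simp [hr, EntryLe]
    · simp [hu, EntryLe]

/-- If everything is a part of the true values `T`, an update loses no information, stays within
`T`, and includes the propagated value. -/
lemma Call.update_le {c : Call n} {V T : View n} (hc : c.Has T) (hV : V.Le T) :
    V.Le (c.update V) ∧ (c.update V).Le T ∧ c.Has (c.update V) := by
  cases c with
  | propContended S =>
    simp only [Call.Has, Call.update] at *
    exact ⟨⟨by simp, fun _ h => h, fun _ _ => le_rfl, fun _ _ _ => EntryLe.refl _⟩,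
      ⟨Finset.union_subset hV.contended hc, hV.door, hV.round, hV.status⟩, by simp⟩
  | propDoor u =>
    simp only [Call.Has, Call.update] at *
    refine ⟨⟨by simp, ?_, by simp, fun _ _ _ => EntryLe.refl _⟩,
      ⟨hV.contended, ?_, hV.round, hV.status⟩, by simp [View.closeDoor_door]⟩
    · intro u' h; rw [View.closeDoor_door]; split_ifs <;> simp [h]
    · intro u'; rw [View.closeDoor_door]; split_ifs with h
      · intro _; rw [h]; exact hc
      · exact hV.door u'
  | propRound u i r =>
    simp only [Call.Has, Call.update] at *
    refine ⟨⟨by simp, by simp, ?_, fun _ _ _ => EntryLe.refl _⟩,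
      ⟨hV.contended, hV.door, ?_, hV.status⟩, by simp [View.setRound_round]⟩
    · intro u' i'; rw [View.setRound_round]; split_ifs with h
      · rw [h.1, h.2]; exact le_max_left _ _
      · exact le_rfl
    · intro u' i'; rw [View.setRound_round]; split_ifs with h
      · rw [h.1, h.2]; exact max_le (hV.round _ _) hc
      · exact hV.round _ _
  | propStatus u r i s =>
    simp only [Call.Has, Call.update] at *
    have hVi := hV.status u r i
    split_ifs with h
    -- A Commit that finds an entry already present is ignored. It still counts as recorded, because
    -- a Commit with empty list lies below every entry; this is why `Call.Has` demands the empty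
    -- list.
    · exact ⟨View.Le.refl _, hV, hc.1, Or.inr (Or.inr ⟨by
        obtain ⟨st, l⟩ := s
        simp only at h hc
        rw [h.1, hc.1 h.1], h.2⟩)⟩
    · refine ⟨⟨by simp, by simp, by simp, ?_⟩, ⟨hV.contended, hV.door, hV.round, ?_⟩,
        hc.1, by simp [View.setStatus_status, EntryLe.refl]⟩
      · intro u' r' i'; rw [View.setStatus_status]; split_ifs with h'
        · obtain ⟨rfl, rfl, rfl⟩ := h'
          by_cases hn : V.status u' r' i' = none
          · exact Or.inl hn
          · have hs : s.stat ≠ Stat.commit := fun hs => h ⟨hs, hn⟩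
            rwa [hc.2.eq_of_prio hs] at hVi
        · exact EntryLe.refl _
      · intro u' r' i'; rw [View.setStatus_status]; split_ifs with h'
        · obtain ⟨rfl, rfl, rfl⟩ := h'; exact hc.2
        · exact hV.status _ _ _
  | _ => exact ⟨View.Le.refl _, hV, trivial⟩

/-! ## Decomposition of computation steps -/

/-- The view of processor `k`. -/
def Config.view (K : Config n) (k : Fin n) : View n := (K.procs k).view

/-- The control state of processor `k`. -/
def Config.pc (K : Config n) (k : Fin n) : PC n := (K.procs k).pc

/-- The number of the current call of processor `k`. -/
def Config.callId (K : Config n) (k : Fin n) : ℕ := (K.procs k).callId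

/-- `p` receives the messages `ms`. -/
def Config.recv (K : Config n) (p : Fin n) (ms : List (Packet n)) : Config n :=
  { K with
    procs := Function.update K.procs p (receiveAll p (K.procs p) ms).1
    packets := K.packets ++ (receiveAll p (K.procs p) ms).2 }

/-- `p` empties its inbox. -/
def Config.clear (K : Config n) (p : Fin n) : Config n :=
  { K with procs := Function.update K.procs p { K.procs p with inbox := [] } }

/-- `p` receives all the messages in its inbox. -/
def Config.drain (K : Config n) (p : Fin n) : Config n :=
  (K.clear p).recv p (K.procs p).inbox

/-- `p` goes on with its protocol. -/
def Config.advance (K : Config n) (p : Fin n) (c : unitInterval) : Config n :=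
  { K with
    procs := Function.update K.procs p (Renaming.advance p (K.procs p) c).1
    packets := K.packets ++ (Renaming.advance p (K.procs p) c).2 }

lemma Config.recv_nil (K : Config n) (p : Fin n) : K.recv p [] = K := by
  simp [Config.recv, receiveAll]

lemma Config.recv_cons (K : Config n) (p : Fin n) (m : Packet n) (ms : List (Packet n)) :
    K.recv p (m :: ms) = (K.recv p [m]).recv p ms := by
  simp [Config.recv, receiveAll, List.append_assoc]

/-- Reception only lets views grow, whereas going on changes the control state of one processor; the
two halves of a step are analysed separately. -/
lemma Config.apply_step (K : Config n) (c : unitInterval) (p : Fin n) :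
    K.apply c (.step p) =
      if ((K.drain p).procs p).ready then (K.drain p).advance p c else K.drain p := by
  simp only [Config.apply, compute, Config.drain, Config.clear, Config.recv, Config.advance,
    Function.update_self, Function.update_idem]
  split_ifs <;> simp [List.append_assoc]

/-- Effect of the reception of messages on everything except the messages. -/
structure Config.Grow (K K' : Config n) : Prop where
  pc : K'.pc = K.pc
  callId : K'.callId = K.callId
  view : ∀ k, (K.view k).Le (K'.view k)

lemma Config.Grow.refl (K : Config n) : K.Grow K := ⟨rfl, rfl, fun _ => View.Le.refl _⟩

lemma Config.Grow.trans {K K' K'' : Config n} (h : K.Grow K') (h' : K'.Grow K'') : K.Grow K'' :=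
  ⟨h'.pc.trans h.pc, h'.callId.trans h.callId, fun k => (h.view k).trans (h'.view k)⟩

/-! ## The invariant of the communication -/

/-- `T` collects the true values of all variables; `snap p k` is the view that `k` had when `p`
started its current call. -/
structure Comm (K : Config n) (T : View n) (snap : Fin n → Fin n → View n) : Prop where
  view_le : ∀ k, (K.view k).Le T
  snap_le : ∀ p k, (snap p k).Le (K.view k)
  request : ∀ m ∈ K.packets, ∀ id c, m.body = .request id c → c.Has T ∧ id ≤ K.callId m.src ∧
    (id = K.callId m.src → (K.pc m.src).call m.src = some c)
  ack : ∀ m ∈ K.packets, ∀ id W, m.body = .ack id W → W.Le T ∧ id ≤ K.callId m.dst ∧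
    (id = K.callId m.dst → ∀ c, (K.pc m.dst).call m.dst = some c →
      c.Has (K.view m.src) ∧ (c.answer (snap m.dst m.src)).Le W)
  replies : ∀ p k W, (K.procs p).replies k = some W →
    ∃ m ∈ K.packets, m.src = k ∧ m.dst = p ∧ m.body = .ack (K.callId p) W
  inbox : ∀ p, ∀ m ∈ (K.procs p).inbox, m ∈ K.packets ∧ m.dst = p

lemma Comm.initial : Comm (Config.initial n) (View.initial n) (fun _ _ => View.initial n) :=
  ⟨fun _ => View.Le.refl _, fun _ _ => View.Le.refl _, by simp [Config.initial],
    by simp [Config.initial], by simp [Config.initial], by simp [Config.initial]⟩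

/-- A request carries a part of the true values, so the truth need not change. The answer is
computed from a view that lies above the snapshot taken at the start of the call and already
contains the propagated value. An acknowledgement only affects the replies. -/
lemma Comm.recv_one {K : Config n} {T : View n} {snap} (h : Comm K T snap) {p : Fin n}
    {m : Packet n} (hm : m ∈ K.packets) (hp : m.dst = p) :
    Comm (K.recv p [m]) T snap ∧ K.Grow (K.recv p [m]) := by
  obtain ⟨src, dst, body⟩ := m
  simp only at hp; subst hp
  cases body with
  | request id c =>
    obtain ⟨hcT, hid, hcall⟩ := h.request _ hm id c rfl
    simp only at hid hcall
    obtain ⟨hu1, hu2, hu3⟩ := Call.update_le hcT (h.view_le dst)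
    have hpc : (K.recv dst [⟨src, dst, .request id c⟩]).pc = K.pc := by
      ext k; by_cases hk : k = dst
      · subst hk; simp [Config.pc, Config.recv, receiveAll, receive]
      · simp [Config.pc, Config.recv, hk]
    have hcid : (K.recv dst [⟨src, dst, .request id c⟩]).callId = K.callId := by
      ext k; by_cases hk : k = dst
      · subst hk; simp [Config.callId, Config.recv, receiveAll, receive]
      · simp [Config.callId, Config.recv, hk]
    have hv : ∀ k, (K.recv dst [⟨src, dst, .request id c⟩]).view k =
        if k = dst then c.update (K.view dst) else K.view k := by
      intro k; by_cases hk : k = dst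
      · subst hk; simp [Config.view, Config.recv, receiveAll, receive]
      · simp [Config.view, Config.recv, hk]
    have hpk : (K.recv dst [⟨src, dst, .request id c⟩]).packets =
        K.packets ++ [⟨dst, src, .ack id (c.answer (c.update (K.view dst)))⟩] := by
      simp [Config.recv, receiveAll, receive, Config.view]
    have hrep : ∀ q, ((K.recv dst [⟨src, dst, .request id c⟩]).procs q).replies = (K.procs q).replies := by
      intro q; by_cases hk : q = dst
      · subst hk; simp [Config.recv, receiveAll, receive]
      · simp [Config.recv, hk]
    have hinb : ∀ q, ((K.recv dst [⟨src, dst, .request id c⟩]).procs q).inbox = (K.procs q).inbox := by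
      intro q; by_cases hk : q = dst
      · subst hk; simp [Config.recv, receiveAll, receive]
      · simp [Config.recv, hk]
    have hgrow : K.Grow (K.recv dst [⟨src, dst, .request id c⟩]) := by
      refine ⟨hpc, hcid, fun k => ?_⟩
      rw [hv]; split_ifs with hk
      · subst hk; exact hu1
      · exact View.Le.refl _
    refine ⟨⟨?_, ?_, ?_, ?_, ?_, ?_⟩, hgrow⟩
    · intro k; rw [hv]; split_ifs
      · exact hu2
      · exact h.view_le k
    · intro p k; exact (h.snap_le p k).trans (hgrow.view k)
    · intro m hm' id' c' hb
      rw [hpk] at hm'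
      rcases List.mem_append.1 hm' with hm' | hm'
      · rw [hpc, hcid]; exact h.request m hm' id' c' hb
      · simp at hm'; subst hm'; simp at hb
    · intro m hm' id' W hb
      rw [hpk] at hm'
      rcases List.mem_append.1 hm' with hm' | hm'
      · rw [hpc, hcid]
        obtain ⟨h1, h2, h3⟩ := h.ack m hm' id' W hb
        exact ⟨h1, h2, fun e c' hc' => ⟨(h3 e c' hc').1.mono (hgrow.view _), (h3 e c' hc').2⟩⟩
      · simp at hm'; subst hm'; simp at hb
        obtain ⟨rfl, rfl⟩ := hb
        refine ⟨(c.answer_le _).trans hu2, by rw [hcid]; exact hid, ?_⟩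
        intro e c' hc'
        rw [hcid] at e; rw [hpc] at hc'
        rw [hcall e] at hc'
        cases hc'
        refine ⟨?_, c.answer_mono ((h.snap_le _ _).trans hu1)⟩
        rw [hv]; simpa using hu3
    · intro q k W hW
      rw [hrep] at hW
      obtain ⟨m, h1, h2⟩ := h.replies q k W hW
      refine ⟨m, by rw [hpk]; exact List.mem_append_left _ h1, ?_⟩
      rw [hcid]; exact h2
    · intro q m hm'
      rw [hinb] at hm'
      exact ⟨by rw [hpk]; exact List.mem_append_left _ (h.inbox q m hm').1, (h.inbox q m hm').2⟩
  | ack id W =>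
    have hpc : (K.recv dst [⟨src, dst, .ack id W⟩]).pc = K.pc := by
      ext k; by_cases hk : k = dst
      · subst hk; simp only [Config.pc, Config.recv, receiveAll, receive, Function.update_self]
        split_ifs <;> rfl
      · simp [Config.pc, Config.recv, hk]
    have hcid : (K.recv dst [⟨src, dst, .ack id W⟩]).callId = K.callId := by
      ext k; by_cases hk : k = dst
      · subst hk; simp only [Config.callId, Config.recv, receiveAll, receive, Function.update_self]
        split_ifs <;> rfl
      · simp [Config.callId, Config.recv, hk]
    have hv : (K.recv dst [⟨src, dst, .ack id W⟩]).view = K.view := by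
      ext1 k; by_cases hk : k = dst
      · subst hk; simp only [Config.view, Config.recv, receiveAll, receive, Function.update_self]
        split_ifs <;> rfl
      · simp [Config.view, Config.recv, hk]
    have hpk : (K.recv dst [⟨src, dst, .ack id W⟩]).packets = K.packets := by
      simp [Config.recv, receiveAll, receive]
    have hinb : ∀ q, ((K.recv dst [⟨src, dst, .ack id W⟩]).procs q).inbox = (K.procs q).inbox := by
      intro q; by_cases hk : q = dst
      · subst hk; simp only [Config.recv, receiveAll, receive, Function.update_self]
        split_ifs <;> rfl
      · simp [Config.recv, hk]
    have hgrow : K.Grow (K.recv dst [⟨src, dst, .ack id W⟩]) :=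
      ⟨hpc, hcid, fun k => by rw [hv]; exact View.Le.refl _⟩
    refine ⟨⟨?_, ?_, ?_, ?_, ?_, ?_⟩, hgrow⟩
    · rw [hv]; exact h.view_le
    · rw [hv]; exact h.snap_le
    · rw [hpc, hcid, hpk]; exact h.request
    · rw [hpc, hcid, hpk, hv]; exact h.ack
    · rw [hcid, hpk]
      intro q k W' hW
      by_cases hk : q = dst
      · subst hk
        simp only [Config.recv, receiveAll, receive, Function.update_self] at hW
        split_ifs at hW with hid
        · simp only [Function.update_apply] at hW
          split_ifs at hW with hks
          · cases hW
            exact ⟨_, hm, hks.symm, rfl, by simp [hid, Config.callId]⟩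
          · exact h.replies _ _ _ hW
        · exact h.replies _ _ _ hW
      · simp [Config.recv, hk] at hW
        exact h.replies _ _ _ hW
    · intro q m hm'
      rw [hinb] at hm'
      rw [hpk]; exact h.inbox q m hm'

lemma Comm.recv {K : Config n} {T : View n} {snap} (h : Comm K T snap) {p : Fin n}
    {ms : List (Packet n)} (hms : ∀ m ∈ ms, m ∈ K.packets ∧ m.dst = p) :
    Comm (K.recv p ms) T snap ∧ K.Grow (K.recv p ms) := by
  induction ms generalizing K with
  | nil => rw [Config.recv_nil]; exact ⟨h, Config.Grow.refl K⟩
  | cons m ms ih =>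
    rw [Config.recv_cons]
    have hm := hms m (by simp)
    obtain ⟨h1, h2⟩ := h.recv_one hm.1 hm.2
    obtain ⟨h3, h4⟩ := ih h1 (fun m' hm' => by
      have := hms m' (by simp [hm'])
      exact ⟨by simp only [Config.recv]; exact List.mem_append_left _ this.1, this.2⟩)
    exact ⟨h3, h2.trans h4⟩

lemma Config.grow_clear (K : Config n) (p : Fin n) : K.Grow (K.clear p) := by
  refine ⟨?_, ?_, ?_⟩
  · ext k; by_cases hk : k = p
    · subst hk; simp [Config.pc, Config.clear]
    · simp [Config.pc, Config.clear, hk]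
  · ext k; by_cases hk : k = p
    · subst hk; simp [Config.callId, Config.clear]
    · simp [Config.callId, Config.clear, hk]
  · intro k
    have : (K.clear p).view k = K.view k := by
      by_cases hk : k = p
      · subst hk; simp [Config.view, Config.clear]
      · simp [Config.view, Config.clear, hk]
    rw [this]; exact View.Le.refl _

lemma Comm.congr {K K' : Config n} {T : View n} {snap} (h : Comm K T snap) (hpc : K'.pc = K.pc)
    (hcid : K'.callId = K.callId) (hv : K'.view = K.view) (hpk : K'.packets = K.packets)
    (hr : ∀ p, (K'.procs p).replies = (K.procs p).replies)
    (hi : ∀ p, ∀ m ∈ (K'.procs p).inbox, m ∈ K.packets ∧ m.dst = p) : Comm K' T snap :=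
  ⟨hv ▸ h.view_le, hv ▸ h.snap_le, by rw [hpc, hcid, hpk]; exact h.request,
    by rw [hpc, hcid, hpk, hv]; exact h.ack,
    by rw [hcid, hpk]; intro p k W; rw [hr]; exact h.replies p k W, by rw [hpk]; exact hi⟩

lemma Comm.clear {K : Config n} {T : View n} {snap} (h : Comm K T snap) (p : Fin n) :
    Comm (K.clear p) T snap := by
  refine h.congr (K.grow_clear p).pc (K.grow_clear p).callId ?_ rfl ?_ ?_
  · ext1 k; by_cases hk : k = p
    · subst hk; simp [Config.view, Config.clear]
    · simp [Config.view, Config.clear, hk]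
  · intro k; by_cases hk : k = p
    · subst hk; simp [Config.clear]
    · simp [Config.clear, hk]
  · intro k m hm; by_cases hk : k = p
    · subst hk; simp [Config.clear] at hm
    · simp [Config.clear, hk] at hm; exact h.inbox k m hm

lemma Comm.drain {K : Config n} {T : View n} {snap} (h : Comm K T snap) (p : Fin n) :
    Comm (K.drain p) T snap ∧ K.Grow (K.drain p) := by
  obtain ⟨h1, h2⟩ := (h.clear p).recv (p := p) (ms := (K.procs p).inbox)
    (fun m hm => h.inbox p m hm)
  exact ⟨h1, (K.grow_clear p).trans h2⟩

lemma Comm.deliver {K : Config n} {T : View n} {snap} (h : Comm K T snap) (c : unitInterval)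
    (i : ℕ) : Comm (K.apply c (.deliver i)) T snap ∧ K.Grow (K.apply c (.deliver i)) ∧
      (K.apply c (.deliver i)).view = K.view := by
  simp only [Config.apply]
  split_ifs with hi
  · exact ⟨h, Config.Grow.refl K, rfl⟩
  cases hm : K.packets[i]? with
  | none => exact ⟨h, Config.Grow.refl K, rfl⟩
  | some m =>
    simp only
    have hpc : ∀ k, ((Function.update K.procs m.dst
        { K.procs m.dst with inbox := (K.procs m.dst).inbox ++ [m] }) k).pc = (K.procs k).pc := by
      intro k; by_cases hk : k = m.dst
      · subst hk; simp
      · simp [hk]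
    have hcid : ∀ k, ((Function.update K.procs m.dst
        { K.procs m.dst with inbox := (K.procs m.dst).inbox ++ [m] }) k).callId = (K.procs k).callId := by
      intro k; by_cases hk : k = m.dst
      · subst hk; simp
      · simp [hk]
    have hv : ∀ k, ((Function.update K.procs m.dst
        { K.procs m.dst with inbox := (K.procs m.dst).inbox ++ [m] }) k).view = (K.procs k).view := by
      intro k; by_cases hk : k = m.dst
      · subst hk; simp
      · simp [hk]
    refine ⟨h.congr (funext hpc) (funext hcid) (funext hv) rfl ?_ ?_,
      ⟨funext hpc, funext hcid, fun k => ?_⟩, funext hv⟩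
    · intro k; by_cases hk : k = m.dst
      · subst hk; simp
      · simp [hk]
    · intro k m' hm'; by_cases hk : k = m.dst
      · subst hk; simp at hm'
        rcases hm' with hm' | rfl
        · exact h.inbox _ _ hm'
        · exact ⟨List.mem_of_getElem? hm, rfl⟩
      · simp [hk] at hm'; exact h.inbox k m' hm'
    · have e := hv k
      unfold Config.view; rw [e]; exact View.Le.refl _

lemma Config.advance_pc (K : Config n) (p : Fin n) (c : unitInterval) :
    (K.advance p c).pc = Function.update K.pc p
      (next p (K.view p) (K.procs p).replies c (K.pc p)).2 := by
  ext k; by_cases hk : k = p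
  · subst hk; simp [Config.pc, Config.advance, Renaming.advance, Config.view]
  · simp [Config.pc, Config.advance, hk]

lemma Config.advance_callId (K : Config n) (p : Fin n) (c : unitInterval) :
    (K.advance p c).callId = Function.update K.callId p (K.callId p + 1) := by
  ext k; by_cases hk : k = p
  · subst hk; simp [Config.callId, Config.advance, Renaming.advance]
  · simp [Config.callId, Config.advance, hk]

lemma Config.advance_view (K : Config n) (p : Fin n) (c : unitInterval) :
    (K.advance p c).view = Function.update K.view p
      (next p (K.view p) (K.procs p).replies c (K.pc p)).1 := by
  ext1 k; by_cases hk : k = p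
  · subst hk; simp [Config.view, Config.advance, Renaming.advance, Config.pc]
  · simp [Config.view, Config.advance, hk]

/-- The new call has a fresh number. Messages of earlier calls of p carry smaller numbers, so the
clauses about the current call become void for them; the snapshot of p is reset to the present
views. -/
lemma Comm.advance {K : Config n} {T T' : View n} {snap} (h : Comm K T snap) {p : Fin n}
    {c : unitInterval} {V' : View n} {pc' : PC n}
    (hnext : next p (K.view p) (K.procs p).replies c (K.pc p) = (V', pc'))
    (hT : T.Le T') (hV : (K.view p).Le V') (hV' : V'.Le T')
    (hcall : ∀ cl, pc'.call p = some cl → cl.Has T') :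
    Comm (K.advance p c) T' (Function.update snap p (K.advance p c).view) ∧
      ∀ k, (K.view k).Le ((K.advance p c).view k) := by
  have hpc := K.advance_pc p c
  have hcid := K.advance_callId p c
  have hv := K.advance_view p c
  rw [hnext] at hpc hv
  simp only at hpc hv
  have hgrow : ∀ k, (K.view k).Le ((K.advance p c).view k) := by
    intro k; rw [hv]; by_cases hk : k = p
    · subst hk; simpa using hV
    · simp [hk, View.Le.refl]
  have hnew : ∀ m ∈ (Renaming.advance p (K.procs p) c).2, m.src = p ∧
      ∃ cl, pc'.call p = some cl ∧ m.body = .request (K.callId p + 1) cl := by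
    intro m hm
    have hnext' : next p (K.procs p).view (K.procs p).replies c (K.procs p).pc = (V', pc') := hnext
    simp only [Renaming.advance, hnext'] at hm
    cases hc : pc'.call p with
    | none => simp [hc] at hm
    | some cl =>
      simp only [hc, List.mem_map] at hm
      obtain ⟨j, _, rfl⟩ := hm
      exact ⟨rfl, cl, rfl, rfl⟩
  have hpk : (K.advance p c).packets = K.packets ++ (Renaming.advance p (K.procs p) c).2 := rfl
  refine ⟨⟨?_, ?_, ?_, ?_, ?_, ?_⟩, hgrow⟩
  · intro k; rw [hv]; by_cases hk : k = p
    · subst hk; simpa using hV'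
    · simpa [hk] using (h.view_le k).trans hT
  · intro q k; by_cases hq : q = p
    · subst hq; simp [View.Le.refl]
    · simpa [hq] using (h.snap_le q k).trans (hgrow k)
  · intro m hm id cl hb
    rw [hpk] at hm
    rcases List.mem_append.1 hm with hm | hm
    · obtain ⟨h1, h2, h3⟩ := h.request m hm id cl hb
      refine ⟨h1.mono hT, ?_, ?_⟩
      · rw [hcid]; by_cases hk : m.src = p
        · rw [hk] at h2 ⊢; simp; omega
        · simpa [hk] using h2
      · rw [hcid, hpc]; by_cases hk : m.src = p
        · rw [hk] at h2 ⊢; simp; omega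
        · simpa [hk] using h3
    · obtain ⟨h1, cl', h2, h3⟩ := hnew m hm
      rw [hb] at h3; cases h3
      rw [h1, hcid, hpc]
      exact ⟨hcall _ h2, by simp, by simpa using h2⟩
  · intro m hm id W hb
    rw [hpk] at hm
    rcases List.mem_append.1 hm with hm | hm
    · obtain ⟨h1, h2, h3⟩ := h.ack m hm id W hb
      refine ⟨h1.trans hT, ?_, ?_⟩
      · rw [hcid]; by_cases hk : m.dst = p
        · rw [hk] at h2 ⊢; simp; omega
        · simpa [hk] using h2
      · rw [hcid, hpc]; by_cases hk : m.dst = p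
        · rw [hk] at h2 ⊢; simp; omega
        · intro e cl hcl
          simp only [hk, ne_eq, not_false_eq_true, Function.update_of_ne] at e hcl ⊢
          exact ⟨(h3 e cl hcl).1.mono (hgrow _), (h3 e cl hcl).2⟩
    · obtain ⟨_, _, _, h3⟩ := hnew m hm
      rw [hb] at h3; cases h3
  · intro q k W hW
    by_cases hq : q = p
    · subst hq; simp [Config.advance, Renaming.advance] at hW
    · simp [Config.advance, hq] at hW
      obtain ⟨m, h1, h2⟩ := h.replies q k W hW
      refine ⟨m, List.mem_append_left _ h1, ?_⟩
      rw [hcid]; simpa [hq] using h2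
  · intro q m hm
    have : (K.procs q).inbox = ((K.advance p c).procs q).inbox := by
      by_cases hq : q = p
      · subst hq; simp [Config.advance, Renaming.advance]
      · simp [Config.advance, hq]
    rw [← this] at hm
    exact ⟨List.mem_append_left _ (h.inbox q m hm).1, (h.inbox q m hm).2⟩

/-! ## What a completed call tells -/

lemma maj_of_ready {L : Local n} {p : Fin n} {cl : Call n} (hr : L.ready)
    (hc : L.pc.call p = some cl) : Maj (fun k => (L.replies k).isSome) := by
  unfold Maj
  unfold Local.ready at hr
  cases hpc : L.pc <;> simp only [hpc, PC.call] at hr hc <;> first | (cases hc; done) | skip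
  all_goals (convert hr)

/-- Each acknowledgement of the current call comes from a processor whose view contains the value,
and a completed call has a majority of them. -/
lemma Comm.maj_has {K : Config n} {T : View n} {snap} (h : Comm K T snap) {p : Fin n} {cl : Call n}
    (hr : (K.procs p).ready) (hc : (K.pc p).call p = some cl) : Maj (fun k => cl.Has (K.view k)) := by
  refine (maj_of_ready hr hc).mono ?_
  intro k hk
  obtain ⟨W, hW⟩ := Option.isSome_iff_exists.1 hk
  obtain ⟨m, h1, rfl, rfl, h4⟩ := h.replies p k W hW
  exact ((h.ack m h1 _ W h4).2.2 rfl cl hc).1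

/-- The repliers form a majority, so one of them lies in X, and it answered from a view no smaller
than its snapshot. Thus a collect sees all that a majority knew at its start. -/
lemma Comm.exists_reply {K : Config n} {T : View n} {snap} (h : Comm K T snap) {p : Fin n} {cl : Call n}
    (hr : (K.procs p).ready) (hc : (K.pc p).call p = some cl) {X : Fin n → Prop} (hX : Maj X) :
    ∃ k, X k ∧ ∃ W ∈ received (K.procs p).replies, (cl.answer (snap p k)).Le W := by
  obtain ⟨k, hk, hXk⟩ := (maj_of_ready hr hc).inter hX
  obtain ⟨W, hW⟩ := Option.isSome_iff_exists.1 hk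
  obtain ⟨m, h1, rfl, rfl, h4⟩ := h.replies p k W hW
  exact ⟨_, hXk, W, ⟨_, hW⟩, ((h.ack m h1 _ W h4).2.2 rfl cl hc).2⟩

lemma Comm.received_le {K : Config n} {T : View n} {snap} (h : Comm K T snap) {p : Fin n} {W : View n}
    (hW : W ∈ received (K.procs p).replies) : W.Le T := by
  obtain ⟨k, hk⟩ := hW
  obtain ⟨m, h1, rfl, rfl, h4⟩ := h.replies p k W hk
  exact (h.ack m h1 _ W h4).1

/-! ## Auxiliary history variables -/

/-- The name for which a processor contends, or which it has returned. -/
def PC.spot : PC n → Option (Fin n)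
  | .doorCol u | .doorProp u | .roundProp u _ | .roundCol u _ | .commitProp u _ | .statusCol u _
  | .prioProp u _ _ | .prioCol u _ _ | .outcomeProp u _ | .returned u => some u
  | _ => none

/-- History variables used in the analysis. -/
structure Ghost (n : ℕ) where
  /-- the true values of all variables -/
  truth : View n
  /-- `snap p k` is the view of `k` at the start of the current call of `p` -/
  snap : Fin n → Fin n → View n
  /-- the processors that have picked a name -/
  picks : Fin n → Finset (Fin n)
  /-- the processors that have lost the leader election for a name -/
  lost : Fin n → Finset (Fin n)
  /-- the processors that have propagated `Commit`, in the order of completion -/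
  order : Fin n → ℕ → List (Fin n)
  /-- the time when a processor has propagated its priority -/
  late : Fin n → ℕ → Fin n → ℕ∞
  clock : ℕ
  /-- the processor that flips the first coin of a round -/
  first : Fin n → ℕ → Option (Fin n)
  /-- the largest round in which a processor has committed -/
  top : Fin n → ℕ
  /-- the processors that had survived round `top - 2` when `top` was reached -/
  cap : Fin n → Finset (Fin n)
  /-- the processor that reached `top` -/
  leader : Fin n → Fin n
  /-- whether nobody had committed when a processor picked its current name -/
  joined : Fin n → Bool

/-- The change of the history variables (except `snap` and `clock`) when `p` goes on. -/
def Ghost.core (g : Ghost n) (p : Fin n) (X Y : PC n) : Ghost n :=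
  match X, Y with
  | .propContended _, .doorCol u =>
      { g with
        truth := { g.truth with contended := insert u g.truth.contended }
        picks := Function.update g.picks u (insert p (g.picks u))
        joined := Function.update g.joined p (decide (g.top u = 0)) }
  | .doorCol u, .doorProp _ => { g with truth := g.truth.closeDoor u }
  | .doorProp u, .roundProp _ r => { g with truth := g.truth.setRound u p r }
  | .roundCol u r, .commitProp _ _ =>
      { g with
        truth := g.truth.setStatus u r p ⟨Stat.commit, ∅⟩
        top := Function.update g.top u (max (g.top u) r)
        cap := if g.top u < r then
            Function.update g.cap u (Finset.univ.filter fun q => r ≤ g.truth.round u q + 1)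
          else g.cap
        leader := if g.top u < r then Function.update g.leader u p else g.leader }
  | .commitProp u r, .statusCol _ _ =>
      { g with
        order := Function.update g.order u
          (Function.update (g.order u) r (g.order u r ++ [p])) }
  | .statusCol u r, .prioProp _ _ s =>
      { g with
        truth := g.truth.setStatus u r p s
        first := if g.first u r = none then
            Function.update g.first u (Function.update (g.first u) r (some p))
          else g.first }
  | .prioProp u r _, .prioCol _ _ _ =>
      { g with
        late := Function.update g.late u
          (Function.update (g.late u) r (Function.update (g.late u r) p (g.clock : ℕ∞))) }
  | .prioCol u _ _, .roundProp _ r => { g with truth := g.truth.setRound u p r }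
  | .doorCol u, .outcomeProp _ false | .roundCol u _, .outcomeProp _ false
  | .prioCol u _ _, .outcomeProp _ false =>
      { g with lost := Function.update g.lost u (insert p (g.lost u)) }
  | _, _ => g

/-- The change of the history variables when `p` goes on; `V` are the new views. -/
def Ghost.event (g : Ghost n) (p : Fin n) (X Y : PC n) (V : Fin n → View n) : Ghost n :=
  { g.core p X Y with
    snap := Function.update g.snap p V
    clock := g.clock + 1 }

def Ghost.initial (n : ℕ) (p₀ : Fin n) : Ghost n where
  truth := View.initial n
  snap := fun _ _ => View.initial n
  picks := fun _ => ∅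
  lost := fun _ => ∅
  order := fun _ _ => []
  late := fun _ _ _ => ⊤
  clock := 0
  first := fun _ _ => none
  top := fun _ => 0
  cap := fun _ => ∅
  leader := fun _ => p₀
  joined := fun _ => false

/-! ## Common knowledge -/

/-- Knowledge of a majority is never lost and is seen by every collect that starts afterwards. These
predicates are the form in which a completed propagate enters the invariant. -/
def KnownName (V : Fin n → View n) (u : Fin n) : Prop := Maj fun k => u ∈ (V k).contended
def KnownDoor (V : Fin n → View n) (u : Fin n) : Prop := Maj fun k => (V k).door u = true
def KnownRound (V : Fin n → View n) (u q : Fin n) (r : ℕ) : Prop := Maj fun k => r ≤ (V k).round u q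
def KnownEntry (V : Fin n → View n) (u : Fin n) (r : ℕ) (q : Fin n) : Prop :=
  Maj fun k => (V k).status u r q ≠ none
def KnownPrio (g : Ghost n) (V : Fin n → View n) (u : Fin n) (r : ℕ) (q : Fin n) : Prop :=
  Maj fun k => EntryLe (g.truth.status u r q) ((V k).status u r q)

def Ghost.Has (g : Ghost n) (b : Stat) (u : Fin n) (r : ℕ) (q : Fin n) : Prop :=
  ∃ s, g.truth.status u r q = some s ∧ s.stat = b

def Ghost.Flipped (g : Ghost n) (u : Fin n) (r : ℕ) (q : Fin n) : Prop :=
  ∃ s, g.truth.status u r q = some s ∧ s.stat ≠ Stat.commit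

/-- `q` has survived the PoisonPill of round `r`. -/
def Ghost.Survived (g : Ghost n) (u : Fin n) (r : ℕ) (q : Fin n) : Prop :=
  ∃ s, g.truth.status u r q = some s ∧ s.stat ≠ Stat.commit ∧
    (s.stat = Stat.low → ∀ j ∈ s.list, g.Has Stat.low u r j)

/-- The reason for which `q` has lost the leader election for `u`. -/
def Ghost.LostWitness (g : Ghost n) (u q : Fin n) : Prop :=
  (g.truth.round u q = 0 → g.truth.door u = true) ∧
  (1 ≤ g.truth.round u q → (∃ j, g.truth.round u q < g.truth.round u j) ∨
    (g.Has Stat.low u (g.truth.round u q) q ∧ ∃ j, g.truth.status u (g.truth.round u q) j ≠ none ∧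
      (g.Has Stat.high u (g.truth.round u q) j ∨
        g.late u (g.truth.round u q) q < g.late u (g.truth.round u q) j)))

/-- The part of the invariant that concerns the control state of `q`. -/
def PcOk (V : Fin n → View n) (g : Ghost n) (q : Fin n) : PC n → Prop
  | .colContended => ∀ v, q ∈ g.picks v → KnownName (g.snap q) v
  | .propContended S => S ⊆ g.truth.contended ∧ S ≠ Finset.univ ∧ ∀ v, q ∈ g.picks v → v ∈ S
  | .doorCol u => g.truth.round u q = 0 ∧ (g.joined q = false → KnownDoor (g.snap q) u)
  | .doorProp u => g.truth.round u q = 0 ∧ g.truth.door u = true ∧ g.joined q = true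
  | .roundProp u r => g.truth.round u q = r ∧ 1 ≤ r ∧ g.joined q = true ∧
      g.truth.status u r q = none
  | .roundCol u r => g.truth.round u q = r ∧ 1 ≤ r ∧ g.joined q = true ∧
      g.truth.status u r q = none ∧ KnownRound V u q r
  | .commitProp u r => g.truth.round u q = r ∧ 1 ≤ r ∧ g.joined q = true ∧
      g.truth.status u r q = some ⟨Stat.commit, ∅⟩ ∧ q ∉ g.order u r
  | .statusCol u r => g.truth.round u q = r ∧ 1 ≤ r ∧ g.joined q = true ∧
      g.truth.status u r q = some ⟨Stat.commit, ∅⟩ ∧ q ∈ g.order u r ∧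
      ∀ j, (g.order u r).idxOf j ≤ (g.order u r).idxOf q → KnownEntry (g.snap q) u r j
  | .prioProp u r s => g.truth.round u q = r ∧ 1 ≤ r ∧ g.joined q = true ∧
      g.truth.status u r q = some s ∧ s.stat ≠ Stat.commit ∧ g.late u r q = ⊤
  | .prioCol u r s => g.truth.round u q = r ∧ 1 ≤ r ∧ g.joined q = true ∧
      g.truth.status u r q = some s ∧ s.stat ≠ Stat.commit ∧ g.late u r q ≠ ⊤ ∧
      ∀ j, g.late u r j ≤ g.late u r q → KnownPrio g (g.snap q) u r j
  | _ => True

/-- The part of the invariant that concerns the name for which `q` contends. -/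
structure SpotOk (X : PC n) (V : Fin n → View n) (g : Ghost n) (q : Fin n) : Prop where
  spot_picks : ∀ u, X.spot = some u → q ∈ g.picks u
  picks_cases : ∀ u, q ∈ g.picks u → X.spot = some u ∨ (q ∈ g.lost u ∧ KnownName V u)
  lost_pc : ∀ u, X.spot = some u → q ∈ g.lost u → X = .outcomeProp u false
  outcome_lost : ∀ u, X = .outcomeProp u false → q ∈ g.lost u

/-- The part of the invariant that concerns the variables of `q`. -/
structure OwnOk (V : Fin n → View n) (g : Ghost n) (q : Fin n) : Prop where
  lost_picks : ∀ u, q ∈ g.lost u → q ∈ g.picks u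
  round_picks : ∀ u, 1 ≤ g.truth.round u q → q ∈ g.picks u
  status_round : ∀ u r, g.truth.status u r q ≠ none → 1 ≤ r ∧ r ≤ g.truth.round u q
  status_top : ∀ u r, g.truth.status u r q ≠ none → r ≤ g.top u
  round_door : ∀ u, 1 ≤ g.truth.round u q → KnownDoor V u
  order_known : ∀ u r, q ∈ g.order u r → KnownEntry V u r q ∧ g.truth.status u r q ≠ none
  flipped_order : ∀ u r, g.Flipped u r q → q ∈ g.order u r
  flipped_list : ∀ u r s, g.truth.status u r q = some s → s.stat ≠ Stat.commit →
    ∀ j, (g.order u r).idxOf j ≤ (g.order u r).idxOf q → j ∈ s.list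
  list_status : ∀ u r s, g.truth.status u r q = some s → ∀ j ∈ s.list, g.truth.status u r j ≠ none
  low_card : ∀ u r s, g.truth.status u r q = some s → s.stat = Stat.low → 2 ≤ s.list.card
  survived : ∀ u r, 1 ≤ r → r + 1 ≤ g.truth.round u q → g.Survived u r q
  lost_witness : ∀ u, q ∈ g.lost u → g.LostWitness u q
  late_known : ∀ u r, g.late u r q ≠ ⊤ →
    g.Flipped u r q ∧ KnownPrio g V u r q ∧ g.late u r q < (g.clock : ℕ∞)

/-- Which processors can still take part in the rounds `top u - 1` and `top u`. -/
structure CapOk (pc : Fin n → PC n) (V : Fin n → View n) (g : Ghost n) (u : Fin n) : Prop where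
  leader_mem : g.leader u ∈ g.cap u
  known : KnownRound V u (g.leader u) (g.top u)
  round_lt : ∀ q, q ∉ g.cap u → g.truth.round u q + 1 ≤ g.top u
  status : ∀ q, q ∉ g.cap u → g.truth.status u (g.top u - 1) q = none
  snap : ∀ q, q ∉ g.cap u → pc q = .roundCol u (g.top u - 1) →
    KnownRound (g.snap q) u (g.leader u) (g.top u)

/-- The invariant of the protocol. -/
structure Sound (pc : Fin n → PC n) (V : Fin n → View n) (g : Ghost n) : Prop where
  pcOk : ∀ q, PcOk V g q (pc q)
  spotOk : ∀ q, SpotOk (pc q) V g q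
  ownOk : ∀ q, OwnOk V g q
  contended : ∀ v, v ∈ g.truth.contended ↔ (g.picks v).Nonempty
  door : ∀ u, g.truth.door u = true → ∃ q ∈ g.picks u, pc q = .doorProp u ∨ 1 ≤ g.truth.round u q
  nodup : ∀ u r, (g.order u r).Nodup
  top_round : ∀ u, 1 ≤ g.top u → ∃ q, 1 ≤ g.truth.round u q
  first : ∀ u r, (g.first u r = none → ∀ q, ¬ g.Flipped u r q) ∧
    ∀ a, g.first u r = some a → g.Flipped u r a
  cap : ∀ u, 2 ≤ g.top u → CapOk pc V g u

/-! ## Stability -/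

/-- From `g` to `g'` nothing of `q` changes, and the other processors proceed. -/
structure Ext (g g' : Ghost n) (q : Fin n) : Prop where
  truth : g.truth.Le g'.truth
  round : ∀ u, g'.truth.round u q = g.truth.round u q
  status : ∀ u r, g'.truth.status u r q = g.truth.status u r q
  picks : ∀ u, q ∈ g'.picks u ↔ q ∈ g.picks u
  lost : ∀ u, q ∈ g'.lost u ↔ q ∈ g.lost u
  mem_order : ∀ u r, q ∈ g'.order u r ↔ q ∈ g.order u r
  idx : ∀ u r, q ∈ g.order u r → ∀ j, (g'.order u r).idxOf j ≤ (g'.order u r).idxOf q →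
    (g.order u r).idxOf j ≤ (g.order u r).idxOf q
  late : ∀ u r, g'.late u r q = g.late u r q
  late_other : ∀ u r j, g'.late u r j = g.late u r j ∨
    (g.late u r j = ⊤ ∧ g'.late u r j = (g.clock : ℕ∞))
  top : ∀ u, g.top u ≤ g'.top u
  clock : g.clock ≤ g'.clock

lemma status_eq_of_le {g g' : Ghost n} (h : g.truth.Le g'.truth) {u r q} {s : Status n}
    (hs : g.truth.status u r q = some s) (hc : s.stat ≠ Stat.commit) :
    g'.truth.status u r q = some s := by
  have := h.status u r q
  rw [hs] at this
  exact this.eq_of_prio hc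

lemma Ghost.Has.mono {g g' : Ghost n} (h : g.truth.Le g'.truth) {b u r q} (hb : b ≠ Stat.commit)
    (hs : g.Has b u r q) : g'.Has b u r q := by
  obtain ⟨s, h1, h2⟩ := hs
  exact ⟨s, status_eq_of_le h h1 (by rw [h2]; exact hb), h2⟩

lemma KnownRound.mono {V V' : Fin n → View n} (h : ∀ k, (V k).Le (V' k)) {u q r}
    (hk : KnownRound V u q r) : KnownRound V' u q r :=
  Maj.mono hk fun k hk => hk.trans ((h k).round u q)

lemma KnownName.mono {V V' : Fin n → View n} (h : ∀ k, (V k).Le (V' k)) {u}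
    (hk : KnownName V u) : KnownName V' u :=
  Maj.mono hk fun k hk => (h k).contended hk

lemma KnownDoor.mono {V V' : Fin n → View n} (h : ∀ k, (V k).Le (V' k)) {u}
    (hk : KnownDoor V u) : KnownDoor V' u :=
  Maj.mono hk fun k hk => (h k).door u hk

lemma KnownEntry.mono {V V' : Fin n → View n} (h : ∀ k, (V k).Le (V' k)) {u r q}
    (hk : KnownEntry V u r q) : KnownEntry V' u r q :=
  Maj.mono hk fun k hk => ((h k).status u r q).ne_none hk

lemma KnownPrio.mono {V V' : Fin n → View n} (h : ∀ k, (V k).Le (V' k)) {g : Ghost n} {u r q}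
    (hk : KnownPrio g V u r q) : KnownPrio g V' u r q :=
  Maj.mono hk fun k hk => hk.trans ((h k).status u r q)

/-- The strict comparison of the times `late` persists: a time that was infinite can only become the
current clock, which exceeds every finite time set before. -/
lemma Ghost.LostWitness.mono {g g' : Ghost n} {u q : Fin n} (h : g.LostWitness u q)
    (hT : g.truth.Le g'.truth) (hr : g'.truth.round u q = g.truth.round u q)
    (hl : ∀ r, g'.late u r q = g.late u r q)
    (ho : ∀ r j, g'.late u r j = g.late u r j ∨
      (g.late u r j = ⊤ ∧ g'.late u r j = (g.clock : ℕ∞)))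
    (hc : ∀ r, g.late u r q ≠ ⊤ → g.late u r q < (g.clock : ℕ∞)) : g'.LostWitness u q := by
  obtain ⟨h1, h2⟩ := h
  unfold Ghost.LostWitness
  rw [hr]
  refine ⟨fun h0 => hT.door _ (h1 h0), fun h0 => ?_⟩
  rcases h2 h0 with ⟨j, hj⟩ | ⟨h3, j, h4, h5⟩
  · exact Or.inl ⟨j, hj.trans_le (hT.round u j)⟩
  · refine Or.inr ⟨h3.mono hT (by simp), j, (hT.status _ _ _).ne_none h4, ?_⟩
    rcases h5 with h5 | h5
    · exact Or.inl (h5.mono hT (by simp))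
    · right
      rw [hl]
      rcases ho (g.truth.round u q) j with h6 | ⟨h6, h7⟩
      · rw [h6]; exact h5
      · rw [h7]; exact hc _ h5.ne_top

lemma OwnOk.stable {V : Fin n → View n} {g g' : Ghost n} {q : Fin n} (h : OwnOk V g q)
    (E : Ext g g' q) : OwnOk V g' q where
  lost_picks u := by rw [E.lost, E.picks]; exact h.lost_picks u
  round_picks u := by rw [E.round, E.picks]; exact h.round_picks u
  status_round u r := by rw [E.round, E.status]; exact h.status_round u r
  status_top u r hs := by rw [E.status] at hs; exact (h.status_top u r hs).trans (E.top u)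
  round_door u := by rw [E.round]; exact h.round_door u
  order_known u r := by rw [E.mem_order, E.status]; exact h.order_known u r
  flipped_order u r := by
    rw [E.mem_order]; unfold Ghost.Flipped; rw [E.status]; exact h.flipped_order u r
  flipped_list u r s hs hc j hj := by
    rw [E.status] at hs
    exact h.flipped_list u r s hs hc j (E.idx u r (h.flipped_order u r ⟨s, hs, hc⟩) j hj)
  list_status u r s hs j hj := by
    rw [E.status] at hs
    exact (E.truth.status u r j).ne_none (h.list_status u r s hs j hj)
  low_card u r s := by rw [E.status]; exact h.low_card u r s
  survived u r := by
    rw [E.round]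
    intro h1 h2
    obtain ⟨s, hs, hc, hl⟩ := h.survived u r h1 h2
    exact ⟨s, by rw [E.status]; exact hs, hc, fun h j hj => (hl h j hj).mono E.truth (by simp)⟩
  lost_witness u := by
    rw [E.lost]; intro hl
    exact (h.lost_witness u hl).mono E.truth (E.round u) (fun r => E.late u r)
      (fun r => E.late_other u r) fun r hr => (h.late_known u r hr).2.2
  late_known u r := by
    rw [E.late]; intro hl
    obtain ⟨h1, h2, h3⟩ := h.late_known u r hl
    unfold Ghost.Flipped KnownPrio
    rw [E.status]
    exact ⟨h1, h2, h3.trans_le (by exact_mod_cast E.clock)⟩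

lemma PcOk.stable {V : Fin n → View n} {g g' : Ghost n} {q : Fin n} {X : PC n}
    (h : PcOk V g q X) (E : Ext g g' q) (ho : OwnOk V g q) (ho' : ∀ j, OwnOk V g j)
    (hs : g'.snap q = g.snap q) (hj : g'.joined q = g.joined q) : PcOk V g' q X := by
  cases X <;> simp only [PcOk, E.round, E.status, E.mem_order, E.late, E.picks, hs, hj] at h ⊢ <;> try exact h
  · exact ⟨h.1.trans E.truth.contended, h.2⟩
  · exact ⟨h.1, E.truth.door _ h.2.1, h.2.2⟩
  · obtain ⟨h1, h2, h3, h4, h5, h6⟩ := h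
    exact ⟨h1, h2, h3, h4, h5, fun j hj => h6 j (E.idx _ _ h5 j hj)⟩
  · rename_i u r s
    obtain ⟨h1, h2, h3, h4, h5, h6, h7⟩ := h
    refine ⟨h1, h2, h3, h4, h5, h6, fun j hj => ?_⟩
    have hjl : g.late u r j ≤ g.late u r q ∧ g.late u r j ≠ ⊤ := by
      rcases E.late_other u r j with h8 | ⟨h8, h9⟩
      · rw [h8] at hj; exact ⟨hj, fun h => h6 (by rw [h] at hj; exact top_le_iff.1 hj)⟩
      · rw [h9] at hj
        exact absurd (ho.late_known _ _ h6).2.2 (not_lt.2 hj)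
    have := h7 j hjl.1
    obtain ⟨⟨s, h10, h11⟩, _⟩ := (ho' j).late_known _ _ hjl.2
    unfold KnownPrio at this ⊢
    rw [h10] at this
    rw [status_eq_of_le E.truth h10 h11]
    exact this

lemma SpotOk.stable {V : Fin n → View n} {g g' : Ghost n} {q : Fin n} {X : PC n}
    (h : SpotOk X V g q) (E : Ext g g' q) : SpotOk X V g' q where
  spot_picks u := by rw [E.picks]; exact h.spot_picks u
  picks_cases u := by rw [E.picks, E.lost]; exact h.picks_cases u
  lost_pc u := by rw [E.lost]; exact h.lost_pc u
  outcome_lost u := by rw [E.lost]; exact h.outcome_lost u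

lemma Sound.mono_view {pc : Fin n → PC n} {V V' : Fin n → View n} {g : Ghost n}
    (h : Sound pc V g) (hV : ∀ k, (V k).Le (V' k)) : Sound pc V' g where
  pcOk q := by
    have := h.pcOk q
    cases hX : pc q <;> rw [hX] at this <;> simp only [PcOk] at this ⊢ <;> try exact this
    exact ⟨this.1, this.2.1, this.2.2.1, this.2.2.2.1, this.2.2.2.2.mono hV⟩
  spotOk q := ⟨(h.spotOk q).spot_picks, fun u hu => ((h.spotOk q).picks_cases u hu).imp id
      fun h => ⟨h.1, h.2.mono hV⟩, (h.spotOk q).lost_pc, (h.spotOk q).outcome_lost⟩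
  ownOk q := { h.ownOk q with
    round_door := fun u hu => ((h.ownOk q).round_door u hu).mono hV
    order_known := fun u r hu => ⟨((h.ownOk q).order_known u r hu).1.mono hV,
      ((h.ownOk q).order_known u r hu).2⟩
    late_known := fun u r hu => ⟨((h.ownOk q).late_known u r hu).1,
      ((h.ownOk q).late_known u r hu).2.1.mono hV, ((h.ownOk q).late_known u r hu).2.2⟩ }
  contended := h.contended
  door := h.door
  nodup := h.nodup
  top_round := h.top_round
  first := h.first
  cap u hu := { h.cap u hu with known := (h.cap u hu).known.mono hV }

lemma Sound.initial (p₀ : Fin n) :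
    Sound (Config.initial n).pc (Config.initial n).view (Ghost.initial n p₀) where
  pcOk q := by simp [Config.pc, Config.initial, PcOk]
  spotOk q := by
    constructor <;> simp [Config.pc, Config.initial, PC.spot, Ghost.initial]
  ownOk q := by
    constructor <;> simp [Ghost.initial, View.initial, Ghost.Flipped]
  contended v := by simp [Ghost.initial, View.initial]
  door u := by simp [Ghost.initial, View.initial]
  nodup u r := by simp [Ghost.initial]
  top_round u hu := by simp [Ghost.initial] at hu
  first u r := by simp [Ghost.initial, Ghost.Flipped, View.initial]
  cap u hu := by simp [Ghost.initial] at hu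

/-- Appending p to a commit order puts nobody new before its earlier members, and a completion time
is set only where it was infinite. -/
lemma ext_of_ne {g : Ghost n} {p q : Fin n} (hq : q ≠ p) (X Y : PC n) (V : Fin n → View n)
    (hT : g.truth.Le (g.event p X Y V).truth)
    (hlate : ∀ u r s, X = .prioProp u r s → g.late u r p = ⊤) : Ext g (g.event p X Y V) q := by
  refine ⟨hT, ?_, ?_, ?_, ?_, ?_, ?_, ?_, ?_, ?_, ?_⟩
  · intro u; unfold Ghost.event Ghost.core; split <;> simp [View.setRound_round, hq]
  · intro u r; unfold Ghost.event Ghost.core; split <;> simp [View.setStatus_status, hq]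
  · intro u; unfold Ghost.event Ghost.core; split <;> simp only
    simp only [Function.update_apply]; split_ifs with h
    · subst h; simp [hq]
    · rfl
  · intro u; unfold Ghost.event Ghost.core; split <;> simp only
    all_goals
      simp only [Function.update_apply]; split_ifs with h
      · subst h; simp [hq]
      · rfl
  · intro u r; unfold Ghost.event Ghost.core; split <;> simp only
    rename_i u' r' _ _ 
    by_cases hu : u = u'
    · subst hu
      by_cases hr : r = r'
      · subst hr; simp [hq]
      · simp [hr]
    · simp [hu]
  · intro u r hqo j; unfold Ghost.event Ghost.core; split <;> simp only <;> try exact id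
    rename_i u' r' _ _ 
    by_cases hu : u = u'
    · subst hu
      by_cases hr : r = r'
      · subst hr
        simp only [Function.update_self]
        rw [List.idxOf_append_of_mem hqo]
        by_cases hjo : j ∈ g.order u r
        · rw [List.idxOf_append_of_mem hjo]; exact id
        · rw [List.idxOf_append_of_notMem hjo]
          have := List.idxOf_lt_length_of_mem hqo
          omega
      · simp [hr]
    · simp [hu]
  · intro u r; unfold Ghost.event Ghost.core; split <;> simp only
    rename_i u' r' _ _ _ _
    by_cases hu : u = u'
    · subst hu
      by_cases hr : r = r'
      · subst hr; simp [hq]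
      · simp [hr]
    · simp [hu]
  · intro u r j; unfold Ghost.event Ghost.core; split <;> simp only <;> try exact Or.inl trivial
    rename_i u' r' s _ _ _
    have hl := hlate u' r' s rfl
    by_cases hu : u = u'
    · subst hu
      by_cases hr : r = r'
      · subst hr
        by_cases hj : j = p
        · subst hj; right; simp [hl]
        · simp [hj]
      · simp [hr]
    · simp [hu]
  · intro u; unfold Ghost.event Ghost.core; split <;> simp only <;> try exact le_rfl
    simp only [Function.update_apply]; split_ifs with h
    · subst h; exact le_max_left _ _
    · exact le_rfl
  · show g.clock ≤ g.clock + 1; omega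

/-! ## Names and their holders -/

def holders (pc : Fin n → PC n) (u : Fin n) : Finset (Fin n) :=
  Finset.univ.filter fun q => (pc q).spot = some u

def idle (pc : Fin n → PC n) : Finset (Fin n) := Finset.univ.filter fun q => (pc q).spot = none

lemma mem_holders {pc : Fin n → PC n} {u q : Fin n} : q ∈ holders pc u ↔ (pc q).spot = some u := by
  simp [holders]

lemma mem_idle {pc : Fin n → PC n} {q : Fin n} : q ∈ idle pc ↔ (pc q).spot = none := by
  simp [idle]

/-- Not all the processors that pick a name lose the leader election for it. -/
lemma Sound.exists_notMem_lost {pc : Fin n → PC n} {V : Fin n → View n} {g : Ghost n}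
    (h : Sound pc V g) {u : Fin n} (hu : (g.picks u).Nonempty) : ∃ q ∈ g.picks u, q ∉ g.lost u := by
  -- Consider a picker q of maximal round. If this round is 0, the door was closed by a picker that
  -- is either still propagating this, and so has not lost, or has entered a positive round.
  by_contra! hall
  obtain ⟨q, hq, hmax⟩ := Finset.exists_max_image (g.picks u) (fun q => g.truth.round u q) hu
  by_cases h0 : g.truth.round u q = 0
  · obtain ⟨q', hq', h1⟩ := h.door u (((h.ownOk q).lost_witness u (hall q hq)).1 h0)
    rcases h1 with h1 | h1
    · have := (h.spotOk q').lost_pc u (by rw [h1]; rfl) (hall q' hq')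
      rw [h1] at this; cases this
    · have := hmax q' hq'; omega
  -- In the maximal round nobody was beaten by a larger round. So all its members have low priority,
  -- and each lost to one with high priority or with a later completion time. High priority is
  -- excluded because that processor lost as well, and a member with the latest time is a
  -- contradiction.
  · have key : ∀ q' ∈ g.picks u, g.truth.round u q' = g.truth.round u q →
        g.Has Stat.low u (g.truth.round u q) q' ∧ ∃ j ∈ g.picks u,
          g.truth.round u j = g.truth.round u q ∧ (g.Has Stat.high u (g.truth.round u q) j ∨
          g.late u (g.truth.round u q) q' < g.late u (g.truth.round u q) j) := by
      intro q' hq' hr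
      rcases ((h.ownOk q').lost_witness u (hall q' hq')).2 (by omega) with ⟨j, hj⟩ | ⟨h1, j, h2, h3⟩
      · have := hmax j ((h.ownOk j).round_picks u (by omega)); omega
      · rw [hr] at h1 h2 h3
        have h4 := ((h.ownOk j).status_round u _ h2).2
        have h5 : j ∈ g.picks u := (h.ownOk j).round_picks u (by omega)
        exact ⟨h1, j, h5, le_antisymm (hmax j h5) h4, h3⟩
    obtain ⟨m, hm, hmm⟩ := Finset.exists_max_image
      ((g.picks u).filter fun q' => g.truth.round u q' = g.truth.round u q)
      (fun q' => g.late u (g.truth.round u q) q') ⟨q, by simp [hq]⟩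
    rw [Finset.mem_filter] at hm
    obtain ⟨-, j, hj, hjr, h3⟩ := key m hm.1 hm.2
    rcases h3 with ⟨s, hs, hs'⟩ | h3
    · obtain ⟨⟨s', h1, h2⟩, -⟩ := key j hj hjr
      rw [hs] at h1; cases h1; rw [hs'] at h2; cases h2
    · exact absurd (hmm j (Finset.mem_filter.2 ⟨hj, hjr⟩)) (not_le.2 h3)

lemma Sound.holders_nonempty {pc : Fin n → PC n} {V : Fin n → View n} {g : Ghost n}
    (h : Sound pc V g) {u : Fin n} (hu : (g.picks u).Nonempty) : (holders pc u).Nonempty := by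
  obtain ⟨q, hq, hl⟩ := h.exists_notMem_lost hu
  refine ⟨q, mem_holders.2 (((h.spotOk q).picks_cases u hq).resolve_right fun h => hl h.1)⟩

lemma Sound.holders_subset {pc : Fin n → PC n} {V : Fin n → View n} {g : Ghost n}
    (h : Sound pc V g) (u : Fin n) : holders pc u ⊆ g.picks u :=
  fun q hq => (h.spotOk q).spot_picks u (mem_holders.1 hq)

/-- The names that nobody has picked. -/
def Ghost.free (g : Ghost n) : Finset (Fin n) := Finset.univ.filter fun u => g.picks u = ∅

lemma card_idle_add_sum_holders (pc : Fin n → PC n) :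
    (idle pc).card + ∑ u, (holders pc u).card = n := by
  have h1 := Finset.card_eq_sum_card_fiberwise (f := fun q => (pc q).spot)
    (s := (Finset.univ : Finset (Fin n))) (t := Finset.univ) (by simp)
  rw [Finset.card_univ, Fintype.card_fin, Fintype.sum_option] at h1
  exact h1.symm

/-- The number of free names is the number of processors without a name, plus the number of
processors that are in excess for some name. -/
lemma Sound.card_free {pc : Fin n → PC n} {V : Fin n → View n} {g : Ghost n} (h : Sound pc V g) :
    g.free.card = (idle pc).card + ∑ u, ((holders pc u).card - 1) := by
  have h1 := card_idle_add_sum_holders pc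
  -- A free name has no holder, so that the truncated difference is 0; a picked name has at least
  -- one holder. Summation over u compares n names with n processors.
  have h2 : ∀ u, (holders pc u).card + (if u ∈ g.free then 1 else 0) =
      ((holders pc u).card - 1) + 1 := by
    intro u
    by_cases hu : g.picks u = ∅
    · have : holders pc u = ∅ := Finset.subset_empty.1 (hu ▸ h.holders_subset u)
      simp [Ghost.free, hu, this]
    · have := (h.holders_nonempty (Finset.nonempty_iff_ne_empty.2 hu)).card_pos
      simp [Ghost.free, hu]; omega
  have h3 := Finset.sum_congr (rfl : (Finset.univ : Finset (Fin n)) = _) fun u _ => h2 u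
  rw [Finset.sum_add_distrib, Finset.sum_add_distrib] at h3
  simp only [Finset.sum_ite_mem, Finset.univ_inter, Finset.sum_const, smul_eq_mul, mul_one,
    Finset.card_univ, Fintype.card_fin] at h3
  omega

lemma Sound.exists_free {pc : Fin n → PC n} {V : Fin n → View n} {g : Ghost n} (h : Sound pc V g)
    {p : Fin n} (hp : (pc p).spot = none) : g.free.Nonempty := by
  rw [← Finset.card_pos, h.card_free]
  have := Finset.card_pos.2 ⟨p, mem_idle.2 hp⟩
  omega

/-! ## Transitions -/

/-- The possible transitions of a processor, with what it has learned. -/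
inductive Trans (V : Fin n → View n) (g : Ghost n) (p : Fin n) : PC n → PC n → Prop
  | start : Trans V g p .start .colContended
  | collect (S) (h1 : S ⊆ g.truth.contended) (h2 : ∀ v, KnownName (g.snap p) v → v ∈ S) :
      Trans V g p .colContended (.propContended S)
  | pick (S u) (hu : u ∉ S) (hS : ∀ v ∈ S, KnownName V v) :
      Trans V g p (.propContended S) (.doorCol u)
  | doorLose (u) (h : g.truth.door u = true) : Trans V g p (.doorCol u) (.outcomeProp u false)
  | doorPass (u) (h : ¬ KnownDoor (g.snap p) u) : Trans V g p (.doorCol u) (.doorProp u)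
  | enter (u) (h : KnownDoor V u) : Trans V g p (.doorProp u) (.roundProp u 1)
  | preround (u r) (h : KnownRound V u p r) : Trans V g p (.roundProp u r) (.roundCol u r)
  | roundLose (u r) (h : ∃ j, r < g.truth.round u j) :
      Trans V g p (.roundCol u r) (.outcomeProp u false)
  | win (u r) : Trans V g p (.roundCol u r) (.outcomeProp u true)
  | commit (u r) (h : 2 ≤ r → ∃ j, j ≠ p ∧ r - 1 ≤ g.truth.round u j)
      (h' : ∀ j, j ≠ p → ¬ KnownRound (g.snap p) u j (r + 1)) :
      Trans V g p (.roundCol u r) (.commitProp u r)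
  | status (u r) (h : KnownEntry V u r p) : Trans V g p (.commitProp u r) (.statusCol u r)
  | flip (u r) (s : Status n) (h : s.stat ≠ Stat.commit)
      (h1 : ∀ j, KnownEntry (g.snap p) u r j → j ∈ s.list)
      (h2 : ∀ j ∈ s.list, g.truth.status u r j ≠ none) (h3 : s.stat = Stat.low → 2 ≤ s.list.card) :
      Trans V g p (.statusCol u r) (.prioProp u r s)
  | prio (u r s) (h : KnownPrio g V u r p) : Trans V g p (.prioProp u r s) (.prioCol u r s)
  | pillLose (u r) (s : Status n) (h : s.stat = Stat.low)
      (h' : ∃ j, g.truth.status u r j ≠ none ∧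
        ¬ (g.Has Stat.low u r j ∧ KnownPrio g (g.snap p) u r j)) :
      Trans V g p (.prioCol u r s) (.outcomeProp u false)
  | survive (u r) (s : Status n) (h : s.stat = Stat.low → ∀ j ∈ s.list, g.Has Stat.low u r j) :
      Trans V g p (.prioCol u r s) (.roundProp u (r + 1))
  | finish (u) : Trans V g p (.outcomeProp u true) (.returned u)
  | retry (u) (h : KnownName V u) : Trans V g p (.outcomeProp u false) .colContended

lemma View.le_setRound {V : View n} {u i r} (h : V.round u i ≤ r) : V.Le (V.setRound u i r) := by
  refine ⟨subset_rfl, fun _ h => h, fun u' i' => ?_, fun _ _ _ => EntryLe.refl _⟩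
  rw [View.setRound_round]; split_ifs with h1
  · rw [h1.1, h1.2]; exact h
  · exact le_rfl

lemma View.le_setStatus {V : View n} {u r i s} (h : EntryLe (V.status u r i) (some s)) :
    V.Le (V.setStatus u r i s) := by
  refine ⟨subset_rfl, fun _ h => h, fun _ _ => le_rfl, fun u' r' i' => ?_⟩
  rw [View.setStatus_status]; split_ifs with h1
  · rw [h1.1, h1.2.1, h1.2.2]; exact h
  · exact EntryLe.refl _

lemma View.le_closeDoor (V : View n) (u) : V.Le (V.closeDoor u) := by
  refine ⟨subset_rfl, fun v hv => ?_, fun _ _ => le_rfl, fun _ _ _ => EntryLe.refl _⟩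
  rw [View.closeDoor_door]; split_ifs <;> simp [hv]

lemma Trans.truth_le {V : Fin n → View n} {g : Ghost n} {p : Fin n} {X Y : PC n}
    (t : Trans V g p X Y) (hp : PcOk V g p X) (V' : Fin n → View n) :
    g.truth.Le (g.event p X Y V').truth := by
  cases t <;> simp only [Ghost.event, Ghost.core] <;> try exact View.Le.refl _
  · exact ⟨Finset.subset_insert _ _, fun _ h => h, fun _ _ => le_rfl, fun _ _ _ => EntryLe.refl _⟩
  · exact View.le_closeDoor _ _
  · exact View.le_setRound (by rw [hp.1]; omega)
  · exact View.le_setStatus (by rw [hp.2.2.2.1]; exact Or.inl rfl)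
  · exact View.le_setStatus (by rw [hp.2.2.2.1]; exact Or.inr (Or.inr ⟨rfl, by simp⟩))
  · exact View.le_setRound (by rw [hp.1]; omega)

/-- Nothing of the other processors changes, so their clauses follow from `Ext`. What remains to be
checked for each transition are the clauses about p and the global ones. -/
lemma Sound.of_event {pc : Fin n → PC n} {V : Fin n → View n} {g : Ghost n} (h : Sound pc V g)
    {p : Fin n} {X Y : PC n} (hX : pc p = X) (t : Trans V g p X Y)
    (hp : PcOk V (g.event p X Y V) p Y) (hs : SpotOk Y V (g.event p X Y V) p)
    (ho : OwnOk V (g.event p X Y V) p)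
    (hc : ∀ v, v ∈ (g.event p X Y V).truth.contended ↔
      ((g.event p X Y V).picks v).Nonempty)
    (hd : ∀ u, (g.event p X Y V).truth.door u = true →
      ((Y = .doorProp u ∨ 1 ≤ (g.event p X Y V).truth.round u p) ∧
        p ∈ (g.event p X Y V).picks u) ∨
      (g.truth.door u = true ∧ X ≠ .doorProp u))
    (hn : ∀ u r, ((g.event p X Y V).order u r).Nodup)
    (ht : ∀ u, 1 ≤ (g.event p X Y V).top u →
      1 ≤ g.top u ∨ 1 ≤ (g.event p X Y V).truth.round u p)
    (hf : ∀ u r, ((g.event p X Y V).first u r = none →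
        ∀ q, ¬ (g.event p X Y V).Flipped u r q) ∧
      ∀ a, (g.event p X Y V).first u r = some a → (g.event p X Y V).Flipped u r a)
    (hcap : ∀ u, 2 ≤ (g.event p X Y V).top u →
      CapOk (Function.update pc p Y) V (g.event p X Y V) u) :
    Sound (Function.update pc p Y) V (g.event p X Y V) := by
  have hP : PcOk V g p X := hX ▸ h.pcOk p
  have hT := t.truth_le hP V
  have hE : ∀ q, q ≠ p → Ext g (g.event p X Y V) q := by
    intro q hq
    refine ext_of_ne hq _ _ _ hT fun u r s hX' => ?_
    rw [hX'] at hP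
    exact hP.2.2.2.2.2
  have hO : ∀ q, OwnOk V (g.event p X Y V) q := by
    intro q
    by_cases hq : q = p
    · subst hq; exact ho
    · exact (h.ownOk q).stable (hE q hq)
  have hj : ∀ q, q ≠ p → (g.event p X Y V).joined q = g.joined q := by
    intro q hq
    cases t <;> simp [Ghost.event, Ghost.core, hq]
  refine ⟨fun q => ?_, fun q => ?_, hO, hc, fun u hu => ?_, hn, fun u hu => ?_, hf, hcap⟩
  · by_cases hq : q = p
    · subst hq; simpa using hp
    · rw [Function.update_of_ne hq]
      refine (h.pcOk q).stable (hE q hq) (h.ownOk q) h.ownOk ?_ (hj q hq)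
      simp [Ghost.event, hq]
  · by_cases hq : q = p
    · subst hq; simpa using hs
    · rw [Function.update_of_ne hq]
      exact (h.spotOk q).stable (hE q hq)
  · rcases hd u hu with ⟨h1, h2⟩ | ⟨h1, h2⟩
    · exact ⟨p, h2, by simpa using h1⟩
    · obtain ⟨q, hq, h3⟩ := h.door u h1
      by_cases hqp : q = p
      · subst hqp
        rcases h3 with h3 | h3
        · exact absurd (hX.symm.trans h3) h2
        · have := hT.round u q
          have h4 : 1 ≤ (g.event q X Y V).truth.round u q := by omega
          exact ⟨q, ho.round_picks u h4, Or.inr h4⟩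
      · refine ⟨q, ((hE q hqp).picks u).2 hq, ?_⟩
        rw [Function.update_of_ne hqp, (hE q hqp).round]
        exact h3
  · rcases ht u hu with h1 | h1
    · obtain ⟨q, hq⟩ := h.top_round u h1
      exact ⟨q, hq.trans (hT.round u q)⟩
    · exact ⟨p, h1⟩

/-- If p starts a new call, its fresh snapshot is the present views, which already know the round of
the leader; only the round and the entries of p itself are left to check. -/
lemma CapOk.of_event {pc : Fin n → PC n} {V : Fin n → View n} {g : Ghost n} {u : Fin n}
    {p : Fin n} {X Y : PC n} (h : CapOk pc V g u)
    (h1 : (g.event p X Y V).top u = g.top u) (h2 : (g.event p X Y V).cap u = g.cap u)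
    (h3 : (g.event p X Y V).leader u = g.leader u)
    (hE : ∀ q, q ≠ p → Ext g (g.event p X Y V) q)
    (hp : p ∉ g.cap u → (g.event p X Y V).truth.round u p + 1 ≤ g.top u ∧
      (g.event p X Y V).truth.status u (g.top u - 1) p = none) :
    CapOk (Function.update pc p Y) V (g.event p X Y V) u := by
  refine ⟨by rw [h2, h3]; exact h.leader_mem, by rw [h1, h3]; exact h.known, ?_, ?_, ?_⟩ <;>
    intro q hq <;> rw [h2] at hq <;> rw [h1]
  · by_cases hqp : q = p
    · subst hqp; exact (hp hq).1
    · rw [(hE q hqp).round]; exact h.round_lt q hq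
  · by_cases hqp : q = p
    · subst hqp; exact (hp hq).2
    · rw [(hE q hqp).status]; exact h.status q hq
  · rw [h3]
    by_cases hqp : q = p
    · subst hqp; intro _
      have : (g.event q X Y V).snap q = V := by simp [Ghost.event]
      rw [this]; exact h.known
    · have : (g.event p X Y V).snap q = g.snap q := by simp [Ghost.event, hqp]
      rw [Function.update_of_ne hqp, this]
      exact h.snap q hq

/-! ## Preservation of the invariant -/

section
variable {pc : Fin n → PC n} {V : Fin n → View n} {g : Ghost n} {p : Fin n}

lemma Sound.ext (h : Sound pc V g) {X Y : PC n} (hX : pc p = X) (t : Trans V g p X Y) {q : Fin n}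
    (hq : q ≠ p) : Ext g (g.event p X Y V) q := by
  have hP : PcOk V g p X := hX ▸ h.pcOk p
  refine ext_of_ne hq _ _ _ (t.truth_le hP V) fun u r s hX' => ?_
  rw [hX'] at hP
  exact hP.2.2.2.2.2

lemma SpotOk.congr {X Y : PC n} {g' : Ghost n} (h : SpotOk X V g p) (hs : Y.spot = X.spot)
    (h1 : g'.picks = g.picks) (h2 : g'.lost = g.lost) (hX : ∀ u, X ≠ .outcomeProp u false)
    (hY : ∀ u, Y ≠ .outcomeProp u false) : SpotOk Y V g' p where
  spot_picks := by rw [hs, h1]; exact h.spot_picks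
  picks_cases := by rw [hs, h1, h2]; exact h.picks_cases
  lost_pc u := by rw [hs, h2]; intro h3 h4; exact absurd (h.lost_pc u h3 h4) (hX u)
  outcome_lost u h3 := absurd h3 (hY u)

lemma SpotOk.notMem_lost {X : PC n} (h : SpotOk X V g p) {u : Fin n} (hs : X.spot = some u)
    (hX : X ≠ .outcomeProp u false) : p ∉ g.lost u := fun h1 => hX (h.lost_pc u hs h1)

lemma SpotOk.lose {X : PC n} {g' : Ghost n} (h : SpotOk X V g p) {u : Fin n} (hs : X.spot = some u)
    (h1 : g'.picks = g.picks)
    (h2 : g'.lost = Function.update g.lost u (insert p (g.lost u))) :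
    SpotOk (.outcomeProp u false) V g' p where
  spot_picks v hv := by cases hv; rw [h1]; exact h.spot_picks u hs
  picks_cases v := by
    rw [h1, h2]; intro hv
    rcases h.picks_cases v hv with h3 | h3
    · left; rw [← h3, hs]; rfl
    · right; refine ⟨?_, h3.2⟩
      by_cases hvu : v = u
      · subst hvu; simp
      · simpa [hvu] using h3.1
  lost_pc v hv _ := by cases hv; rfl
  outcome_lost v hv := by cases hv; rw [h2]; simp

lemma Sound.of_core (h : Sound pc V g) {X Y : PC n} (hX : pc p = X) (t : Trans V g p X Y)
    (hc : g.core p X Y = g) (hp : PcOk V (g.event p X Y V) p Y)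
    (hs : SpotOk Y V g p) (hXd : ∀ u, X ≠ .doorProp u) :
    Sound (Function.update pc p Y) V (g.event p X Y V) := by
  have hev : g.event p X Y V =
      { g with snap := Function.update g.snap p V, clock := g.clock + 1 } := by
    unfold Ghost.event; rw [hc]
  have hE : Ext g (g.event p X Y V) p := by
    rw [hev]
    exact ⟨View.Le.refl _, fun _ => rfl, fun _ _ => rfl, fun _ => Iff.rfl, fun _ => Iff.rfl,
      fun _ _ => Iff.rfl, fun _ _ _ _ => id, fun _ _ => rfl, fun _ _ _ => Or.inl rfl,
      fun _ => le_rfl, Nat.le_succ _⟩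
  refine h.of_event hX t hp (hs.stable hE) ((h.ownOk p).stable hE) ?_ ?_ ?_ ?_ ?_ ?_ <;>
    (try rw [hev])
  · exact h.contended
  · exact fun u hu => Or.inr ⟨hu, hXd u⟩
  · exact h.nodup
  · exact fun u hu => Or.inl hu
  · exact h.first
  · intro u hu
    rw [← hev] at hu ⊢
    have hcap := h.cap u (by rw [hev] at hu; exact hu)
    refine hcap.of_event (by rw [hev]) (by rw [hev]) (by rw [hev]) (fun q hq => h.ext hX t hq) ?_
    intro hpc; rw [hev]
    exact ⟨hcap.round_lt p hpc, hcap.status p hpc⟩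

/-- Losing the leader election. -/
lemma Sound.lose (h : Sound pc V g) {X : PC n} {u : Fin n} (hX : pc p = X)
    (t : Trans V g p X (.outcomeProp u false)) (hs : X.spot = some u)
    (hev : g.core p X (.outcomeProp u false) =
      { g with lost := Function.update g.lost u (insert p (g.lost u)) })
    (hXd : ∀ u, X ≠ .doorProp u) (hw : g.LostWitness u p) :
    Sound (Function.update pc p (.outcomeProp u false)) V (g.event p X (.outcomeProp u false) V) := by
  have hev : g.event p X (.outcomeProp u false) V =
      { g with
        lost := Function.update g.lost u (insert p (g.lost u))
        snap := Function.update g.snap p V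
        clock := g.clock + 1 } := by
    unfold Ghost.event; rw [hev]
  have hS : SpotOk X V g p := hX ▸ h.spotOk p
  refine h.of_event hX t trivial (hS.lose hs (by rw [hev]) (by rw [hev])) ?_ ?_ ?_ ?_ ?_ ?_ ?_ <;>
    (try rw [hev])
  · have ho := h.ownOk p
    refine ⟨fun v => ?_, ho.round_picks, ho.status_round, ho.status_top, ho.round_door,
      ho.order_known, ho.flipped_order, ho.flipped_list, ho.list_status, ho.low_card, ho.survived,
      fun v => ?_, fun v r hv => ⟨(ho.late_known v r hv).1, (ho.late_known v r hv).2.1,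
        (ho.late_known v r hv).2.2.trans (by exact_mod_cast Nat.lt_succ_self _)⟩⟩
    · by_cases hvu : v = u
      · subst hvu; exact fun _ => hS.spot_picks v hs
      · simpa [hvu] using ho.lost_picks v
    · by_cases hvu : v = u
      · subst hvu; exact fun _ => hw
      · have := ho.lost_witness v
        simp only [Function.update_of_ne hvu]
        exact this
  · exact h.contended
  · exact fun u hu => Or.inr ⟨hu, hXd u⟩
  · exact h.nodup
  · exact fun u hu => Or.inl hu
  · exact h.first
  · intro v hv
    rw [← hev] at hv ⊢
    have hcap := h.cap v (by rw [hev] at hv; exact hv)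
    refine hcap.of_event (by rw [hev]) (by rw [hev]) (by rw [hev]) (fun q hq => h.ext hX t hq) ?_
    intro hpc; rw [hev]
    exact ⟨hcap.round_lt p hpc, hcap.status p hpc⟩

lemma Sound.start (h : Sound pc V g) (hX : pc p = .start) :
    Sound (Function.update pc p .colContended) V (g.event p .start .colContended V) := by
  have hS : SpotOk .start V g p := hX ▸ h.spotOk p
  refine h.of_core hX .start rfl ?_ (hS.congr rfl rfl rfl (by simp) (by simp)) (by simp)
  intro v hv
  have := ((hS.picks_cases v hv).resolve_left (by simp [PC.spot])).2
  simpa [Ghost.event, Ghost.core] using this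

lemma Sound.retry (h : Sound pc V g) {u : Fin n} (hX : pc p = .outcomeProp u false)
    (hu : KnownName V u) :
    Sound (Function.update pc p .colContended) V
      (g.event p (.outcomeProp u false) .colContended V) := by
  have hS : SpotOk (.outcomeProp u false) V g p := hX ▸ h.spotOk p
  have hS' : SpotOk .colContended V g p := by
    refine ⟨by simp [PC.spot], fun v hv => Or.inr ?_, by simp [PC.spot], by simp⟩
    rcases hS.picks_cases v hv with h1 | h1
    · cases h1; exact ⟨hS.outcome_lost u rfl, hu⟩
    · exact h1
  refine h.of_core hX (.retry u hu) rfl ?_ hS' (by simp)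
  intro v hv
  have := ((hS'.picks_cases v hv).resolve_left (by simp [PC.spot])).2
  simpa [Ghost.event, Ghost.core] using this

lemma Sound.collect (h : Sound pc V g) {S} (hX : pc p = .colContended)
    (h1 : S ⊆ g.truth.contended) (h2 : ∀ v, KnownName (g.snap p) v → v ∈ S) :
    Sound (Function.update pc p (.propContended S)) V
      (g.event p .colContended (.propContended S) V) := by
  have hS : SpotOk .colContended V g p := hX ▸ h.spotOk p
  have hP : PcOk V g p .colContended := hX ▸ h.pcOk p
  refine h.of_core hX (.collect S h1 h2) rfl ⟨h1, ?_, fun v hv => h2 v (hP v hv)⟩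
    (hS.congr rfl rfl rfl (by simp) (by simp)) (by simp)
  -- Since p has no name, some name has not been picked, whereas S consists of picked names.
  rintro rfl
  obtain ⟨v, hv⟩ := h.exists_free (p := p) (by rw [hX]; rfl)
  have := (h.contended v).1 (h1 (Finset.mem_univ v))
  simp [Ghost.free] at hv
  simp [hv] at this

lemma Sound.finish (h : Sound pc V g) {u} (hX : pc p = .outcomeProp u true) :
    Sound (Function.update pc p (.returned u)) V
      (g.event p (.outcomeProp u true) (.returned u) V) := by
  have hS : SpotOk (.outcomeProp u true) V g p := hX ▸ h.spotOk p
  exact h.of_core hX (.finish u) rfl trivial (hS.congr rfl rfl rfl (by simp) (by simp)) (by simp)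

lemma Sound.win (h : Sound pc V g) {u r} (hX : pc p = .roundCol u r) :
    Sound (Function.update pc p (.outcomeProp u true)) V
      (g.event p (.roundCol u r) (.outcomeProp u true) V) := by
  have hS : SpotOk (.roundCol u r) V g p := hX ▸ h.spotOk p
  exact h.of_core hX (.win u r) rfl trivial (hS.congr rfl rfl rfl (by simp) (by simp)) (by simp)

lemma Sound.preround (h : Sound pc V g) {u r} (hX : pc p = .roundProp u r)
    (hr : KnownRound V u p r) :
    Sound (Function.update pc p (.roundCol u r)) V
      (g.event p (.roundProp u r) (.roundCol u r) V) := by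
  have hS : SpotOk (.roundProp u r) V g p := hX ▸ h.spotOk p
  have hP : PcOk V g p (.roundProp u r) := hX ▸ h.pcOk p
  exact h.of_core hX (.preround u r hr) rfl ⟨hP.1, hP.2.1, hP.2.2.1, hP.2.2.2, hr⟩
    (hS.congr rfl rfl rfl (by simp) (by simp)) (by simp)

lemma Sound.doorLose (h : Sound pc V g) {u} (hX : pc p = .doorCol u) (hd : g.truth.door u = true) :
    Sound (Function.update pc p (.outcomeProp u false)) V
      (g.event p (.doorCol u) (.outcomeProp u false) V) := by
  have hP : PcOk V g p (.doorCol u) := hX ▸ h.pcOk p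
  exact h.lose hX (.doorLose u hd) rfl rfl (by simp)
    ⟨fun _ => hd, fun h1 => by rw [hP.1] at h1; omega⟩

lemma Sound.roundLose (h : Sound pc V g) {u r} (hX : pc p = .roundCol u r)
    (hd : ∃ j, r < g.truth.round u j) :
    Sound (Function.update pc p (.outcomeProp u false)) V
      (g.event p (.roundCol u r) (.outcomeProp u false) V) := by
  have hP : PcOk V g p (.roundCol u r) := hX ▸ h.pcOk p
  have h1 := hP.1
  have h2 := hP.2.1
  exact h.lose hX (.roundLose u r hd) rfl rfl (by simp)
    ⟨fun h3 => by omega, fun _ => Or.inl (by rw [h1]; exact hd)⟩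

lemma Sound.pillLose (h : Sound pc V g) {u r s} (hX : pc p = .prioCol u r s)
    (hs : s.stat = Stat.low) (hj : ∃ j, g.truth.status u r j ≠ none ∧
        ¬ (g.Has Stat.low u r j ∧ KnownPrio g (g.snap p) u r j)) :
    Sound (Function.update pc p (.outcomeProp u false)) V
      (g.event p (.prioCol u r s) (.outcomeProp u false) V) := by
  have hP : PcOk V g p (.prioCol u r s) := hX ▸ h.pcOk p
  obtain ⟨h1, h2, h3, h4, h5, h6, h7⟩ := hP
  refine h.lose hX (.pillLose u r s hs hj) rfl rfl (by simp)
    ⟨fun h3 => by omega, fun _ => Or.inr ?_⟩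
  rw [h1]
  obtain ⟨j, hj1, hj2⟩ := hj
  refine ⟨⟨s, h4, hs⟩, j, hj1, ?_⟩
  -- Otherwise j does not have high priority and its propagation ended no later than that of p. So j
  -- has low priority, known to a majority when p started its last collect, contrary to the choice
  -- of j.
  by_contra! hc
  have h8 : g.late u r j ≠ ⊤ := fun h => h6 (top_le_iff.1 (h ▸ hc.2))
  obtain ⟨⟨s', h9, h10⟩, -⟩ := (h.ownOk j).late_known u r h8
  refine hj2 ⟨⟨s', h9, ?_⟩, h7 j hc.2⟩
  cases h11 : s'.stat with
  | commit => exact absurd h11 h10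
  | low => rfl
  | high => exact absurd ⟨s', h9, h11⟩ hc.1

lemma Sound.pick (h : Sound pc V g) {S u} (hX : pc p = .propContended S) (hu : u ∉ S)
    (hk : ∀ v ∈ S, KnownName V v) :
    Sound (Function.update pc p (.doorCol u)) V (g.event p (.propContended S) (.doorCol u) V) := by
  have hS : SpotOk (.propContended S) V g p := hX ▸ h.spotOk p
  have hP : PcOk V g p (.propContended S) := hX ▸ h.pcOk p
  have t := Trans.pick (V := V) (g := g) (p := p) S u hu hk
  have hpu : p ∉ g.picks u := fun h1 => hu (hP.2.2 u h1)
  have ho := h.ownOk p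
  have hmono : ∀ v, g.picks v ⊆ (g.event p (.propContended S) (.doorCol u) V).picks v := by
    intro v
    simp only [Ghost.event, Ghost.core, Function.update_apply]; split_ifs with hv
    · subst hv; exact Finset.subset_insert _ _
    · exact subset_rfl
  refine h.of_event hX t ⟨?_, ?_⟩ ?_ ?_ ?_ ?_ ?_ ?_ ?_ ?_
  · show g.truth.round u p = 0
    by_contra hc
    exact hpu (ho.round_picks u (by omega))
  -- If somebody has committed for u, some processor is in a positive round, and therefore a
  -- majority already knows that the door is closed.
  · simp only [Ghost.event, Ghost.core, Function.update_self, decide_eq_false_iff_not]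
    intro h1
    obtain ⟨q, hq⟩ := h.top_round u (by omega)
    exact (h.ownOk q).round_door u hq
  · refine ⟨fun v hv => ?_, fun v hv => ?_, fun v hv => ?_, by simp⟩
    · cases hv; simp [Ghost.event, Ghost.core]
    · by_cases hvu : v = u
      · subst hvu; exact Or.inl rfl
      · simp only [Ghost.event, Ghost.core, Function.update_of_ne hvu] at hv
        exact Or.inr ((hS.picks_cases v hv).resolve_left (by simp [PC.spot]))
    · cases hv; intro h1
      exact absurd (ho.lost_picks u h1) hpu
  · exact ⟨fun v hv => hmono v (ho.lost_picks v hv), fun v hv => hmono v (ho.round_picks v hv),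
      ho.status_round, ho.status_top, ho.round_door,
      ho.order_known, ho.flipped_order, ho.flipped_list, ho.list_status, ho.low_card, ho.survived,
      ho.lost_witness, fun v r hv => ⟨(ho.late_known v r hv).1, (ho.late_known v r hv).2.1,
        (ho.late_known v r hv).2.2.trans (by exact_mod_cast Nat.lt_succ_self _)⟩⟩
  · intro v
    simp only [Ghost.event, Ghost.core, Finset.mem_insert, Function.update_apply]
    split_ifs with hv
    · simp [hv]
    · simp [hv, h.contended v]
  · exact fun v hv => Or.inr ⟨hv, by simp⟩
  · exact h.nodup
  · exact fun v hv => Or.inl hv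
  · exact h.first
  · intro v hv
    have hcap := h.cap v hv
    refine hcap.of_event rfl rfl rfl (fun q hq => h.ext hX t hq) ?_
    intro hpc
    exact ⟨hcap.round_lt p hpc, hcap.status p hpc⟩

lemma Sound.doorPass (h : Sound pc V g) {u} (hX : pc p = .doorCol u)
    (hd : ¬ KnownDoor (g.snap p) u) :
    Sound (Function.update pc p (.doorProp u)) V (g.event p (.doorCol u) (.doorProp u) V) := by
  have hS : SpotOk (.doorCol u) V g p := hX ▸ h.spotOk p
  have hP : PcOk V g p (.doorCol u) := hX ▸ h.pcOk p
  have t := Trans.doorPass (V := V) (g := g) (p := p) u hd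
  have ho := h.ownOk p
  have hpu : p ∉ g.lost u := hS.notMem_lost rfl (by simp)
  -- A processor that picked the name after the first commit is stopped by the doorway.
  have hj : g.joined p = true := by
    by_contra hc
    exact hd (hP.2 (by simpa using hc))
  have hT : g.truth.Le (g.event p (.doorCol u) (.doorProp u) V).truth := t.truth_le hP V
  refine h.of_event hX t ⟨hP.1, ?_, hj⟩ (hS.congr rfl rfl rfl (by simp) (by simp)) ?_ ?_ ?_ ?_ ?_ ?_ ?_
  · show (g.truth.closeDoor u).door u = true
    simp [View.closeDoor_door]
  · exact ⟨ho.lost_picks, ho.round_picks,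
      ho.status_round, ho.status_top, ho.round_door,
      ho.order_known, ho.flipped_order, ho.flipped_list, ho.list_status, ho.low_card, ho.survived,
      fun v hv => (ho.lost_witness v hv).mono hT rfl (fun _ => rfl) (fun _ _ => Or.inl rfl)
        (fun r hr => (ho.late_known v r hr).2.2),
      fun v r hv => ⟨(ho.late_known v r hv).1, (ho.late_known v r hv).2.1,
        (ho.late_known v r hv).2.2.trans (by exact_mod_cast Nat.lt_succ_self _)⟩⟩
  · exact h.contended
  · intro v hv
    by_cases hvu : v = u
    · subst hvu; exact Or.inl ⟨Or.inl rfl, hS.spot_picks v rfl⟩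
    · refine Or.inr ⟨?_, by simp⟩
      simpa [Ghost.event, Ghost.core, View.closeDoor_door, hvu] using hv
  · exact h.nodup
  · exact fun v hv => Or.inl hv
  · exact h.first
  · intro v hv
    have hcap := h.cap v hv
    refine hcap.of_event rfl rfl rfl (fun q hq => h.ext hX t hq) ?_
    intro hpc
    exact ⟨hcap.round_lt p hpc, hcap.status p hpc⟩

/-- The critical clause is `CapOk`. A commit in a new largest round r makes p the leader; a majority
knows that it reached r, and the cap is the set of processors of round at least r - 1. A processor
outside the cap that later collects `Round` in round r - 1 sees the round r and cannot commit there.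
-/
lemma Sound.commit (h : Sound pc V g) {u r} (hX : pc p = .roundCol u r)
    (hj : 2 ≤ r → ∃ j, j ≠ p ∧ r - 1 ≤ g.truth.round u j)
    (hk : ∀ j, j ≠ p → ¬ KnownRound (g.snap p) u j (r + 1)) :
    Sound (Function.update pc p (.commitProp u r)) V
      (g.event p (.roundCol u r) (.commitProp u r) V) := by
  have hS : SpotOk (.roundCol u r) V g p := hX ▸ h.spotOk p
  have hP : PcOk V g p (.roundCol u r) := hX ▸ h.pcOk p
  have t := Trans.commit (V := V) (g := g) (p := p) u r hj hk
  have ho := h.ownOk p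
  have hpu : p ∉ g.lost u := hS.notMem_lost rfl (by simp)
  have hT : g.truth.Le (g.event p (.roundCol u r) (.commitProp u r) V).truth := t.truth_le hP V
  obtain ⟨h1, h2, h3, h4, h5⟩ := hP
  have hst : ∀ v r' q, (g.event p (.roundCol u r) (.commitProp u r) V).truth.status v r' q =
      if v = u ∧ r' = r ∧ q = p then some ⟨Stat.commit, ∅⟩ else g.truth.status v r' q :=
    fun v r' q => View.setStatus_status _ _ _ _ _ _ _ _
  have hfl : ∀ v r' q, (g.event p (.roundCol u r) (.commitProp u r) V).Flipped v r' q ↔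
      g.Flipped v r' q := by
    intro v r' q
    unfold Ghost.Flipped
    rw [hst]
    split_ifs with hc
    · obtain ⟨rfl, rfl, rfl⟩ := hc
      simp [h4]
    · rfl
  refine h.of_event hX t ⟨h1, h2, h3, ?_, ?_⟩ (hS.congr rfl rfl rfl (by simp) (by simp)) ?_ ?_ ?_ ?_ ?_ ?_ ?_
  · simp [hst]
  · intro hc
    exact (ho.order_known u r hc).2 h4
  · refine ⟨ho.lost_picks, ho.round_picks, fun v r' hv => ?_, fun v r' hv => ?_, ho.round_door,
      fun v r' hv => ⟨(ho.order_known v r' hv).1, (hT.status _ _ _).ne_none (ho.order_known v r' hv).2⟩,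
      fun v r' hv => ?_, fun v r' s hs => ?_, fun v r' s hs j hj => ?_, fun v r' s hs => ?_,
      fun v r' hr hr' => ?_, fun v hv => ?_, fun v r' hv => ?_⟩
    · rw [hst] at hv; split_ifs at hv with hc
      · obtain ⟨rfl, rfl, -⟩ := hc
        exact ⟨h2, h1.ge⟩
      · exact ho.status_round v r' hv
    · simp only [Ghost.event, Ghost.core, Function.update_apply]
      rw [hst] at hv; split_ifs at hv with hc
      · obtain ⟨rfl, rfl, -⟩ := hc
        simp
      · have := ho.status_top v r' hv
        split_ifs with hvu
        · subst hvu; exact this.trans (le_max_left _ _)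
        · exact this
    · exact ho.flipped_order v r' ((hfl v r' p).1 hv)
    · intro hc
      rw [hst] at hs; split_ifs at hs with h6
      · cases hs; exact absurd rfl hc
      · exact ho.flipped_list v r' s hs hc
    · rw [hst] at hs; split_ifs at hs with h6
      · cases hs; simp at hj
      · exact (hT.status _ _ _).ne_none (ho.list_status v r' s hs j hj)
    · rw [hst] at hs; split_ifs at hs with h6
      · cases hs; intro h7; cases h7
      · exact ho.low_card v r' s hs
    · obtain ⟨s, hs, hc, hl⟩ := ho.survived v r' hr hr'
      exact ⟨s, status_eq_of_le hT hs hc, hc, fun h j hj => (hl h j hj).mono hT (by simp)⟩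
    · exact (ho.lost_witness v hv).mono hT rfl (fun _ => rfl) (fun _ _ => Or.inl rfl)
        (fun r hr => (ho.late_known v r hr).2.2)
    · obtain ⟨h6, h7, h8⟩ := ho.late_known v r' hv
      refine ⟨(hfl v r' p).2 h6, ?_, h8.trans (by exact_mod_cast Nat.lt_succ_self _)⟩
      obtain ⟨s, hs, hc⟩ := h6
      unfold KnownPrio at h7 ⊢
      rw [status_eq_of_le hT hs hc, ← hs]
      exact h7
  · exact h.contended
  · exact fun v hv => Or.inr ⟨hv, by simp⟩
  · exact h.nodup
  · intro v hv
    by_cases hvu : v = u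
    · subst hvu; right; show 1 ≤ g.truth.round v p; omega
    · left; simpa [Ghost.event, Ghost.core, hvu] using hv
  · intro v r'
    simp only [hfl]
    exact h.first v r'
  · intro v hv
    by_cases hvu : v = u ∧ g.top v < r
    · obtain ⟨rfl, hlt⟩ := hvu
      have htop : (g.event p (.roundCol v r) (.commitProp v r) V).top v = r := by
        simp [Ghost.event, Ghost.core, hlt.le]
      have hcapv : (g.event p (.roundCol v r) (.commitProp v r) V).cap v =
          Finset.univ.filter fun q => r ≤ g.truth.round v q + 1 := by
        simp [Ghost.event, Ghost.core, hlt]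
      have hlead : (g.event p (.roundCol v r) (.commitProp v r) V).leader v = p := by
        simp [Ghost.event, Ghost.core, hlt]
      rw [htop] at hv
      refine ⟨?_, ?_, ?_, ?_, ?_⟩
      · rw [hcapv, hlead]; simp [h1]
      · rw [hlead, htop]; exact h5
      all_goals
        intro q hq
        rw [hcapv] at hq
        simp only [Finset.mem_filter, Finset.mem_univ, true_and, not_le] at hq
        rw [htop]
      · exact Nat.le_of_lt hq
      · rw [hst, if_neg (by omega)]
        by_contra hc
        have := ((h.ownOk q).status_round v (r - 1) hc).2
        omega
      · by_cases hqp : q = p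
        · subst hqp; omega
        · rw [Function.update_of_ne hqp]
          intro hq'
          have := h.pcOk q
          rw [hq'] at this
          have := this.1
          omega
    · have htop : (g.event p (.roundCol u r) (.commitProp u r) V).top v = g.top v := by
        by_cases h6 : v = u
        · subst h6
          have : r ≤ g.top v := by by_contra hc; exact hvu ⟨rfl, by omega⟩
          simp [Ghost.event, Ghost.core, this]
        · simp [Ghost.event, Ghost.core, h6]
      have hcapv : (g.event p (.roundCol u r) (.commitProp u r) V).cap v = g.cap v := by
        simp only [Ghost.event, Ghost.core]; split_ifs with h7
        · have : v ≠ u := by rintro rfl; exact hvu ⟨rfl, h7⟩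
          simp [this]
        · rfl
      have hlead : (g.event p (.roundCol u r) (.commitProp u r) V).leader v = g.leader v := by
        simp only [Ghost.event, Ghost.core]; split_ifs with h7
        · have : v ≠ u := by rintro rfl; exact hvu ⟨rfl, h7⟩
          simp [this]
        · rfl
      rw [htop] at hv
      have hcap := h.cap v hv
      refine hcap.of_event htop hcapv hlead (fun q hq => h.ext hX t hq) ?_
      intro hpc
      have h6 := hcap.round_lt p hpc
      refine ⟨h6, ?_⟩
      rw [hst]
      split_ifs with h7
      · exfalso
        obtain ⟨rfl, h8, -⟩ := h7
        have h9 := hcap.snap p hpc (by rw [hX, h8])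
        have h10 : g.leader v ≠ p := by rintro rfl; exact hpc hcap.leader_mem
        refine hk _ h10 ?_
        have : r + 1 = g.top v := by omega
        rw [this]; exact h9
      · exact hcap.status p hpc

lemma OwnOk.late_clock (ho : OwnOk V g p) {g' : Ghost n} (hT : g.truth.Le g'.truth)
    (hl : ∀ u r, g'.late u r p = g.late u r p) (hc : g'.clock = g.clock + 1) (u : Fin n) (r : ℕ)
    (hv : g'.late u r p ≠ ⊤) :
    g'.Flipped u r p ∧ KnownPrio g' V u r p ∧ g'.late u r p < (g'.clock : ℕ∞) := by
  rw [hl] at hv ⊢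
  obtain ⟨⟨s, hs, hs'⟩, h7, h8⟩ := ho.late_known u r hv
  refine ⟨⟨s, status_eq_of_le hT hs hs', hs'⟩, ?_, ?_⟩
  · unfold KnownPrio at h7 ⊢
    rw [status_eq_of_le hT hs hs', ← hs]
    exact h7
  · rw [hc]; exact h8.trans (by exact_mod_cast Nat.lt_succ_self _)

/-- Entering a new round. -/
lemma Sound.setRound (h : Sound pc V g) {X : PC n} {u r} (hX : pc p = X)
    (t : Trans V g p X (.roundProp u (r + 1))) (hs : X.spot = some u)
    (hXo : ∀ u, X ≠ .outcomeProp u false)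
    (hev : g.core p X (.roundProp u (r + 1)) = { g with truth := g.truth.setRound u p (r + 1) })
    (hr : g.truth.round u p = r) (hj : g.joined p = true) (hd : KnownDoor V u)
    (hsv : 1 ≤ r → g.Survived u r p) :
    Sound (Function.update pc p (.roundProp u (r + 1))) V
      (g.event p X (.roundProp u (r + 1)) V) := by
  have hS : SpotOk X V g p := hX ▸ h.spotOk p
  have hP : PcOk V g p X := hX ▸ h.pcOk p
  have ho := h.ownOk p
  have hT : g.truth.Le (g.event p X (.roundProp u (r + 1)) V).truth := t.truth_le hP V
  have hrd : ∀ v q, (g.event p X (.roundProp u (r + 1)) V).truth.round v q =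
      if v = u ∧ q = p then r + 1 else g.truth.round v q := by
    intro v q; unfold Ghost.event; rw [hev]; exact View.setRound_round _ _ _ _ _ _
  have hE : ∀ q, q ≠ p → Ext g (g.event p X (.roundProp u (r + 1)) V) q :=
    fun q hq => h.ext hX t hq
  have hev : g.event p X (.roundProp u (r + 1)) V =
      { g with
        truth := g.truth.setRound u p (r + 1)
        snap := Function.update g.snap p V
        clock := g.clock + 1 } := by
    unfold Ghost.event; rw [hev]
  have hpl : p ∉ g.lost u := hS.notMem_lost hs (hXo u)
  refine h.of_event hX t ⟨?_, by omega, ?_, ?_⟩ ?_ ?_ ?_ ?_ ?_ ?_ ?_ ?_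
  · simp [hrd]
  · rw [hev]; exact hj
  · by_contra hc
    have := (ho.status_round u (r + 1) (by rw [hev] at hc; exact hc)).2
    omega
  · exact hS.congr (by rw [hs]; rfl) (by rw [hev]) (by rw [hev]) hXo (by simp)
  · refine ⟨by rw [hev]; exact ho.lost_picks, fun v hv => ?_, fun v r' hv => ?_,
      by rw [hev]; exact ho.status_top, fun v hv => ?_, by rw [hev]; exact ho.order_known,
      by rw [hev]; exact ho.flipped_order, by rw [hev]; exact ho.flipped_list,
      by rw [hev]; exact ho.list_status, by rw [hev]; exact ho.low_card, fun v r' h1 h2 => ?_,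
      fun v hv => ?_, ho.late_clock hT (by rw [hev]; exact fun _ _ => rfl) (by rw [hev])⟩
    · rw [hev]
      rw [hrd] at hv; split_ifs at hv with hc
      · obtain ⟨rfl, -⟩ := hc; exact hS.spot_picks v hs
      · exact ho.round_picks v hv
    · have := ho.status_round v r' (by rw [hev] at hv; exact hv)
      exact ⟨this.1, this.2.trans (hT.round v p)⟩
    · rw [hrd] at hv; split_ifs at hv with hc
      · obtain ⟨rfl, -⟩ := hc; exact hd
      · exact ho.round_door v hv
    · have : g.Survived v r' p := by
        rw [hrd] at h2; split_ifs at h2 with hc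
        · obtain ⟨rfl, -⟩ := hc
          by_cases hrr : r' = r
          · subst hrr; exact hsv h1
          · exact ho.survived v r' h1 (by omega)
        · exact ho.survived v r' h1 h2
      rw [hev]; exact this
    · have hv' : p ∈ g.lost v := by rw [hev] at hv; exact hv
      have hvu : v ≠ u := by rintro rfl; exact hpl hv'
      exact (ho.lost_witness v hv').mono hT (by simp [hrd, hvu]) (by rw [hev]; exact fun _ => rfl)
        (by rw [hev]; exact fun _ _ => Or.inl rfl) (fun r hr => (ho.late_known v r hr).2.2)
  · rw [hev]; exact h.contended
  · intro v hv
    have hv' : g.truth.door v = true := by rw [hev] at hv; exact hv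
    by_cases hX' : X = .doorProp v
    · left
      have hvu : v = u := by rw [hX'] at hs; exact Option.some.inj hs
      subst hvu
      exact ⟨Or.inr (by simp [hrd]), by rw [hev]; exact hS.spot_picks v hs⟩
    · exact Or.inr ⟨hv', hX'⟩
  · rw [hev]; exact h.nodup
  · rw [hev]; exact fun v hv => Or.inl hv
  · rw [hev]; exact h.first
  · intro v hv
    have hcap := h.cap v (by rw [hev] at hv; exact hv)
    refine hcap.of_event (by rw [hev]) (by rw [hev]) (by rw [hev]) hE ?_
    intro hpc
    have h6 := hcap.round_lt p hpc
    have h7 := hcap.status p hpc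
    refine ⟨?_, by rw [hev]; exact h7⟩
    rw [hrd]
    rw [hev] at hv
    have hv : 2 ≤ g.top v := hv
    split_ifs with hc
    · obtain ⟨rfl, -⟩ := hc
      rcases Nat.eq_zero_or_pos r with h0 | h0
      · omega
      · obtain ⟨s, hs, -⟩ := hsv h0
        -- A processor outside the cap has no entry in round `top - 1`, so it cannot have survived
        -- that round; hence even its new round stays below `top`.
        have : r ≠ g.top v - 1 := by
          intro h8; rw [← h8, hs] at h7; cases h7
        omega
    · exact h6

lemma Sound.enter (h : Sound pc V g) {u} (hX : pc p = .doorProp u) (hd : KnownDoor V u) :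
    Sound (Function.update pc p (.roundProp u 1)) V (g.event p (.doorProp u) (.roundProp u 1) V) := by
  have hP : PcOk V g p (.doorProp u) := hX ▸ h.pcOk p
  exact h.setRound (r := 0) hX (.enter u hd) rfl (by simp) rfl hP.1 hP.2.2 hd (by omega)

lemma Sound.survive (h : Sound pc V g) {u r s} (hX : pc p = .prioCol u r s)
    (hs : s.stat = Stat.low → ∀ j ∈ s.list, g.Has Stat.low u r j) :
    Sound (Function.update pc p (.roundProp u (r + 1))) V
      (g.event p (.prioCol u r s) (.roundProp u (r + 1)) V) := by
  have hP : PcOk V g p (.prioCol u r s) := hX ▸ h.pcOk p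
  obtain ⟨h1, h2, h3, h4, h5, h6, h7⟩ := hP
  exact h.setRound hX (.survive u r s hs) rfl (by simp) rfl h1 h3
    ((h.ownOk p).round_door u (by omega)) (fun _ => ⟨s, h4, h5, hs⟩)

/-- All earlier members of the commit order have entries known to a majority when p starts to
collect `Status`. Therefore the list of p will contain everybody up to p in this order. -/
lemma Sound.status (h : Sound pc V g) {u r} (hX : pc p = .commitProp u r)
    (hk : KnownEntry V u r p) :
    Sound (Function.update pc p (.statusCol u r)) V
      (g.event p (.commitProp u r) (.statusCol u r) V) := by
  have hS : SpotOk (.commitProp u r) V g p := hX ▸ h.spotOk p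
  have hP : PcOk V g p (.commitProp u r) := hX ▸ h.pcOk p
  have t := Trans.status (V := V) (g := g) (p := p) u r hk
  have ho := h.ownOk p
  have hT : g.truth.Le (g.event p (.commitProp u r) (.statusCol u r) V).truth := t.truth_le hP V
  obtain ⟨h1, h2, h3, h4, h5⟩ := hP
  have hor : ∀ v r', (g.event p (.commitProp u r) (.statusCol u r) V).order v r' =
      if v = u ∧ r' = r then g.order u r ++ [p] else g.order v r' := by
    intro v r'
    simp only [Ghost.event, Ghost.core, Function.update_apply]
    by_cases hv : v = u
    · subst hv; by_cases hr : r' = r <;> simp [hr]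
    · simp [hv]
  refine h.of_event hX t ⟨h1, h2, h3, h4, ?_, ?_⟩ (hS.congr rfl rfl rfl (by simp) (by simp))
    ?_ ?_ ?_ ?_ ?_ ?_ ?_
  · simp [hor]
  · intro j hj
    simp only [hor, and_self, if_true] at hj
    have hs : (g.event p (.commitProp u r) (.statusCol u r) V).snap p = V := by
      simp [Ghost.event]
    rw [hs]
    rw [List.idxOf_append_of_notMem h5] at hj
    by_cases hjo : j ∈ g.order u r
    · exact ((h.ownOk j).order_known u r hjo).1
    · by_cases hjp : j = p
      · subst hjp; exact hk
      · rw [List.idxOf_append_of_notMem hjo] at hj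
        simp [Ne.symm hjp] at hj
  · refine ⟨ho.lost_picks, ho.round_picks, ho.status_round, ho.status_top, ho.round_door,
      fun v r' hv => ?_, fun v r' hv => ?_, fun v r' s hs hc => ?_, ho.list_status, ho.low_card,
      ho.survived, ho.lost_witness, ho.late_clock hT (fun _ _ => rfl) rfl⟩
    · rw [hor] at hv; split_ifs at hv with hc
      · obtain ⟨rfl, rfl⟩ := hc
        refine ⟨hk, ?_⟩
        show g.truth.status v r' p ≠ none
        rw [h4]; simp
      · exact ho.order_known v r' hv
    · have := ho.flipped_order v r' hv
      rw [hor]; split_ifs with hc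
      · simp
      · exact this
    · rw [hor]; split_ifs with h6
      · obtain ⟨rfl, rfl⟩ := h6
        have hs : g.truth.status v r' p = some s := hs
        rw [h4] at hs; cases hs; exact absurd rfl hc
      · exact ho.flipped_list v r' s hs hc
  · exact h.contended
  · exact fun v hv => Or.inr ⟨hv, by simp⟩
  · intro v r'
    rw [hor]; split_ifs with h6
    · rw [List.nodup_append]
      refine ⟨h.nodup u r, by simp, ?_⟩
      intro a ha b hb hab
      simp only [List.mem_singleton] at hb
      subst hb; subst hab; exact h5 ha
    · exact h.nodup v r'
  · exact fun v hv => Or.inl hv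
  · exact h.first
  · intro v hv
    have hcap := h.cap v hv
    refine hcap.of_event rfl rfl rfl (fun q hq => h.ext hX t hq) ?_
    intro hpc
    exact ⟨hcap.round_lt p hpc, hcap.status p hpc⟩

/-- The completion time of p is the current clock, so the processors with a time at most that of p
have their priorities known to a majority before the last collect of p starts. -/
lemma Sound.prio (h : Sound pc V g) {u r s} (hX : pc p = .prioProp u r s)
    (hk : KnownPrio g V u r p) :
    Sound (Function.update pc p (.prioCol u r s)) V
      (g.event p (.prioProp u r s) (.prioCol u r s) V) := by
  have hS : SpotOk (.prioProp u r s) V g p := hX ▸ h.spotOk p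
  have hP : PcOk V g p (.prioProp u r s) := hX ▸ h.pcOk p
  have t := Trans.prio (V := V) (g := g) (p := p) u r s hk
  have ho := h.ownOk p
  have hT : g.truth.Le (g.event p (.prioProp u r s) (.prioCol u r s) V).truth := t.truth_le hP V
  obtain ⟨h1, h2, h3, h4, h5, h6⟩ := hP
  have hpl : p ∉ g.lost u := hS.notMem_lost rfl (by simp)
  have hla : ∀ v r' q, (g.event p (.prioProp u r s) (.prioCol u r s) V).late v r' q =
      if v = u ∧ r' = r ∧ q = p then (g.clock : ℕ∞) else g.late v r' q := by
    intro v r' q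
    simp only [Ghost.event, Ghost.core, Function.update_apply]
    by_cases hv : v = u
    · subst hv
      by_cases hr : r' = r
      · subst hr; by_cases hq : q = p <;> simp [hq]
      · simp [hr]
    · simp [hv]
  refine h.of_event hX t ⟨h1, h2, h3, h4, h5, ?_, ?_⟩ (hS.congr rfl rfl rfl (by simp) (by simp))
    ?_ ?_ ?_ ?_ ?_ ?_ ?_
  · simp [hla]
  · intro j hj
    have hs : (g.event p (.prioProp u r s) (.prioCol u r s) V).snap p = V := by
      simp [Ghost.event]
    rw [hs]
    show KnownPrio g V u r j
    by_cases hjp : j = p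
    · subst hjp; exact hk
    · simp only [hla, true_and, hjp, if_false, if_true] at hj
      exact ((h.ownOk j).late_known u r (fun h => by simp [h] at hj)).2.1
  · refine ⟨ho.lost_picks, ho.round_picks, ho.status_round, ho.status_top, ho.round_door,
      ho.order_known, ho.flipped_order, ho.flipped_list, ho.list_status, ho.low_card,
      ho.survived, fun v hv => ?_, fun v r' hv => ?_⟩
    · have hvu : v ≠ u := by rintro rfl; exact hpl hv
      exact (ho.lost_witness v hv).mono hT rfl (fun r' => by simp [hla, hvu])
        (fun r' j => Or.inl (by simp [hla, hvu])) (fun r hr => (ho.late_known v r hr).2.2)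
    · rw [hla] at hv ⊢
      split_ifs at hv ⊢ with hc
      · obtain ⟨rfl, rfl, -⟩ := hc
        exact ⟨⟨s, h4, h5⟩, hk, by exact_mod_cast Nat.lt_succ_self g.clock⟩
      · obtain ⟨h7, h8, h9⟩ := ho.late_known v r' hv
        exact ⟨h7, h8, h9.trans (by exact_mod_cast Nat.lt_succ_self g.clock)⟩
  · exact h.contended
  · exact fun v hv => Or.inr ⟨hv, by simp⟩
  · exact h.nodup
  · exact fun v hv => Or.inl hv
  · exact h.first
  · intro v hv
    have hcap := h.cap v hv
    refine hcap.of_event rfl rfl rfl (fun q hq => h.ext hX t hq) ?_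
    intro hpc
    exact ⟨hcap.round_lt p hpc, hcap.status p hpc⟩

lemma Sound.flip (h : Sound pc V g) {u r} {s : Status n} (hX : pc p = .statusCol u r)
    (hc : s.stat ≠ Stat.commit) (hl : ∀ j, KnownEntry (g.snap p) u r j → j ∈ s.list)
    (hl' : ∀ j ∈ s.list, g.truth.status u r j ≠ none) (hlow : s.stat = Stat.low → 2 ≤ s.list.card) :
    Sound (Function.update pc p (.prioProp u r s)) V
      (g.event p (.statusCol u r) (.prioProp u r s) V) := by
  have hS : SpotOk (.statusCol u r) V g p := hX ▸ h.spotOk p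
  have hP : PcOk V g p (.statusCol u r) := hX ▸ h.pcOk p
  have t := Trans.flip (V := V) (g := g) (p := p) u r s hc hl hl' hlow
  have ho := h.ownOk p
  have hpl : p ∉ g.lost u := hS.notMem_lost rfl (by simp)
  have hT : g.truth.Le (g.event p (.statusCol u r) (.prioProp u r s) V).truth := t.truth_le hP V
  obtain ⟨h1, h2, h3, h4, h5, h6⟩ := hP
  have hst : ∀ v r' q, (g.event p (.statusCol u r) (.prioProp u r s) V).truth.status v r' q =
      if v = u ∧ r' = r ∧ q = p then some s else g.truth.status v r' q :=
    fun v r' q => View.setStatus_status _ _ _ _ _ _ _ _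
  have hfl : ∀ v r' q, (g.event p (.statusCol u r) (.prioProp u r s) V).Flipped v r' q ↔
      (v = u ∧ r' = r ∧ q = p) ∨ g.Flipped v r' q := by
    intro v r' q
    unfold Ghost.Flipped
    rw [hst]
    split_ifs with h7
    · simp [h7, hc]
    · simp [h7]
  have hlate : g.late u r p = ⊤ := by
    by_contra h7
    obtain ⟨⟨s', h8, h9⟩, -⟩ := ho.late_known u r h7
    rw [h4] at h8; cases h8; exact h9 rfl
  refine h.of_event hX t ⟨h1, h2, h3, ?_, hc, hlate⟩ (hS.congr rfl rfl rfl (by simp) (by simp))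
    ?_ ?_ ?_ ?_ ?_ ?_ ?_
  · simp [hst]
  · refine ⟨ho.lost_picks, ho.round_picks, fun v r' hv => ?_, fun v r' hv => ?_, ho.round_door,
      fun v r' hv => ⟨(ho.order_known v r' hv).1, (hT.status _ _ _).ne_none (ho.order_known v r' hv).2⟩,
      fun v r' hv => ?_, fun v r' s hs => ?_, fun v r' s hs j hj => ?_, fun v r' s hs => ?_,
      fun v r' hr hr' => ?_, fun v hv => ?_, ho.late_clock hT (fun _ _ => rfl) rfl⟩
    · rw [hst] at hv; split_ifs at hv with hc
      · obtain ⟨rfl, rfl, -⟩ := hc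
        exact ⟨h2, h1.ge⟩
      · exact ho.status_round v r' hv
    · rw [hst] at hv; split_ifs at hv with hc
      · obtain ⟨rfl, rfl, -⟩ := hc
        exact ho.status_top v r' (by rw [h4]; simp)
      · exact ho.status_top v r' hv
    · rcases (hfl v r' p).1 hv with ⟨rfl, rfl, -⟩ | h7
      · exact h5
      · exact ho.flipped_order v r' h7
    · intro hc' j hj
      rw [hst] at hs; split_ifs at hs with h7
      · obtain ⟨rfl, rfl, -⟩ := h7
        cases hs; exact hl j (h6 j hj)
      · exact ho.flipped_list v r' s hs hc' j hj
    · rw [hst] at hs; split_ifs at hs with h7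
      · obtain ⟨rfl, rfl, -⟩ := h7
        cases hs; exact (hT.status _ _ _).ne_none (hl' j hj)
      · exact (hT.status _ _ _).ne_none (ho.list_status v r' s hs j hj)
    · rw [hst] at hs; split_ifs at hs with h7
      · cases hs; exact hlow
      · exact ho.low_card v r' s hs
    · obtain ⟨s, hs, hc, hl⟩ := ho.survived v r' hr hr'
      exact ⟨s, status_eq_of_le hT hs hc, hc, fun h j hj => (hl h j hj).mono hT (by simp)⟩
    · exact (ho.lost_witness v hv).mono hT rfl (fun _ => rfl) (fun _ _ => Or.inl rfl)
        (fun r hr => (ho.late_known v r hr).2.2)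
  · exact h.contended
  · exact fun v hv => Or.inr ⟨hv, by simp⟩
  · exact h.nodup
  · exact fun v hv => Or.inl hv
  · intro v r'
    obtain ⟨hf1, hf2⟩ := h.first v r'
    simp only [hfl]
    by_cases hv : v = u ∧ r' = r
    · obtain ⟨rfl, rfl⟩ := hv
      by_cases hfn : g.first v r' = none
      · have : (g.event p (.statusCol v r') (.prioProp v r' s) V).first v r' = some p := by
          simp [Ghost.event, Ghost.core, hfn]
        rw [this]
        refine ⟨by simp, fun a ha => ?_⟩
        cases ha; simp
      · have : (g.event p (.statusCol v r') (.prioProp v r' s) V).first v r' = g.first v r' := by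
          simp [Ghost.event, Ghost.core, hfn]
        rw [this]
        exact ⟨fun h => absurd h hfn, fun a ha => Or.inr (hf2 a ha)⟩
    · have : (g.event p (.statusCol u r) (.prioProp u r s) V).first v r' = g.first v r' := by
        simp only [Ghost.event, Ghost.core]
        split_ifs with h7
        · by_cases hvu : v = u
          · subst hvu; simp only [Function.update_self]
            rw [Function.update_of_ne]; rintro rfl; exact hv ⟨rfl, rfl⟩
          · simp [hvu]
        · rfl
      rw [this]
      refine ⟨fun h7 q => ?_, fun a ha => Or.inr (hf2 a ha)⟩
      rintro (⟨h8, h9, -⟩ | h8)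
      · exact hv ⟨h8, h9⟩
      · exact hf1 h7 q h8
  · intro v hv
    have hcap := h.cap v hv
    refine hcap.of_event rfl rfl rfl (fun q hq => h.ext hX t hq) ?_
    intro hpc
    refine ⟨hcap.round_lt p hpc, ?_⟩
    rw [hst]; split_ifs with h7
    · obtain ⟨rfl, h8, -⟩ := h7
      have := hcap.status p hpc
      rw [h8, h4] at this; cases this
    · exact hcap.status p hpc

theorem Sound.event {Y : PC n} (h : Sound pc V g) (t : Trans V g p (pc p) Y) :
    Sound (Function.update pc p Y) V (g.event p (pc p) Y V) := by
  generalize hX : pc p = X at t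
  cases t with
  | start => exact h.start hX
  | collect S h1 h2 => exact h.collect hX h1 h2
  | pick S u hu hS => exact h.pick hX hu hS
  | doorLose u hd => exact h.doorLose hX hd
  | doorPass u hd => exact h.doorPass hX hd
  | enter u hd => exact h.enter hX hd
  | preround u r hr => exact h.preround hX hr
  | roundLose u r hr => exact h.roundLose hX hr
  | win u r => exact h.win hX
  | commit u r h1 h2 => exact h.commit hX h1 h2
  | status u r hk => exact h.status hX hk
  | flip u r s h0 h1 h2 h3 => exact h.flip hX h0 h1 h2 h3
  | prio u r s hk => exact h.prio hX hk
  | pillLose u r s hs hj => exact h.pillLose hX hs hj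
  | survive u r s hs => exact h.survive hX hs
  | finish u => exact h.finish hX
  | retry u hu => exact h.retry hX hu

end

/-! ## The algorithm follows the transitions -/

lemma EntryLe.of_commit {a : Option (Status n)} (h : EntryLe a (some ⟨Stat.commit, ∅⟩))
    (s : Status n) : EntryLe a (some s) := by
  rcases h with h | h | h
  · exact Or.inl h
  · exact Or.inr (Or.inr ⟨h, by simp⟩)
  · exact Or.inr (Or.inr ⟨h.1, by simp⟩)

lemma EntryLe.of_none {a : Option (Status n)} (h : EntryLe a none) : a = none := by
  rcases h with h | h | h
  · exact h
  · exact h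
  · exact absurd rfl h.2

lemma View.Le.closeDoor {V W : View n} (h : V.Le W) (u : Fin n) : (V.closeDoor u).Le (W.closeDoor u) :=
  ⟨h.contended, fun v => by
    rw [View.closeDoor_door, View.closeDoor_door]; split_ifs
    · simp
    · exact h.door v, h.round, h.status⟩

lemma View.Le.setRound {V W : View n} (h : V.Le W) (u i : Fin n) (r : ℕ) :
    (V.setRound u i r).Le (W.setRound u i r) :=
  ⟨h.contended, h.door, fun v j => by
    rw [View.setRound_round, View.setRound_round]; split_ifs
    · exact le_rfl
    · exact h.round v j, h.status⟩

lemma View.Le.setStatus {V W : View n} (h : V.Le W) (u : Fin n) (r : ℕ) (i : Fin n) (s : Status n) :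
    (V.setStatus u r i s).Le (W.setStatus u r i s) :=
  ⟨h.contended, h.door, h.round, fun v r' j => by
    rw [View.setStatus_status, View.setStatus_status]; split_ifs
    · exact EntryLe.refl _
    · exact h.status v r' j⟩

lemma le_maxRound {p : Fin n} {views : Fin n → Option (View n)} {u j : Fin n} {W : View n}
    (hW : W ∈ received views) (hj : j ≠ p) : W.round u j ≤ maxRound p views u := by
  obtain ⟨k, hk⟩ := hW
  have h1 : (match views k with
      | some W => W.round u j
      | none => 0) ≤ (Finset.univ.erase p).sup fun j => match views k with
      | some W => W.round u j
      | none => 0 :=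
    Finset.le_sup (f := fun j => match views k with
      | some W => W.round u j
      | none => 0) (Finset.mem_erase.2 ⟨hj, Finset.mem_univ j⟩)
  rw [hk] at h1
  refine h1.trans ?_
  unfold maxRound
  have h2 := Finset.le_sup (f := fun k => (Finset.univ.erase p).sup fun j =>
    match views k with
    | some W => W.round u j
    | none => 0) (Finset.mem_univ k)
  simp only [hk] at h2
  exact h2

lemma exists_of_lt_maxRound {p : Fin n} {views : Fin n → Option (View n)} {u : Fin n} {m : ℕ}
    (h : m < maxRound p views u) : ∃ W ∈ received views, ∃ j, j ≠ p ∧ m < W.round u j := by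
  unfold maxRound at h
  rw [Finset.lt_sup_iff] at h
  obtain ⟨k, -, h⟩ := h
  rw [Finset.lt_sup_iff] at h
  obtain ⟨j, hj, h⟩ := h
  cases hk : views k with
  | none => rw [hk] at h; simp at h
  | some W => rw [hk] at h; exact ⟨W, ⟨k, hk⟩, j, (Finset.mem_erase.1 hj).1, h⟩

lemma bias_eq_one_of_le {k : ℕ} (h : k ≤ 1) (hk : k ≠ 0) : bias k = 1 := by
  have : k = 1 := by omega
  simp [bias, this]

/-- The control state after a call is completed, with its effect on the views. -/
structure NextOk (K : Config n) (g : Ghost n) (p : Fin n) (c : unitInterval) : Prop where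
  trans : Trans K.view g p (K.pc p) (next p (K.view p) (K.procs p).replies c (K.pc p)).2
  le_view : (K.view p).Le (next p (K.view p) (K.procs p).replies c (K.pc p)).1
  view_le : ∀ V, (next p (K.view p) (K.procs p).replies c (K.pc p)).1.Le
    (g.event p (K.pc p) (next p (K.view p) (K.procs p).replies c (K.pc p)).2 V).truth
  call : ∀ V cl, (next p (K.view p) (K.procs p).replies c (K.pc p)).2.call p = some cl → cl.Has
    (g.event p (K.pc p) (next p (K.view p) (K.procs p).replies c (K.pc p)).2 V).truth

section
variable {K : Config n} {g : Ghost n} {p : Fin n}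

lemma Comm.reply_contended (hC : Comm K g.truth g.snap) (hr : (K.procs p).ready)
    (hX : K.pc p = .colContended) {v} (hv : KnownName (g.snap p) v) :
    ∃ W ∈ received (K.procs p).replies, v ∈ W.contended := by
  obtain ⟨k, hk, W, hW, hle⟩ := hC.exists_reply (cl := .colContended) hr (by rw [hX]; rfl) hv
  exact ⟨W, hW, hle.contended hk⟩

lemma Comm.reply_door (hC : Comm K g.truth g.snap) (hr : (K.procs p).ready) {u}
    (hX : K.pc p = .doorCol u) (hv : KnownDoor (g.snap p) u) :
    ∃ W ∈ received (K.procs p).replies, W.door u = true := by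
  obtain ⟨k, hk, W, hW, hle⟩ := hC.exists_reply (cl := .colDoor u) hr (by rw [hX]; rfl) hv
  exact ⟨W, hW, hle.door u (by simpa [Call.answer] using hk)⟩

lemma Comm.reply_round (hC : Comm K g.truth g.snap) (hr : (K.procs p).ready) {u r}
    (hX : K.pc p = .roundCol u r) {j m} (hv : KnownRound (g.snap p) u j m) :
    ∃ W ∈ received (K.procs p).replies, m ≤ W.round u j := by
  obtain ⟨k, hk, W, hW, hle⟩ := hC.exists_reply (cl := .colRound u) hr (by rw [hX]; rfl) hv
  exact ⟨W, hW, hk.trans (by simpa [Call.answer] using hle.round u j)⟩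

lemma Comm.reply_status (hC : Comm K g.truth g.snap) (hr : (K.procs p).ready) {u r}
    (hX : (K.pc p).call p = some (.colStatus u r)) {P : Option (Status n) → Prop} {j}
    (hv : Maj fun k => P ((g.snap p k).status u r j)) :
    ∃ a, P a ∧ ∃ W ∈ received (K.procs p).replies, EntryLe a (W.status u r j) := by
  obtain ⟨k, hk, W, hW, hle⟩ := hC.exists_reply hr hX hv
  refine ⟨_, hk, W, hW, ?_⟩
  simpa [Call.answer] using hle.status u r j

/-- The side conditions of the transitions come from two bounds on the replies: what they show is
part of the truth, and what a majority knew at the start of the call is shown by one of them. -/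
lemma nextOk (hC : Comm K g.truth g.snap) (hS : Sound K.pc K.view g) (hr : (K.procs p).ready)
    (c : unitInterval) : NextOk K g p c := by
  have hV := hC.view_le p
  have hP := hS.pcOk p
  have hW : ∀ W ∈ received (K.procs p).replies, W.Le g.truth := fun W hW => hC.received_le hW
  cases hX : K.pc p with
  | start =>
    refine ⟨?_, ?_, fun V => ?_, fun V cl hcl => ?_⟩ <;> rw [hX]
    · exact .start
    · exact View.Le.refl _
    · exact hV
    · rw [hX] at hcl; cases hcl; trivial
  | colContended =>
    have hsub : (K.view p).contended ∪
        ({j | ∃ W ∈ received (K.procs p).replies, j ∈ W.contended} : Finset (Fin n)) ⊆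
          g.truth.contended := by
      refine Finset.union_subset hV.contended fun v hv => ?_
      simp only [Finset.mem_filter, Finset.mem_univ, true_and] at hv
      obtain ⟨W, h1, h2⟩ := hv
      exact (hW W h1).contended h2
    refine ⟨?_, ?_, fun V => ?_, fun V cl hcl => ?_⟩ <;> rw [hX]
    · refine .collect _ hsub fun v hv => ?_
      obtain ⟨W, h1, h2⟩ := hC.reply_contended hr hX hv
      exact Finset.mem_union_right _ (by simp only [Finset.mem_filter, Finset.mem_univ, true_and]; exact ⟨W, h1, h2⟩)
    · exact ⟨Finset.subset_union_left, fun _ h => h, fun _ _ => le_rfl, fun _ _ _ => EntryLe.refl _⟩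
    · exact ⟨hsub, hV.door, hV.round, hV.status⟩
    · rw [hX] at hcl; cases hcl; exact hsub
  | propContended S =>
    rw [hX] at hP
    have hSn : (Sᶜ).Nonempty := by
      rw [Finset.nonempty_iff_ne_empty]; intro h; exact hP.2.1 (Finset.compl_eq_empty_iff _ |>.1 h)
    obtain ⟨h0, hu⟩ := pickUniform_eq hSn c
    generalize (Sᶜ.sort (· ≤ ·))[min ⌊(c : ℝ) * Sᶜ.card⌋₊ (Sᶜ.card - 1)] = u at hu
    have hmem := pickUniform_mem hu
    refine ⟨?_, ?_, fun V => ?_, fun V cl hcl => ?_⟩ <;> rw [hX] <;> simp only [next, hu]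
    · refine .pick S u (by simpa using hmem) fun v hv => ?_
      have := hC.maj_has (cl := .propContended S) hr (by rw [hX]; rfl)
      exact this.mono fun k hk => hk hv
    · exact ⟨Finset.subset_insert _ _, fun _ h => h, fun _ _ => le_rfl, fun _ _ _ => EntryLe.refl _⟩
    · exact ⟨Finset.insert_subset_insert _ hV.contended, hV.door, hV.round, hV.status⟩
    · rw [hX] at hcl; simp only [next, hu] at hcl; cases hcl; trivial
  | doorCol u =>
    by_cases hd : ∃ W ∈ received (K.procs p).replies, W.door u = true
    · refine ⟨?_, ?_, fun V => ?_, fun V cl hcl => ?_⟩ <;> rw [hX] <;> simp only [next, if_pos hd]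
      · obtain ⟨W, h1, h2⟩ := hd
        exact .doorLose u ((hW W h1).door u h2)
      · exact View.Le.refl _
      · exact hV
      · rw [hX] at hcl; simp only [next, if_pos hd] at hcl; cases hcl
        have hsp := (hS.spotOk p).spot_picks u (by rw [hX]; rfl)
        have := (hS.contended u).2 ⟨p, hsp⟩
        intro v hv; rw [Finset.mem_singleton] at hv; subst hv; exact this
    · refine ⟨?_, ?_, fun V => ?_, fun V cl hcl => ?_⟩ <;> rw [hX] <;> simp only [next, if_neg hd]
      · exact .doorPass u fun h => hd (hC.reply_door hr hX h)
      · exact View.le_closeDoor _ _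
      · exact hV.closeDoor u
      · rw [hX] at hcl; simp only [next, if_neg hd] at hcl; cases hcl
        show (g.truth.closeDoor u).door u = true
        simp [View.closeDoor_door]
  | doorProp u =>
    rw [hX] at hP
    refine ⟨?_, ?_, fun V => ?_, fun V cl hcl => ?_⟩ <;> rw [hX]
    · exact .enter u (hC.maj_has (cl := .propDoor u) hr (by rw [hX]; rfl))
    · exact View.le_setRound ((hV.round u p).trans (by rw [hP.1]; omega))
    · exact hV.setRound u p 1
    · rw [hX] at hcl; cases hcl
      show 1 ≤ (g.truth.setRound u p 1).round u p
      simp [View.setRound_round]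
  | roundProp u r =>
    refine ⟨?_, ?_, fun V => ?_, fun V cl hcl => ?_⟩ <;> rw [hX]
    · exact .preround u r (hC.maj_has (cl := .propRound u p r) hr (by rw [hX]; rfl))
    · exact View.Le.refl _
    · exact hV
    · rw [hX] at hcl; cases hcl; trivial
  | roundCol u r =>
    rw [hX] at hP
    have hcon : ∀ v ∈ ({u} : Finset (Fin n)), v ∈ g.truth.contended := by
      have hsp := (hS.spotOk p).spot_picks u (by rw [hX]; rfl)
      have := (hS.contended u).2 ⟨p, hsp⟩
      intro v hv; rw [Finset.mem_singleton] at hv; subst hv; exact this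
    by_cases h1 : r < maxRound p (K.procs p).replies u
    · refine ⟨?_, ?_, fun V => ?_, fun V cl hcl => ?_⟩ <;> rw [hX] <;> simp only [next, if_pos h1]
      · obtain ⟨W, h2, j, -, h3⟩ := exists_of_lt_maxRound h1
        exact .roundLose u r ⟨j, h3.trans_le ((hW W h2).round u j)⟩
      · exact View.Le.refl _
      · exact hV
      · rw [hX] at hcl; simp only [next, if_pos h1] at hcl; cases hcl
        exact hcon
    · by_cases h2 : maxRound p (K.procs p).replies u + 1 < r
      · refine ⟨?_, ?_, fun V => ?_, fun V cl hcl => ?_⟩ <;> rw [hX] <;>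
          simp only [next, if_neg h1, if_pos h2]
        · exact .win u r
        · exact View.Le.refl _
        · exact hV
        · rw [hX] at hcl; simp only [next, if_neg h1, if_pos h2] at hcl; cases hcl
          exact hcon
      · refine ⟨?_, ?_, fun V => ?_, fun V cl hcl => ?_⟩ <;> rw [hX] <;>
          simp only [next, if_neg h1, if_neg h2]
        · refine .commit u r (fun h3 => ?_) fun j hj hk => ?_
          -- As p did not win, the largest other round is at least `r - 1`, which exceeds `r - 2`
          -- because `r ≥ 2`.
          · obtain ⟨W, h4, j, hj, h5⟩ := exists_of_lt_maxRound (p := p)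
              (views := (K.procs p).replies) (u := u) (m := r - 2) (by omega)
            have := (hW W h4).round u j
            exact ⟨j, hj, by omega⟩
          · obtain ⟨W, h4, h5⟩ := hC.reply_round hr hX hk
            have := le_maxRound (u := u) h4 hj
            omega
        · refine View.le_setStatus ?_
          have := hV.status u r p
          rw [hP.2.2.2.1] at this
          exact Or.inl this.of_none
        · exact hV.setStatus u r p _
        · rw [hX] at hcl; simp only [next, if_neg h1, if_neg h2] at hcl; cases hcl
          simp [Call.Has, Ghost.event, Ghost.core, View.setStatus_status, EntryLe.refl]
  | commitProp u r =>
    rw [hX] at hP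
    refine ⟨?_, ?_, fun V => ?_, fun V cl hcl => ?_⟩ <;> rw [hX]
    · have := hC.maj_has (cl := .propStatus u r p ⟨Stat.commit, ∅⟩) hr (by rw [hX]; rfl)
      exact .status u r (this.mono fun k hk => hk.2.ne_none (by simp))
    · exact View.Le.refl _
    · exact hV
    · rw [hX] at hcl; cases hcl; trivial
  | statusCol u r =>
    rw [hX] at hP
    obtain ⟨h1, h2, h3, h4, h5, h6⟩ := hP
    have hl : ∀ j, KnownEntry (g.snap p) u r j → j ∈ participants (K.procs p).replies u r := by
      intro j hj
      obtain ⟨a, ha, W, hW', hle⟩ := hC.reply_status (P := fun a => a ≠ none) hr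
        (by rw [hX]; rfl) hj
      simp only [participants, Finset.mem_filter, Finset.mem_univ, true_and]
      exact ⟨W, hW', hle.ne_none ha⟩
    have hl' : ∀ j ∈ participants (K.procs p).replies u r, g.truth.status u r j ≠ none := by
      intro j hj
      simp only [participants, Finset.mem_filter, Finset.mem_univ, true_and] at hj
      obtain ⟨W, h7, h8⟩ := hj
      exact ((hW W h7).status u r j).ne_none h8
    have hpl : p ∈ participants (K.procs p).replies u r := hl p (h6 p le_rfl)
    have hle1 : (K.view p).Le ((K.view p).setStatus u r p
        ⟨Stat.high, participants (K.procs p).replies u r⟩) := by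
      refine View.le_setStatus ?_
      have := hV.status u r p
      rw [h4] at this
      exact this.of_commit _
    have hle2 : (K.view p).Le ((K.view p).setStatus u r p
        ⟨Stat.low, participants (K.procs p).replies u r⟩) := by
      refine View.le_setStatus ?_
      have := hV.status u r p
      rw [h4] at this
      exact this.of_commit _
    by_cases hb : (c : ℝ) ≤ bias (participants (K.procs p).replies u r).card
    · refine ⟨?_, ?_, fun V => ?_, fun V cl hcl => ?_⟩ <;> rw [hX] <;> simp only [next, if_pos hb]
      · exact .flip u r _ (by simp) hl hl' (by simp)
      · exact hle1
      · exact hV.setStatus u r p _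
      · rw [hX] at hcl; simp only [next, if_pos hb] at hcl; cases hcl
        simp [Call.Has, Ghost.event, Ghost.core, View.setStatus_status, EntryLe.refl]
    · refine ⟨?_, ?_, fun V => ?_, fun V cl hcl => ?_⟩ <;> rw [hX] <;> simp only [next, if_neg hb]
      · refine .flip u r _ (by simp) hl hl' fun _ => ?_
        -- The list contains p itself. If it had only one element, the bias would be 1 and every
        -- coin would give high priority.
        by_contra hc
        refine hb ?_
        rw [bias_eq_one_of_le (by simp only at hc; omega) (Finset.card_pos.2 ⟨p, hpl⟩).ne']
        exact c.2.2
      · exact hle2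
      · exact hV.setStatus u r p _
      · rw [hX] at hcl; simp only [next, if_neg hb] at hcl; cases hcl
        simp [Call.Has, Ghost.event, Ghost.core, View.setStatus_status, EntryLe.refl]
  | prioProp u r s =>
    rw [hX] at hP
    refine ⟨?_, ?_, fun V => ?_, fun V cl hcl => ?_⟩ <;> rw [hX]
    · have := hC.maj_has (cl := .propStatus u r p s) hr (by rw [hX]; rfl)
      refine .prio u r s ?_
      unfold KnownPrio
      rw [hP.2.2.2.1]; exact this.mono fun k hk => hk.2
    · exact View.Le.refl _
    · exact hV
    · rw [hX] at hcl; cases hcl; trivial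
  | prioCol u r s =>
    rw [hX] at hP
    obtain ⟨h1, h2, h3, h4, h5, h6, h7⟩ := hP
    have hpl := h7 p le_rfl
    -- The priority of p is known to a majority, so some reply contains it together with its list: p
    -- checks all members of its own list.
    have hsub : s.list ⊆ learned (K.procs p).replies u r := by
      intro j hj
      obtain ⟨a, ha, W, hW', hle⟩ := hC.reply_status (P := fun a => EntryLe (g.truth.status u r p) a)
        hr (by rw [hX]; rfl) hpl
      rw [h4] at ha
      have := (ha.trans hle).eq_of_prio h5
      refine Finset.mem_union_left _ ?_
      simp only [Finset.mem_filter, Finset.mem_univ, true_and]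
      exact ⟨W, hW', p, s, this, hj⟩
    have hln : ∀ j ∈ learned (K.procs p).replies u r, g.truth.status u r j ≠ none := by
      intro j hj
      rcases Finset.mem_union.1 hj with hj | hj
      · simp only [Finset.mem_filter, Finset.mem_univ, true_and] at hj
        obtain ⟨W, hW', i, s', h8, h9⟩ := hj
        have h10 := (hW W hW').status u r i
        rw [h8] at h10
        rcases h10 with h10 | h10 | ⟨h10, -⟩
        · cases h10
        · exact (hS.ownOk i).list_status u r s' h10.symm j h9
        · cases h10; simp at h9
      · simp only [participants, Finset.mem_filter, Finset.mem_univ, true_and] at hj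
        obtain ⟨W, h7, h8⟩ := hj
        exact ((hW W h7).status u r j).ne_none h8
    by_cases hd : s.stat = Stat.low ∧ ∃ j ∈ learned (K.procs p).replies u r,
        ∀ W ∈ received (K.procs p).replies, ∀ s', W.status u r j = some s' → s'.stat ≠ Stat.low
    · refine ⟨?_, ?_, fun V => ?_, fun V cl hcl => ?_⟩ <;> rw [hX] <;> simp only [next, if_pos hd]
      · obtain ⟨hlow, j, hj, hj'⟩ := hd
        refine .pillLose u r s hlow ⟨j, hln j hj, ?_⟩
        rintro ⟨⟨s', h8, h9⟩, h10⟩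
        obtain ⟨a, ha, W, hW', hle⟩ := hC.reply_status (P := fun a => EntryLe (g.truth.status u r j) a)
          hr (by rw [hX]; rfl) h10
        rw [h8] at ha
        have := (ha.trans hle).eq_of_prio (by rw [h9]; simp)
        exact hj' W hW' s' this h9
      · exact View.Le.refl _
      · exact hV
      · rw [hX] at hcl; simp only [next, if_pos hd] at hcl; cases hcl
        have hsp := (hS.spotOk p).spot_picks u (by rw [hX]; rfl)
        have := (hS.contended u).2 ⟨p, hsp⟩
        intro v hv; rw [Finset.mem_singleton] at hv; subst hv; exact this
    · refine ⟨?_, ?_, fun V => ?_, fun V cl hcl => ?_⟩ <;> rw [hX] <;> simp only [next, if_neg hd]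
      · refine .survive u r s fun hlow j hj => ?_
        push Not at hd
        obtain ⟨W, hW', s', h8, h9⟩ := hd hlow j (hsub hj)
        have := (hW W hW').status u r j
        rw [h8] at this
        exact ⟨s', this.eq_of_prio (by rw [h9]; simp), h9⟩
      · exact View.le_setRound ((hV.round u p).trans (by rw [h1]; omega))
      · exact hV.setRound u p (r + 1)
      · rw [hX] at hcl; simp only [next, if_neg hd] at hcl; cases hcl
        simp [Call.Has, Ghost.event, Ghost.core, View.setRound_round]
  | outcomeProp u win =>
    cases win with
    | true =>
      refine ⟨?_, ?_, fun V => ?_, fun V cl hcl => ?_⟩ <;> rw [hX]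
      · exact .finish u
      · exact View.Le.refl _
      · exact hV
      · rw [hX] at hcl; cases hcl
    | false =>
      refine ⟨?_, ?_, fun V => ?_, fun V cl hcl => ?_⟩ <;> rw [hX]
      · refine .retry u ?_
        have := hC.maj_has (cl := .propContended {u}) hr (by rw [hX]; rfl)
        exact this.mono fun k hk => hk (Finset.mem_singleton_self u)
      · exact View.Le.refl _
      · exact hV
      · rw [hX] at hcl; cases hcl; trivial
  | returned u => exact absurd hr (by have : (K.procs p).pc = .returned u := hX; simp [Local.ready, this])

end

/-! ## The system with its history variables -/

/-- Counters for the analysis, for each processor. -/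
structure Tally (n : ℕ) where
  /-- the number of calls -/
  calls : Fin n → ℕ
  /-- the number of names picked -/
  picked : Fin n → ℕ
  /-- the number of picked names that had several holders, and of later arrivals at the name held -/
  crowd : Fin n → ℕ
  /-- the number of iterations in which the number of free names was halved -/
  halved : Fin n → ℕ
  load : Fin n → ℕ
  /-- the number of rounds in completed leader elections -/
  rounds : Fin n → ℕ
  /-- the sum of the probabilities of picking a free name -/
  hits : Fin n → ℝ
  /-- the number of free names at the start of the iteration -/
  free₀ : Fin n → ℕ

def Tally.initial (n : ℕ) : Tally n where
  calls := fun _ => 0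
  picked := fun _ => 0
  crowd := fun _ => 0
  halved := fun _ => 0
  load := fun _ => 0
  rounds := fun _ => 0
  hits := fun _ => 0
  free₀ := fun _ => 0

/-- The names that are not known to be contended. -/
def unknown (V : Fin n → View n) : Finset (Fin n) := Finset.univ.filter fun v => ¬ KnownName V v

/-- Control states, protocol views, and history variables. -/
structure State (n : ℕ) where
  pc : Fin n → PC n
  view : Fin n → View n
  ghost : Ghost n
  tally : Tally n

def State.sound (a : State n) : Prop := Sound a.pc a.view a.ghost

/-- The change of the counters when `p` goes on to `Y`. -/
def State.newTally (a : State n) (p : Fin n) (Y : PC n) : Tally n :=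
  let t := { a.tally with calls := Function.update a.tally.calls p (a.tally.calls p + 1) }
  match a.pc p, Y with
  | .propContended S, .doorCol u =>
      { t with
        picked := Function.update t.picked p (t.picked p + 1)
        crowd := fun q =>
          if q = p then t.crowd p + (if 2 ≤ (holders a.pc u).card then 1 else 0)
          else t.crowd q + (if (a.pc q).spot = some u then 1 else 0)
        halved := Function.update t.halved p
          (t.halved p + if 2 * a.ghost.free.card < t.free₀ p then 1 else 0)
        load := fun q =>
          if q = p then t.load p + ((holders a.pc u).card + 2)
          else t.load q + (if (a.pc q).spot = some u then 1 else 0)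
        hits := Function.update t.hits p (t.hits p + a.ghost.free.card / (Sᶜ.card : ℝ)) }
  | _, .colContended =>
      { t with
        free₀ := Function.update t.free₀ p a.ghost.free.card }
  | _, .outcomeProp u _ =>
      { t with
        rounds := Function.update t.rounds p
          (t.rounds p + if a.ghost.joined p = true then a.ghost.top u else 0) }
  | _, _ => t

/-- The state after `p` goes on to `Y`, when the views become `V`. -/
def State.event (a : State n) (p : Fin n) (Y : PC n) (V : Fin n → View n) : State n where
  pc := Function.update a.pc p Y
  view := V
  ghost := a.ghost.event p (a.pc p) Y V
  tally := a.newTally p Y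

lemma State.sound.event {a : State n} (h : a.sound) {p : Fin n} {Y : PC n} {V : Fin n → View n}
    (hV : ∀ k, (a.view k).Le (V k)) (t : Trans V a.ghost p (a.pc p) Y) : (a.event p Y V).sound :=
  (h.mono_view hV).event t

lemma Trans.mono_view {V V' : Fin n → View n} {g : Ghost n} {p : Fin n} {X Y : PC n}
    (t : Trans V g p X Y) (hV : ∀ k, (V k).Le (V' k)) : Trans V' g p X Y := by
  cases t with
  | start => exact .start
  | collect S h1 h2 => exact .collect S h1 h2
  | pick S u hu hS => exact .pick S u hu fun v hv => (hS v hv).mono hV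
  | doorLose u hd => exact .doorLose u hd
  | doorPass u hd => exact .doorPass u hd
  | enter u hd => exact .enter u (hd.mono hV)
  | preround u r hr => exact .preround u r (hr.mono hV)
  | roundLose u r hr => exact .roundLose u r hr
  | win u r => exact .win u r
  | commit u r h1 h2 => exact .commit u r h1 h2
  | status u r hk => exact .status u r (hk.mono hV)
  | flip u r s h0 h1 h2 h3 => exact .flip u r s h0 h1 h2 h3
  | prio u r s hk => exact .prio u r s (hk.mono hV)
  | pillLose u r s hs hj => exact .pillLose u r s hs hj
  | survive u r s hs => exact .survive u r s hs
  | finish u => exact .finish u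
  | retry u hu => exact .retry u (hu.mono hV)

/-- The control states in which a random choice is made. -/
def PC.random : PC n → Prop
  | .propContended _ | .statusCol _ _ => True
  | _ => False

/-- A function of the state that does not increase on average. -/
structure Super (ψ : State n → ℝ) : Prop where
  nonneg : ∀ a, 0 ≤ ψ a
  view : ∀ a V, (∀ k, (a.view k).Le (V k)) → ψ { a with view := V } ≤ ψ a
  det : ∀ a, a.sound → ∀ p Y V, Trans a.view a.ghost p (a.pc p) Y → ¬ (a.pc p).random →
    (∀ k, (a.view k).Le (V k)) → ψ (a.event p Y V) ≤ ψ a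
  pick : ∀ a, a.sound → ∀ p S, a.pc p = .propContended S → (∀ v ∈ S, KnownName a.view v) →
    ∀ V : Fin n → Fin n → View n, (∀ u k, (a.view k).Le (V u k)) →
    ∑ u ∈ Sᶜ, ψ (a.event p (.doorCol u) (V u)) ≤ (Sᶜ.card : ℝ) * ψ a
  flip : ∀ a, a.sound → ∀ p u r l, a.pc p = .statusCol u r →
    (∀ j, KnownEntry (a.ghost.snap p) u r j → j ∈ l) →
    ∀ V W : Fin n → View n, (∀ k, (a.view k).Le (V k)) → (∀ k, (a.view k).Le (W k)) →
    bias l.card * ψ (a.event p (.prioProp u r ⟨Stat.high, l⟩) V) +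
      (1 - bias l.card) * ψ (a.event p (.prioProp u r ⟨Stat.low, l⟩) W) ≤ ψ a

/-- The whole system, with the history seen by the adversary. -/
structure World (n : ℕ) where
  config : Config n
  past : List (Config n)
  ghost : Ghost n
  tally : Tally n

def World.state (w : World n) : State n := ⟨w.config.pc, w.config.view, w.ghost, w.tally⟩

/-- The configuration before `p` goes on, when it has received its messages. -/
def World.drain (w : World n) (p : Fin n) : State n :=
  { w.state with view := (w.config.drain p).view }

def World.step (A : Adversary n) (w : World n) (c : unitInterval) : World n :=
  match (A (w.config :: w.past)).1 with
  | .deliver i => ⟨w.config.apply c (.deliver i), w.config :: w.past, w.ghost, w.tally⟩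
  | .step p =>
      if ((w.config.drain p).procs p).ready then
        let K := (w.config.drain p).advance p c
        let b := (w.drain p).event p (K.pc p) K.view
        ⟨K, w.config :: w.past, b.ghost, b.tally⟩
      else ⟨w.config.drain p, w.config :: w.past, w.ghost, w.tally⟩

def World.initial (n : ℕ) (p₀ : Fin n) : World n :=
  ⟨Config.initial n, [], Ghost.initial n p₀, Tally.initial n⟩

/-- The invariant of the system. -/
structure World.Good (w : World n) : Prop where
  comm : Comm w.config w.ghost.truth w.ghost.snap
  sound : Sound w.config.pc w.config.view w.ghost

/-- History variables and counters do not feed back into the execution; they can be forgotten. -/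
lemma World.run_eq (A : Adversary n) (p₀ : Fin n) (ω : Coins) (k : ℕ) :
    run A ω k = ((trajectory (World.step A) (World.initial n p₀) ω k).config,
      (trajectory (World.step A) (World.initial n p₀) ω k).past) := by
  induction k with
  | zero => rfl
  | succ k ih =>
    simp only [run, trajectory]
    rw [ih]
    simp only [World.step]
    split
    · rename_i i hi; simp only [hi]
    · rename_i p hp
      simp only [hp, Config.apply_step]
      split_ifs <;> rfl

lemma World.Good.drain {w : World n} (h : w.Good) (p : Fin n) :
    Comm (w.config.drain p) w.ghost.truth w.ghost.snap ∧
    Sound (w.config.drain p).pc (w.config.drain p).view w.ghost ∧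
    (w.config.drain p).pc = w.config.pc ∧
    ∀ k, (w.config.view k).Le ((w.config.drain p).view k) := by
  obtain ⟨h1, h2⟩ := h.comm.drain p
  exact ⟨h1, by rw [h2.pc]; exact h.sound.mono_view h2.view, h2.pc, h2.view⟩

lemma World.Good.advance {w : World n} (h : w.Good) {p : Fin n}
    (hr : ((w.config.drain p).procs p).ready) (c : unitInterval) :
    Trans (w.drain p).view (w.drain p).ghost p ((w.drain p).pc p)
      (((w.config.drain p).advance p c).pc p) ∧
    (∀ k, ((w.drain p).view k).Le (((w.config.drain p).advance p c).view k)) ∧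
    Comm ((w.config.drain p).advance p c)
      ((w.drain p).event p (((w.config.drain p).advance p c).pc p)
        ((w.config.drain p).advance p c).view).ghost.truth
      ((w.drain p).event p (((w.config.drain p).advance p c).pc p)
        ((w.config.drain p).advance p c).view).ghost.snap := by
  obtain ⟨h1, h2, h3, h4⟩ := h.drain p
  have hn := nextOk h1 h2 hr c
  have hpc : ((w.config.drain p).advance p c).pc p = (next p ((w.config.drain p).view p)
      ((w.config.drain p).procs p).replies c ((w.config.drain p).pc p)).2 := by
    rw [Config.advance_pc]; simp
  have hpc' : (w.drain p).pc p = (w.config.drain p).pc p := by rw [h3]; rfl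
  have ht := hn.trans
  rw [← hpc] at ht
  have hP := h2.pcOk p
  have hadv := h1.advance (c := c) (T' := ((w.drain p).event p
      (((w.config.drain p).advance p c).pc p) ((w.config.drain p).advance p c).view).ghost.truth)
    rfl (by
      show w.ghost.truth.Le (w.ghost.event p ((w.drain p).pc p) _ _).truth
      rw [hpc']
      exact ht.truth_le hP _) hn.le_view
    (by
      show View.Le _ (w.ghost.event p ((w.drain p).pc p) _ _).truth
      rw [hpc', hpc]; exact hn.view_le _)
    (by
      intro cl hcl
      show cl.Has (w.ghost.event p ((w.drain p).pc p) _ _).truth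
      rw [hpc', hpc]; exact hn.call _ cl hcl)
  refine ⟨by rw [hpc']; exact ht, hadv.2, ?_⟩
  exact hadv.1

lemma World.Good.step {w : World n} (h : w.Good) (A : Adversary n) (c : unitInterval) :
    (World.step A w c).Good := by
  unfold World.step
  split
  · rename_i i _
    obtain ⟨h1, h2, h3⟩ := h.comm.deliver c i
    exact ⟨h1, by simp only; rw [h2.pc]; exact h.sound.mono_view h2.view⟩
  · rename_i p _
    obtain ⟨h1, h2, h3, h4⟩ := h.drain p
    split_ifs with hr
    · obtain ⟨h5, h6, h7⟩ := h.advance hr c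
      refine ⟨h7, ?_⟩
      have hs : (w.drain p).sound := by
        show Sound w.config.pc (w.config.drain p).view w.ghost
        rw [← h3]; exact h2
      have := hs.event h6 (h5.mono_view h6)
      have hpc : ((w.config.drain p).advance p c).pc = Function.update w.config.pc p
          (((w.config.drain p).advance p c).pc p) := by
        rw [Config.advance_pc, h3]; simp
      simp only
      rw [hpc]
      simp only [Function.update_self]
      exact this
    · exact ⟨h1, h2⟩

lemma World.good (A : Adversary n) (p₀ : Fin n) (ω : Coins) (k : ℕ) :
    (trajectory (World.step A) (World.initial n p₀) ω k).Good := by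
  induction k with
  | zero => exact ⟨Comm.initial, Sound.initial p₀⟩
  | succ k ih => exact ih.step A _

/-! ### Measurability of a single move -/

lemma next_countablyValued (p : Fin n) (V : View n) (views : Fin n → Option (View n)) (X : PC n) :
    CountablyValued (fun c => next p V views c X) := by
  cases X with
  | propContended S =>
    exact (pickUniform_countablyValued Sᶜ).comp (fun o => match o with
      | some u => ({ V with contended := insert u V.contended }, PC.doorCol u)
      | none => (V, PC.colContended))
  | statusCol u r =>
    have h1 : CountablyValued (fun c : unitInterval =>
        if (c : ℝ) ≤ bias (participants views u r).card then (0 : ℕ) else 1) :=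
      ⟨_, id, Measurable.ite (measurableSet_le measurable_subtype_coe measurable_const)
        measurable_const measurable_const, fun _ => rfl⟩
    convert h1.comp (fun m =>
        let s : Status n := if m = 0 then ⟨Stat.high, participants views u r⟩
          else ⟨Stat.low, participants views u r⟩
        (V.setStatus u r p s, PC.prioProp u r s)) using 2 with c
    simp only [next]
    split_ifs <;> simp_all
  | _ => exact CountablyValued.const _

/-- For a fixed history the move is fixed, and the coin enters only through `next`, whose outcome is
discrete. -/
lemma World.step_countablyValued (A : Adversary n) (w : World n) :
    CountablyValued (World.step A w) := by
  unfold World.step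
  cases (A (w.config :: w.past)).1 with
  | deliver i =>
    exact CountablyValued.const
      (⟨w.config.apply 0 (.deliver i), w.config :: w.past, w.ghost, w.tally⟩ : World n)
  | step p =>
    by_cases hr : ((w.config.drain p).procs p).ready
    · simp only [if_pos hr]
      let F : View n × PC n → World n := fun N =>
        let K : Config n :=
          { w.config.drain p with
            procs := Function.update (w.config.drain p).procs p
              { (w.config.drain p).procs p with
                pc := N.2, view := N.1, callId := ((w.config.drain p).procs p).callId + 1,
                replies := fun _ => none }
            packets := (w.config.drain p).packets ++ (match N.2.call p with
              | some call => (List.finRange n).map fun j =>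
                  ⟨p, j, .request (((w.config.drain p).procs p).callId + 1) call⟩
              | none => []) }
        let b := (w.drain p).event p (K.pc p) K.view
        ⟨K, w.config :: w.past, b.ghost, b.tally⟩
      exact (next_countablyValued p ((w.config.drain p).procs p).view
        ((w.config.drain p).procs p).replies ((w.config.drain p).procs p).pc).comp F
    · simp only [if_neg hr]; exact CountablyValued.const _

lemma bias_nonneg (k : ℕ) : 0 ≤ bias k := by
  unfold bias
  split_ifs
  · exact zero_le_one
  · rcases Nat.eq_zero_or_pos k with rfl | hk
    · simp
    · exact div_nonneg (Real.logb_nonneg (by norm_num) (by exact_mod_cast hk)) (by positivity)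

lemma bias_le_one (k : ℕ) : bias k ≤ 1 := by
  unfold bias
  split_ifs with h
  · exact le_rfl
  · rcases Nat.eq_zero_or_pos k with rfl | hk
    · simp
    · have hk' : (0 : ℝ) < k := by exact_mod_cast hk
      rw [div_le_one hk', Real.logb_le_iff_le_rpow (by norm_num) hk']
      have := (Nat.lt_two_pow_self (n := k)).le
      rw [Real.rpow_natCast]
      exact_mod_cast this

lemma World.state_step_advance {w : World n} (h : w.Good) {p : Fin n} (c : unitInterval) :
    (⟨((w.config.drain p).advance p c).pc, ((w.config.drain p).advance p c).view,
      ((w.drain p).event p (((w.config.drain p).advance p c).pc p)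
        ((w.config.drain p).advance p c).view).ghost,
      ((w.drain p).event p (((w.config.drain p).advance p c).pc p)
        ((w.config.drain p).advance p c).view).tally⟩ : State n) =
      (w.drain p).event p (((w.config.drain p).advance p c).pc p)
        ((w.config.drain p).advance p c).view := by
  obtain ⟨h1, h2, h3, h4⟩ := h.drain p
  have hpc : ((w.config.drain p).advance p c).pc = Function.update w.config.pc p
      (((w.config.drain p).advance p c).pc p) := by
    rw [Config.advance_pc, h3]; simp
  conv_lhs => rw [hpc]
  simp only [Function.update_self]
  rfl

/-- A function of the state that does not increase on average in a transition does not increase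
on average in a move. -/
theorem Super.lintegral_step_le {ψ : State n → ℝ} (hψ : Super ψ) (A : Adversary n) {w : World n}
    (h : w.Good) :
    ∫⁻ c, ENNReal.ofReal (ψ (World.step A w c).state) ≤ ENNReal.ofReal (ψ w.state) := by
  have hconst : ∀ x : ℝ≥0∞, ∫⁻ _ : unitInterval, x = x := fun x => by simp
  unfold World.step
  cases (A (w.config :: w.past)).1 with
  | deliver i =>
    refine (lintegral_mono (g := fun _ => ENNReal.ofReal (ψ w.state)) fun c => ?_).trans
      (hconst _).le
    obtain ⟨h1, h2, h3⟩ := h.comm.deliver c i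
    refine ENNReal.ofReal_le_ofReal ?_
    simp only [World.state]
    rw [h2.pc, h3]
  | step p =>
    obtain ⟨h1, h2, h3, h4⟩ := h.drain p
    have hdr : ψ (w.drain p) ≤ ψ w.state := hψ.view w.state _ h4
    by_cases hr : ((w.config.drain p).procs p).ready
    · simp only [if_pos hr]
      have hst : ∀ c, World.state (⟨(w.config.drain p).advance p c, w.config :: w.past,
          ((w.drain p).event p (((w.config.drain p).advance p c).pc p)
            ((w.config.drain p).advance p c).view).ghost,
          ((w.drain p).event p (((w.config.drain p).advance p c).pc p)
            ((w.config.drain p).advance p c).view).tally⟩ : World n) =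
          (w.drain p).event p (((w.config.drain p).advance p c).pc p)
            ((w.config.drain p).advance p c).view := fun c => World.state_step_advance h c
      simp only [hst]
      have hs : (w.drain p).sound := by
        show Sound w.config.pc (w.config.drain p).view w.ghost
        rw [← h3]; exact h2
      have hpc : ∀ c, ((w.config.drain p).advance p c).pc p = (next p ((w.config.drain p).view p)
          ((w.config.drain p).procs p).replies c ((w.drain p).pc p)).2 := by
        intro c
        rw [Config.advance_pc, h3]; simp [World.drain, World.state]
      have hvw : ∀ c, ((w.config.drain p).advance p c).view =
          Function.update (w.config.drain p).view p (next p ((w.config.drain p).view p)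
          ((w.config.drain p).procs p).replies c ((w.drain p).pc p)).1 := by
        intro c
        rw [Config.advance_view, h3]; rfl
      -- In a random state the outcomes, a uniform name or a biased priority, are averaged; in all
      -- other states the bound holds for every single coin.
      by_cases hX : ((w.drain p).pc p).random
      · cases hX' : (w.drain p).pc p <;> rw [hX'] at hX <;> try exact hX.elim
        · rename_i S
          simp only [hpc, hvw, hX']
          have hP := hs.pcOk p
          rw [hX'] at hP
          have hSn : (Sᶜ).Nonempty := by
            rw [Finset.nonempty_iff_ne_empty]
            intro h; exact hP.2.1 (Finset.compl_eq_empty_iff _ |>.1 h)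
          let V : Fin n → Fin n → View n := fun u =>
            Function.update (w.config.drain p).view p
              { (w.config.drain p).view p with
                contended := insert u ((w.config.drain p).view p).contended }
          let F : Option (Fin n) → ℝ≥0∞ := fun o => match o with
            | some u => ENNReal.ofReal (ψ ((w.drain p).event p (.doorCol u) (V u)))
            | none => ENNReal.ofReal (ψ ((w.drain p).event p .colContended
                (Function.update (w.config.drain p).view p ((w.config.drain p).view p))))
          have hF : ∀ c : unitInterval, ENNReal.ofReal (ψ ((w.drain p).event p
              (next p ((w.config.drain p).view p) ((w.config.drain p).procs p).replies c
                (PC.propContended S)).2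
              (Function.update (w.config.drain p).view p
                (next p ((w.config.drain p).view p) ((w.config.drain p).procs p).replies c
                (PC.propContended S)).1))) = F (pickUniform Sᶜ c) := by
            intro c
            cases hpk : pickUniform Sᶜ c <;> simp only [next, hpk, F, V]
          simp only [hF]
          rw [lintegral_pickUniform hSn F]
          have hk : ∀ v ∈ S, KnownName (w.drain p).view v := by
            intro v hv
            have h5 : (w.config.drain p).pc p = .propContended S := by rw [h3]; exact hX'
            have := h1.maj_has (cl := .propContended S) hr (by rw [h5]; rfl)
            exact this.mono fun k hk => hk hv
          have key := hψ.pick _ hs p S hX' hk V (by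
            intro u k
            simp only [V, Function.update_apply]; split_ifs with hk
            · subst hk
              exact ⟨Finset.subset_insert _ _, fun _ h => h, fun _ _ => le_rfl,
                fun _ _ _ => EntryLe.refl _⟩
            · exact View.Le.refl _)
          have hc : (0 : ℝ) < Sᶜ.card := by exact_mod_cast hSn.card_pos
          have h6 : ∑ u ∈ Sᶜ, F (some u) =
              ENNReal.ofReal (∑ u ∈ Sᶜ, ψ ((w.drain p).event p (.doorCol u) (V u))) := by
            rw [ENNReal.ofReal_sum_of_nonneg fun u _ => hψ.nonneg _]
          rw [h6]
          calc (Sᶜ.card : ℝ≥0∞)⁻¹ *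
                ENNReal.ofReal (∑ u ∈ Sᶜ, ψ ((w.drain p).event p (.doorCol u) (V u)))
              ≤ (Sᶜ.card : ℝ≥0∞)⁻¹ * ENNReal.ofReal ((Sᶜ.card : ℝ) * ψ (w.drain p)) := by
                gcongr
            _ = ENNReal.ofReal (ψ (w.drain p)) := by
                rw [ENNReal.ofReal_mul hc.le, ENNReal.ofReal_natCast, ← mul_assoc,
                  ENNReal.inv_mul_cancel (by exact_mod_cast hSn.card_pos.ne') (by simp), one_mul]
            _ ≤ ENNReal.ofReal (ψ w.state) := ENNReal.ofReal_le_ofReal hdr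
        · rename_i u r
          simp only [hpc, hvw, hX']
          set l := participants ((w.config.drain p).procs p).replies u r with hl
          have hF : ∀ c : unitInterval, ENNReal.ofReal (ψ ((w.drain p).event p
              (next p ((w.config.drain p).view p) ((w.config.drain p).procs p).replies c
                (PC.statusCol u r)).2
              (Function.update (w.config.drain p).view p
                (next p ((w.config.drain p).view p) ((w.config.drain p).procs p).replies c
                (PC.statusCol u r)).1))) = if (c : ℝ) ≤ bias l.card then
              ENNReal.ofReal (ψ ((w.drain p).event p (.prioProp u r ⟨Stat.high, l⟩)
                (Function.update (w.config.drain p).view p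
                  (((w.config.drain p).view p).setStatus u r p ⟨Stat.high, l⟩)))) else
              ENNReal.ofReal (ψ ((w.drain p).event p (.prioProp u r ⟨Stat.low, l⟩)
                (Function.update (w.config.drain p).view p
                  (((w.config.drain p).view p).setStatus u r p ⟨Stat.low, l⟩)))) := by
            intro c
            by_cases hb : (c : ℝ) ≤ bias l.card
            · simp only [next, ← hl, if_pos hb]
            · simp only [next, ← hl, if_neg hb]
          simp only [hF]
          rw [lintegral_bernoulli (bias_nonneg _) (bias_le_one _)]
          have h5 : (w.config.drain p).pc p = .statusCol u r := by rw [h3]; exact hX'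
          have hfl : ∀ j, KnownEntry ((w.drain p).ghost.snap p) u r j → j ∈ l := by
            intro j hj
            obtain ⟨a, ha, W, hW', hle⟩ := h1.reply_status (P := fun a => a ≠ none) hr
              (by rw [h5]; rfl) hj
            simp only [hl, participants, Finset.mem_filter, Finset.mem_univ, true_and]
            exact ⟨W, hW', hle.ne_none ha⟩
          have hle : ∀ (s : Status n) k, ((w.drain p).view k).Le
              (Function.update (w.config.drain p).view p
                (((w.config.drain p).view p).setStatus u r p s) k) := by
            intro s k
            rw [Function.update_apply]; split_ifs with hk
            · subst hk
              refine View.le_setStatus ?_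
              have h6 := (h1.view_le k).status u r k
              have h7 := h2.pcOk k
              rw [h5] at h7
              rw [h7.2.2.2.1] at h6
              exact h6.of_commit s
            · exact View.Le.refl _
          have key := hψ.flip _ hs p u r l hX' hfl
            (Function.update (w.config.drain p).view p
                  (((w.config.drain p).view p).setStatus u r p ⟨Stat.high, l⟩))
            (Function.update (w.config.drain p).view p
                  (((w.config.drain p).view p).setStatus u r p ⟨Stat.low, l⟩))
            (hle _) (hle _)
          have hb0 := bias_nonneg l.card
          have hb1 : 0 ≤ 1 - bias l.card := sub_nonneg.2 (bias_le_one _)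
          rw [← ENNReal.ofReal_mul hb0, ← ENNReal.ofReal_mul hb1,
            ← ENNReal.ofReal_add (mul_nonneg hb0 (hψ.nonneg _)) (mul_nonneg hb1 (hψ.nonneg _))]
          exact ENNReal.ofReal_le_ofReal (key.trans hdr)
      · refine (lintegral_mono (g := fun _ => ENNReal.ofReal (ψ w.state)) fun c => ?_).trans
          (hconst _).le
        refine ENNReal.ofReal_le_ofReal (le_trans ?_ hdr)
        obtain ⟨h5, h6, h7⟩ := h.advance hr c
        exact hψ.det _ hs p _ _ h5 hX h6
    · simp only [if_neg hr]
      refine (lintegral_mono (g := fun _ => ENNReal.ofReal (ψ w.state)) fun c => ?_).trans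
        (hconst _).le
      refine ENNReal.ofReal_le_ofReal (le_trans (le_of_eq ?_) hdr)
      simp only [World.state, World.drain]
      rw [h3]

/-- Ville's inequality for the system. -/
theorem Super.measure_le {ψ : State n → ℝ} (hψ : Super ψ) (A : Adversary n) (p₀ : Fin n) {a : ℝ}
    (ha : 0 < a) :
    coinMeasure {ω | ∃ k, a ≤ ψ (trajectory (World.step A) (World.initial n p₀) ω k).state} ≤
      ENNReal.ofReal (ψ (World.initial n p₀).state / a) := by
  have := measure_exists_ge_le (World.step_countablyValued A) (x₀ := World.initial n p₀)
    (World.good A p₀) (φ := fun w => ENNReal.ofReal (ψ w.state))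
    (fun w hw => hψ.lintegral_step_le A hw) (a := ENNReal.ofReal a) (by simpa using ha) (by simp)
  rw [← ENNReal.ofReal_div_of_pos ha] at this
  refine le_trans (measure_mono ?_) this
  rintro ω ⟨k, hk⟩
  exact ⟨k, ENNReal.ofReal_le_ofReal hk⟩

/-! ## Effect of the transitions on names and counters -/

lemma mem_free {g : Ghost n} {u : Fin n} : u ∈ g.free ↔ g.picks u = ∅ := by simp [Ghost.free]

lemma Trans.picks_eq {V : Fin n → View n} {g : Ghost n} {p : Fin n} {X Y : PC n}
    (t : Trans V g p X Y) (hX : ∀ S, X ≠ .propContended S) (V' : Fin n → View n) :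
    (g.event p X Y V').picks = g.picks := by
  cases t <;> first | rfl | exact absurd rfl (hX _)

lemma free_congr {g g' : Ghost n} (h : g'.picks = g.picks) : g'.free = g.free := by
  unfold Ghost.free; rw [h]

lemma Trans.spot_eq {V : Fin n → View n} {g : Ghost n} {p : Fin n} {X Y : PC n}
    (t : Trans V g p X Y) (hX : ∀ S, X ≠ .propContended S) :
    Y.spot = X.spot ∨ ∃ u, X = .outcomeProp u false ∧ Y = .colContended := by
  cases t <;> first
    | exact Or.inl rfl
    | exact absurd rfl (hX _)
    | exact Or.inr ⟨_, rfl, rfl⟩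

lemma not_random_propContended {X : PC n} (h : ¬ X.random) : ∀ S, X ≠ .propContended S := by
  rintro S rfl; exact h trivial

lemma State.newTally_of_ne {a : State n} {p : Fin n} (h : ∀ S, a.pc p ≠ .propContended S) (Y : PC n) :
    (a.newTally p Y).picked = a.tally.picked ∧
      (a.newTally p Y).crowd = a.tally.crowd ∧ (a.newTally p Y).halved = a.tally.halved ∧
      (a.newTally p Y).load = a.tally.load ∧ (a.newTally p Y).hits = a.tally.hits := by
  unfold State.newTally
  split
  · rename_i S u hS; exact absurd hS (h S)
  all_goals exact ⟨rfl, rfl, rfl, rfl, rfl⟩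

lemma sound_notMem_picks {a : State n} (h : a.sound) {p : Fin n} {S : Finset (Fin n)}
    (hX : a.pc p = .propContended S) {u : Fin n} (hu : u ∉ S) : p ∉ a.ghost.picks u := by
  have := h.pcOk p
  rw [hX] at this
  exact fun h => hu (this.2.2 u h)

lemma free_subset_compl {a : State n} (h : a.sound) {p : Fin n} {S : Finset (Fin n)}
    (hX : a.pc p = .propContended S) : a.ghost.free ⊆ Sᶜ := by
  have := h.pcOk p
  rw [hX] at this
  intro u hu
  rw [Finset.mem_compl]
  intro hS
  have h2 := (h.contended u).1 (this.1 hS)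
  rw [mem_free.1 hu] at h2
  simp at h2

lemma sum_free {a : State n} (h : a.sound) {p : Fin n} {S : Finset (Fin n)}
    (hX : a.pc p = .propContended S) :
    ∑ u ∈ Sᶜ, (if u ∈ a.ghost.free then (1 : ℝ) else 0) = a.ghost.free.card := by
  rw [Finset.sum_ite_mem, Finset.inter_eq_right.2 (free_subset_compl h hX)]
  simp

lemma sum_eq_le (D : Finset (Fin n)) (v : Fin n) : ∑ u ∈ D, (if u = v then (1 : ℝ) else 0) ≤ 1 := by
  rw [Finset.sum_ite_eq']; split_ifs <;> norm_num

lemma free_card_pos {a : State n} (h : a.sound) {p : Fin n} {S : Finset (Fin n)}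
    (hX : a.pc p = .propContended S) : 1 ≤ a.ghost.free.card :=
  (Sound.exists_free h (p := p) (by rw [hX]; rfl)).card_pos

section
variable {a : State n} {p : Fin n} {S : Finset (Fin n)} (hX : a.pc p = .propContended S)
  (u : Fin n) (V : Fin n → View n)
include hX

lemma pick_picks : (a.event p (.doorCol u) V).ghost.picks =
    Function.update a.ghost.picks u (insert p (a.ghost.picks u)) := by
  simp [State.event, Ghost.event, Ghost.core, hX]

lemma pick_free : (a.event p (.doorCol u) V).ghost.free = a.ghost.free.erase u := by
  ext v
  rw [mem_free, pick_picks hX, Finset.mem_erase, mem_free, Function.update_apply]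
  split_ifs with h
  · simp [h]
  · simp [h]

lemma pick_free_card : ((a.event p (.doorCol u) V).ghost.free.card : ℝ) =
    a.ghost.free.card - if u ∈ a.ghost.free then 1 else 0 := by
  rw [pick_free hX]
  split_ifs with h
  · rw [Finset.card_erase_of_mem h, Nat.cast_sub (Finset.card_pos.2 ⟨u, h⟩)]; simp
  · rw [Finset.erase_eq_of_notMem h]; simp

lemma pick_tally : (a.event p (.doorCol u) V).tally =
    { a.tally with
        calls := Function.update a.tally.calls p (a.tally.calls p + 1)
        picked := Function.update a.tally.picked p (a.tally.picked p + 1)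
        crowd := fun q =>
          if q = p then a.tally.crowd p + (if 2 ≤ (holders a.pc u).card then 1 else 0)
          else a.tally.crowd q + (if (a.pc q).spot = some u then 1 else 0)
        halved := Function.update a.tally.halved p
          (a.tally.halved p + if 2 * a.ghost.free.card < a.tally.free₀ p then 1 else 0)
        load := fun q =>
          if q = p then a.tally.load p + ((holders a.pc u).card + 2)
          else a.tally.load q + (if (a.pc q).spot = some u then 1 else 0)
        hits := Function.update a.tally.hits p
          (a.tally.hits p + a.ghost.free.card / (Sᶜ.card : ℝ)) } := by
  simp [State.event, State.newTally, hX]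

end

/-! ## The number of processors that pick a name -/

/-- Among the |Sᶜ| equally likely names, v gains half of the value, and each of the f free names
loses one unit of the factor f + 1. The balance (f + 1)/2 - f is at most 0, since f ≥ 1 as long as
somebody has to pick. The summand 1 keeps the potential positive when no name is free. -/
def popularity (v : Fin n) (a : State n) : ℝ :=
  (3 / 2) ^ (a.ghost.picks v).card * (a.ghost.free.card + 1)

lemma super_popularity (v : Fin n) : Super (popularity v) where
  nonneg a := by unfold popularity; positivity
  view a V _ := le_rfl
  det a ha p Y V t hr hV := by
    have h1 : (a.event p Y V).ghost.picks = a.ghost.picks :=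
      t.picks_eq (not_random_propContended hr) V
    unfold popularity; rw [free_congr h1, h1]
  pick a ha p S hX hS V hV := by
    have hf := free_card_pos ha hX
    have hf' : (1 : ℝ) ≤ a.ghost.free.card := by exact_mod_cast hf
    set f : ℝ := (a.ghost.free.card : ℝ) with hfdef
    set C : ℝ := (3 / 2) ^ (a.ghost.picks v).card with hC
    have hC0 : 0 < C := by positivity
    have key : ∀ u ∈ Sᶜ, popularity v (a.event p (.doorCol u) (V u)) ≤
        C * ((f + 1) - (if u ∈ a.ghost.free then 1 else 0) + (if u = v then 1 else 0) * ((f + 1) / 2)) := by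
      intro u hu
      unfold popularity
      rw [pick_free_card hX, pick_picks hX]
      by_cases huv : u = v
      · subst huv
        rw [Function.update_self, Finset.card_insert_of_notMem
          (sound_notMem_picks ha hX (Finset.mem_compl.1 hu)), pow_succ, ← hC, ← hfdef]
        simp only [if_true]
        split_ifs <;> nlinarith
      · rw [Function.update_of_ne (Ne.symm huv), ← hC, ← hfdef]
        simp only [huv, if_false]
        apply le_of_eq; ring
    refine (Finset.sum_le_sum key).trans ?_
    rw [← Finset.mul_sum, Finset.sum_add_distrib, Finset.sum_sub_distrib, ← Finset.sum_mul,
      sum_free ha hX, Finset.sum_const, nsmul_eq_mul]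
    have h1 := sum_eq_le Sᶜ v
    unfold popularity
    rw [← hC, ← hfdef]
    have h2 : (∑ u ∈ Sᶜ, if u = v then (1 : ℝ) else 0) * ((f + 1) / 2) ≤ 1 * ((f + 1) / 2) := by
      gcongr
    calc _ ≤ C * ((Sᶜ.card : ℝ) * (f + 1)) := by
          gcongr; linarith
      _ = _ := by ring
  flip a ha p u r l hX hl V W _ _ := by
    have h1 : ∀ s V, popularity v (a.event p (.prioProp u r s) V) = popularity v a := by
      intro s V; simp [popularity, Ghost.free, State.event, Ghost.event, Ghost.core, hX]
    rw [h1, h1]; apply le_of_eq; ring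

/-! ## Collisions -/

/-- `p` is the only one that has picked its name. -/
def State.Alone (a : State n) (p : Fin n) : Prop :=
  ∃ u, (a.pc p).spot = some u ∧ a.ghost.picks u = {p}

/-- When p picks, each of the f free names turns f + 1 into 3/5 (f + 1), and at most f names have
several holders and cost a factor 6/5. The net loss, a fraction f/(5|Sᶜ|), pays for the growth of
the exponential. When another processor picks, the possible loss of a free name pays for an
encounter with p: if p is alone, passing from 3/5 (f + 2) to 6/5 (f + 1) costs 3/5 f, exactly what
the f free names give back; otherwise the cost is (f + 1)/5 ≤ f. -/
def collisions (p : Fin n) (a : State n) : ℝ :=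
  (6 / 5) ^ a.tally.crowd p * Real.exp (a.tally.hits p / 5) *
    (if a.Alone p then 3 / 5 * ((a.ghost.free.card : ℝ) + 2) else (a.ghost.free.card : ℝ) + 1)

/-- A name with several holders has excess at least one, and the total excess is at most the number
of free names. -/
lemma card_crowded_le {a : State n} (ha : a.sound) (D : Finset (Fin n)) :
    ∑ u ∈ D, (if 2 ≤ (holders a.pc u).card then (1 : ℝ) else 0) ≤ a.ghost.free.card := by
  have h1 : ∑ u ∈ D, (if 2 ≤ (holders a.pc u).card then 1 else 0) ≤
      ∑ u, ((holders a.pc u).card - 1) := by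
    refine (Finset.sum_le_sum fun u _ => ?_).trans
      (Finset.sum_le_sum_of_subset (Finset.subset_univ D))
    split_ifs <;> omega
  have h2 := Sound.card_free ha
  have h3 : ∑ u ∈ D, (if 2 ≤ (holders a.pc u).card then 1 else 0) ≤ a.ghost.free.card := by omega
  exact_mod_cast h3

lemma alone_congr {a b : State n} {p : Fin n} (h1 : (b.pc p).spot = (a.pc p).spot)
    (h2 : b.ghost.picks = a.ghost.picks) : b.Alone p ↔ a.Alone p := by
  unfold State.Alone; rw [h1, h2]

lemma exp_mul_le {x : ℝ} : Real.exp x * (1 - x) ≤ 1 := by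
  have := Real.add_one_le_exp (-x)
  have h2 : Real.exp x * (1 - x) ≤ Real.exp x * Real.exp (-x) := by
    gcongr; linarith
  rwa [← Real.exp_add, add_neg_cancel, Real.exp_zero] at h2

lemma super_collisions (p : Fin n) : Super (collisions p) where
  nonneg a := by unfold collisions; split_ifs <;> positivity
  view a V _ := le_rfl
  det a ha q Y V t hr hV := by
    have hne := not_random_propContended hr
    have h1 : (a.event q Y V).ghost.picks = a.ghost.picks := t.picks_eq hne V
    obtain ⟨-, h2, -, -, h3⟩ := State.newTally_of_ne hne Y
    have h4 : (a.event q Y V).Alone p ↔ a.Alone p := by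
      by_cases hqp : q = p
      · subst hqp
        rcases t.spot_eq hne with h5 | ⟨u, h5, h6⟩
        · exact alone_congr (by simp [State.event, h5]) h1
        · constructor
          · rintro ⟨v, hv, -⟩
            simp [State.event, h6, PC.spot] at hv
          · rintro ⟨v, hv, hv'⟩
            -- A processor that has just lost is not alone: some picker of its name has not lost.
            exfalso
            rw [h5] at hv; cases hv
            obtain ⟨x, hx, hx'⟩ := Sound.exists_notMem_lost ha (u := u) (by rw [hv']; simp)
            rw [hv', Finset.mem_singleton] at hx
            subst hx
            exact hx' ((ha.spotOk x).outcome_lost u h5)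
      · exact alone_congr (by simp [State.event, Ne.symm hqp]) h1
    have h2' : (a.event q Y V).tally.crowd = a.tally.crowd := h2
    have h3' : (a.event q Y V).tally.hits = a.tally.hits := h3
    unfold collisions
    rw [free_congr h1, h2', h3']
    simp only [h4]
    exact le_rfl
  pick a ha q S hX hS V hV := by
    have hf := free_card_pos ha hX
    have hf' : (1 : ℝ) ≤ a.ghost.free.card := by exact_mod_cast hf
    have hD : (Sᶜ.card : ℝ) ≥ a.ghost.free.card := by
      exact_mod_cast Finset.card_le_card (free_subset_compl ha hX)
    set f : ℝ := (a.ghost.free.card : ℝ) with hfdef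
    set D : ℝ := (Sᶜ.card : ℝ) with hDdef
    have hsf := sum_free ha hX
    rw [← hfdef] at hsf
    have hD0 : 0 < D := by linarith
    by_cases hqp : q = p
    · subst hqp
      have hal : ¬ a.Alone q := by
        rintro ⟨u, hu, -⟩; rw [hX] at hu; cases hu
      set C : ℝ := (6 / 5) ^ a.tally.crowd q * Real.exp (a.tally.hits q / 5) with hC
      have hC0 : 0 < C := by positivity
      have key : ∀ u ∈ Sᶜ, collisions q (a.event q (.doorCol u) (V u)) ≤
          C * Real.exp (f / D / 5) * ((f + 1) * (1 - 2 / 5 * (if u ∈ a.ghost.free then 1 else 0) +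
            1 / 5 * (if 2 ≤ (holders a.pc u).card then 1 else 0))) := by
        intro u hu
        have hqu := sound_notMem_picks ha hX (Finset.mem_compl.1 hu)
        have hal' : (a.event q (.doorCol u) (V u)).Alone q ↔ u ∈ a.ghost.free := by
          unfold State.Alone
          rw [pick_picks hX]
          simp only [State.event, Function.update_self, PC.spot, Option.some.injEq]
          rw [mem_free]
          constructor
          · rintro ⟨v, rfl, hv⟩
            rw [Function.update_self] at hv
            rw [Finset.eq_empty_iff_forall_notMem]
            intro x hx
            have : x ∈ ({q} : Finset (Fin n)) := by rw [← hv]; exact Finset.mem_insert_of_mem hx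
            rw [Finset.mem_singleton] at this; subst this; exact hqu hx
          · intro h; exact ⟨u, rfl, by simp [h]⟩
        unfold collisions
        rw [pick_free_card hX, pick_tally hX]
        simp only [hal', if_true, Function.update_self, ← hfdef, ← hDdef]
        rw [add_div (a.tally.hits q), Real.exp_add, pow_add]
        by_cases huf : u ∈ a.ghost.free
        · have h0 : (holders a.pc u).card = 0 := by
            rw [Finset.card_eq_zero]
            exact Finset.subset_empty.1 (mem_free.1 huf ▸ Sound.holders_subset ha u)
          simp only [huf, h0, if_true]
          norm_num
          apply le_of_eq; rw [hC]; ring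
        · simp only [huf, if_false]
          split_ifs
          · apply le_of_eq; rw [hC]; ring
          · apply le_of_eq; rw [hC]; ring
      refine (Finset.sum_le_sum key).trans ?_
      rw [← Finset.mul_sum, ← Finset.mul_sum, Finset.sum_add_distrib, Finset.sum_sub_distrib,
        ← Finset.mul_sum, ← Finset.mul_sum, hsf, Finset.sum_const, nsmul_eq_mul, mul_one]
      have h1 := card_crowded_le ha Sᶜ
      rw [← hfdef] at h1
      unfold collisions
      rw [if_neg hal, ← hC, ← hfdef, ← hDdef]
      have h2 : D * (Real.exp (f / D / 5) * (1 - f / D / 5)) ≤ D * 1 := by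
        gcongr; exact exp_mul_le
      have h3 : D * (1 - f / D / 5) = D - f / 5 := by field_simp
      calc _ ≤ C * Real.exp (f / D / 5) * ((f + 1) * (D - f / 5)) := by
            gcongr; linarith
        _ = C * (f + 1) * (D * (Real.exp (f / D / 5) * (1 - f / D / 5))) := by
            rw [← h3]; ring
        _ ≤ C * (f + 1) * (D * 1) := by gcongr
        _ = _ := by ring
    · have hpq : p ≠ q := Ne.symm hqp
      set C : ℝ := (6 / 5) ^ a.tally.crowd p * Real.exp (a.tally.hits p / 5) with hC
      have hC0 : 0 < C := by positivity
      have hpc : ∀ u, ((a.event q (.doorCol u) (V u)).pc p) = a.pc p := by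
        intro u; simp [State.event, hpq]
      have hval : ∀ u, collisions p (a.event q (.doorCol u) (V u)) =
          C * (6 / 5) ^ (if (a.pc p).spot = some u then 1 else 0) *
            (if (a.event q (.doorCol u) (V u)).Alone p then
              3 / 5 * (f - (if u ∈ a.ghost.free then 1 else 0) + 2)
              else f - (if u ∈ a.ghost.free then 1 else 0) + 1) := by
        intro u
        unfold collisions
        rw [pick_free_card hX, pick_tally hX, ← hfdef]
        simp only [hpq, if_false, Function.update_of_ne hpq, pow_add, hC]
        ring
      have hal' : ∀ u ∈ Sᶜ, (a.event q (.doorCol u) (V u)).Alone p ↔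
          a.Alone p ∧ (a.pc p).spot ≠ some u := by
        intro u hu
        have hqu := sound_notMem_picks ha hX (Finset.mem_compl.1 hu)
        unfold State.Alone
        rw [hpc, pick_picks hX]
        constructor
        · rintro ⟨v, hv, hv'⟩
          by_cases huv : v = u
          · subst huv
            rw [Function.update_self] at hv'
            have : q ∈ ({p} : Finset (Fin n)) := by rw [← hv']; exact Finset.mem_insert_self _ _
            exact absurd (Finset.mem_singleton.1 this) hqp
          · rw [Function.update_of_ne huv] at hv'
            refine ⟨⟨v, hv, hv'⟩, ?_⟩
            rw [hv]; intro h; cases h; exact huv rfl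
        · rintro ⟨⟨v, hv, hv'⟩, h⟩
          refine ⟨v, hv, ?_⟩
          rw [Function.update_of_ne, hv']
          rintro rfl; exact h hv
      cases hsp : (a.pc p).spot with
      | none =>
        have hal : ¬ a.Alone p := by rintro ⟨u, hu, -⟩; rw [hsp] at hu; cases hu
        have key : ∀ u ∈ Sᶜ, collisions p (a.event q (.doorCol u) (V u)) =
            C * (f + 1 - (if u ∈ a.ghost.free then 1 else 0)) := by
          intro u hu
          rw [hval, if_neg (fun h => hal ((hal' u hu).1 h).1), hsp]
          simp; left; ring
        rw [Finset.sum_congr rfl key, ← Finset.mul_sum, Finset.sum_sub_distrib, hsf,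
          Finset.sum_const, nsmul_eq_mul]
        unfold collisions
        rw [if_neg hal, ← hC, ← hfdef, ← hDdef]
        nlinarith
      | some u₀ =>
        have hu0 : u₀ ∉ a.ghost.free := by
          intro h
          have := (ha.spotOk p).spot_picks u₀ hsp
          rw [mem_free.1 h] at this; simp at this
        have h1 := sum_eq_le Sᶜ u₀
        by_cases hal : a.Alone p
        · have key : ∀ u ∈ Sᶜ, collisions p (a.event q (.doorCol u) (V u)) =
              C * (3 / 5 * (f + 2) - 3 / 5 * (if u ∈ a.ghost.free then 1 else 0) +
                (if u = u₀ then 1 else 0) * (3 / 5 * f)) := by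
            intro u hu
            rw [hval]
            simp only [hal' u hu, hal, hsp, true_and, Option.some.injEq, ne_eq]
            by_cases huu : u = u₀
            · subst huu
              simp only [hu0, not_true_eq_false, if_true, if_false, pow_one]; ring
            · have huu' : ¬ u₀ = u := fun h => huu h.symm
              simp only [huu, huu', not_false_eq_true, if_true, if_false, pow_zero]; ring
          rw [Finset.sum_congr rfl key, ← Finset.mul_sum, Finset.sum_add_distrib,
            Finset.sum_sub_distrib, Finset.sum_const, nsmul_eq_mul, ← Finset.mul_sum,
            ← Finset.sum_mul, hsf]
          unfold collisions
          rw [if_pos hal, ← hC, ← hfdef, ← hDdef]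
          have h2 : (∑ u ∈ Sᶜ, if u = u₀ then (1 : ℝ) else 0) * (3 / 5 * f) ≤ 1 * (3 / 5 * f) := by
            gcongr
          calc _ ≤ C * (D * (3 / 5 * (f + 2))) := by gcongr; linarith
            _ = _ := by ring
        · have key : ∀ u ∈ Sᶜ, collisions p (a.event q (.doorCol u) (V u)) =
              C * ((f + 1) - (if u ∈ a.ghost.free then 1 else 0) +
                (if u = u₀ then 1 else 0) * ((f + 1) / 5)) := by
            intro u hu
            rw [hval, if_neg (fun h => hal ((hal' u hu).1 h).1), hsp]
            by_cases huu : u = u₀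
            · subst huu
              simp only [hu0, if_true, if_false, pow_one]; ring
            · have huu' : ¬ u₀ = u := fun h => huu h.symm
              simp only [Option.some.injEq, huu, huu', if_false, pow_zero]; ring
          rw [Finset.sum_congr rfl key, ← Finset.mul_sum, Finset.sum_add_distrib,
            Finset.sum_sub_distrib, ← Finset.sum_mul, hsf, Finset.sum_const, nsmul_eq_mul]
          unfold collisions
          rw [if_neg hal, ← hC, ← hfdef, ← hDdef]
          have h2 : (∑ u ∈ Sᶜ, if u = u₀ then (1 : ℝ) else 0) * ((f + 1) / 5) ≤
              1 * ((f + 1) / 5) := by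
            gcongr
          calc _ ≤ C * (D * (f + 1)) := by gcongr; linarith
            _ = _ := by ring
  flip a ha q u r l hX hl V W _ _ := by
    have h1 : ∀ s V, collisions p (a.event q (.prioProp u r s) V) = collisions p a := by
      intro s V
      have h2 : (a.event q (.prioProp u r s) V).ghost.picks = a.ghost.picks := by
        simp [State.event, Ghost.event, Ghost.core, hX]
      have h3 : (a.event q (.prioProp u r s) V).Alone p ↔ a.Alone p := by
        refine alone_congr ?_ h2
        by_cases hqp : p = q
        · subst hqp; simp [State.event, hX, PC.spot]
        · simp [State.event, hqp]
      unfold collisions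
      simp only [h3]
      rw [free_congr h2]
      simp [State.event, State.newTally, hX]
    rw [h1, h1]; apply le_of_eq; ring

/-! ## Names picked by a single processor -/

/-- The names that have been picked by one processor, and are not known to be contended. -/
def State.single (a : State n) : Finset (Fin n) :=
  Finset.univ.filter fun v => ¬ KnownName a.view v ∧ (a.ghost.picks v).card = 1

/-- A harmonic function for the walk that goes from (f, s) to (f - 1, s + 1) with weight f and to
(f, s - 1) with weight s, as long as f ≥ 1. The quadratic term is what later bounds s by O(log n)(f
+ 1); the other two compensate its drift. -/
def singleBound (f s : ℕ) : ℝ :=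
  (s : ℝ) * (s - 1) / ((f + 1) * (f + 2)) + 2 * (harmonic (f + 1) : ℝ) * s / (f + 1) +
    ∑ j ∈ Finset.range f, 2 * (harmonic (j + 1) : ℝ) / (j + 1)

def singles (a : State n) : ℝ := singleBound a.ghost.free.card a.single.card

lemma harmonic_cast_nonneg (m : ℕ) : (0 : ℝ) ≤ (harmonic m : ℝ) := by
  unfold harmonic
  push_cast
  exact Finset.sum_nonneg fun i _ => by positivity

lemma mul_sub_one_nonneg (s : ℕ) : (0 : ℝ) ≤ (s : ℝ) * (s - 1) := by
  rcases s with _ | s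
  · simp
  · push_cast; have : (0:ℝ) ≤ s := by positivity
    nlinarith

lemma singleBound_nonneg (f s : ℕ) : 0 ≤ singleBound f s := by
  unfold singleBound
  have h1 := mul_sub_one_nonneg s
  have h2 := harmonic_cast_nonneg (f + 1)
  have h3 : 0 ≤ ∑ j ∈ Finset.range f, 2 * (harmonic (j + 1) : ℝ) / (j + 1) :=
    Finset.sum_nonneg fun j _ => by have := harmonic_cast_nonneg (j + 1); positivity
  positivity

lemma singleBound_mono (f : ℕ) {s s' : ℕ} (h : s ≤ s') : singleBound f s ≤ singleBound f s' := by
  unfold singleBound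
  have h2 := harmonic_cast_nonneg (f + 1)
  have h3 : (s : ℝ) * (s - 1) ≤ (s' : ℝ) * (s' - 1) := by
    rcases s with _ | s
    · simpa using mul_sub_one_nonneg s'
    · have : ((s + 1 : ℕ) : ℝ) ≤ s' := by exact_mod_cast h
      push_cast at *
      have : (0 : ℝ) ≤ s := by positivity
      nlinarith
  gcongr

/-- The drift, written for `f + 1` free names, vanishes identically. The truncation of `s - 1` at s
= 0 is harmless because of the factor s. -/
lemma singleBound_drift (f s : ℕ) :
    ((f : ℝ) + 1) * (singleBound f (s + 1) - singleBound (f + 1) s) +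
      s * (singleBound (f + 1) (s - 1) - singleBound (f + 1) s) ≤ 0 := by
  unfold singleBound
  rw [Finset.sum_range_succ, harmonic_succ (f + 1)]
  rcases s with _ | s
  · push_cast
    apply le_of_eq
    field_simp
    ring
  · push_cast
    apply le_of_eq
    field_simp
    ring

lemma single_anti {a b : State n} (hV : ∀ k, (a.view k).Le (b.view k))
    (hp : b.ghost.picks = a.ghost.picks) : b.single ⊆ a.single := by
  intro v hv
  simp only [State.single, Finset.mem_filter, Finset.mem_univ, true_and] at hv ⊢
  exact ⟨fun h => hv.1 (h.mono hV), by rw [← hp]; exact hv.2⟩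

lemma super_singles : Super (singles (n := n)) where
  nonneg a := singleBound_nonneg _ _
  view a V hV := singleBound_mono _ (Finset.card_le_card (single_anti hV rfl))
  det a ha p Y V t hr hV := by
    have h1 : (a.event p Y V).ghost.picks = a.ghost.picks :=
      t.picks_eq (not_random_propContended hr) V
    unfold singles
    rw [free_congr h1]
    exact singleBound_mono _ (Finset.card_le_card (single_anti hV h1))
  pick a ha p S hX hS V hV := by
    have hf := free_card_pos ha hX
    obtain ⟨f, hfe⟩ : ∃ f, a.ghost.free.card = f + 1 := ⟨_, (Nat.sub_add_cancel hf).symm⟩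
    set s := a.single.card with hs
    -- The names of S are known to be contended, so every name in `single` can be chosen and then
    -- leaves the set.
    have hsS : a.single ⊆ Sᶜ := by
      intro v hv
      simp only [State.single, Finset.mem_filter, Finset.mem_univ, true_and] at hv
      exact Finset.mem_compl.2 fun h => hv.1 (hS v h)
    have key : ∀ u ∈ Sᶜ, singles (a.event p (.doorCol u) (V u)) ≤
        singleBound (f + 1) s +
          (if u ∈ a.ghost.free then 1 else 0) * (singleBound f (s + 1) - singleBound (f + 1) s) +
          (if u ∈ a.single then 1 else 0) *
            (singleBound (f + 1) (s - 1) - singleBound (f + 1) s) := by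
      intro u hu
      have hpu := sound_notMem_picks ha hX (Finset.mem_compl.1 hu)
      have hsub : (a.event p (.doorCol u) (V u)).single ⊆
          if u ∈ a.single then a.single.erase u else if u ∈ a.ghost.free then insert u a.single
            else a.single := by
        intro v hv
        simp only [State.single, Finset.mem_filter, Finset.mem_univ, true_and] at hv
        rw [pick_picks hX] at hv
        have hk : ¬ KnownName a.view v := fun h => hv.1 (h.mono (hV u))
        by_cases hvu : v = u
        · subst hvu
          rw [Function.update_self, Finset.card_insert_of_notMem hpu] at hv
          have h0 : a.ghost.picks v = ∅ := by
            rw [← Finset.card_eq_zero]; omega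
          have h1 : v ∉ a.single := by simp [State.single, h0]
          rw [if_neg h1, if_pos (mem_free.2 h0)]
          exact Finset.mem_insert_self _ _
        · rw [Function.update_of_ne hvu] at hv
          have h1 : v ∈ a.single := by
            simp only [State.single, Finset.mem_filter, Finset.mem_univ, true_and]
            exact ⟨hk, hv.2⟩
          split_ifs
          · exact Finset.mem_erase.2 ⟨hvu, h1⟩
          · exact Finset.mem_insert_of_mem h1
          · exact h1
      have hcard := Finset.card_le_card hsub
      unfold singles
      rw [pick_free hX]
      by_cases h1 : u ∈ a.single
      · have h2 : u ∉ a.ghost.free := by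
          intro h; simp [State.single, mem_free.1 h] at h1
        rw [if_pos h1, Finset.card_erase_of_mem h1] at hcard
        rw [Finset.erase_eq_of_notMem h2, hfe]
        simp only [h1, h2, if_true, if_false]
        have := singleBound_mono (f + 1) hcard
        linarith
      · by_cases h2 : u ∈ a.ghost.free
        · rw [if_neg h1, if_pos h2, Finset.card_insert_of_notMem h1] at hcard
          rw [Finset.card_erase_of_mem h2, hfe]
          simp only [h1, h2, if_true, if_false, Nat.add_sub_cancel]
          have := singleBound_mono f hcard
          linarith
        · rw [if_neg h1, if_neg h2] at hcard
          rw [Finset.erase_eq_of_notMem h2, hfe]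
          simp only [h1, h2, if_false]
          have := singleBound_mono (f + 1) hcard
          linarith
    refine (Finset.sum_le_sum key).trans ?_
    rw [Finset.sum_add_distrib, Finset.sum_add_distrib, ← Finset.sum_mul, ← Finset.sum_mul,
      sum_free ha hX, Finset.sum_const, nsmul_eq_mul, hfe]
    have h1 : ∑ u ∈ Sᶜ, (if u ∈ a.single then (1 : ℝ) else 0) = s := by
      rw [Finset.sum_ite_mem, Finset.inter_eq_right.2 hsS]; simp [hs]
    rw [h1]
    have := singleBound_drift f s
    unfold singles
    rw [hfe, ← hs]
    push_cast
    linarith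
  flip a ha p u r l hX hl V W hV hW := by
    have h1 : ∀ s V, (∀ k, (a.view k).Le (V k)) →
        singles (a.event p (.prioProp u r s) V) ≤ singles a := by
      intro s V hV
      have h2 : (a.event p (.prioProp u r s) V).ghost.picks = a.ghost.picks := by
        simp [State.event, Ghost.event, Ghost.core, hX]
      unfold singles
      rw [free_congr h2]
      exact singleBound_mono _ (Finset.card_le_card (single_anti hV h2))
    have hb0 := bias_nonneg l.card
    have hb1 : 0 ≤ 1 - bias l.card := sub_nonneg.2 (bias_le_one _)
    nlinarith [mul_le_mul_of_nonneg_left (h1 ⟨Stat.high, l⟩ V hV) hb0,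
      mul_le_mul_of_nonneg_left (h1 ⟨Stat.low, l⟩ W hW) hb1]

/-! ## Bounds for the coin -/

/-- The inequality log m ≤ m/e bounds the bias by 1/(e log 2) ≈ 0.531. -/
lemma bias_le_of_two_le {m : ℕ} (hm : 2 ≤ m) : bias m ≤ 3 / 5 := by
  have hm0 : (0 : ℝ) < m := by positivity
  unfold bias
  rw [if_neg (by omega), div_le_iff₀ hm0, Real.logb, div_le_iff₀ (Real.log_pos (by norm_num))]
  have he := Real.exp_one_gt_d9
  have h1 : Real.log m ≤ m / Real.exp 1 := by
    have h2 := Real.log_le_sub_one_of_pos (x := m / Real.exp 1) (by positivity)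
    rw [Real.log_div hm0.ne' (Real.exp_pos 1).ne', Real.log_exp] at h2
    linarith
  refine h1.trans ?_
  rw [div_le_iff₀ (Real.exp_pos 1)]
  have h3 := Real.log_two_gt_d9
  have h4 : (1 : ℝ) ≤ 3 / 5 * Real.log 2 * Real.exp 1 := by
    nlinarith [mul_le_mul h3.le he.le (by norm_num) (by linarith)]
  nlinarith

/-- The function log x / x decreases for x ≥ e. The sizes 1 and 2 are outside this range, but there
the bias is at least 1/2, the maximum of the left-hand side. -/
lemma le_bias {m t : ℕ} (hm : 1 ≤ m) (h : m ≤ 2 ^ (t + 1)) :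
    ((t : ℝ) + 1) / 2 ^ (t + 1) ≤ bias m := by
  have hp : (0 : ℝ) < 2 ^ (t + 1) := by positivity
  have h2 : (t : ℝ) + 1 ≤ 2 ^ t := by
    have : t + 1 ≤ 2 ^ t := Nat.lt_two_pow_self
    exact_mod_cast this
  rcases Nat.lt_or_ge m 3 with h3 | h3
  · have h4 : 1 / 2 ≤ bias m := by
      interval_cases m
      · simp [bias]; norm_num
      · simp [bias]
    refine le_trans ?_ h4
    rw [div_le_iff₀ hp, pow_succ]; linarith
  · have h4 : (3 : ℝ) ≤ m := by exact_mod_cast h3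
    have h5 : (m : ℝ) ≤ 2 ^ (t + 1) := by exact_mod_cast h
    have he := Real.exp_one_lt_d9
    have h6 := Real.log_div_self_antitoneOn (a := (m : ℝ)) (b := 2 ^ (t + 1))
      (by change Real.exp 1 ≤ _; linarith) (by change Real.exp 1 ≤ _; linarith) h5
    have hl : 0 < Real.log 2 := Real.log_pos (by norm_num)
    unfold bias
    rw [if_neg (by omega), Real.logb, div_right_comm, le_div_iff₀ hl]
    refine le_trans (le_of_eq ?_) h6
    change _ = Real.log (2 ^ (t + 1)) / 2 ^ (t + 1)
    rw [Real.log_pow]; push_cast; ring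

/-- An upper bound for the probability of low priority with at most `2 ^ (t + 1)` participants. -/
def lowBound (t : ℕ) : ℝ := 1 - (t + 1) / 2 ^ (t + 1)

lemma one_sub_bias_le {m t : ℕ} (hm : 1 ≤ m) (h : m ≤ 2 ^ (t + 1)) :
    1 - bias m ≤ lowBound t := by
  have := le_bias hm h
  unfold lowBound; linarith

lemma lowBound_nonneg (t : ℕ) : 0 ≤ lowBound t := by
  unfold lowBound
  have h2 : (t : ℝ) + 1 ≤ 2 ^ (t + 1) := by
    have : t + 1 ≤ 2 ^ (t + 1) := (Nat.lt_two_pow_self).le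
    exact_mod_cast this
  rw [sub_nonneg, div_le_one (by positivity)]; exact h2

lemma lowBound_le_one (t : ℕ) : lowBound t ≤ 1 := by
  unfold lowBound
  have : (0 : ℝ) ≤ (t + 1) / 2 ^ (t + 1) := by positivity
  linarith

lemma le_lowBound {t : ℕ} (ht : 5 ≤ t) : 29 / 32 ≤ lowBound t := by
  have h : ((t : ℝ) + 1) * 64 ≤ 6 * 2 ^ (t + 1) := by
    induction t, ht using Nat.le_induction with
    | base => norm_num
    | succ k hk ih =>
      have hk' : (5 : ℝ) ≤ k := by exact_mod_cast hk
      rw [pow_succ]; push_cast; linarith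
  unfold lowBound
  have hp : (0 : ℝ) < 2 ^ (t + 1) := by positivity
  have h2 : ((t : ℝ) + 1) / 2 ^ (t + 1) ≤ 3 / 32 := by
    rw [div_le_iff₀ hp]; linarith
  linarith

/-- The power with exponent 2^t is at most exp(-(t + 1)/2), and exp(-1/2) < 0.61. The factor missing
in the exponent costs at most 32/29, by `le_lowBound`. -/
lemma lowBound_pow_le {t : ℕ} (ht : 5 ≤ t) :
    lowBound t ^ (2 ^ t - 1) ≤ 32 / 29 * (61 / 100) ^ (t + 1) := by
  have h0 := le_lowBound ht
  have h1 : lowBound t ≤ Real.exp (-((t + 1) / 2 ^ (t + 1))) := by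
    have := Real.add_one_le_exp (-(((t : ℝ) + 1) / 2 ^ (t + 1)))
    unfold lowBound; linarith
  have h2 : lowBound t ^ (2 ^ t) ≤ (Real.exp (-(1 / 2))) ^ (t + 1) := by
    calc lowBound t ^ (2 ^ t) ≤ Real.exp (-((t + 1) / 2 ^ (t + 1))) ^ (2 ^ t) :=
          pow_le_pow_left₀ (lowBound_nonneg t) h1 _
      _ = (Real.exp (-(1 / 2))) ^ (t + 1) := by
          rw [← Real.exp_nat_mul, ← Real.exp_nat_mul]
          congr 1
          push_cast
          rw [pow_succ]
          field_simp
  have h3 : Real.exp (-(1 / 2)) ≤ 61 / 100 := by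
    have h4 : Real.exp (1 / 2) * Real.exp (1 / 2) = Real.exp 1 := by
      rw [← Real.exp_add]; norm_num
    have h5 := Real.exp_one_gt_d9
    have h6 := Real.exp_pos (1 / 2)
    rw [Real.exp_neg, inv_le_comm₀ h6 (by norm_num)]
    by_contra hc
    push Not at hc
    norm_num at hc
    nlinarith
  have h4 : lowBound t ^ (2 ^ t) ≤ (61 / 100) ^ (t + 1) :=
    h2.trans (pow_le_pow_left₀ (Real.exp_pos _).le h3 _)
  have h5 : lowBound t ^ (2 ^ t - 1) * lowBound t = lowBound t ^ (2 ^ t) := by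
    rw [← pow_succ, Nat.sub_add_cancel Nat.one_le_two_pow]
  have h6 : 0 ≤ lowBound t ^ (2 ^ t - 1) := pow_nonneg (lowBound_nonneg t) _
  nlinarith

lemma sum_lowBound_pow_le (M : ℕ) :
    ∑ t ∈ Finset.Ico 5 M, lowBound t ^ (2 ^ t - 1) ≤ 1458 / 10000 := by
  have h1 : ∀ t ∈ Finset.Ico 5 M, lowBound t ^ (2 ^ t - 1) ≤ 32 / 29 * (61 / 100) ^ (t + 1) :=
    fun t ht => lowBound_pow_le (Finset.mem_Ico.1 ht).1
  refine (Finset.sum_le_sum h1).trans ?_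
  -- The partial sum plus the remainder of the geometric series does not depend on M, and for M = 5
  -- it is a number.
  have h2 : ∀ M : ℕ, 5 ≤ M → ∑ t ∈ Finset.Ico 5 M, (32 / 29 * (61 / 100 : ℝ) ^ (t + 1)) +
      32 / 29 * (61 / 100 : ℝ) ^ (M + 1) * (100 / 39) ≤ 1458 / 10000 := by
    intro M hM
    induction M, hM using Nat.le_induction with
    | base => norm_num
    | succ k hk ih =>
      rw [Finset.sum_Ico_succ_top hk]
      refine le_trans (le_of_eq ?_) ih
      rw [pow_succ (61 / 100 : ℝ) (k + 1)]; ring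
  rcases le_or_gt 5 M with h3 | h3
  · have := h2 M h3
    have h4 : (0 : ℝ) ≤ 32 / 29 * (61 / 100 : ℝ) ^ (M + 1) * (100 / 39) := by positivity
    linarith
  · rw [Finset.Ico_eq_empty (by omega)]; norm_num

/-! ## The value of a round

`P q` is the priority of `q`, `L` the order in which the processors have committed, and `F` the
first processor that has flipped its coin. The value bounds the probability that all processors
survive. -/

section
variable (L : List (Fin n)) (P : Fin n → Option (Status n))

def flippedIn (k : ℕ) : Finset (Fin n) := (L.take k).toFinset.filter fun q => P q ≠ none

/-- An upper bound for the probability that the first 2^t processors to commit all get low priority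
with lists shorter than 2^(t+1). A violation gives 0, and each coin still to be flipped contributes
a factor `lowBound t`, which is valid for lists of that length. -/
def blockValue (t : ℕ) : ℝ :=
  if ∃ q ∈ L.take (2 ^ t), ∃ s, P q = some s ∧ (s.stat = Stat.high ∨ 2 ^ (t + 1) ≤ s.list.card)
  then 0 else lowBound t ^ (2 ^ t - (flippedIn L P (2 ^ t)).card)

/-- Another processor from the list of a. If a survives with low priority, the helper has low
priority too. -/
def helper (a : Fin n) (l : Finset (Fin n)) : Fin n :=
  if h : (l.erase a).Nonempty then h.choose else a

/-- This covers lists shorter than 32, which no block with t ≥ 5 detects. The number 27/32 = 1 -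
5/32 bounds the probability that a coin with at most 32 participants gives low priority. -/
def helperValue (a : Fin n) (l : Finset (Fin n)) : ℝ :=
  if 32 ≤ l.card then 0 else
    match P (helper a l) with
    | none => 27 / 32
    | some s => if s.stat = Stat.low ∧ s.list.card < 32 then 1 else 0

def lowValue (a : Fin n) (l : Finset (Fin n)) : ℝ :=
  helperValue P a l + ∑ t ∈ Finset.Ico 5 (n + 5), blockValue L P t

/-- If the list of a is a singleton, a was the first to commit, and it belongs to the lists of all
others. As a has high priority, nobody with low priority can survive. The number 3/5 bounds the
probability that the second coin is high as well. -/
def highValue (a : Fin n) (l : Finset (Fin n)) : ℝ :=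
  if l.card = 1 then
    if ∃ q s, P q = some s ∧ s.stat = Stat.low then 0
    else if ∀ q, P q ≠ none → q = a then 3 / 5 else 1
  else 1

/-- The initial 249/250 is what the first coin requires: with a list of at least two, it is high
with probability at most 3/5, and the value is then at most 1; if it is low, the value is at most
0.98955, and 3/5 + 2/5 · 0.98955 = 0.99582. With a singleton list the coin is always high and the
value becomes 3/5. -/
def roundValue (F : Option (Fin n)) : ℝ :=
  match F with
  | none => 249 / 250
  | some a =>
    match P a with
    | none => 1
    | some s => if s.stat = Stat.high then highValue P a s.list else lowValue L P a s.list

end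

lemma blockValue_nonneg (L : List (Fin n)) (P) (t : ℕ) : 0 ≤ blockValue L P t := by
  unfold blockValue; split_ifs
  · exact le_rfl
  · exact pow_nonneg (lowBound_nonneg t) _

lemma helperValue_nonneg (P : Fin n → Option (Status n)) (a l) : 0 ≤ helperValue P a l := by
  unfold helperValue; split_ifs
  · exact le_rfl
  · split
    · norm_num
    · split_ifs <;> norm_num

lemma lowValue_nonneg (L : List (Fin n)) (P) (a l) : 0 ≤ lowValue L P a l :=
  add_nonneg (helperValue_nonneg _ _ _) (Finset.sum_nonneg fun t _ => blockValue_nonneg L P t)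

lemma highValue_nonneg (P : Fin n → Option (Status n)) (a l) : 0 ≤ highValue P a l := by
  unfold highValue; split_ifs <;> norm_num

lemma highValue_le_one (P : Fin n → Option (Status n)) (a l) : highValue P a l ≤ 1 := by
  unfold highValue; split_ifs <;> norm_num

lemma roundValue_nonneg (L : List (Fin n)) (P) (F) : 0 ≤ roundValue L P F := by
  unfold roundValue
  split
  · norm_num
  · split
    · norm_num
    · split_ifs
      · exact highValue_nonneg _ _ _
      · exact lowValue_nonneg _ _ _ _

lemma helper_mem {a : Fin n} {l : Finset (Fin n)} (h : 2 ≤ l.card) :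
    helper a l ∈ l ∧ helper a l ≠ a := by
  have h1 : (l.erase a).Nonempty := by
    rw [← Finset.card_pos]
    have := Finset.pred_card_le_card_erase (s := l) (a := a)
    omega
  have h2 : helper a l ∈ l.erase a := by
    unfold helper; rw [dif_pos h1]; exact h1.choose_spec
  exact ⟨Finset.mem_of_mem_erase h2, Finset.ne_of_mem_erase h2⟩

/-! ### A processor commits -/

/-- A processor that has only committed does not count in any block, and the exponents refer to 2^t
positions whether or not they are filled yet. -/
lemma roundValue_append {L : List (Fin n)} {P : Fin n → Option (Status n)} {F : Option (Fin n)}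
    {p : Fin n} (hp : P p = none) : roundValue (L ++ [p]) P F = roundValue L P F := by
  have h1 : ∀ t q, P q ≠ none → (q ∈ (L ++ [p]).take (2 ^ t) ↔ q ∈ L.take (2 ^ t)) := by
    intro t q hq
    rw [List.take_append]
    simp only [List.mem_append]
    constructor
    · rintro (h | h)
      · exact h
      · have := List.mem_of_mem_take h
        rw [List.mem_singleton] at this
        subst this; exact absurd hp hq
    · exact Or.inl
  have h2 : ∀ t, blockValue (L ++ [p]) P t = blockValue L P t := by
    intro t
    unfold blockValue
    have h3 : (∃ q ∈ (L ++ [p]).take (2 ^ t), ∃ s, P q = some s ∧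
        (s.stat = Stat.high ∨ 2 ^ (t + 1) ≤ s.list.card)) ↔ (∃ q ∈ L.take (2 ^ t), ∃ s, P q = some s ∧
        (s.stat = Stat.high ∨ 2 ^ (t + 1) ≤ s.list.card)) := by
      constructor
      · rintro ⟨q, hq, s, hs, h⟩
        exact ⟨q, (h1 t q (by rw [hs]; simp)).1 hq, s, hs, h⟩
      · rintro ⟨q, hq, s, hs, h⟩
        exact ⟨q, (h1 t q (by rw [hs]; simp)).2 hq, s, hs, h⟩
    have h4 : flippedIn (L ++ [p]) P (2 ^ t) = flippedIn L P (2 ^ t) := by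
      ext q
      simp only [flippedIn, Finset.mem_filter, List.mem_toFinset]
      constructor
      · rintro ⟨h, h'⟩; exact ⟨(h1 t q h').1 h, h'⟩
      · rintro ⟨h, h'⟩; exact ⟨(h1 t q h').2 h, h'⟩
    simp only [h3, h4]
  unfold roundValue lowValue
  simp only [h2]

/-! ### A processor flips its coin -/

section
variable {L : List (Fin n)} {P : Fin n → Option (Status n)} {q : Fin n} {l : Finset (Fin n)}

/-- If q is among the first 2^t, high priority or a long list annihilates the value; otherwise low
priority has probability at most `lowBound t` and shortens the exponent by one. If q comes later,
nothing changes. -/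
lemma blockValue_flip (hq : P q = none) (hl : 1 ≤ l.card) (t : ℕ) :
    bias l.card * blockValue L (Function.update P q (some ⟨Stat.high, l⟩)) t +
      (1 - bias l.card) * blockValue L (Function.update P q (some ⟨Stat.low, l⟩)) t ≤
      blockValue L P t := by
  have hb0 := bias_nonneg l.card
  have hb1 : 0 ≤ 1 - bias l.card := sub_nonneg.2 (bias_le_one _)
  by_cases hqt : q ∈ L.take (2 ^ t)
  · have h1 : blockValue L (Function.update P q (some ⟨Stat.high, l⟩)) t = 0 := by
      unfold blockValue; rw [if_pos]
      exact ⟨q, hqt, ⟨Stat.high, l⟩, by simp, Or.inl rfl⟩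
    rw [h1, mul_zero, zero_add]
    by_cases h2 : ∃ q ∈ L.take (2 ^ t), ∃ s, P q = some s ∧
        (s.stat = Stat.high ∨ 2 ^ (t + 1) ≤ s.list.card)
    · have h3 : blockValue L (Function.update P q (some ⟨Stat.low, l⟩)) t = 0 := by
        unfold blockValue; rw [if_pos]
        obtain ⟨q', hq', s, hs, h⟩ := h2
        refine ⟨q', hq', s, ?_, h⟩
        rw [Function.update_of_ne, hs]
        rintro rfl; rw [hq] at hs; cases hs
      rw [h3, mul_zero]; exact blockValue_nonneg _ _ _
    · have hv : blockValue L P t = lowBound t ^ (2 ^ t - (flippedIn L P (2 ^ t)).card) := by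
        unfold blockValue; rw [if_neg h2]
      by_cases h3 : 2 ^ (t + 1) ≤ l.card
      · have h4 : blockValue L (Function.update P q (some ⟨Stat.low, l⟩)) t = 0 := by
          unfold blockValue; rw [if_pos]
          exact ⟨q, hqt, ⟨Stat.low, l⟩, by simp, Or.inr h3⟩
        rw [h4, mul_zero]; exact blockValue_nonneg _ _ _
      · have h5 : flippedIn L (Function.update P q (some ⟨Stat.low, l⟩)) (2 ^ t) =
            insert q (flippedIn L P (2 ^ t)) := by
          ext x
          simp only [flippedIn, Finset.mem_filter, List.mem_toFinset, Finset.mem_insert]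
          by_cases hx : x = q
          · subst hx; simp [hqt]
          · simp [hx]
        have h6 : q ∉ flippedIn L P (2 ^ t) := by simp [flippedIn, hq]
        have h7 : (insert q (flippedIn L P (2 ^ t))).card ≤ 2 ^ t := by
          rw [← h5]
          refine (Finset.card_filter_le _ _).trans ((List.toFinset_card_le _).trans ?_)
          rw [List.length_take]; exact min_le_left _ _
        rw [Finset.card_insert_of_notMem h6] at h7
        have h8 : blockValue L (Function.update P q (some ⟨Stat.low, l⟩)) t ≤
            lowBound t ^ (2 ^ t - ((flippedIn L P (2 ^ t)).card + 1)) := by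
          unfold blockValue
          rw [h5, Finset.card_insert_of_notMem h6]
          split_ifs
          · exact pow_nonneg (lowBound_nonneg t) _
          · exact le_rfl
        have h9 : lowBound t ^ (2 ^ t - (flippedIn L P (2 ^ t)).card) =
            lowBound t * lowBound t ^ (2 ^ t - ((flippedIn L P (2 ^ t)).card + 1)) := by
          rw [← pow_succ']; congr 1; omega
        rw [hv, h9]
        exact mul_le_mul (one_sub_bias_le hl (by omega)) h8 (blockValue_nonneg _ _ _)
          (lowBound_nonneg t)
  · have h1 : ∀ s, blockValue L (Function.update P q (some s)) t = blockValue L P t := by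
      intro s
      have h2 : ∀ x ∈ L.take (2 ^ t), Function.update P q (some s) x = P x := by
        intro x hx; rw [Function.update_of_ne]; rintro rfl; exact hqt hx
      have h3 : (∃ x ∈ L.take (2 ^ t), ∃ s', Function.update P q (some s) x = some s' ∧
          (s'.stat = Stat.high ∨ 2 ^ (t + 1) ≤ s'.list.card)) ↔
          (∃ x ∈ L.take (2 ^ t), ∃ s, P x = some s ∧
          (s.stat = Stat.high ∨ 2 ^ (t + 1) ≤ s.list.card)) := by
        constructor
        · rintro ⟨x, hx, s', hs, h⟩; rw [h2 x hx] at hs; exact ⟨x, hx, s', hs, h⟩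
        · rintro ⟨x, hx, s', hs, h⟩; exact ⟨x, hx, s', by rw [h2 x hx]; exact hs, h⟩
      have h4 : flippedIn L (Function.update P q (some s)) (2 ^ t) = flippedIn L P (2 ^ t) := by
        ext x
        simp only [flippedIn, Finset.mem_filter, List.mem_toFinset]
        refine and_congr_right fun hx => ?_
        rw [h2 x hx]
      unfold blockValue
      simp only [h3, h4]
    rw [h1, h1]; apply le_of_eq; ring

lemma helperValue_flip (hq : P q = none) (hl : 1 ≤ l.card) (a : Fin n) (l' : Finset (Fin n)) :
    bias l.card * helperValue (Function.update P q (some ⟨Stat.high, l⟩)) a l' +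
      (1 - bias l.card) * helperValue (Function.update P q (some ⟨Stat.low, l⟩)) a l' ≤
      helperValue P a l' := by
  unfold helperValue
  by_cases h1 : 32 ≤ l'.card
  · simp [h1]
  · simp only [h1, if_false]
    by_cases h2 : helper a l' = q
    · rw [h2, Function.update_self, Function.update_self, hq]
      simp only [true_and, reduceCtorEq, false_and, if_false, mul_zero, zero_add]
      split_ifs with h3
      · have := one_sub_bias_le (t := 4) hl (by norm_num; omega)
        unfold lowBound at this
        norm_num at this ⊢
        linarith
      · norm_num
    · rw [Function.update_of_ne h2, Function.update_of_ne h2]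
      apply le_of_eq; ring

lemma lowValue_flip (hq : P q = none) (hl : 1 ≤ l.card) (a : Fin n) (l' : Finset (Fin n)) :
    bias l.card * lowValue L (Function.update P q (some ⟨Stat.high, l⟩)) a l' +
      (1 - bias l.card) * lowValue L (Function.update P q (some ⟨Stat.low, l⟩)) a l' ≤
      lowValue L P a l' := by
  have h1 := helperValue_flip hq hl a l'
  have h2 : ∑ t ∈ Finset.Ico 5 (n + 5),
      (bias l.card * blockValue L (Function.update P q (some ⟨Stat.high, l⟩)) t +
      (1 - bias l.card) * blockValue L (Function.update P q (some ⟨Stat.low, l⟩)) t) ≤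
      ∑ t ∈ Finset.Ico 5 (n + 5), blockValue L P t :=
    Finset.sum_le_sum fun t _ => blockValue_flip hq hl t
  rw [Finset.sum_add_distrib, ← Finset.mul_sum, ← Finset.mul_sum] at h2
  unfold lowValue
  linarith

lemma highValue_flip (hq : P q = none) {a : Fin n} (hqa : q ≠ a) {l' : Finset (Fin n)}
    (hl : l'.card = 1 → 2 ≤ l.card) :
    bias l.card * highValue (Function.update P q (some ⟨Stat.high, l⟩)) a l' +
      (1 - bias l.card) * highValue (Function.update P q (some ⟨Stat.low, l⟩)) a l' ≤
      highValue P a l' := by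
  have hb0 := bias_nonneg l.card
  have hb1 : 0 ≤ 1 - bias l.card := sub_nonneg.2 (bias_le_one _)
  by_cases h1 : l'.card = 1
  · have h2 : highValue (Function.update P q (some ⟨Stat.low, l⟩)) a l' = 0 := by
      unfold highValue
      rw [if_pos h1, if_pos ⟨q, ⟨Stat.low, l⟩, by simp, rfl⟩]
    rw [h2, mul_zero, add_zero]
    by_cases h3 : ∃ q s, P q = some s ∧ s.stat = Stat.low
    · have h4 : highValue (Function.update P q (some ⟨Stat.high, l⟩)) a l' = 0 := by
        unfold highValue
        rw [if_pos h1, if_pos]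
        obtain ⟨x, s, hs, h⟩ := h3
        refine ⟨x, s, ?_, h⟩
        rw [Function.update_of_ne, hs]
        rintro rfl; rw [hq] at hs; cases hs
      rw [h4, mul_zero]; exact highValue_nonneg _ _ _
    · have h5 := highValue_le_one (Function.update P q (some ⟨Stat.high, l⟩)) a l'
      have h6 : 3 / 5 ≤ highValue P a l' := by
        unfold highValue
        rw [if_pos h1, if_neg h3]; split_ifs <;> norm_num
      have h7 := bias_le_of_two_le (hl h1)
      nlinarith [highValue_nonneg (Function.update P q (some ⟨Stat.high, l⟩)) a l']
  · unfold highValue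
    simp only [h1, if_false]
    linarith

/-- The helper has not flipped its coin, which gives 27/32, and in each block at most the coin of q
is settled: 0.84375 + 0.1458 = 0.98955. -/
lemma firstFlip_low (hP : ∀ x, P x = none) (hl : 2 ≤ l.card) :
    lowValue L (Function.update P q (some ⟨Stat.low, l⟩)) q l ≤ 98955 / 100000 := by
  have h1 : helperValue (Function.update P q (some ⟨Stat.low, l⟩)) q l ≤ 27 / 32 := by
    unfold helperValue
    split_ifs
    · norm_num
    · rw [Function.update_of_ne (helper_mem hl).2, hP]
  have h2 : ∑ t ∈ Finset.Ico 5 (n + 5), blockValue L (Function.update P q (some ⟨Stat.low, l⟩)) t ≤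
      ∑ t ∈ Finset.Ico 5 (n + 5), lowBound t ^ (2 ^ t - 1) := by
    refine Finset.sum_le_sum fun t _ => ?_
    unfold blockValue
    split_ifs
    · exact pow_nonneg (lowBound_nonneg t) _
    · refine pow_le_pow_of_le_one (lowBound_nonneg t) (lowBound_le_one t) ?_
      have : (flippedIn L (Function.update P q (some ⟨Stat.low, l⟩)) (2 ^ t)).card ≤ 1 := by
        rw [← Finset.card_singleton q]
        refine Finset.card_le_card fun x hx => ?_
        simp only [flippedIn, Finset.mem_filter] at hx
        rw [Finset.mem_singleton]
        by_contra hxq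
        rw [Function.update_of_ne hxq] at hx
        exact hx.2 (hP x)
      omega
  have h3 := sum_lowBound_pow_le (n + 5)
  unfold lowValue
  linarith

/-- The value does not increase on average when a processor flips its coin. -/
lemma roundValue_flip {F : Option (Fin n)} (hq : P q = none) (hqL : q ∈ L)
    (hl : ∀ j, L.idxOf j ≤ L.idxOf q → j ∈ l)
    (hF : F = none → ∀ x, P x = none)
    (hF' : ∀ a, F = some a → ∃ s, P a = some s ∧ ∀ j, L.idxOf j ≤ L.idxOf a → j ∈ s.list) :
    bias l.card * roundValue L (Function.update P q (some ⟨Stat.high, l⟩))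
        (if F = none then some q else F) +
      (1 - bias l.card) * roundValue L (Function.update P q (some ⟨Stat.low, l⟩))
        (if F = none then some q else F) ≤ roundValue L P F := by
  have hb0 := bias_nonneg l.card
  have hb1 : 0 ≤ 1 - bias l.card := sub_nonneg.2 (bias_le_one _)
  have hql : q ∈ l := hl q le_rfl
  have hl1 : 1 ≤ l.card := Finset.card_pos.2 ⟨q, hql⟩
  cases F with
  | none =>
    have hP := hF rfl
    simp only [if_true, roundValue, Function.update_self, reduceCtorEq, if_false]
    by_cases h1 : l.card = 1
    · have h2 : bias l.card = 1 := by rw [h1]; simp [bias]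
      have h3 : highValue (Function.update P q (some ⟨Stat.high, l⟩)) q l = 3 / 5 := by
        unfold highValue
        rw [if_pos h1, if_neg, if_pos]
        · intro x hx; by_contra hxq; rw [Function.update_of_ne hxq] at hx; exact hx (hP x)
        · rintro ⟨x, s, hs, h⟩
          by_cases hxq : x = q
          · subst hxq; rw [Function.update_self] at hs; cases hs; cases h
          · rw [Function.update_of_ne hxq, hP] at hs; cases hs
      rw [h2, h3]; norm_num
    · have h2 : 2 ≤ l.card := by omega
      have h3 := bias_le_of_two_le h2
      have h4 := firstFlip_low (L := L) (q := q) hP h2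
      have h5 := highValue_le_one (Function.update P q (some ⟨Stat.high, l⟩)) q l
      nlinarith
  | some a =>
    obtain ⟨s, hs, hsl⟩ := hF' a rfl
    have hqa : q ≠ a := by rintro rfl; rw [hq] at hs; cases hs
    simp only [reduceCtorEq, if_false, roundValue, Function.update_of_ne hqa.symm, hs]
    by_cases h1 : s.stat = Stat.high
    · simp only [h1, if_true]
      refine highValue_flip hq hqa fun h2 => ?_
      -- If the list of a is a singleton, nobody precedes a in the commit order; so the list of q
      -- contains both a and q, as `highValue_flip` requires.
      obtain ⟨x, hx⟩ := Finset.card_eq_one.1 h2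
      have h3 : ∀ j, L.idxOf j ≤ L.idxOf a → j = a := by
        intro j hj
        have h4 := hsl j hj
        have h5 := hsl a le_rfl
        rw [hx, Finset.mem_singleton] at h4 h5
        rw [h4, h5]
      have h6 : L.idxOf a ≤ L.idxOf q := by
        by_contra hc
        exact hqa (h3 q (by omega))
      have h7 : ({a, q} : Finset (Fin n)) ⊆ l := by
        intro x hx
        rw [Finset.mem_insert, Finset.mem_singleton] at hx
        rcases hx with rfl | rfl
        · exact hl _ h6
        · exact hql
      have := Finset.card_le_card h7
      rwa [Finset.card_pair hqa.symm] at this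
    · simp only [h1, if_false]
      exact lowValue_flip hq hl1 a s.list

end

/-! ### All processors survive -/

/-- Let a be the first to flip. If a is high with a singleton list, any low processor would have a
in its list and could not survive. If a is low and its list and that of its helper are shorter than
32, the helper value is 1. Otherwise take a low processor with the longest list, of size in [2^t,
2^(t+1)). The last member z of this list in the commit order has rank at least 2^t; being low and
surviving, it forces the first 2^t processors to be low, and their lists are no longer than the
maximum. So block t has the value 1. -/
lemma one_le_roundValue {L : List (Fin n)} {P : Fin n → Option (Status n)} {F : Option (Fin n)}
    (hL : ∀ q, P q ≠ none → q ∈ L) (hnd : L.Nodup)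
    (hl : ∀ q s, P q = some s → s.stat ≠ Stat.commit ∧ ∀ j, L.idxOf j ≤ L.idxOf q → j ∈ s.list)
    (hc : ∀ q s, P q = some s → s.stat = Stat.low → 2 ≤ s.list.card)
    (hF : F = none → ∀ x, P x = none) (hF' : ∀ a, F = some a → P a ≠ none)
    (hne : ∃ q, P q ≠ none) (htwo : ∀ a, ∃ q, q ≠ a ∧ P q ≠ none)
    (hs : ∀ q s, P q = some s → s.stat = Stat.low →
      ∀ j ∈ s.list, ∃ s', P j = some s' ∧ s'.stat = Stat.low) : 1 ≤ roundValue L P F := by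
  cases F with
  | none =>
    obtain ⟨q, hq⟩ := hne
    exact absurd (hF rfl q) hq
  | some a =>
    obtain ⟨s, hsa⟩ := Option.ne_none_iff_exists'.1 (hF' a rfl)
    unfold roundValue
    simp only [hsa]
    obtain ⟨hs1, hs2⟩ := hl a s hsa
    split_ifs with h1
    · unfold highValue
      split_ifs with h2 h3 h4
      · exfalso
        obtain ⟨q, sq, hq, hql⟩ := h3
        obtain ⟨x, hx⟩ := Finset.card_eq_one.1 h2
        have hqa : q ≠ a := by
          rintro rfl; rw [hsa] at hq; cases hq; rw [h1] at hql; cases hql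
        have h6 : L.idxOf a ≤ L.idxOf q := by
          by_contra hc
          have h4 := hs2 q (by omega)
          have h5 := hs2 a le_rfl
          rw [hx, Finset.mem_singleton] at h4 h5
          exact hqa (h4.trans h5.symm)
        obtain ⟨s', hs', hs''⟩ := hs q sq hq hql a ((hl q sq hq).2 a h6)
        rw [hsa] at hs'; cases hs'; rw [h1] at hs''; cases hs''
      · exfalso
        obtain ⟨q, hqa, hq⟩ := htwo a
        exact hqa (h4 q hq)
      · exact le_rfl
      · exact le_rfl
    · have hlow : s.stat = Stat.low := by
        cases h : s.stat with
        | commit => exact absurd h hs1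
        | low => rfl
        | high => exact absurd h h1
      -- the processors with low priority in the lists of `a` and its helper
      have key : ∀ q s, P q = some s → s.stat = Stat.low → 32 ≤ s.list.card →
          ∃ t ∈ Finset.Ico 5 (n + 5), 1 ≤ blockValue L P t := by
        intro q₀ s₀ hq₀ hs₀ hc₀
        obtain ⟨q, hq, hmax⟩ := Finset.exists_max_image
          (Finset.univ.filter fun q => ∃ s, P q = some s ∧ s.stat = Stat.low)
          (fun q => match P q with
            | some s => s.list.card
            | none => 0) ⟨q₀, by simp [hq₀, hs₀]⟩
        simp only [Finset.mem_filter, Finset.mem_univ, true_and] at hq hmax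
        obtain ⟨sq, hsq, hsql⟩ := hq
        have hmax' : ∀ x s, P x = some s → s.stat = Stat.low → s.list.card ≤ sq.list.card := by
          intro x s hx hxs
          have := hmax x ⟨s, hx, hxs⟩
          rwa [hx, hsq] at this
        have hcq : 32 ≤ sq.list.card := hc₀.trans (hmax' q₀ s₀ hq₀ hs₀)
        have hne : sq.list.card ≠ 0 := by omega
        set t := Nat.log 2 sq.list.card with ht
        have ht1 : 2 ^ t ≤ sq.list.card := Nat.pow_log_le_self 2 hne
        have ht2 : sq.list.card < 2 ^ (t + 1) := Nat.lt_pow_succ_log_self (by norm_num) _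
        have ht5 : 5 ≤ t := by
          exact Nat.le_log_of_pow_le (by norm_num) (by norm_num; exact hcq)
        have htn : t < n := by
          have h1 : sq.list.card ≤ n := by
            have := Finset.card_le_univ sq.list; rwa [Fintype.card_fin] at this
          exact (Nat.lt_two_pow_self).trans_le (ht1.trans h1)
        refine ⟨t, Finset.mem_Ico.2 ⟨ht5, by omega⟩, ?_⟩
        have hlist : ∀ j ∈ sq.list, j ∈ L := by
          intro j hj
          obtain ⟨s', h1, -⟩ := hs q sq hsq hsql j hj
          exact hL j (by rw [h1]; simp)
        -- the last one of the list in the order of committing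
        obtain ⟨z, hz, hzmax⟩ := Finset.exists_max_image sq.list (fun j => L.idxOf j)
          (Finset.card_pos.1 (by omega))
        obtain ⟨sz, hsz, hszl⟩ := hs q sq hsq hsql z hz
        -- At least 2^t members of the list occupy distinct positions not beyond that of z.
        have hidx : 2 ^ t ≤ L.idxOf z + 1 := by
          refine ht1.trans ?_
          have := Finset.card_le_card_of_injOn (s := sq.list) (t := Finset.range (L.idxOf z + 1))
            (fun j => L.idxOf j) (fun j hj => by
              have := hzmax j hj
              simp only [Finset.coe_range, Set.mem_Iio]; omega)
            (fun i hi j hj hij => (List.idxOf_inj (hlist i hi)).1 hij)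
          simpa using this
        have hzL : L.idxOf z < L.length := List.idxOf_lt_length_of_mem (hlist z hz)
        have htake : ∀ x ∈ L.take (2 ^ t), ∃ s, P x = some s ∧ s.stat = Stat.low := by
          intro x hx
          refine hs z sz hsz hszl x ((hl z sz hsz).2 x ?_)
          have := (List.mem_take_iff_idxOf_lt (List.mem_of_mem_take hx)).1 hx
          omega
        unfold blockValue
        rw [if_neg]
        · have h2 : flippedIn L P (2 ^ t) = (L.take (2 ^ t)).toFinset := by
            unfold flippedIn
            rw [Finset.filter_eq_self]
            intro x hx
            rw [List.mem_toFinset] at hx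
            obtain ⟨s, h3, -⟩ := htake x hx
            rw [h3]; simp
          rw [h2, List.toFinset_card_of_nodup ((List.take_sublist _ _).nodup hnd),
            List.length_take, min_eq_left (by omega), Nat.sub_self, pow_zero]
        · rintro ⟨x, hx, s', hs', h3⟩
          obtain ⟨s'', h4, h5⟩ := htake x hx
          rw [hs'] at h4; cases h4
          rcases h3 with h3 | h3
          · rw [h5] at h3; cases h3
          · have := hmax' x s' hs' h5
            omega
      have hblock : (∃ t ∈ Finset.Ico 5 (n + 5), 1 ≤ blockValue L P t) →
          1 ≤ lowValue L P a s.list := by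
        rintro ⟨t, ht, h2⟩
        have h3 := Finset.single_le_sum (f := fun t => blockValue L P t)
          (fun t _ => blockValue_nonneg L P t) ht
        have h4 := helperValue_nonneg P a s.list
        unfold lowValue
        linarith
      by_cases h2 : 32 ≤ s.list.card
      · exact hblock (key a s hsa hlow h2)
      · have h3 := helper_mem (a := a) (hc a s hsa hlow)
        obtain ⟨s', h4, h5⟩ := hs a s hsa hlow _ h3.1
        by_cases h6 : 32 ≤ s'.list.card
        · exact hblock (key _ s' h4 h5 h6)
        · have h7 : helperValue P a s.list = 1 := by
            unfold helperValue
            rw [if_neg h2, h4]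
            simp only [h5, true_and]
            rw [if_pos (by omega)]
          have h8 : 0 ≤ ∑ t ∈ Finset.Ico 5 (n + 5), blockValue L P t :=
            Finset.sum_nonneg fun t _ => blockValue_nonneg L P t
          unfold lowValue
          linarith

/-! ## The number of rounds of a leader election -/

/-- The entry of a processor that has flipped its coin. -/
def Ghost.prio (g : Ghost n) (u : Fin n) (r : ℕ) (q : Fin n) : Option (Status n) :=
  match g.truth.status u r q with
  | some s => if s.stat = Stat.commit then none else some s
  | none => none

lemma Ghost.prio_eq_some {g : Ghost n} {u : Fin n} {r : ℕ} {q : Fin n} {s : Status n} :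
    g.prio u r q = some s ↔ g.truth.status u r q = some s ∧ s.stat ≠ Stat.commit := by
  unfold Ghost.prio
  cases h : g.truth.status u r q with
  | none => simp
  | some s' =>
    simp only [Option.some.injEq]
    split_ifs with h'
    · simp only [false_iff, not_and, not_not]; rintro rfl; exact h'
    · constructor
      · rintro h1; cases h1; exact ⟨rfl, h'⟩
      · rintro ⟨rfl, -⟩; rfl

lemma Ghost.prio_ne_none {g : Ghost n} {u : Fin n} {r : ℕ} {q : Fin n} :
    g.prio u r q ≠ none ↔ g.Flipped u r q := by
  rw [Option.ne_none_iff_exists']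
  unfold Ghost.Flipped
  simp only [Ghost.prio_eq_some]

/-- The summand 1/1000 keeps the weight away from 0, so that a weight can be discarded at bounded
cost. A round that has not begun weighs 1/1000 + 249/250 = 997/1000; the 1 for r = 0 is a
placeholder. -/
def Ghost.weight (g : Ghost n) (u : Fin n) (r : ℕ) : ℝ :=
  if r = 0 then 1 else 1 / 1000 + roundValue (g.order u r) (g.prio u r) (g.first u r)

/-- The processors that can still take part in the last rounds. -/
def Ghost.team (g : Ghost n) (u : Fin n) : Finset (Fin n) :=
  if g.top u ≤ 1 then (g.picks u).filter fun q => q ∉ g.lost u ∨ 1 ≤ g.truth.round u q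
  else g.cap u

/-- The weight of a round is cashed in one round later, when it is settled who can take part; hence
two weights. On passing to a new top round, the fresh weight 997/1000 is offset by the power of
1000/997. The oldest weight is discarded: either all survived its round and it is at least 1, or the
team has shrunk and a factor 1000000 is released. -/
def Ghost.stake (g : Ghost n) (u : Fin n) : ℝ :=
  (1000 / 997) ^ g.top u * 1000000 ^ (g.team u).card * g.weight u (g.top u - 1) *
    g.weight u (g.top u)

lemma Ghost.le_weight (g : Ghost n) (u : Fin n) (r : ℕ) : 1 / 1000 ≤ g.weight u r := by
  unfold Ghost.weight
  have := roundValue_nonneg (g.order u r) (g.prio u r) (g.first u r)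
  split_ifs
  · norm_num
  · linarith

lemma Ghost.weight_pos (g : Ghost n) (u : Fin n) (r : ℕ) : 0 < g.weight u r :=
  lt_of_lt_of_le (by norm_num) (g.le_weight u r)

lemma Ghost.stake_nonneg (g : Ghost n) (u : Fin n) : 0 ≤ g.stake u := by
  unfold Ghost.stake
  have h1 := g.weight_pos u (g.top u - 1)
  have h2 := g.weight_pos u (g.top u)
  positivity

lemma Ghost.pow_top_le_stake (g : Ghost n) (u : Fin n) :
    (1000 / 997) ^ g.top u ≤ 1000000 * g.stake u := by
  unfold Ghost.stake
  have h1 := g.le_weight u (g.top u - 1)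
  have h2 := g.le_weight u (g.top u)
  have h3 : (1 : ℝ) ≤ 1000000 ^ (g.team u).card := one_le_pow₀ (by norm_num)
  have h4 : (1 : ℝ) / 1000000 ≤ g.weight u (g.top u - 1) * g.weight u (g.top u) := by
    nlinarith
  have h5 : (0 : ℝ) < (1000 / 997) ^ g.top u := by positivity
  have h6 : (1 : ℝ) * (1 / 1000000) ≤
      1000000 ^ (g.team u).card * (g.weight u (g.top u - 1) * g.weight u (g.top u)) :=
    mul_le_mul h3 h4 (by norm_num) (by positivity)
  nlinarith

lemma Ghost.stake_le {g g' : Ghost n} {u : Fin n} (h : g'.top u = g.top u)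
    (ht : g'.team u ⊆ g.team u) (hw : ∀ r, g'.weight u r = g.weight u r) :
    g'.stake u ≤ g.stake u := by
  unfold Ghost.stake
  rw [h, hw, hw]
  have h1 := g.weight_pos u (g.top u - 1)
  have h2 := g.weight_pos u (g.top u)
  have h3 : (1000000 : ℝ) ^ (g'.team u).card ≤ 1000000 ^ (g.team u).card :=
    pow_le_pow_right₀ (by norm_num) (Finset.card_le_card ht)
  gcongr

/-! ### Effect of the transitions on the stake -/

lemma stake_lose (g : Ghost n) (u p : Fin n) (snap clock) (v : Fin n) :
    Ghost.stake { g with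
      lost := Function.update g.lost u (insert p (g.lost u))
      snap := snap
      clock := clock } v ≤ g.stake v := by
  refine Ghost.stake_le rfl ?_ (fun _ => rfl)
  unfold Ghost.team
  simp only
  split_ifs
  · refine Finset.monotone_filter_right _ fun q _ hq => ?_
    refine hq.imp_left fun h h' => h ?_
    rw [Function.update_apply]; split_ifs with hv
    · subst hv; exact Finset.mem_insert_of_mem h'
    · exact h'
  · exact subset_rfl

lemma stake_setRound {g : Ghost n} {u p : Fin n} (hl : p ∉ g.lost u) (r : ℕ)
    (snap clock) (v : Fin n) :
    Ghost.stake { g with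
      truth := g.truth.setRound u p r
      snap := snap
      clock := clock } v ≤ g.stake v := by
  refine Ghost.stake_le rfl ?_ (fun _ => rfl)
  unfold Ghost.team
  simp only
  split_ifs
  · intro q hq
    rw [Finset.mem_filter] at hq ⊢
    refine ⟨hq.1, ?_⟩
    rw [View.setRound_round] at hq
    by_cases hc : v = u ∧ q = p
    · rw [hc.1, hc.2]; exact Or.inl hl
    · rw [if_neg hc] at hq; exact hq.2
  · exact subset_rfl

section
variable {pc : Fin n → PC n} {V : Fin n → View n} {g : Ghost n} {p : Fin n}

lemma Sound.stake_status (h : Sound pc V g) {u r} (hX : pc p = .commitProp u r)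
    (V' : Fin n → View n) (v : Fin n) :
    (g.event p (.commitProp u r) (.statusCol u r) V').stake v ≤ g.stake v := by
  refine Ghost.stake_le rfl subset_rfl fun r' => ?_
  have hP := h.pcOk p
  rw [hX] at hP
  obtain ⟨h1, h2, h3, h4, h5⟩ := hP
  have hpr : ∀ v r', (g.event p (.commitProp u r) (.statusCol u r) V').prio v r' = g.prio v r' :=
    fun _ _ => rfl
  have hfi : (g.event p (.commitProp u r) (.statusCol u r) V').first = g.first := rfl
  have hor : (g.event p (.commitProp u r) (.statusCol u r) V').order v r' =
      if v = u ∧ r' = r then g.order u r ++ [p] else g.order v r' := by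
    simp only [Ghost.event, Ghost.core, Function.update_apply]
    by_cases hv : v = u
    · subst hv; by_cases hr : r' = r <;> simp [hr]
    · simp [hv]
  unfold Ghost.weight
  rw [hpr, hor, hfi]
  split_ifs with h6 h7
  · rfl
  · obtain ⟨rfl, rfl⟩ := h7
    rw [roundValue_append]
    unfold Ghost.prio; rw [h4]; simp
  · rfl

lemma Sound.one_le_weight (h : Sound pc V g) {u : Fin n} {r : ℕ} (hr : r ≠ 0)
    (hs : ∀ q, g.truth.status u r q ≠ none → g.Survived u r q)
    (htwo : ∃ q q', q ≠ q' ∧ g.truth.status u r q ≠ none ∧ g.truth.status u r q' ≠ none) :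
    1 ≤ g.weight u r := by
  have hfl : ∀ q, g.truth.status u r q ≠ none → g.prio u r q ≠ none := by
    intro q hq
    obtain ⟨s, h1, h2, -⟩ := hs q hq
    exact Ghost.prio_ne_none.2 ⟨s, h1, h2⟩
  obtain ⟨q, q', hqq, hq, hq'⟩ := htwo
  have := one_le_roundValue (L := g.order u r) (P := g.prio u r) (F := g.first u r)
    (fun q hq => (h.ownOk q).flipped_order u r (Ghost.prio_ne_none.1 hq)) (h.nodup u r)
    (fun q s hq => ⟨(Ghost.prio_eq_some.1 hq).2,
      (h.ownOk q).flipped_list u r s (Ghost.prio_eq_some.1 hq).1 (Ghost.prio_eq_some.1 hq).2⟩)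
    (fun q s hq => (h.ownOk q).low_card u r s (Ghost.prio_eq_some.1 hq).1)
    (fun hF x => by
      by_contra hc
      exact (h.first u r).1 hF x (Ghost.prio_ne_none.1 hc))
    (fun a ha => Ghost.prio_ne_none.2 ((h.first u r).2 a ha))
    ⟨q, hfl q hq⟩
    (fun a => by
      by_cases hqa : q = a
      · exact ⟨q', fun h => hqq (hqa.trans h.symm), hfl q' hq'⟩
      · exact ⟨q, hqa, hfl q hq⟩)
    (fun q s hq hsl j hj => by
      obtain ⟨s', h1, -, h3⟩ := hs q (by rw [(Ghost.prio_eq_some.1 hq).1]; simp)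
      rw [(Ghost.prio_eq_some.1 hq).1] at h1; cases h1
      obtain ⟨s'', h4, h5⟩ := h3 hsl j hj
      exact ⟨s'', Ghost.prio_eq_some.2 ⟨h4, by rw [h5]; simp⟩, h5⟩)
  unfold Ghost.weight
  rw [if_neg hr]; linarith

lemma Sound.weight_of_top_lt (h : Sound pc V g) {u : Fin n} {r : ℕ} (hr : g.top u < r) :
    g.weight u r = 997 / 1000 := by
  have h1 : g.first u r = none := by
    by_contra hc
    obtain ⟨a, ha⟩ := Option.ne_none_iff_exists'.1 hc
    obtain ⟨s, h2, -⟩ := (h.first u r).2 a ha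
    have := (h.ownOk a).status_top u r (by rw [h2]; simp)
    omega
  unfold Ghost.weight roundValue
  rw [if_neg (by omega), h1]; norm_num

/-- Let the top round pass from T to T + 1. For T ≤ 1 the discarded weight is the placeholder 1.
Otherwise the new team consists of processors of round at least T, all survivors of round T - 1. If
it equals the old team, then by `CapOk` everybody with an entry in round T - 1 survived, and there
are at least two, since p did not win; so the discarded weight is at least 1. If the team is
smaller, the factor 1000000 outweighs the lower bound 1/1000. -/
lemma Sound.stake_commit (h : Sound pc V g) {u r} (hX : pc p = .roundCol u r)
    (hj : 2 ≤ r → ∃ j, j ≠ p ∧ r - 1 ≤ g.truth.round u j) (V' : Fin n → View n) (v : Fin n) :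
    (g.event p (.roundCol u r) (.commitProp u r) V').stake v ≤ g.stake v := by
  have hP := h.pcOk p
  rw [hX] at hP
  obtain ⟨h1, h2, h3, h4, h5⟩ := hP
  have hpr : ∀ v r', (g.event p (.roundCol u r) (.commitProp u r) V').prio v r' = g.prio v r' := by
    intro v r'
    ext1 q
    have hst : (g.event p (.roundCol u r) (.commitProp u r) V').truth.status v r' q =
      if v = u ∧ r' = r ∧ q = p then some ⟨Stat.commit, ∅⟩ else g.truth.status v r' q :=
      View.setStatus_status _ _ _ _ _ _ _ _
    unfold Ghost.prio
    rw [hst]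
    split_ifs with hc
    · obtain ⟨rfl, rfl, rfl⟩ := hc
      rw [h4]; simp
    · rfl
  have hw : ∀ v r', (g.event p (.roundCol u r) (.commitProp u r) V').weight v r' =
      g.weight v r' := by
    intro v r'
    unfold Ghost.weight
    rw [hpr]; rfl
  by_cases hvu : v = u ∧ g.top v < r
  · obtain ⟨rfl, hlt⟩ := hvu
    have htop : r = g.top v + 1 := by
      rcases Nat.lt_or_ge r 2 with h6 | h6
      · omega
      · obtain ⟨s, hs, -⟩ := (h.ownOk p).survived v (r - 1) (by omega) (by omega)
        have := (h.ownOk p).status_top v (r - 1) (by rw [hs]; simp)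
        omega
    have htop' : (g.event p (.roundCol v r) (.commitProp v r) V').top v = g.top v + 1 := by
      simp [Ghost.event, Ghost.core, htop]
    have hcap' : (g.event p (.roundCol v r) (.commitProp v r) V').cap v =
        Finset.univ.filter fun q => r ≤ g.truth.round v q + 1 := by
      simp [Ghost.event, Ghost.core, hlt]
    have hwt : g.weight v (g.top v + 1) = 997 / 1000 := h.weight_of_top_lt (Nat.lt_succ_self _)
    have hpos := g.weight_pos v (g.top v)
    have hpos' := g.weight_pos v (g.top v - 1)
    have hsub : (g.event p (.roundCol v r) (.commitProp v r) V').team v ⊆ g.team v := by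
      unfold Ghost.team
      rw [htop']
      by_cases h6 : g.top v = 0
      · simp only [h6, zero_add, le_refl, if_true, zero_le]; exact subset_rfl
      · rw [if_neg (by omega), hcap']
        intro q hq
        rw [Finset.mem_filter] at hq
        split_ifs with h7
        · rw [Finset.mem_filter]
          have : 1 ≤ g.truth.round v q := by omega
          exact ⟨(h.ownOk q).round_picks v this, Or.inr this⟩
        · by_contra hc
          have := (h.cap v (by omega)).round_lt q hc
          omega
    have key : (1000000 : ℝ) ^ ((g.event p (.roundCol v r) (.commitProp v r) V').team v).card ≤
        1000000 ^ (g.team v).card * g.weight v (g.top v - 1) := by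
      by_cases h6 : g.top v ≤ 1
      · have h7 : g.weight v (g.top v - 1) = 1 := by
          unfold Ghost.weight; rw [if_pos (by omega)]
        rw [h7, mul_one]
        exact pow_le_pow_right₀ (by norm_num) (Finset.card_le_card hsub)
      · by_cases h7 : (g.event p (.roundCol v r) (.commitProp v r) V').team v = g.team v
        · rw [h7]
          refine le_mul_of_one_le_right (by positivity) ?_
          have hcap := h.cap v (by omega)
          have hmem : ∀ q ∈ g.cap v, g.top v ≤ g.truth.round v q := by
            intro q hq
            have h8 : q ∈ g.team v := by unfold Ghost.team; rw [if_neg h6]; exact hq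
            rw [← h7] at h8
            unfold Ghost.team at h8
            rw [htop', if_neg (by omega), hcap', Finset.mem_filter] at h8
            omega
          have hsv : ∀ q, g.top v ≤ g.truth.round v q → g.Survived v (g.top v - 1) q :=
            fun q hq => (h.ownOk q).survived v _ (by omega) (by omega)
          obtain ⟨j, hjp, hj⟩ := hj (by omega)
          have hne : ∀ q, g.Survived v (g.top v - 1) q →
              g.truth.status v (g.top v - 1) q ≠ none := by
            rintro q ⟨s, hs, -⟩; rw [hs]; simp
          refine h.one_le_weight (by omega) (fun q hq => hsv q (hmem q ?_))
            ⟨j, p, hjp, hne j (hsv j (by omega)), hne p (hsv p (by omega))⟩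
          by_contra hc
          exact hq (hcap.status q hc)
        · have h8 := Finset.card_lt_card (hsub.ssubset_of_ne h7)
          have h9 : (1000000 : ℝ) ^
              (((g.event p (.roundCol v r) (.commitProp v r) V').team v).card + 1) ≤
              1000000 ^ (g.team v).card := pow_le_pow_right₀ (by norm_num) h8
          rw [pow_succ] at h9
          have h10 := g.le_weight v (g.top v - 1)
          have h11 : (0 : ℝ) < 1000000 ^ (g.team v).card := by positivity
          nlinarith
    unfold Ghost.stake
    rw [htop', hw, hw, Nat.add_sub_cancel, hwt, pow_succ]
    have h12 : (0 : ℝ) < (1000 / 997) ^ g.top v := by positivity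
    calc _ = (1000 / 997 : ℝ) ^ g.top v *
          1000000 ^ ((g.event p (.roundCol v r) (.commitProp v r) V').team v).card *
          g.weight v (g.top v) := by ring
      _ ≤ (1000 / 997 : ℝ) ^ g.top v *
          (1000000 ^ (g.team v).card * g.weight v (g.top v - 1)) * g.weight v (g.top v) := by
          gcongr
      _ = _ := by ring
  · have htop : (g.event p (.roundCol u r) (.commitProp u r) V').top v = g.top v := by
      by_cases h6 : v = u
      · subst h6
        have : r ≤ g.top v := by by_contra hc; exact hvu ⟨rfl, by omega⟩
        simp [Ghost.event, Ghost.core, this]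
      · simp [Ghost.event, Ghost.core, h6]
    have hcapv : (g.event p (.roundCol u r) (.commitProp u r) V').cap v = g.cap v := by
      simp only [Ghost.event, Ghost.core]; split_ifs with h7
      · have : v ≠ u := by rintro rfl; exact hvu ⟨rfl, h7⟩
        simp [this]
      · rfl
    refine Ghost.stake_le htop ?_ (hw v)
    unfold Ghost.team
    rw [htop, hcapv]
    exact subset_rfl

lemma Sound.stake_det (h : Sound pc V g) {X Y : PC n} (hX : pc p = X) (t : Trans V g p X Y)
    (hr : ¬ X.random) (V' : Fin n → View n) (v : Fin n) :
    (g.event p X Y V').stake v ≤ g.stake v := by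
  have hS : SpotOk X V g p := hX ▸ h.spotOk p
  cases t with
  | start => exact le_rfl
  | collect S h1 h2 => exact le_rfl
  | pick S u hu hS => exact absurd trivial hr
  | doorLose u hd => exact stake_lose g u p _ _ v
  | doorPass u hd => exact le_rfl
  | enter u hd => exact stake_setRound (hS.notMem_lost rfl (by simp)) _ _ _ v
  | preround u r hr => exact le_rfl
  | roundLose u r hr => exact stake_lose g u p _ _ v
  | win u r => exact le_rfl
  | commit u r h1 h2 => exact h.stake_commit hX h1 V' v
  | status u r hk => exact h.stake_status hX V' v
  | flip u r s h0 h1 h2 h3 => exact absurd trivial hr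
  | prio u r s hk => exact le_rfl
  | pillLose u r s hs hj => exact stake_lose g u p _ _ v
  | survive u r s hs =>
    exact stake_setRound (hS.notMem_lost rfl (by simp)) _ _ _ v
  | finish u => exact le_rfl
  | retry u hu => exact le_rfl

/-- The round of the coin enters at most one of the two weights, so the product inherits the
averaging property of `roundValue`; coins of older rounds and of other elections change nothing. -/
lemma Sound.stake_flip (h : Sound pc V g) {u r l} (hX : pc p = .statusCol u r)
    (hl : ∀ j, KnownEntry (g.snap p) u r j → j ∈ l) (V' W' : Fin n → View n) (v : Fin n) :
    bias l.card * (g.event p (.statusCol u r) (.prioProp u r ⟨Stat.high, l⟩) V').stake v +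
      (1 - bias l.card) * (g.event p (.statusCol u r) (.prioProp u r ⟨Stat.low, l⟩) W').stake v ≤
      g.stake v := by
  have hP := h.pcOk p
  rw [hX] at hP
  obtain ⟨h1, h2, h3, h4, h5, h6⟩ := hP
  have hpp : g.prio u r p = none := by unfold Ghost.prio; rw [h4]; simp
  have hpr : ∀ (s : Status n) (V' : Fin n → View n), s.stat ≠ Stat.commit → ∀ v r',
      (g.event p (.statusCol u r) (.prioProp u r s) V').prio v r' =
        if v = u ∧ r' = r then Function.update (g.prio u r) p (some s) else g.prio v r' := by
    intro s V' hs v r'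
    ext1 q
    have hst : (g.event p (.statusCol u r) (.prioProp u r s) V').truth.status v r' q =
      if v = u ∧ r' = r ∧ q = p then some s else g.truth.status v r' q :=
      View.setStatus_status _ _ _ _ _ _ _ _
    unfold Ghost.prio
    rw [hst]
    by_cases hc : v = u ∧ r' = r
    · obtain ⟨rfl, rfl⟩ := hc
      simp only [true_and, and_self, if_true]
      by_cases hq : q = p
      · subst hq; simp [hs]
      · simp [hq]
    · rw [if_neg hc, if_neg (fun h => hc ⟨h.1, h.2.1⟩)]
  have hfi : ∀ (s : Status n) (V' : Fin n → View n) v r',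
      (g.event p (.statusCol u r) (.prioProp u r s) V').first v r' =
        if v = u ∧ r' = r then (if g.first u r = none then some p else g.first u r)
        else g.first v r' := by
    intro s V' v r'
    simp only [Ghost.event, Ghost.core]
    by_cases hc : v = u ∧ r' = r
    · obtain ⟨rfl, rfl⟩ := hc
      simp only [and_self, if_true]
      split_ifs <;> simp
    · rw [if_neg hc]
      split_ifs
      · by_cases hvu : v = u
        · subst hvu; simp only [Function.update_self]
          rw [Function.update_of_ne]; rintro rfl; exact hc ⟨rfl, rfl⟩
        · simp [hvu]
      · rfl
  have hwt : ∀ (s : Status n) (V' : Fin n → View n), s.stat ≠ Stat.commit → ∀ v r',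
      (g.event p (.statusCol u r) (.prioProp u r s) V').weight v r' =
        if v = u ∧ r' = r then 1 / 1000 + roundValue (g.order u r)
          (Function.update (g.prio u r) p (some s)) (if g.first u r = none then some p else g.first u r)
        else g.weight v r' := by
    intro s V' hs v r'
    unfold Ghost.weight
    rw [hpr s V' hs, hfi]
    by_cases hc : v = u ∧ r' = r
    · obtain ⟨rfl, rfl⟩ := hc
      simp only [and_self, if_true]
      rw [if_neg (by omega)]; rfl
    · simp only [if_neg hc]; rfl
  have key := roundValue_flip (L := g.order u r) (P := g.prio u r) (q := p) (l := l)
    (F := g.first u r) hpp h5 (fun j hj => hl j (h6 j hj))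
    (fun hF x => by
      by_contra hc
      exact (h.first u r).1 hF x (Ghost.prio_ne_none.1 hc))
    (fun a ha => by
      obtain ⟨s, h7, h8⟩ := (h.first u r).2 a ha
      exact ⟨s, Ghost.prio_eq_some.2 ⟨h7, h8⟩, (h.ownOk a).flipped_list u r s h7 h8⟩)
  have hwr : g.weight u r = 1 / 1000 + roundValue (g.order u r) (g.prio u r) (g.first u r) := by
    unfold Ghost.weight; rw [if_neg (by omega)]
  have hst : ∀ (s : Status n) (V' : Fin n → View n),
      (g.event p (.statusCol u r) (.prioProp u r s) V').stake v =
      (1000 / 997) ^ g.top v * 1000000 ^ (g.team v).card *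
        (g.event p (.statusCol u r) (.prioProp u r s) V').weight v (g.top v - 1) *
        (g.event p (.statusCol u r) (.prioProp u r s) V').weight v (g.top v) := fun _ _ => rfl
  rw [hst, hst]
  simp only [hwt ⟨Stat.high, l⟩ V' (by simp), hwt ⟨Stat.low, l⟩ W' (by simp)]
  have hgs : g.stake v = (1000 / 997) ^ g.top v * 1000000 ^ (g.team v).card *
      g.weight v (g.top v - 1) * g.weight v (g.top v) := rfl
  rw [hgs]
  set C : ℝ := (1000 / 997) ^ g.top v * 1000000 ^ (g.team v).card with hC
  have hC0 : 0 < C := by positivity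
  have hw1 := g.weight_pos v (g.top v - 1)
  have hw2 := g.weight_pos v (g.top v)
  set x := roundValue (g.order u r) (Function.update (g.prio u r) p (some ⟨Stat.high, l⟩))
    (if g.first u r = none then some p else g.first u r)
  set y := roundValue (g.order u r) (Function.update (g.prio u r) p (some ⟨Stat.low, l⟩))
    (if g.first u r = none then some p else g.first u r)
  have key' : bias l.card * (1 / 1000 + x) + (1 - bias l.card) * (1 / 1000 + y) ≤
      g.weight u r := by rw [hwr]; linarith
  clear_value x y
  by_cases hc1 : v = u ∧ g.top v = r
  · obtain ⟨rfl, rfl⟩ := hc1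
    have hc2 : g.top v - 1 ≠ g.top v := by omega
    simp only [hc2, and_false, if_false, and_self, if_true]
    have := mul_le_mul_of_nonneg_left key' (mul_pos hC0 hw1).le
    refine le_trans (le_of_eq ?_) this
    ring
  · by_cases hc2 : v = u ∧ g.top v - 1 = r
    · obtain ⟨rfl, hr⟩ := hc2
      have hr' : g.top v ≠ r := by omega
      simp only [hr, hr', and_false, if_false, and_self, if_true]
      have := mul_le_mul_of_nonneg_left key' (mul_pos hC0 hw2).le
      rw [hr] at hw1
      refine le_trans (le_of_eq ?_) (this.trans (le_of_eq ?_)) <;> ring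
    · simp only [hc1, hc2, if_false]
      apply le_of_eq; ring

end

/-- The name for whose leader election a processor is running. -/
def PC.race : PC n → Option (Fin n)
  | .doorCol u | .doorProp u | .roundProp u _ | .roundCol u _ | .commitProp u _ | .statusCol u _
  | .prioProp u _ _ | .prioCol u _ _ => some u
  | _ => none

lemma PC.spot_of_race {X : PC n} {u : Fin n} (h : X.race = some u) : X.spot = some u := by
  cases X <;> simp_all [PC.race, PC.spot]

/-- The contribution of the current leader election. -/
def State.factor (a : State n) (p : Fin n) : ℝ :=
  match (a.pc p).race with
  | some u => if a.ghost.joined p = true then 1000000 * a.ghost.stake u else 1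
  | none => 1

/-- Each unit of `load` is a payment of 10⁻⁶. At its pick p pays for the present holders, for itself
and for the constant 1000000 in `State.factor`; later it pays one unit for each arrival. The
election then costs nothing on average, and at its end the factor is exchanged for (1000/997)^top.
-/
def duration (p : Fin n) (a : State n) : ℝ :=
  (1000 / 997) ^ a.tally.rounds p * (1 / 1000000) ^ a.tally.load p * a.factor p

lemma State.factor_nonneg (a : State n) (p : Fin n) : 0 ≤ a.factor p := by
  unfold State.factor
  split
  · split_ifs
    · exact mul_nonneg (by norm_num) (a.ghost.stake_nonneg _)
    · norm_num
  · norm_num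

lemma State.one_le_factor (a : State n) (p : Fin n) : 1 ≤ a.factor p := by
  unfold State.factor
  split
  · rename_i u _
    split_ifs
    · exact (one_le_pow₀ (by norm_num)).trans (a.ghost.pow_top_le_stake u)
    · exact le_rfl
  · exact le_rfl

lemma Trans.race_eq {V : Fin n → View n} {g : Ghost n} {p : Fin n} {X Y : PC n}
    (t : Trans V g p X Y) (hX : ∀ S, X ≠ .propContended S) :
    (Y.race = X.race ∧ ∀ u b, Y ≠ .outcomeProp u b) ∨
      ∃ u b, X.race = some u ∧ Y = .outcomeProp u b := by
  cases t <;> first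
    | exact absurd rfl (hX _)
    | exact Or.inl ⟨rfl, by simp⟩
    | exact Or.inr ⟨_, _, rfl, rfl⟩

lemma State.newTally_rounds_of_ne {a : State n} {p : Fin n} {Y : PC n}
    (h : ∀ u b, Y ≠ .outcomeProp u b) :
    (a.newTally p Y).rounds = a.tally.rounds := by
  unfold State.newTally
  split
  · rfl
  · rfl
  · rename_i u b; exact absurd rfl (h u b)
  · rfl

lemma Ghost.event_joined_of_ne {V : Fin n → View n} {g : Ghost n} {p : Fin n} {X Y : PC n}
    (t : Trans V g p X Y) (hX : ∀ S, X ≠ .propContended S) (V') :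
    (g.event p X Y V').joined = g.joined := by
  cases t <;> first | rfl | exact absurd rfl (hX _)

/-- As long as nobody has committed there is no entry and no second round, so nobody can have lost
behind the doorway: members of the team are current holders. -/
lemma team_of_top_eq_zero {pc : Fin n → PC n} {V : Fin n → View n} {g : Ghost n}
    (h : Sound pc V g) {u : Fin n} (h0 : g.top u = 0) : g.team u ⊆ holders pc u := by
  intro q hq
  unfold Ghost.team at hq
  rw [if_pos (by omega), Finset.mem_filter] at hq
  have hst : ∀ r j, g.truth.status u r j = none := by
    intro r j
    by_contra hc
    have h1 := (h.ownOk j).status_top u r hc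
    have h2 := (h.ownOk j).status_round u r hc
    omega
  have hl : q ∉ g.lost u := by
    intro hl
    have hr : 1 ≤ g.truth.round u q := hq.2.resolve_left (fun h => h hl)
    rcases ((h.ownOk q).lost_witness u hl).2 hr with ⟨j, hj⟩ | ⟨-, j, hj, -⟩
    · obtain ⟨s, hs, -⟩ := (h.ownOk j).survived u 1 le_rfl (by omega)
      rw [hst] at hs; cases hs
    · exact hj (hst _ _)
  exact mem_holders.2 (((h.spotOk q).picks_cases u hq.1).resolve_right fun h => hl h.1)

lemma super_duration (p : Fin n) : Super (duration p) where
  nonneg a := by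
    unfold duration; have := a.factor_nonneg p; positivity
  view a V _ := le_rfl
  det a ha q Y V t hr hV := by
    have hne := not_random_propContended hr
    obtain ⟨-, -, -, h1, -⟩ := State.newTally_of_ne hne Y
    have h1' : (a.event q Y V).tally.load = a.tally.load := h1
    have hst : ∀ v, (a.event q Y V).ghost.stake v ≤ a.ghost.stake v :=
      fun v => Sound.stake_det ha rfl t hr V v
    have hj : (a.event q Y V).ghost.joined = a.ghost.joined := Ghost.event_joined_of_ne t hne V
    have hsame : (((a.event q Y V).pc p).race = (a.pc p).race) →
        (a.event q Y V).factor p ≤ a.factor p := by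
      intro h
      unfold State.factor
      rw [h, hj]
      split
      · split_ifs
        · have := hst; gcongr; exact this _
        · exact le_rfl
      · exact le_rfl
    unfold duration
    rw [h1']
    rcases t.race_eq hne with ⟨h2, h3⟩ | ⟨u, b, h2, h3⟩
    · have h4 : (a.event q Y V).tally.rounds = a.tally.rounds := State.newTally_rounds_of_ne h3
      rw [h4]
      have h5 : (a.event q Y V).factor p ≤ a.factor p := by
        refine hsame ?_
        by_cases hpq : p = q
        · subst hpq; simp [State.event, h2]
        · simp [State.event, hpq]
      gcongr
    · by_cases hpq : p = q
      · subst hpq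
        have h4 : (a.event p Y V).tally.rounds p = a.tally.rounds p +
            if a.ghost.joined p = true then a.ghost.top u else 0 := by
          subst h3
          cases hX : a.pc p <;> first
            | exact absurd hX (hne _)
            | simp [State.event, State.newTally, hX]
        have h5 : (a.event p Y V).factor p = 1 := by
          unfold State.factor
          simp [State.event, h3, PC.race]
        rw [h4, h5, pow_add, mul_one]
        have h6 : (1000 / 997 : ℝ) ^ (if a.ghost.joined p = true then a.ghost.top u else 0) ≤
            a.factor p := by
          unfold State.factor
          rw [h2]
          simp only
          split_ifs
          · exact a.ghost.pow_top_le_stake u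
          · simp
        calc _ = (1000 / 997 : ℝ) ^ a.tally.rounds p * (1 / 1000000) ^ a.tally.load p *
              (1000 / 997 : ℝ) ^ (if a.ghost.joined p = true then a.ghost.top u else 0) := by ring
          _ ≤ _ := by gcongr
      · have h4 : (a.event q Y V).tally.rounds p = a.tally.rounds p := by
          subst h3
          unfold State.event State.newTally
          simp only
          split <;> simp [hpq]
        have h5 : (a.event q Y V).factor p ≤ a.factor p :=
          hsame (by simp [State.event, hpq])
        rw [h4]
        gcongr
  pick a ha q S hX hS V hV := by
    have key : ∀ u ∈ Sᶜ, duration p (a.event q (.doorCol u) (V u)) ≤ duration p a := by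
      intro u hu
      have hqu := sound_notMem_picks ha hX (Finset.mem_compl.1 hu)
      have hrounds : (a.event q (.doorCol u) (V u)).tally.rounds = a.tally.rounds := by
        rw [pick_tally hX]
      have hload : (a.event q (.doorCol u) (V u)).tally.load p =
          if p = q then a.tally.load q + ((holders a.pc u).card + 2)
          else a.tally.load p + (if (a.pc p).spot = some u then 1 else 0) := by
        rw [pick_tally hX]
      have hteam : ∀ v, (a.event q (.doorCol u) (V u)).ghost.team v ⊆
          if v = u then insert q (a.ghost.team v) else a.ghost.team v := by
        intro v x hx
        have htop : (a.event q (.doorCol u) (V u)).ghost.top = a.ghost.top := by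
          simp [State.event, hX, Ghost.event, Ghost.core]
        have hlost : (a.event q (.doorCol u) (V u)).ghost.lost = a.ghost.lost := by
          simp [State.event, hX, Ghost.event, Ghost.core]
        have hround : (a.event q (.doorCol u) (V u)).ghost.truth.round = a.ghost.truth.round := by
          simp [State.event, hX, Ghost.event, Ghost.core]
        have hcap : (a.event q (.doorCol u) (V u)).ghost.cap = a.ghost.cap := by
          simp [State.event, hX, Ghost.event, Ghost.core]
        unfold Ghost.team at hx ⊢
        rw [htop, hlost, hround, hcap, pick_picks hX] at hx
        by_cases h1 : a.ghost.top v ≤ 1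
        · rw [if_pos h1] at hx ⊢
          rw [Finset.mem_filter] at hx
          split_ifs with h2
          · subst h2
            rw [Function.update_self, Finset.mem_insert] at hx
            rw [Finset.mem_insert, Finset.mem_filter]
            exact hx.1.imp id fun h => ⟨h, hx.2⟩
          · rw [Function.update_of_ne h2] at hx
            exact Finset.mem_filter.2 hx
        · rw [if_neg h1] at hx ⊢
          split_ifs
          · exact Finset.mem_insert_of_mem hx
          · exact hx
      have hstake : ∀ v, (a.event q (.doorCol u) (V u)).ghost.stake v =
          (1000 / 997) ^ a.ghost.top v *
            1000000 ^ ((a.event q (.doorCol u) (V u)).ghost.team v).card *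
            a.ghost.weight v (a.ghost.top v - 1) * a.ghost.weight v (a.ghost.top v) := by
        intro v
        simp only [State.event, hX]; rfl
      by_cases hpq : p = q
      · subst hpq
        have hfa : a.factor p = 1 := by unfold State.factor; rw [hX]; rfl
        have hfb : (a.event p (.doorCol u) (V u)).factor p ≤
            1000000 ^ ((holders a.pc u).card + 2) := by
          unfold State.factor
          have h1 : ((a.event p (.doorCol u) (V u)).pc p).race = some u := by
            simp [State.event, PC.race]
          rw [h1]
          simp only
          split_ifs with h2
          · have h0 : a.ghost.top u = 0 := by
              simpa [State.event, hX, Ghost.event, Ghost.core] using h2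
            have h3 : a.ghost.weight u 0 = 1 := by simp [Ghost.weight]
            rw [hstake, h0, h3, pow_zero, one_mul, mul_one, mul_one, pow_succ, mul_comm]
            gcongr
            · norm_num
            · refine (Finset.card_le_card (hteam u)).trans ?_
              rw [if_pos rfl]
              refine (Finset.card_insert_le _ _).trans ?_
              have := Finset.card_le_card (team_of_top_eq_zero ha h0)
              omega
          · exact one_le_pow₀ (by norm_num)
        unfold duration
        rw [hrounds, hload, if_pos rfl, hfa, pow_add, mul_one]
        have h4 : (1 / 1000000 : ℝ) ^ ((holders a.pc u).card + 2) *
            1000000 ^ ((holders a.pc u).card + 2) = 1 := by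
          rw [← mul_pow]; norm_num
        calc _ = (1000 / 997 : ℝ) ^ a.tally.rounds p * (1 / 1000000) ^ a.tally.load p *
              ((1 / 1000000) ^ ((holders a.pc u).card + 2) *
                (a.event p (.doorCol u) (V u)).factor p) := by ring
          _ ≤ (1000 / 997 : ℝ) ^ a.tally.rounds p * (1 / 1000000) ^ a.tally.load p *
              ((1 / 1000000) ^ ((holders a.pc u).card + 2) *
                1000000 ^ ((holders a.pc u).card + 2)) := by gcongr
          _ = _ := by rw [h4, mul_one]
      · have hpc : (a.event q (.doorCol u) (V u)).pc p = a.pc p := by simp [State.event, hpq]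
        have hjn : (a.event q (.doorCol u) (V u)).ghost.joined p = a.ghost.joined p := by
          simp [State.event, hX, Ghost.event, Ghost.core, hpq]
        have hfac : (1 / 1000000) ^ (if (a.pc p).spot = some u then 1 else 0) *
            (a.event q (.doorCol u) (V u)).factor p ≤ a.factor p := by
          unfold State.factor
          rw [hpc, hjn]
          have hb : (1 / 1000000 : ℝ) ^ (if (a.pc p).spot = some u then 1 else 0) ≤ 1 :=
            pow_le_one₀ (by norm_num) (by norm_num)
          rcases hv : (a.pc p).race with _ | v
          · simp only [mul_one]; exact hb
          · simp only
            by_cases h1 : a.ghost.joined p = true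
            rw [if_pos h1, if_pos h1]
            · have hsp := PC.spot_of_race hv
              have hw1 := a.ghost.weight_pos v (a.ghost.top v - 1)
              have hw2 := a.ghost.weight_pos v (a.ghost.top v)
              have hcard := Finset.card_le_card (hteam v)
              rw [hstake, hsp]
              unfold Ghost.stake
              simp only [Option.some.injEq]
              -- An arrival enlarges the team by at most one processor, and the new unit of `load`
              -- pays for it.
              have h5 : (1 / 1000000 : ℝ) ^ (if v = u then 1 else 0) *
                  1000000 ^ ((a.event q (.doorCol u) (V u)).ghost.team v).card ≤
                  1000000 ^ (a.ghost.team v).card := by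
                split_ifs at hcard ⊢ with h6
                · have h7 : (1000000 : ℝ) ^ ((a.event q (.doorCol u) (V u)).ghost.team v).card ≤
                      1000000 ^ ((a.ghost.team v).card + 1) :=
                    pow_le_pow_right₀ (by norm_num) (hcard.trans (Finset.card_insert_le _ _))
                  rw [pow_succ] at h7
                  linarith
                · rw [pow_zero, one_mul]
                  exact pow_le_pow_right₀ (by norm_num) hcard
              calc _ = 1000000 * ((1000 / 997) ^ a.ghost.top v *
                    ((1 / 1000000 : ℝ) ^ (if v = u then 1 else 0) *
                    1000000 ^ ((a.event q (.doorCol u) (V u)).ghost.team v).card) *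
                    a.ghost.weight v (a.ghost.top v - 1) * a.ghost.weight v (a.ghost.top v)) := by
                    ring
                _ ≤ _ := by gcongr
            · rw [if_neg h1, if_neg h1, mul_one]; exact hb
        unfold duration
        rw [hrounds, hload, if_neg hpq, pow_add]
        calc _ = (1000 / 997 : ℝ) ^ a.tally.rounds p * (1 / 1000000) ^ a.tally.load p *
              ((1 / 1000000) ^ (if (a.pc p).spot = some u then 1 else 0) *
              (a.event q (.doorCol u) (V u)).factor p) := by ring
          _ ≤ _ := by gcongr
    refine (Finset.sum_le_sum key).trans ?_
    rw [Finset.sum_const, nsmul_eq_mul]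
  flip a ha q u r l hX hl V W hV hW := by
    have hst := fun v => Sound.stake_flip ha hX hl V W v
    have hval : ∀ s V, duration p (a.event q (.prioProp u r s) V) =
        (1000 / 997) ^ a.tally.rounds p * (1 / 1000000) ^ a.tally.load p *
          (match (a.pc p).race with
            | some v => if a.ghost.joined p = true then
                1000000 * (a.ghost.event q (.statusCol u r) (.prioProp u r s) V).stake v else 1
            | none => 1) := by
      intro s V
      have h1 : ((a.event q (.prioProp u r s) V).pc p).race = (a.pc p).race := by
        by_cases hpq : p = q
        · subst hpq; simp [State.event, hX, PC.race]
        · simp [State.event, hpq]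
      have h2 : (a.event q (.prioProp u r s) V).ghost =
          a.ghost.event q (.statusCol u r) (.prioProp u r s) V := by simp [State.event, hX]
      have h3 : (a.ghost.event q (.statusCol u r) (.prioProp u r s) V).joined = a.ghost.joined := rfl
      unfold duration State.factor
      rw [h1, h2, h3]
      simp [State.event, State.newTally, hX]
    rw [hval, hval]
    unfold duration State.factor
    set C : ℝ := (1000 / 997) ^ a.tally.rounds p * (1 / 1000000) ^ a.tally.load p with hC
    have hC0 : 0 < C := by positivity
    split
    · rename_i v _
      split_ifs
      · have := mul_le_mul_of_nonneg_left (hst v) (mul_pos hC0 (by norm_num : (0 : ℝ) < 1000000)).le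
        refine le_trans (le_of_eq ?_) (this.trans (le_of_eq ?_)) <;> ring
      · apply le_of_eq; ring
    · apply le_of_eq; ring

/-! ## Deterministic bounds on the number of calls -/

/-- The round of the current leader election. -/
def PC.stage : PC n → ℕ
  | .roundProp _ r | .roundCol _ r | .commitProp _ r | .statusCol _ r | .prioProp _ r _
  | .prioCol _ r _ => r
  | _ => 0

/-- The number of calls by which the bound on the number of calls is not attained. -/
def PC.slack : PC n → ℕ
  | .start => 2
  | .colContended => 1
  | .propContended _ => 0
  | .doorCol _ => 9
  | .doorProp _ => 8
  | .roundProp _ _ => 13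
  | .roundCol _ _ => 12
  | .commitProp _ _ => 11
  | .statusCol _ _ => 10
  | .prioProp _ _ _ => 9
  | .prioCol _ _ _ => 8
  | .outcomeProp _ _ => 5
  | .returned _ => 4

/-- The number of rounds of the leader election that `p` completes. -/
def PC.gain (g : Ghost n) (p : Fin n) : PC n → ℕ
  | .outcomeProp u _ => if g.joined p = true then g.top u else 0
  | _ => 0

/-- `p` is about to pick a name. -/
def PC.collecting : PC n → Prop
  | .colContended | .propContended _ => True
  | _ => False

/-- Relations between the counters of `p`, if at any time the number of unknown names that were
picked once is at most `ρ (f + 1)`, where `f` is the number of free names, and no name is picked by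
more than `H` processors. -/
structure State.Bounded (ρ : ℝ) (H : ℕ) (a : State n) (p : Fin n) : Prop where
  calls : a.tally.calls p + (a.pc p).slack ≤
    10 * a.tally.picked p + 6 * a.tally.rounds p + 6 * (a.pc p).stage + 2
  pow_le : 2 ^ a.tally.halved p ≤ n
  pow_free : 2 ^ a.tally.halved p * a.ghost.free.card ≤ n
  pow_start : (a.pc p).collecting → 2 ^ a.tally.halved p * a.tally.free₀ p ≤ n
  collect : a.pc p = .colContended →
    ((unknown (a.ghost.snap p)).card : ℝ) ≤ 2 * (1 + ρ) * a.tally.free₀ p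
  compl : ∀ S, a.pc p = .propContended S → (Sᶜ.card : ℝ) ≤ 2 * (1 + ρ) * a.tally.free₀ p
  picked : (a.tally.picked p : ℝ) ≤ a.tally.halved p + 4 * (1 + ρ) * a.tally.hits p
  load : a.tally.load p ≤ 3 * a.tally.picked p + a.tally.crowd p * (H + 2)
  hits : 0 ≤ a.tally.hits p

lemma State.Bounded.view {ρ : ℝ} {H : ℕ} {a : State n} {p : Fin n} (h : a.Bounded ρ H p)
    (V : Fin n → View n) : State.Bounded ρ H { a with view := V } p :=
  ⟨h.calls, h.pow_le, h.pow_free, h.pow_start, h.collect, h.compl, h.picked, h.load, h.hits⟩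

/-- The round of a processor exceeds the largest round in which somebody has committed by at
most one. -/
lemma Sound.stage_le {pc : Fin n → PC n} {V : Fin n → View n} {g : Ghost n} (h : Sound pc V g)
    (p : Fin n) : (pc p).stage = 0 ∨
      ∃ u, (pc p).race = some u ∧ g.joined p = true ∧ (pc p).stage ≤ g.top u + 1 := by
  have hP := h.pcOk p
  have hs : ∀ u r, g.truth.round u p = r → 1 ≤ r → r ≤ g.top u + 1 := by
    intro u r h1 h2
    by_cases h3 : r = 1
    · omega
    · obtain ⟨s, h4, -⟩ := (h.ownOk p).survived u (r - 1) (by omega) (by omega)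
      have := (h.ownOk p).status_top u (r - 1) (by rw [h4]; simp)
      omega
  cases hX : pc p <;> rw [hX] at hP <;> first
    | exact Or.inl rfl
    | exact Or.inr ⟨_, rfl, hP.2.2.1, hs _ _ hP.1 hP.2.1⟩

/-- An unknown name is free, picked once, or picked several times. In the last case nobody has
abandoned it, since abandoning it requires that a majority knows it; all its pickers still hold it,
so the excess bounds the number of such names by the number of free ones. -/
lemma Sound.card_unknown_le {pc : Fin n → PC n} {V : Fin n → View n} {g : Ghost n} {t : Tally n}
    (h : Sound pc V g) :
    (unknown V).card ≤ 2 * g.free.card + (State.single ⟨pc, V, g, t⟩).card := by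
  have h1 : unknown V ⊆ g.free ∪ (State.single ⟨pc, V, g, t⟩ ∪
      Finset.univ.filter fun v => 2 ≤ (holders pc v).card) := by
    intro v hv
    simp only [unknown, Finset.mem_filter, Finset.mem_univ, true_and] at hv
    simp only [Finset.mem_union, mem_free, State.single, Finset.mem_filter, Finset.mem_univ,
      true_and]
    by_cases h0 : g.picks v = ∅
    · exact Or.inl h0
    · by_cases h1 : (g.picks v).card = 1
      · exact Or.inr (Or.inl ⟨hv, h1⟩)
      · right; right
        have h2 := Finset.card_pos.2 (Finset.nonempty_iff_ne_empty.2 h0)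
        have h3 : g.picks v ⊆ holders pc v := fun q hq =>
          mem_holders.2 (((h.spotOk q).picks_cases v hq).resolve_right fun h => hv h.2)
        have := Finset.card_le_card h3
        omega
  have h2 : (Finset.univ.filter fun v => 2 ≤ (holders pc v).card).card ≤ g.free.card := by
    rw [h.card_free, Finset.card_filter]
    refine (Finset.sum_le_sum fun u _ => ?_).trans (Nat.le_add_left _ _)
    split_ifs <;> omega
  have h3 := Finset.card_le_card h1
  have h4 := Finset.card_union_le g.free (State.single ⟨pc, V, g, t⟩ ∪
      Finset.univ.filter fun v => 2 ≤ (holders pc v).card)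
  have h5 := Finset.card_union_le (State.single ⟨pc, V, g, t⟩)
    (Finset.univ.filter fun v => 2 ≤ (holders pc v).card)
  omega

/-- The bounds for `p` are preserved when another processor goes on. -/
lemma State.Bounded.event_of_ne {ρ : ℝ} {H : ℕ} {a : State n} {p q : Fin n}
    (h : a.Bounded ρ H p) (hpq : p ≠ q) {Y : PC n} {V : Fin n → View n}
    (t : Trans a.view a.ghost q (a.pc q) Y) : (a.event q Y V).Bounded ρ H p := by
  have hpc : (a.event q Y V).pc p = a.pc p := by simp [State.event, hpq]
  have hsnap : (a.event q Y V).ghost.snap p = a.ghost.snap p := by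
    simp [State.event, Ghost.event, hpq]
  have hfree : (a.event q Y V).ghost.free.card ≤ a.ghost.free.card := by
    by_cases hX : ∃ S, a.pc q = .propContended S
    · obtain ⟨S, hX⟩ := hX
      have hu : ∃ u, Y = .doorCol u := by
        rw [hX] at t; cases t; exact ⟨_, rfl⟩
      obtain ⟨u, rfl⟩ := hu
      rw [pick_free hX]; exact Finset.card_erase_le
    · push Not at hX
      exact (congrArg Finset.card (free_congr (t.picks_eq hX V))).le
  have htally : (a.event q Y V).tally.calls p = a.tally.calls p ∧
      (a.event q Y V).tally.picked p = a.tally.picked p ∧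
      (a.event q Y V).tally.halved p = a.tally.halved p ∧
      (a.event q Y V).tally.rounds p = a.tally.rounds p ∧
      (a.event q Y V).tally.hits p = a.tally.hits p ∧
      (a.event q Y V).tally.free₀ p = a.tally.free₀ p ∧
      ∃ d, (a.event q Y V).tally.load p = a.tally.load p + d ∧
        (a.event q Y V).tally.crowd p = a.tally.crowd p + d := by
    simp only [State.event, State.newTally]
    split
    · rename_i S u _ _
      simp only [Function.update_of_ne hpq, if_neg hpq, true_and]
      exact ⟨_, rfl, rfl⟩
    all_goals
      simp only [Function.update_of_ne hpq, true_and]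
      exact ⟨0, rfl, rfl⟩
  obtain ⟨h1, h2, h3, h4, h5, h6, d, h7, h8⟩ := htally
  refine ⟨?_, ?_, ?_, ?_, ?_, ?_, ?_, ?_, ?_⟩
  · rw [hpc, h1, h2, h4]; exact h.calls
  · rw [h3]; exact h.pow_le
  · rw [h3]; exact (Nat.mul_le_mul_left _ hfree).trans h.pow_free
  · rw [hpc, h3, h6]; exact h.pow_start
  · rw [hpc, hsnap, h6]; exact h.collect
  · rw [hpc, h6]; exact h.compl
  · rw [h2, h3, h5]; exact h.picked
  · rw [h2, h7, h8]
    have := h.load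
    nlinarith
  · rw [h5]; exact h.hits

/-- The bounds for `p` are preserved when `p` picks a name. -/
lemma State.Bounded.pick {ρ : ℝ} {H : ℕ} {a : State n} {p : Fin n} (h : a.Bounded ρ H p)
    (ha : a.sound) (hρ : 0 ≤ ρ) (hH : ∀ v, (a.ghost.picks v).card ≤ H) {S : Finset (Fin n)}
    (hX : a.pc p = .propContended S) (u : Fin n) (V : Fin n → View n) :
    (a.event p (.doorCol u) V).Bounded ρ H p := by
  have hpc : (a.event p (.doorCol u) V).pc p = .doorCol u := by simp [State.event]
  have hf := free_card_pos ha hX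
  have hfree : (a.event p (.doorCol u) V).ghost.free.card ≤ a.ghost.free.card := by
    rw [pick_free hX]; exact Finset.card_erase_le
  have hpow : 2 ^ (a.event p (.doorCol u) V).tally.halved p * a.ghost.free.card ≤ n := by
    rw [pick_tally hX]
    simp only [Function.update_self]
    -- The counter increases exactly when less than half of `free₀` is left, so the new product is
    -- at most `2 ^ halved * free₀`, with the old exponent.
    split_ifs with hc
    · have h1 := h.pow_start (by rw [hX]; trivial)
      rw [pow_succ]
      nlinarith [Nat.mul_le_mul_left (2 ^ a.tally.halved p) hc.le]
    · exact h.pow_free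
  refine ⟨?_, ?_, ?_, ?_, ?_, ?_, ?_, ?_, ?_⟩
  · have := h.calls
    rw [hpc, pick_tally hX]
    rw [hX] at this
    simp only [Function.update_self, PC.slack, PC.stage] at this ⊢
    omega
  · exact le_trans (Nat.le_mul_of_pos_right _ hf) hpow
  · exact (Nat.mul_le_mul_left _ hfree).trans hpow
  · rw [hpc]; exact fun h => h.elim
  · rw [hpc]; exact fun h => by cases h
  · rw [hpc]; exact fun _ h => by cases h
  · have h1 := h.picked
    have h2 := h.compl S hX
    have h3 : (a.ghost.free.card : ℝ) ≤ Sᶜ.card := by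
      exact_mod_cast Finset.card_le_card (free_subset_compl ha hX)
    have h4 : (1 : ℝ) ≤ a.ghost.free.card := by exact_mod_cast hf
    rw [pick_tally hX]
    simp only [Function.update_self]
    have h5 : (0 : ℝ) ≤ a.ghost.free.card / (Sᶜ.card : ℝ) := by positivity
    have h6 := mul_nonneg (by linarith : 0 ≤ 4 * (1 + ρ)) h5
    split_ifs with hc
    · push_cast; linarith
    · have hc' : (a.tally.free₀ p : ℝ) ≤ 2 * a.ghost.free.card := by
        exact_mod_cast not_lt.1 hc
      -- If the free names were not halved, |Sᶜ| ≤ 2(1 + ρ) free₀ ≤ 4(1 + ρ) f: the probability of a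
      -- free name is at least 1/(4(1 + ρ)), and the pick is paid for by `hits`.
      have h7 : (1 : ℝ) ≤ 4 * (1 + ρ) * (a.ghost.free.card / (Sᶜ.card : ℝ)) := by
        rw [mul_div_assoc', le_div_iff₀ (by linarith), one_mul]
        refine h2.trans ?_
        nlinarith
      push_cast
      linarith
  · have h1 := h.load
    have h2 := (Finset.card_le_card (ha.holders_subset u)).trans (hH u)
    rw [pick_tally hX]
    simp only [Function.update_self, if_true]
    -- With several holders the pick adds at most H + 2 to the load and one to `crowd`; with at most
    -- one holder it adds at most 3.
    split_ifs with hc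
    · nlinarith
    · have : (holders a.pc u).card ≤ 1 := by omega
      nlinarith
  · have h1 := h.hits
    rw [pick_tally hX]
    simp only [Function.update_self]
    positivity

/-- The bounds for `p` are preserved when `p` goes on. -/
lemma State.Bounded.event_self {ρ : ℝ} {H : ℕ} {a : State n} {p : Fin n} (h : a.Bounded ρ H p)
    (ha : a.sound) (hρ : 0 ≤ ρ) (hH : ∀ v, (a.ghost.picks v).card ≤ H) {Y : PC n}
    {V : Fin n → View n} (hV : ∀ k, (a.view k).Le (V k))
    (t : Trans a.view a.ghost p (a.pc p) Y)
    (hs : ((a.event p Y V).single.card : ℝ) ≤ ρ * ((a.event p Y V).ghost.free.card + 1)) :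
    (a.event p Y V).Bounded ρ H p := by
  by_cases hX : ∃ S, a.pc p = .propContended S
  · obtain ⟨S, hX⟩ := hX
    have hu : ∃ u, Y = .doorCol u := by
      rw [hX] at t; cases t; exact ⟨_, rfl⟩
    obtain ⟨u, rfl⟩ := hu
    exact h.pick ha hρ hH hX u V
  push Not at hX
  obtain ⟨h1, h2, h3, h4, h5⟩ := State.newTally_of_ne hX Y
  have hpc : (a.event p Y V).pc p = Y := by simp [State.event]
  have hsound := ha.event hV (t.mono_view hV)
  have hfree : (a.event p Y V).ghost.free = a.ghost.free := free_congr (t.picks_eq hX V)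
  have hcalls : (a.newTally p Y).calls p = a.tally.calls p + 1 := by
    unfold State.newTally; split <;> simp
  have hrounds : (a.newTally p Y).rounds p = a.tally.rounds p +
      Y.gain a.ghost p := by
    generalize hZ : a.pc p = Z at t
    cases t <;> simp [State.newTally, hZ, PC.gain]
  have hfree₀ : (a.newTally p Y).free₀ p =
      if Y = .colContended then a.ghost.free.card else a.tally.free₀ p := by
    generalize hZ : a.pc p = Z at t
    cases t <;> simp [State.newTally, hZ]
  -- From 2f + ρ(f + 1) to 2(1 + ρ)f: a processor about to collect has no name, so f ≥ 1.
  have hcol : Y = .colContended →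
      ((unknown V).card : ℝ) ≤ 2 * (1 + ρ) * a.ghost.free.card := by
    intro hY
    have h6 : ((unknown V).card : ℝ) ≤ 2 * a.ghost.free.card + (a.event p Y V).single.card := by
      have := Sound.card_unknown_le (t := (a.event p Y V).tally) hsound
      rw [hfree] at this
      exact_mod_cast this
    have h7 : (1 : ℝ) ≤ a.ghost.free.card := by
      rw [← hfree]
      exact_mod_cast (Sound.exists_free hsound (p := p) (by rw [hpc, hY]; rfl)).card_pos
    rw [hfree] at hs
    nlinarith
  refine ⟨?_, ?_, ?_, ?_, ?_, ?_, ?_, ?_, ?_⟩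
  -- A round costs six calls. An election ends for p in a round at most `top`, or in the pre-round
  -- of round `top + 1`, whose two calls are covered by the ten granted per name.
  · rw [hpc]
    show (a.newTally p Y).calls p + _ ≤ 10 * (a.newTally p Y).picked p +
      6 * (a.newTally p Y).rounds p + _ + 2
    rw [hcalls, h1, hrounds]
    have hc := h.calls
    have hst := Sound.stage_le ha p
    have hP := ha.pcOk p
    generalize hZ : a.pc p = Z at t hc hst hP
    cases t <;> simp only [PC.slack, PC.stage, PC.race, PC.gain, Option.some.injEq, exists_eq_left',
      reduceCtorEq, false_and, exists_false, or_false] at hc hst ⊢ <;> try omega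
    · exact absurd hZ (hX _)
    · rw [hP.2.2.1, if_pos rfl]; omega
    · rw [hP.2.2.1, if_pos rfl]; omega
    · have := (ha.ownOk p).status_top _ _ (by rw [hP.2.2.2.1]; simp)
      rw [hP.2.2.1, if_pos rfl]; omega
  · show 2 ^ (a.newTally p Y).halved p ≤ n
    rw [h3]; exact h.pow_le
  · show 2 ^ (a.newTally p Y).halved p * _ ≤ n
    rw [h3, hfree]; exact h.pow_free
  · rw [hpc]
    show _ → 2 ^ (a.newTally p Y).halved p * (a.newTally p Y).free₀ p ≤ n
    rw [h3, hfree₀]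
    intro hY
    generalize hZ : a.pc p = Z at t
    cases t <;> first
      | exact hY.elim
      | (rw [if_pos rfl]; exact h.pow_free)
      | (rw [if_neg (by simp)]; exact h.pow_start (by rw [hZ]; trivial))
  · rw [hpc]
    rintro rfl
    show ((unknown ((a.ghost.event p (a.pc p) _ V).snap p)).card : ℝ) ≤
      2 * (1 + ρ) * (a.newTally p _).free₀ p
    rw [hfree₀, if_pos rfl]
    have : (a.ghost.event p (a.pc p) .colContended V).snap p = V := by simp [Ghost.event]
    rw [this]
    exact hcol rfl
  · rw [hpc]
    rintro S rfl
    show (Sᶜ.card : ℝ) ≤ 2 * (1 + ρ) * (a.newTally p _).free₀ p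
    rw [hfree₀, if_neg (by simp)]
    generalize hZ : a.pc p = Z at t
    cases t with
    | collect _ _ hk =>
      refine le_trans ?_ (h.collect hZ)
      have : Sᶜ ⊆ unknown (a.ghost.snap p) := by
        intro v hv
        simp only [unknown, Finset.mem_filter, Finset.mem_univ, true_and]
        exact fun hv' => Finset.mem_compl.1 hv (hk v hv')
      exact_mod_cast Finset.card_le_card this
  · show ((a.newTally p Y).picked p : ℝ) ≤ (a.newTally p Y).halved p +
      4 * (1 + ρ) * (a.newTally p Y).hits p
    rw [h1, h3, h5]; exact h.picked
  · show (a.newTally p Y).load p ≤ 3 * (a.newTally p Y).picked p +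
      (a.newTally p Y).crowd p * (H + 2)
    rw [h1, h2, h4]; exact h.load
  · show 0 ≤ (a.newTally p Y).hits p
    rw [h5]; exact h.hits

/-! ### The bounds along an execution -/

lemma World.step_cases {w : World n} (h : w.Good) (A : Adversary n) (c : unitInterval) :
    ∃ V, (∀ k, (w.config.view k).Le (V k)) ∧
    (((World.step A w c).state = { w.state with view := V } ∧
      (World.step A w c).config.callId = w.config.callId) ∨
    ∃ p Y V', (∀ k, (V k).Le (V' k)) ∧ Sound w.config.pc V w.ghost ∧
      Trans V w.ghost p (w.config.pc p) Y ∧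
      (World.step A w c).state = State.event { w.state with view := V } p Y V' ∧
      (World.step A w c).config.callId =
        Function.update w.config.callId p (w.config.callId p + 1)) := by
  unfold World.step
  split
  · rename_i i _
    obtain ⟨h1, h2, h3⟩ := h.comm.deliver c i
    refine ⟨(w.config.apply c (.deliver i)).view, h2.view, Or.inl ⟨?_, h2.callId⟩⟩
    simp only [World.state, h2.pc]
  · rename_i p _
    obtain ⟨h1, h2, h3, h4⟩ := h.drain p
    refine ⟨(w.config.drain p).view, h4, ?_⟩
    have hid := (h.comm.drain p).2.callId
    split_ifs with hr
    · obtain ⟨h5, h6, h7⟩ := h.advance hr c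
      refine Or.inr ⟨p, _, _, h6, h3 ▸ h2, h5, World.state_step_advance h c, ?_⟩
      simp only
      rw [Config.advance_callId, hid]
    · refine Or.inl ⟨?_, hid⟩
      simp only [World.state, h3]

/-- The state before the `k`-th move. -/
def stateAt (A : Adversary n) (p₀ : Fin n) (ω : Coins) (k : ℕ) : State n :=
  (trajectory (World.step A) (World.initial n p₀) ω k).state

lemma State.calls_event (a : State n) (p : Fin n) (Y : PC n) (V : Fin n → View n) :
    (a.event p Y V).tally.calls = Function.update a.tally.calls p (a.tally.calls p + 1) := by
  simp only [State.event, State.newTally]; split <;> rfl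

lemma World.calls_eq (A : Adversary n) (p₀ : Fin n) (ω : Coins) (k : ℕ) :
    (stateAt A p₀ ω k).tally.calls =
      (trajectory (World.step A) (World.initial n p₀) ω k).config.callId := by
  induction k with
  | zero => rfl
  | succ k ih =>
    obtain ⟨V, -, ⟨h1, h2⟩ | ⟨p, Y, V', -, -, -, h1, h2⟩⟩ :=
      World.step_cases (World.good A p₀ ω k) A (ω k)
    · show (World.step A _ _).state.tally.calls = (World.step A _ _).config.callId
      rw [h1, h2]; exact ih
    · show (World.step A _ _).state.tally.calls = (World.step A _ _).config.callId
      rw [h1, h2, State.calls_event, ← ih]; rfl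

lemma State.bounded_initial (ρ : ℝ) (H : ℕ) (p p₀ : Fin n) :
    (World.initial n p₀).state.Bounded ρ H p := by
  have hn : 1 ≤ n := p.pos
  refine ⟨?_, ?_, ?_, ?_, ?_, ?_, ?_, ?_, ?_⟩
  · exact le_rfl
  · exact hn
  · have : (World.initial n p₀).state.ghost.free.card ≤ n := by
      simpa using Finset.card_le_univ (World.initial n p₀).state.ghost.free
    simpa [World.initial, World.state, Tally.initial] using this
  · exact fun h => h.elim
  · exact fun h => by cases h
  · exact fun _ h => by cases h
  · simp [World.initial, World.state, Tally.initial]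
  · exact Nat.zero_le _
  · exact le_rfl

/-- This is purely deterministic: all the probability is in the two hypotheses about names. -/
theorem bounded_stateAt {A : Adversary n} {p₀ : Fin n} {ω : Coins} {ρ : ℝ} {H : ℕ} (hρ : 0 ≤ ρ)
    (hs : ∀ k, ((stateAt A p₀ ω k).single.card : ℝ) ≤
      ρ * ((stateAt A p₀ ω k).ghost.free.card + 1))
    (hH : ∀ k v, ((stateAt A p₀ ω k).ghost.picks v).card ≤ H) (k : ℕ) (p : Fin n) :
    (stateAt A p₀ ω k).Bounded ρ H p := by
  induction k with
  | zero => exact State.bounded_initial ρ H p p₀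
  | succ k ih =>
    obtain ⟨V, hV, ⟨h1, -⟩ | ⟨q, Y, V', hV', h2, h3, h1, -⟩⟩ :=
      World.step_cases (World.good A p₀ ω k) A (ω k)
    · show (World.step A _ _).state.Bounded ρ H p
      rw [h1]; exact ih.view V
    · show (World.step A _ _).state.Bounded ρ H p
      have h4 := hs (k + 1)
      have h5 : stateAt A p₀ ω (k + 1) = (World.step A
        (trajectory (World.step A) (World.initial n p₀) ω k) (ω k)).state := rfl
      rw [h5, h1] at h4
      rw [h1]
      by_cases hpq : p = q
      · subst hpq
        exact (ih.view V).event_self h2 hρ (hH k) hV' h3 h4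
      · exact (ih.view V).event_of_ne hpq h3

/-! ## Progress of the communication -/

/-- What never decreases in the course of an execution. -/
structure Config.Prog (K K' : Config n) : Prop where
  packets : K.packets <+: K'.packets
  delivered : K.delivered ⊆ K'.delivered
  callId : ∀ p, K.callId p ≤ K'.callId p
  replies : ∀ p k, K'.callId p = K.callId p → ((K.procs p).replies k).isSome →
    ((K'.procs p).replies k).isSome

lemma Config.Prog.refl (K : Config n) : K.Prog K :=
  ⟨List.prefix_rfl, subset_rfl, fun _ => le_rfl, fun _ _ _ h => h⟩

lemma Config.Prog.trans {K K' K'' : Config n} (h : K.Prog K') (h' : K'.Prog K'') : K.Prog K'' :=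
  ⟨h.packets.trans h'.packets, h.delivered.trans h'.delivered,
    fun p => (h.callId p).trans (h'.callId p), fun p k hk hr => by
      have h1 := h.callId p
      have h2 := h'.callId p
      exact h'.replies p k (by omega) (h.replies p k (by omega) hr)⟩

lemma Config.prog_clear (K : Config n) (p : Fin n) : K.Prog (K.clear p) := by
  refine ⟨List.prefix_rfl, subset_rfl, fun q => ?_, fun q k _ => ?_⟩
  · rw [(K.grow_clear p).callId]
  · by_cases hq : q = p
    · subst hq; simp [Config.clear]
    · simp [Config.clear, hq]

lemma Config.prog_recv_one (K : Config n) (p : Fin n) (m : Packet n) :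
    K.Prog (K.recv p [m]) ∧ ∀ q, ((K.recv p [m]).procs q).inbox = (K.procs q).inbox := by
  obtain ⟨src, dst, body⟩ := m
  have hpr : ∀ q, ((K.recv p [⟨src, dst, body⟩]).procs q).callId = (K.procs q).callId ∧
      ((K.recv p [⟨src, dst, body⟩]).procs q).inbox = (K.procs q).inbox ∧
      ∀ k, ((K.procs q).replies k).isSome →
        (((K.recv p [⟨src, dst, body⟩]).procs q).replies k).isSome := by
    intro q
    by_cases hq : q = p
    · subst hq
      cases body with
      | request id c => simp [Config.recv, receiveAll, receive]
      | ack id W =>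
        simp only [Config.recv, receiveAll, receive, Function.update_self]
        split_ifs
        · refine ⟨rfl, rfl, fun k hk => ?_⟩
          simp only [Function.update_apply]
          split_ifs
          · rfl
          · exact hk
        · exact ⟨rfl, rfl, fun _ h => h⟩
    · simp [Config.recv, hq]
  exact ⟨⟨List.prefix_append _ _, subset_rfl, fun q => (hpr q).1.ge,
    fun q k _ => (hpr q).2.2 k⟩, fun q => (hpr q).2.1⟩

lemma Config.prog_recv (K : Config n) (p : Fin n) (ms : List (Packet n)) :
    K.Prog (K.recv p ms) ∧ ∀ q, ((K.recv p ms).procs q).inbox = (K.procs q).inbox := by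
  induction ms generalizing K with
  | nil => rw [Config.recv_nil]; exact ⟨Config.Prog.refl K, fun _ => rfl⟩
  | cons m ms ih =>
    rw [Config.recv_cons]
    obtain ⟨h1, h2⟩ := K.prog_recv_one p m
    obtain ⟨h3, h4⟩ := ih (K.recv p [m])
    exact ⟨h1.trans h3, fun q => (h4 q).trans (h2 q)⟩

lemma Config.prog_drain (K : Config n) (p : Fin n) : K.Prog (K.drain p) :=
  (K.prog_clear p).trans (Config.prog_recv _ p _).1

lemma Config.prog_advance (K : Config n) (p : Fin n) (c : unitInterval) :
    K.Prog (K.advance p c) := by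
  have hid := K.advance_callId p c
  refine ⟨List.prefix_append _ _, subset_rfl, fun q => ?_, fun q k hk => ?_⟩
  · rw [hid, Function.update_apply]; split_ifs with hq
    · subst hq; omega
    · exact le_rfl
  · rw [hid, Function.update_apply] at hk
    split_ifs at hk with hq
    · subst hq; omega
    · simp [Config.advance, hq]

lemma Config.prog_deliver (K : Config n) (c : unitInterval) (i : ℕ) :
    K.Prog (K.apply c (.deliver i)) := by
  simp only [Config.apply]
  split_ifs
  · exact Config.Prog.refl K
  split
  · rename_i m _
    refine ⟨List.prefix_rfl, Finset.subset_insert _ _, fun q => ?_, fun q k _ => ?_⟩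
    · by_cases hq : q = m.dst
      · subst hq; simp [Config.callId]
      · simp [Config.callId, hq]
    · by_cases hq : q = m.dst
      · subst hq; simp
      · simp [hq]
  · exact Config.Prog.refl K

lemma Config.prog_apply (K : Config n) (c : unitInterval) (m : Move n) : K.Prog (K.apply c m) := by
  cases m with
  | deliver i => exact K.prog_deliver c i
  | step p =>
    rw [Config.apply_step]
    split_ifs
    · exact (K.prog_drain p).trans (Config.prog_advance _ p c)
    · exact K.prog_drain p

/-- A message has been processed by its recipient. -/
def Config.Handled (K : Config n) (m : Packet n) : Prop :=
  match m.body with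
  | .request id _ => ∃ W, (⟨m.dst, m.src, .ack id W⟩ : Packet n) ∈ K.packets
  | .ack id _ => id ≤ K.callId m.dst ∧
      (id = K.callId m.dst → ((K.procs m.dst).replies m.src).isSome)

lemma Config.Handled.mono {K K' : Config n} (h : K.Prog K') {m : Packet n} (hm : K.Handled m) :
    K'.Handled m := by
  unfold Config.Handled at hm ⊢
  split at hm
  · obtain ⟨W, hW⟩ := hm; exact ⟨W, h.packets.subset hW⟩
  · have h1 := h.callId m.dst
    exact ⟨hm.1.trans h1, fun h2 => h.replies _ _ (by omega) (hm.2 (by omega))⟩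

lemma Comm.handled_recv_one {K : Config n} {T : View n} {snap} (h : Comm K T snap)
    {m : Packet n} (hm : m ∈ K.packets) : (K.recv m.dst [m]).Handled m := by
  obtain ⟨src, dst, body⟩ := m
  cases body with
  | request id c =>
    exact ⟨_, List.mem_append_right _ (by simp [receiveAll, receive]; rfl)⟩
  | ack id W =>
    have h1 := (h.ack _ hm id W rfl).2.1
    have h2 := (h.recv_one hm rfl).2.callId
    unfold Config.Handled
    simp only at h1 h2 ⊢
    rw [h2]
    refine ⟨h1, fun h3 => ?_⟩
    subst h3
    simp [Config.recv, receiveAll, receive, Config.callId]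

lemma Comm.handled_recv {K : Config n} {T : View n} {snap} (h : Comm K T snap) {p : Fin n}
    {ms : List (Packet n)} (hms : ∀ m ∈ ms, m ∈ K.packets ∧ m.dst = p) :
    ∀ m ∈ ms, (K.recv p ms).Handled m := by
  induction ms generalizing K with
  | nil => simp
  | cons m ms ih =>
    intro m' hm'
    rw [Config.recv_cons]
    have hm := hms m (by simp)
    rcases List.mem_cons.1 hm' with rfl | hm'
    · have := h.handled_recv_one hm.1
      rw [hm.2] at this
      exact this.mono (Config.prog_recv _ p _).1
    · exact ih (h.recv_one hm.1 hm.2).1 (fun m'' h'' =>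
        ⟨List.mem_append_left _ (hms m'' (by simp [h''])).1, (hms m'' (by simp [h''])).2⟩) m' hm'

lemma Comm.handled_drain {K : Config n} {T : View n} {snap} (h : Comm K T snap) (p : Fin n)
    {m : Packet n} (hm : m ∈ (K.procs p).inbox) : (K.drain p).Handled m :=
  (h.clear p).handled_recv (fun m hm => h.inbox p m hm) m hm

/-- Delivered messages are in the inbox of the recipient or have been processed; the requests of
the current calls have been sent. -/
structure Config.Live (K : Config n) : Prop where
  delivered : ∀ i ∈ K.delivered, ∃ m, K.packets[i]? = some m ∧
    (m ∈ (K.procs m.dst).inbox ∨ K.Handled m)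
  requests : ∀ p cl, (K.pc p).call p = some cl → ∀ q,
    (⟨p, q, .request (K.callId p) cl⟩ : Packet n) ∈ K.packets
  start : ∀ p, K.pc p = .start ↔ K.callId p = 0

lemma Config.Live.initial : (Config.initial n).Live := by
  refine ⟨by simp [Config.initial], ?_, ?_⟩
  · intro p cl h; simp [Config.pc, Config.initial, PC.call] at h
  · intro p; simp [Config.pc, Config.callId, Config.initial]

lemma prefix_getElem? {α : Type*} {l l' : List α} (h : l <+: l') {i : ℕ} {a : α}
    (ha : l[i]? = some a) : l'[i]? = some a := by
  obtain ⟨t, rfl⟩ := h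
  rw [List.getElem?_append_left (List.getElem?_eq_some_iff.1 ha).1]; exact ha

lemma Config.Live.grow {K K' : Config n} (h : K.Live) (hp : K.Prog K') (hg : K.Grow K')
    (hd : ∀ i ∈ K'.delivered, ∃ m, K'.packets[i]? = some m ∧
      (m ∈ (K'.procs m.dst).inbox ∨ K'.Handled m)) : K'.Live :=
  ⟨hd, by
    rw [hg.pc, hg.callId]
    exact fun p cl hcl q => hp.packets.subset (h.requests p cl hcl q), by
    rw [hg.pc, hg.callId]; exact h.start⟩

lemma Config.Live.deliver {K : Config n} (h : K.Live) {T : View n} {snap} (hc : Comm K T snap)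
    (c : unitInterval) (i : ℕ) : (K.apply c (.deliver i)).Live := by
  refine h.grow (K.prog_deliver c i) (hc.deliver c i).2.1 ?_
  intro j hj
  have hpr := K.prog_deliver c i
  have hinb : ∀ q, ∀ m ∈ (K.procs q).inbox, m ∈ ((K.apply c (.deliver i)).procs q).inbox := by
    intro q m hm
    simp only [Config.apply]
    split_ifs
    · exact hm
    split
    · rename_i m' _
      by_cases hq : q = m'.dst
      · subst hq; simp [hm]
      · simp [hq, hm]
    · exact hm
  by_cases hj' : j ∈ K.delivered
  · obtain ⟨m, h1, h2⟩ := h.delivered j hj'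
    exact ⟨m, prefix_getElem? hpr.packets h1, h2.imp (hinb _ _) fun h => h.mono hpr⟩
  · simp only [Config.apply] at hj ⊢
    split_ifs at hj ⊢ with hi
    · exact absurd hj hj'
    cases hm : K.packets[i]? with
    | none => simp only [hm] at hj; exact absurd hj hj'
    | some m =>
      simp only [hm] at hj ⊢
      rcases Finset.mem_insert.1 hj with rfl | hj
      · exact ⟨m, hm, Or.inl (by simp)⟩
      · exact absurd hj hj'

/-- A delivered message waits in the inbox at most until the next step of its recipient, even if
that processor has returned. -/
lemma Config.Live.handled_drain {K : Config n} (h : K.Live) {T : View n} {snap}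
    (hc : Comm K T snap) {i : ℕ} (hi : i ∈ K.delivered) {m : Packet n}
    (hm : K.packets[i]? = some m) : (K.drain m.dst).Handled m := by
  obtain ⟨m', h1, h2⟩ := h.delivered i hi
  rw [hm] at h1; cases h1
  rcases h2 with h2 | h2
  · exact hc.handled_drain _ h2
  · exact h2.mono (K.prog_drain _)

lemma Config.Live.drain {K : Config n} (h : K.Live) {T : View n} {snap} (hc : Comm K T snap)
    (p : Fin n) : (K.drain p).Live := by
  have hpr := K.prog_drain p
  refine h.grow hpr (hc.drain p).2 ?_
  intro i hi
  obtain ⟨m, h1, h2⟩ := h.delivered i hi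
  refine ⟨m, prefix_getElem? hpr.packets h1, ?_⟩
  by_cases hm : m.dst = p
  · subst hm; exact Or.inr (h.handled_drain hc hi h1)
  · refine h2.imp (fun h3 => ?_) fun h => h.mono hpr
    rw [Config.drain, (Config.prog_recv _ p _).2]
    simpa [Config.clear, hm] using h3

lemma next_ne_start (p : Fin n) (V : View n) (views : Fin n → Option (View n)) (c : unitInterval)
    (X : PC n) : (next p V views c X).2 ≠ .start := by
  cases X <;> simp only [next] <;> (repeat' split) <;> simp

lemma Config.Live.advance {K : Config n} (h : K.Live) (p : Fin n) (c : unitInterval) :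
    (K.advance p c).Live := by
  have hpr := K.prog_advance p c
  have hpc := K.advance_pc p c
  have hid := K.advance_callId p c
  refine ⟨?_, ?_, ?_⟩
  · intro i hi
    obtain ⟨m, h1, h2⟩ := h.delivered i hi
    refine ⟨m, prefix_getElem? hpr.packets h1, h2.imp (fun h3 => ?_) fun h => h.mono hpr⟩
    by_cases hm : m.dst = p
    · rw [hm] at h3 ⊢; simpa [Config.advance, Renaming.advance] using h3
    · simpa [Config.advance, hm] using h3
  · intro q cl hcl k
    rw [hpc] at hcl
    rw [hid]
    by_cases hq : q = p
    · subst hq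
      rw [Function.update_self] at hcl ⊢
      refine List.mem_append_right _ ?_
      have hcl' : (next q (K.procs q).view (K.procs q).replies c (K.procs q).pc).2.call q =
        some cl := hcl
      simp only [Renaming.advance, hcl', List.mem_map]
      exact ⟨k, List.mem_finRange k, rfl⟩
    · rw [Function.update_of_ne hq] at hcl ⊢
      exact hpr.packets.subset (h.requests q cl hcl k)
  · intro q
    rw [hpc, hid]
    by_cases hq : q = p
    · subst hq
      simp [next_ne_start]
    · simp only [Function.update_of_ne hq]; exact h.start q

/-! ### Timing of messages and calls -/

lemma config_succ (A : Adversary n) (ω : Coins) (k : ℕ) :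
    config A ω (k + 1) = (config A ω k).apply (ω k) (choice A ω k).1 := rfl

lemma exists_comm (A : Adversary n) (p₀ : Fin n) (ω : Coins) (k : ℕ) :
    ∃ T snap, Comm (config A ω k) T snap := by
  have := (World.good A p₀ ω k).comm
  rw [config, World.run_eq A p₀]
  exact ⟨_, _, this⟩

lemma config_live (A : Adversary n) (p₀ : Fin n) (ω : Coins) (k : ℕ) : (config A ω k).Live := by
  induction k with
  | zero => exact Config.Live.initial
  | succ k ih =>
    obtain ⟨T, snap, hc⟩ := exists_comm A p₀ ω k
    rw [config_succ]
    cases (choice A ω k).1 with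
    | deliver i => exact ih.deliver hc _ i
    | step p =>
      rw [Config.apply_step]
      split_ifs
      · exact (ih.drain hc p).advance p _
      · exact ih.drain hc p

lemma config_prog (A : Adversary n) (ω : Coins) {k k' : ℕ} (h : k ≤ k') :
    (config A ω k).Prog (config A ω k') := by
  induction k', h using Nat.le_induction with
  | base => exact Config.Prog.refl _
  | succ k' _ ih => exact ih.trans (Config.prog_apply _ _ _)

lemma time_mono (A : Adversary n) (ω : Coins) : Monotone (time A ω) := by
  intro k k' h
  exact Finset.sum_le_sum_of_subset (Finset.range_mono (by omega))

/-- Every message is sent in some move. -/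
lemma exists_sends (A : Adversary n) (ω : Coins) {k i : ℕ} {m : Packet n}
    (h : (config A ω (k + 1)).packets[i]? = some m) : ∃ k' ≤ k, Sends A ω m.src k' i := by
  induction k with
  | zero => exact ⟨0, le_rfl, Nat.zero_le _, m, h, rfl⟩
  | succ k ih =>
    by_cases hi : (config A ω (k + 1)).packets.length ≤ i
    · exact ⟨k + 1, le_rfl, hi, m, h, rfl⟩
    · obtain ⟨m', hm'⟩ : ∃ m', (config A ω (k + 1)).packets[i]? = some m' :=
        ⟨_, List.getElem?_eq_getElem (not_le.1 hi)⟩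
      have h2 := prefix_getElem? (config_prog A ω (Nat.le_succ (k + 1))).packets hm'
      rw [h] at h2; cases h2
      obtain ⟨k', h3, h4⟩ := ih hm'
      exact ⟨k', by omega, h4⟩

/-- The time bound is applied to the last step of q up to the move k, or to its first step if it has
not taken one. -/
lemma exists_step_after {A : Adversary n} {ω : Coins} {t₁ t₂ : ℝ≥0} {q : Fin n}
    (h : Timely A ω t₁ t₂ q) (k : ℕ) : ∃ k' > k, StepsAt A ω q k' ∧ time A ω k' ≤ time A ω k + t₂ := by
  obtain ⟨-, ⟨k₀, h1, h2⟩, h3⟩ := h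
  by_cases hk : ∃ j ≤ k, StepsAt A ω q j
  · have hs : ((Finset.range (k + 1)).filter fun j => StepsAt A ω q j).Nonempty := by
      obtain ⟨j, hj, hj'⟩ := hk
      exact ⟨j, by simp [hj']; omega⟩
    obtain ⟨j, hj, hmax⟩ := Finset.exists_max_image _ id hs
    rw [Finset.mem_filter, Finset.mem_range] at hj
    obtain ⟨k', h4, h5, h6⟩ := h3 j hj.2
    refine ⟨k', ?_, h5, h6.trans (add_le_add_left (time_mono A ω (by omega)) _)⟩
    by_contra hc
    have := hmax k' (by simp [h5]; omega)
    simp at this; omega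
  · push Not at hk
    refine ⟨k₀, ?_, h1, h2.trans le_add_self⟩
    by_contra hc
    exact hk k₀ (by omega) h1

/-- A message of a non-faulty processor is delivered in time. -/
lemma exists_delivered {A : Adversary n} {ω : Coins} {t₁ t₂ : ℝ≥0} {m : Packet n}
    (h : Timely A ω t₁ t₂ m.src) {k : ℕ} (hm : m ∈ (config A ω (k + 1)).packets) :
    ∃ i k', (config A ω (k + 1)).packets[i]? = some m ∧ DeliveredBy A ω k' i ∧
      time A ω k' ≤ time A ω k + t₁ := by
  obtain ⟨i, hi⟩ := List.getElem?_of_mem hm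
  obtain ⟨k₁, h1, h2⟩ := exists_sends A ω hi
  obtain ⟨k', h3, h4⟩ := h.1 k₁ i h2
  exact ⟨i, k', hi, h3, h4.trans (add_le_add_left (time_mono A ω h1) _)⟩

lemma drain_handled {A : Adversary n} {ω : Coins} {k k' i : ℕ} {m : Packet n}
    (hk' : k' < k) (hi : DeliveredBy A ω k' i) {j : ℕ}
    (hm : (config A ω j).packets[i]? = some m) (hj : j ≤ k) :
    ((config A ω k).drain m.dst).Handled m := by
  obtain ⟨T, snap, hc⟩ := exists_comm A m.dst ω k
  exact (config_live A m.dst ω k).handled_drain hc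
    ((config_prog A ω (by omega : k' + 1 ≤ k)).delivered hi)
    (prefix_getElem? (config_prog A ω hj).packets hm)

lemma prog_drain_step {A : Adversary n} {ω : Coins} {k : ℕ} {p : Fin n} (hk : StepsAt A ω p k) :
    ((config A ω k).drain p).Prog (config A ω (k + 1)) := by
  rw [config_succ, hk, Config.apply_step]
  split_ifs
  · exact Config.prog_advance _ _ _
  · exact Config.Prog.refl _

lemma callId_step {A : Adversary n} {ω : Coins} {k : ℕ} {p : Fin n} (hk : StepsAt A ω p k)
    (hr : (((config A ω k).drain p).procs p).ready) :
    (config A ω (k + 1)).callId p = ((config A ω k).drain p).callId p + 1 := by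
  rw [config_succ, hk, Config.apply_step, if_pos hr, Config.advance_callId, Function.update_self]

/-- The acknowledgement of a request by a non-faulty processor arrives in time. -/
lemma exists_ack {A : Adversary n} {ω : Coins} {t₁ t₂ : ℝ≥0} {p q : Fin n}
    (hp : Timely A ω t₁ t₂ p) (hq : Timely A ω t₁ t₂ q) {k id : ℕ} {cl : Call n}
    (hm : (⟨p, q, .request id cl⟩ : Packet n) ∈ (config A ω (k + 1)).packets) :
    ∃ i j k' W, (config A ω j).packets[i]? = some ⟨q, p, .ack id W⟩ ∧ j ≤ k' + 1 ∧
      DeliveredBy A ω k' i ∧ time A ω k' ≤ time A ω k + (2 * t₁ + t₂) := by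
  obtain ⟨i, k₁, h1, h2, h3⟩ := exists_delivered (m := ⟨p, q, .request id cl⟩) hp hm
  obtain ⟨k₂, h4, h5, h6⟩ := exists_step_after hq (max k k₁)
  have h7 := drain_handled (m := ⟨p, q, .request id cl⟩) (by omega : k₁ < k₂) h2 h1 (by omega)
  obtain ⟨W, hW⟩ := h7.mono (prog_drain_step h5)
  obtain ⟨i', k₃, h8, h9, h10⟩ := exists_delivered (m := ⟨q, p, .ack id W⟩) hq hW
  have h11 : time A ω (max k k₁) ≤ time A ω k + t₁ := by
    rcases le_total k k₁ with h | h
    · rw [max_eq_right h]; exact h3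
    · rw [max_eq_left h]; exact le_self_add
  refine ⟨i', k₂ + 1, max k₃ k₂, W, h8, by omega,
    (config_prog A ω (by omega : k₃ + 1 ≤ max k₃ k₂ + 1)).delivered h9, ?_⟩
  have h12 : time A ω (max k₃ k₂) ≤ time A ω k₂ + t₁ := by
    rcases le_total k₃ k₂ with h | h
    · rw [max_eq_right h]; exact le_self_add
    · rw [max_eq_left h]; exact h10
  calc _ ≤ time A ω k₂ + t₁ := h12
    _ ≤ (time A ω (max k k₁) + t₂) + t₁ := by gcongr
    _ ≤ ((time A ω k + t₁) + t₂) + t₁ := by gcongr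
    _ = _ := by ring

def PC.Returned (X : PC n) : Prop := ∃ u, X = .returned u

lemma ready_of_card {L : Local n} (hs : L.pc ≠ .start) (hr : ¬ L.pc.Returned)
    (h : n < 2 * (Finset.univ.filter fun k => (L.replies k).isSome).card) : L.ready := by
  unfold Local.ready
  cases hX : L.pc with
  | start => exact absurd hX hs
  | returned u => exact absurd ⟨u, hX⟩ hr
  | _ => simp only; convert h

lemma exists_call {X : PC n} (hs : X ≠ .start) (hr : ¬ X.Returned) (p : Fin n) :
    ∃ cl, X.call p = some cl := by
  cases X <;> first
    | exact absurd rfl hs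
    | exact absurd ⟨_, rfl⟩ hr
    | exact ⟨_, rfl⟩

/-- Every call of a non-faulty processor is completed in time. -/
lemma exists_next_call {A : Adversary n} {ω : Coins} {t₁ t₂ : ℝ≥0} (hA : Admissible A ω t₁ t₂)
    {p : Fin n} (hp : NonFaulty A ω p) {k : ℕ} (hs : 1 ≤ (config A ω (k + 1)).callId p)
    (hr : ¬ ((config A ω (k + 1)).pc p).Returned) :
    ∃ k', time A ω k' ≤ time A ω k + 2 * (t₁ + t₂) ∧
      (((config A ω (k' + 1)).pc p).Returned ∨
        (config A ω (k + 1)).callId p + 1 ≤ (config A ω (k' + 1)).callId p) := by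
  obtain ⟨hF, hT⟩ := hA
  have hTp := hT p hp
  have hlive := config_live A p ω (k + 1)
  obtain ⟨cl, hcl⟩ := exists_call (fun h => by have := (hlive.start p).1 h; omega) hr p
  have hack : ∀ q, NonFaulty A ω q → _ := fun q hq =>
    exists_ack hTp (hT q hq) (hlive.requests p cl hcl q)
  choose i j k' W h1 h2 h3 h4 using hack
  -- A move by which the acknowledgements of all the non-faulty processors have been delivered: the
  -- latest of finitely many.
  have hmax : ∃ k₁, time A ω k₁ ≤ time A ω k + (2 * t₁ + t₂) ∧ k ≤ k₁ ∧
      ∀ q hq, k' q hq ≤ k₁ := by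
    let f : Fin n → ℕ := fun q => if hq : NonFaulty A ω q then max k (k' q hq) else k
    obtain ⟨q, -, hq⟩ := Finset.exists_max_image Finset.univ f ⟨p, Finset.mem_univ p⟩
    refine ⟨f q, ?_, ?_, fun q' hq' => ?_⟩
    · simp only [f]
      split_ifs with hq
      · rcases le_total k (k' q hq) with h | h
        · rw [max_eq_right h]; exact h4 q hq
        · rw [max_eq_left h]; exact le_self_add
      · exact le_self_add
    · simp only [f]; split_ifs
      · exact le_max_left _ _
      · exact le_rfl
    · refine le_trans ?_ (hq q' (Finset.mem_univ _))
      simp only [f]; rw [dif_pos hq']; exact le_max_right _ _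
  obtain ⟨k₁, h5, h6, h7⟩ := hmax
  obtain ⟨k₂, h8, h9, h10⟩ := exists_step_after hTp k₁
  have htime : time A ω k₂ ≤ time A ω k + 2 * (t₁ + t₂) :=
    calc _ ≤ time A ω k₁ + t₂ := h10
      _ ≤ (time A ω k + (2 * t₁ + t₂)) + t₂ := by gcongr
      _ = _ := by ring
  refine ⟨k₂, htime, ?_⟩
  -- If p were still in the same call after its step k₂, it would have received the acknowledgements
  -- of all non-faulty processors. These are a majority, so p would have gone on in that step.
  by_contra hc
  push Not at hc
  have hpr := prog_drain_step h9
  have hpr' : (config A ω (k + 1)).Prog ((config A ω k₂).drain p) :=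
    (config_prog A ω (by omega)).trans (Config.prog_drain _ p)
  have hid1 := hpr.callId p
  have hid2 := hpr'.callId p
  have hid : ((config A ω k₂).drain p).callId p = (config A ω (k + 1)).callId p := by omega
  obtain ⟨T, snap, hcm⟩ := exists_comm A p ω k₂
  have hlive' := (config_live A p ω k₂).drain hcm p
  have hready : (((config A ω k₂).drain p).procs p).ready := by
    refine ready_of_card (fun h => ?_) (fun h => ?_) ?_
    · have := (hlive'.start p).1 h; omega
    · obtain ⟨u, hu⟩ := h
      refine hc.1 ⟨u, ?_⟩
      rw [config_succ, h9, Config.apply_step, if_neg]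
      · exact hu
      · unfold Local.ready; rw [hu]; exact id
    · have h11 : (Finset.univ.filter fun q => NonFaulty A ω q) ⊆ Finset.univ.filter fun q =>
          ((((config A ω k₂).drain p).procs p).replies q).isSome := by
        intro q hq
        simp only [Finset.mem_filter, Finset.mem_univ, true_and] at hq ⊢
        have := drain_handled (m := ⟨q, p, .ack _ (W q hq)⟩) (k := k₂)
          (by have := h7 q hq; omega) (h3 q hq) (h1 q hq)
          (by have := h7 q hq; have := h2 q hq; omega)
        exact this.2 hid.symm
      have h12 := Finset.card_le_card h11
      have h13 := Finset.card_filter_add_card_filter_not (s := (Finset.univ : Finset (Fin n)))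
        (fun q => NonFaulty A ω q)
      rw [Finset.card_univ, Fintype.card_fin] at h13
      omega
  have := callId_step h9 hready
  omega

/-- The time complexity in terms of the number of calls. -/
theorem returnTime_le {A : Adversary n} {ω : Coins} {t₁ t₂ : ℝ≥0} (hA : Admissible A ω t₁ t₂)
    {p : Fin n} (hp : NonFaulty A ω p) {J : ℕ} (hJ : ∀ k, (config A ω k).callId p ≤ J) :
    returnTime A ω p ≤ (((2 * J + 1) * (t₁ + t₂) : ℝ≥0) : ℝ≥0∞) := by
  -- The first step, by time t₂, starts the first call, and each later call begins within another
  -- 2(t₁ + t₂). As the call number never exceeds J, p has returned after J such intervals.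
  have key : ∀ j : ℕ, ∃ k, time A ω k ≤ t₂ + j * (2 * (t₁ + t₂)) ∧
      (((config A ω (k + 1)).pc p).Returned ∨ j + 1 ≤ (config A ω (k + 1)).callId p) := by
    intro j
    induction j with
    | zero =>
      obtain ⟨k, h1, h2⟩ := (hA.2 p hp).2.1
      refine ⟨k, by simpa using h2, ?_⟩
      right
      by_cases h3 : (config A ω k).callId p = 0
      · obtain ⟨T, snap, hcm⟩ := exists_comm A p ω k
        have h4 := ((config_live A p ω k).drain hcm p).start p
        have h5 := (hcm.drain p).2.callId
        rw [h5] at h4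
        have h6 : (((config A ω k).drain p).procs p).pc = .start := h4.2 h3
        have := callId_step h1 (by unfold Local.ready; rw [h6]; trivial)
        omega
      · have := (config_prog A ω (by omega : k ≤ k + 1)).callId p
        omega
    | succ j ih =>
      obtain ⟨k, h1, h2⟩ := ih
      have hmono : t₂ + j * (2 * (t₁ + t₂)) ≤ t₂ + (j + 1 : ℕ) * (2 * (t₁ + t₂)) := by
        push_cast; gcongr; simp
      by_cases hr : ((config A ω (k + 1)).pc p).Returned
      · exact ⟨k, h1.trans hmono, Or.inl hr⟩
      · have h3 := h2.resolve_left hr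
        obtain ⟨k', h4, h5⟩ := exists_next_call hA hp (by omega) hr
        refine ⟨k', h4.trans ?_, h5.imp id fun h => by omega⟩
        calc _ ≤ t₂ + j * (2 * (t₁ + t₂)) + 2 * (t₁ + t₂) := by gcongr
          _ = _ := by push_cast; ring
  obtain ⟨k, h1, h2⟩ := key J
  have h3 := h2.resolve_right (by have := hJ (k + 1); omega)
  refine (iInf₂_le k h3).trans ?_
  refine ENNReal.coe_le_coe.2 (h1.trans ?_)
  calc t₂ + J * (2 * (t₁ + t₂)) ≤ (t₁ + t₂) + J * (2 * (t₁ + t₂)) := by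
        gcongr; exact le_add_self
    _ = _ := by ring

/-! ## The expected number of calls -/

/-- With the smallest m such that ω is outside the m-th set, either m = 0 or ω lies in the preceding
set. So the integral is at most B + Σ 8^(m+1) B · 6/16^m = B + 96 B. Neither X nor the sets are
assumed measurable, which is why measurable hulls are used. -/
lemma lintegral_le_of_tail {Ω : Type*} [MeasurableSpace Ω] {μ : Measure Ω} [IsProbabilityMeasure μ]
    {X : Ω → ℝ≥0∞} {E : ℕ → Set Ω} {B : ℝ} (hB : 0 ≤ B)
    (hE : ∀ m, μ (E m) ≤ ENNReal.ofReal (6 / 16 ^ m))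
    (hX : ∀ᵐ ω ∂μ, ∀ m, ω ∉ E m → X ω ≤ ENNReal.ofReal (8 ^ m * B)) :
    ∫⁻ ω, X ω ∂μ ≤ ENNReal.ofReal (97 * B) := by
  let E' : ℕ → Set Ω := fun m => toMeasurable μ (E m)
  have hE' : ∀ m, MeasurableSet (E' m) := fun m => measurableSet_toMeasurable _ _
  have hμ : ∀ m, μ (E' m) ≤ ENNReal.ofReal (6 / 16 ^ m) := fun m => by
    simp only [E']; rw [measure_toMeasurable]; exact hE m
  have hgeom : ∀ c : ℝ, 0 ≤ c → ∑' m : ℕ, ENNReal.ofReal (c * (1 / 2) ^ m) =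
      ENNReal.ofReal (c * 2) := by
    intro c hc
    rw [← ENNReal.ofReal_tsum_of_nonneg (fun m => by positivity)
      (summable_geometric_two.mul_left c), tsum_mul_left, tsum_geometric_two]
  have hfin : ∑' m, μ (E' m) ≠ ∞ := by
    refine ne_top_of_le_ne_top ?_ (ENNReal.tsum_le_tsum fun m => (hμ m).trans
      (ENNReal.ofReal_le_ofReal (?_ : (6 : ℝ) / 16 ^ m ≤ 6 * (1 / 2) ^ m)))
    · rw [hgeom 6 (by norm_num)]; exact ENNReal.ofReal_ne_top
    · rw [div_eq_mul_one_div, ← one_div_pow]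
      gcongr; norm_num
  -- Borel–Cantelli: almost every point is outside one of the hulls, so the smallest m exists.
  have hev := ae_eventually_notMem hfin
  calc ∫⁻ ω, X ω ∂μ
      ≤ ∫⁻ ω, (ENNReal.ofReal B + ∑' m, (E' m).indicator
          (fun _ => ENNReal.ofReal (8 ^ (m + 1) * B)) ω) ∂μ := by
        refine lintegral_mono_ae ?_
        filter_upwards [hX, hev] with ω h1 h2
        have h3 : ∃ m, ω ∉ E' m := h2.exists
        have h4 := Nat.find_spec h3
        have h5 := h1 _ (fun h => h4 (subset_toMeasurable μ _ h))
        cases hm : Nat.find h3 with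
        | zero =>
          rw [hm] at h5
          exact (h5.trans (by simp)).trans le_self_add
        | succ m =>
          rw [hm] at h5
          have h6 : ω ∈ E' m := not_not.1 (Nat.find_min h3 (by omega))
          refine (h5.trans ?_).trans le_add_self
          refine le_trans ?_ (ENNReal.le_tsum m)
          rw [Set.indicator_of_mem h6]
    _ = ENNReal.ofReal B + ∑' m, ENNReal.ofReal (8 ^ (m + 1) * B) * μ (E' m) := by
        rw [lintegral_add_left measurable_const, lintegral_const, measure_univ, mul_one,
          lintegral_tsum fun m => (measurable_const.indicator (hE' m)).aemeasurable]
        congr 2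
        ext m
        rw [lintegral_indicator_const (hE' m)]
    _ ≤ ENNReal.ofReal B + ∑' m : ℕ, ENNReal.ofReal (48 * B * (1 / 2) ^ m) := by
        gcongr with m
        refine (mul_le_mul_right (hμ m) _).trans ?_
        rw [← ENNReal.ofReal_mul (by positivity)]
        refine ENNReal.ofReal_le_ofReal (le_of_eq ?_)
        have h16 : (16 : ℝ) ^ m = 8 ^ m * 2 ^ m := by rw [← mul_pow]; norm_num
        rw [h16, one_div_pow, pow_succ]
        field_simp
        ring
    _ = ENNReal.ofReal (97 * B) := by
        rw [hgeom _ (by positivity), ← ENNReal.ofReal_add hB (by positivity)]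
        congr 1; ring

/-! ### Initial values of the potentials and exceptional events -/

lemma le_two_mul_log (hn : 2 ≤ n) : 1 ≤ 2 * Real.log n := by
  have h1 := Real.log_two_gt_d9
  have h2 : Real.log 2 ≤ Real.log n := Real.log_le_log (by norm_num) (by exact_mod_cast hn)
  linarith

/-- Bounding every harmonic number in the sum by that of n gives 2 H_n², and H_n ≤ 1 + log n ≤ 3 log
n. The lower bound is the term j = 0. -/
lemma singleBound_initial_le (hn : 2 ≤ n) :
    2 ≤ singleBound n 0 ∧ singleBound n 0 ≤ 18 * Real.log n ^ 2 := by
  have hl := le_two_mul_log hn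
  have hH : (harmonic n : ℝ) ≤ 3 * Real.log n := by
    have := harmonic_le_one_add_log n; linarith
  have e : singleBound n 0 = ∑ j ∈ Finset.range n, 2 * (harmonic (j + 1) : ℝ) / (j + 1) := by
    simp [singleBound]
  have hterm : ∀ j ∈ Finset.range n, 0 ≤ 2 * (harmonic (j + 1) : ℝ) / (j + 1) := fun j _ => by
    have := harmonic_cast_nonneg (j + 1); positivity
  have hmono : ∀ j ∈ Finset.range n, (harmonic (j + 1) : ℝ) ≤ harmonic n := by
    intro j hj
    unfold harmonic
    push_cast
    exact Finset.sum_le_sum_of_subset_of_nonneg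
      (Finset.range_mono (by have := Finset.mem_range.1 hj; omega)) fun i _ _ => by positivity
  rw [e]
  constructor
  · refine le_trans ?_ (Finset.single_le_sum hterm (Finset.mem_range.2 (by omega : 0 < n)))
    simp
  · calc _ ≤ ∑ j ∈ Finset.range n, 2 * (harmonic n : ℝ) * (1 / (j + 1)) := by
          refine Finset.sum_le_sum fun j hj => ?_
          rw [mul_one_div]
          have := hmono j hj
          gcongr
      _ = 2 * (harmonic n : ℝ) * harmonic n := by
          rw [← Finset.mul_sum]
          congr 1
          simp [harmonic]
      _ ≤ 2 * (3 * Real.log n) * (3 * Real.log n) := by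
          have := harmonic_cast_nonneg n; gcongr
      _ = _ := by ring

/-- Some potential is large at some time. -/
def exceptional (A : Adversary n) (p₀ : Fin n) (m : ℕ) : Set Coins :=
  {ω | ∃ k, singleBound n 0 * 16 ^ m ≤ singles (stateAt A p₀ ω k)} ∪
  ⋃ v : Fin n, ({ω | ∃ k, (n : ℝ) ^ 2 * 16 ^ m ≤ popularity v (stateAt A p₀ ω k)} ∪
    {ω | ∃ k, (n : ℝ) ^ 2 * 16 ^ m ≤ collisions v (stateAt A p₀ ω k)} ∪
    {ω | ∃ k, (n : ℝ) ^ 2 * 16 ^ m ≤ duration v (stateAt A p₀ ω k)})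

lemma initial_free_card (p₀ : Fin n) : (World.initial n p₀).state.ghost.free.card = n := by
  have : (World.initial n p₀).state.ghost.free = Finset.univ := by
    ext u; rw [mem_free]; simp [World.initial, World.state, Ghost.initial]
  rw [this, Finset.card_univ, Fintype.card_fin]

lemma measure_exceptional_le (hn : 2 ≤ n) (A : Adversary n) (p₀ : Fin n) (m : ℕ) :
    coinMeasure (exceptional A p₀ m) ≤ ENNReal.ofReal (6 / 16 ^ m) := by
  have hn' : (2 : ℝ) ≤ n := by exact_mod_cast hn
  have hZ := (singleBound_initial_le hn).1
  have hl : (0 : ℝ) < (n : ℝ) ^ 2 * 16 ^ m := by positivity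
  have h1 := super_singles.measure_le A p₀ (a := singleBound n 0 * 16 ^ m) (by positivity)
  have h2 := fun v => (super_popularity v).measure_le A p₀ hl
  have h3 := fun v => (super_collisions v).measure_le A p₀ hl
  have h4 := fun v => (super_duration v).measure_le A p₀ hl
  have hpc : ∀ v, (World.initial n p₀).state.pc v = .start := fun _ => rfl
  have e1 : singles (World.initial n p₀).state = singleBound n 0 := by
    have : (World.initial n p₀).state.single = ∅ := by
      ext v; simp [State.single, World.initial, World.state, Ghost.initial]
    rw [singles, this, initial_free_card, Finset.card_empty]
  have e2 : ∀ v, popularity v (World.initial n p₀).state = n + 1 := by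
    intro v
    rw [popularity, initial_free_card]
    simp [World.initial, World.state, Ghost.initial]
  have e3 : ∀ v, collisions v (World.initial n p₀).state = n + 1 := by
    intro v
    rw [collisions, initial_free_card, if_neg]
    · simp [World.initial, World.state, Tally.initial]
    · rintro ⟨u, hu, -⟩; rw [hpc] at hu; cases hu
  have e4 : ∀ v, duration v (World.initial n p₀).state = 1 := by
    intro v
    have : (World.initial n p₀).state.factor v = 1 := by
      unfold State.factor; rw [hpc]; rfl
    rw [duration, this]
    simp [World.initial, World.state, Tally.initial]
  simp only [e1, e2, e3, e4] at h1 h2 h3 h4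
  have h5 : singleBound n 0 / (singleBound n 0 * 16 ^ m) = 1 / 16 ^ m := by
    field_simp
  rw [h5] at h1
  -- The initial values n + 1, n + 1 and 1 stand against the threshold n² 16^m. The square leaves
  -- 5/16^m after the union over n processors; `singles` needs no union and contributes 1/16^m.
  have h6 : ∀ v : Fin n, coinMeasure
      ({ω | ∃ k, (n : ℝ) ^ 2 * 16 ^ m ≤ popularity v (stateAt A p₀ ω k)} ∪
      {ω | ∃ k, (n : ℝ) ^ 2 * 16 ^ m ≤ collisions v (stateAt A p₀ ω k)} ∪
      {ω | ∃ k, (n : ℝ) ^ 2 * 16 ^ m ≤ duration v (stateAt A p₀ ω k)}) ≤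
      ENNReal.ofReal (5 / (n * 16 ^ m)) := by
    intro v
    refine (measure_union_le _ _).trans ((add_le_add (measure_union_le _ _) le_rfl).trans ?_)
    refine (add_le_add (add_le_add (h2 v) (h3 v)) (h4 v)).trans ?_
    rw [← ENNReal.ofReal_add (by positivity) (by positivity),
      ← ENNReal.ofReal_add (by positivity) (by positivity)]
    refine ENNReal.ofReal_le_ofReal ?_
    rw [← add_div, ← add_div, div_le_div_iff₀ hl (by positivity)]
    have : (0 : ℝ) < 16 ^ m := by positivity
    have h7 : (n : ℝ) + 1 + (n + 1) + 1 ≤ 5 * n := by linarith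
    calc ((n : ℝ) + 1 + (n + 1) + 1) * (n * 16 ^ m) ≤ (5 * n) * (n * 16 ^ m) := by gcongr
      _ = _ := by ring
  unfold exceptional
  refine (measure_union_le _ _).trans ((add_le_add h1 (measure_iUnion_fintype_le _ _)).trans ?_)
  refine (add_le_add le_rfl (Finset.sum_le_sum fun v _ => h6 v)).trans ?_
  rw [Finset.sum_const, Finset.card_univ, Fintype.card_fin, nsmul_eq_mul,
    ← ENNReal.ofReal_natCast, ← ENNReal.ofReal_mul (by positivity),
    ← ENNReal.ofReal_add (by positivity) (by positivity)]
  refine ENNReal.ofReal_le_ofReal (le_of_eq ?_)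
  field_simp
  norm_num

/-- Only the quadratic term is used: s > 9a(f + 1) would give s(s - 1) ≥ 72 a²(f + 1)², whereas (f +
1)(f + 2) ≤ 2(f + 1)² allows at most 36 a²(f + 1)². -/
lemma single_le_of_singles_lt {f s : ℕ} {a : ℝ} (ha : 1 ≤ a) (h : singleBound f s ≤ 18 * a ^ 2) :
    (s : ℝ) ≤ 9 * a * (f + 1) := by
  by_contra! hc
  have h1 : (0 : ℝ) ≤ f := Nat.cast_nonneg f
  have h2 : (s : ℝ) * (s - 1) / ((f + 1) * (f + 2)) ≤ singleBound f s := by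
    unfold singleBound
    have h2 := harmonic_cast_nonneg (f + 1)
    have h3 : 0 ≤ ∑ j ∈ Finset.range f, 2 * (harmonic (j + 1) : ℝ) / (j + 1) :=
      Finset.sum_nonneg fun j _ => by have := harmonic_cast_nonneg (j + 1); positivity
    have h4 : 0 ≤ 2 * (harmonic (f + 1) : ℝ) * s / (f + 1) := by positivity
    linarith
  have h3 := h2.trans h
  rw [div_le_iff₀ (by positivity)] at h3
  have h4 : 9 * a * (f + 1) - 1 ≥ 8 * a * (f + 1) := by nlinarith
  have h5 : (9 * a * (f + 1)) * (8 * a * (f + 1)) ≤ s * (s - 1 : ℝ) := by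
    apply mul_le_mul hc.le (by linarith) (by positivity) (by positivity)
  have h6 : 18 * a ^ 2 * (((f : ℝ) + 1) * (f + 2)) ≤ 36 * a ^ 2 * (f + 1) ^ 2 := by
    have h7 : (f : ℝ) + 2 ≤ 2 * (f + 1) := by linarith
    calc _ ≤ 18 * a ^ 2 * (((f : ℝ) + 1) * (2 * (f + 1))) := by gcongr
      _ = _ := by ring
  have h7 : (0 : ℝ) < a ^ 2 * (f + 1) ^ 2 := by positivity
  nlinarith

lemma mul_log_le {b c : ℝ} (hb : 0 < b) {k : ℕ} (h : b ^ k ≤ c) :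
    k * Real.log b ≤ Real.log c := by
  rw [← Real.log_pow]; exact Real.log_le_log (by positivity) h

lemma sq_le_four_mul_two_pow (m : ℕ) : (m + 1) ^ 2 ≤ 4 * 2 ^ m := by
  induction m with
  | zero => norm_num
  | succ m ih =>
    rcases m with _ | _ | m
    · norm_num
    · norm_num
    · have e : 2 ^ (m + 1 + 1 + 1) = 2 ^ (m + 1 + 1) * 2 := pow_succ _ _
      have h : (m + 1 + 1 + 1 + 1) ^ 2 ≤ 2 * (m + 1 + 1 + 1) ^ 2 := by
        nlinarith [Nat.zero_le (m ^ 2), Nat.zero_le m]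
      rw [e]; linarith

/-- The rounds of an unfinished election are bounded by the same potential as those of the finished
ones; T is the top round, or 0 when p takes part in no round. -/
lemma Sound.exists_stage_le_factor {a : State n} (ha : a.sound) (p : Fin n) :
    ∃ T, (a.pc p).stage ≤ T + 1 ∧ (1000 / 997 : ℝ) ^ T ≤ a.factor p := by
  rcases Sound.stage_le ha p with h | ⟨u, h1, h2, h3⟩
  · exact ⟨0, by omega, by simpa using a.one_le_factor p⟩
  · refine ⟨a.ghost.top u, h3, ?_⟩
    unfold State.factor
    rw [h1]
    simp only [h2, if_true]
    exact a.ghost.pow_top_le_stake u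

/-- The arithmetic of the bounds. -/
lemma calls_arith {l x M L Q N k R T Y S H c : ℝ} (hl : 1 ≤ 2 * l) (hx : 1 ≤ x) (hM : 1 ≤ M)
    (hL : L ≤ 4 * M * l) (hY : Y ≤ 5 * L) (hQ : Q ≤ 6 * L) (hQ0 : 0 ≤ Q) (hH : H ≤ 3 * L)
    (hS : S ≤ 2 * l) (hN : N ≤ S + 4 * (1 + 9 * (2 * (l * x))) * Y)
    (hk : k ≤ 3 * N + Q * (H + 2)) (hR : (R + T) * (3 / 1000) ≤ L + k * 1000000)
    (hc : c ≤ 10 * N + 6 * R + 6 * (T + 1) + 2) : c ≤ 20000000000000 * (M ^ 2 * x * l ^ 2) := by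
  have hl0 : 0 < l := by linarith
  have hMl : 0 < M * l := by positivity
  have hx1 : l ≤ l * x := le_mul_of_one_le_right hl0.le hx
  have hM1 : l ≤ M * l := le_mul_of_one_le_left hl0.le hM
  have hl2 : l ≤ 2 * l ^ 2 := by nlinarith
  have e1 : M * x * l ^ 2 ≤ M ^ 2 * x * l ^ 2 := by
    have : M ≤ M ^ 2 := by nlinarith
    gcongr
  have e2 : M ^ 2 * l ^ 2 ≤ M ^ 2 * x * l ^ 2 := by
    have : M ^ 2 * l ^ 2 * 1 ≤ M ^ 2 * l ^ 2 * x := by gcongr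
    linarith
  have e3 : M * l ≤ 2 * (M ^ 2 * l ^ 2) := by nlinarith
  -- Everything is compared with W: the picks are of order M x l², the encounters times the
  -- popularity of order M² l², and all other terms are linear in l.
  set W := M ^ 2 * x * l ^ 2 with hW
  have f1 : 4 * (1 + 9 * (2 * (l * x))) * Y ≤ 1600 * W := by
    have g1 : 4 * (1 + 9 * (2 * (l * x))) ≤ 80 * (l * x) := by linarith
    have g2 : Y ≤ 20 * (M * l) := by linarith
    calc 4 * (1 + 9 * (2 * (l * x))) * Y ≤ 4 * (1 + 9 * (2 * (l * x))) * (20 * (M * l)) := by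
          gcongr
      _ ≤ 80 * (l * x) * (20 * (M * l)) := by gcongr
      _ = 1600 * (M * x * l ^ 2) := by ring
      _ ≤ 1600 * W := by gcongr
  have f2 : Q * (H + 2) ≤ 384 * W := by
    have g1 : Q ≤ 24 * (M * l) := by linarith
    have g2 : H + 2 ≤ 16 * (M * l) := by linarith
    calc Q * (H + 2) ≤ Q * (16 * (M * l)) := by gcongr
      _ ≤ 24 * (M * l) * (16 * (M * l)) := by gcongr
      _ = 384 * (M ^ 2 * l ^ 2) := by ring
      _ ≤ 384 * W := by gcongr
  linarith

/-- The number of calls is bounded outside of the exceptional set. -/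
lemma callId_le (hn : 2 ≤ n) {A : Adversary n} {p₀ : Fin n} {m : ℕ} {ω : Coins}
    (hω : ω ∉ exceptional A p₀ m) (k : ℕ) (p : Fin n) :
    ((config A ω k).callId p : ℝ) ≤ 8 ^ m * (100000000000000 * Real.log n ^ 2) := by
  have hl := le_two_mul_log hn
  set l := Real.log n with hl_def
  have hl0 : 0 < l := by linarith
  have hn0 : (0 : ℝ) < n := by exact_mod_cast (by omega : 0 < n)
  have hx : (1 : ℝ) ≤ 4 ^ m := one_le_pow₀ (by norm_num)
  simp only [exceptional, Set.mem_union, Set.mem_iUnion, Set.mem_ofPred_eq, not_or, not_exists,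
    not_le] at hω
  obtain ⟨h1, hv⟩ := hω
  set c : ℝ := (n : ℝ) ^ 2 * 16 ^ m with hc_def
  have hc : 0 < c := by positivity
  have hlog : Real.log c ≤ 4 * (m + 1 : ℝ) * l := by
    rw [hc_def, Real.log_mul (by positivity) (by positivity), Real.log_pow, Real.log_pow,
      show (16 : ℝ) = 2 ^ 4 by norm_num, Real.log_pow]
    have : Real.log 2 ≤ l := Real.log_le_log (by norm_num) (by exact_mod_cast hn)
    push_cast
    have h2 : (m : ℝ) * (4 * Real.log 2) ≤ m * (4 * l) := by gcongr
    linarith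
  have hf : ∀ k, (1 : ℝ) ≤ (stateAt A p₀ ω k).ghost.free.card + 1 := fun k => by simp
  have hpop : ∀ k v, (((stateAt A p₀ ω k).ghost.picks v).card : ℝ) ≤ 3 * Real.log c := by
    intro k v
    have h2 := (hv v).1.1 k
    have h3 := mul_log_le (by norm_num : (0 : ℝ) < 3 / 2)
      ((le_mul_of_one_le_right (by positivity) (hf k)).trans h2.le)
    -- Here and below, 1 - 1/x ≤ log x gives log(3/2) ≥ 1/3, log(6/5) ≥ 1/6 and log(1000/997) ≥
    -- 3/1000.
    have h4 := Real.one_sub_inv_le_log_of_pos (by norm_num : (0 : ℝ) < 3 / 2)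
    have h5 : (0 : ℝ) ≤ ((stateAt A p₀ ω k).ghost.picks v).card := Nat.cast_nonneg _
    norm_num at h4
    nlinarith
  have hsingle : ∀ k, ((stateAt A p₀ ω k).single.card : ℝ) ≤
      9 * (2 * (l * 4 ^ m)) * ((stateAt A p₀ ω k).ghost.free.card + 1) := by
    intro k
    -- Here a = 2 l 4^m, and its square absorbs the factor 16^m of the threshold; only this square
    -- root makes the bounds exponential in m.
    refine single_le_of_singles_lt (by nlinarith) ((h1 k).le.trans ?_)
    have h16 : (16 : ℝ) ^ m = 4 ^ m * 4 ^ m := by rw [← mul_pow]; norm_num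
    rw [h16]
    have h2 := (singleBound_initial_le hn).2
    have h3 : (0 : ℝ) ≤ l ^ 2 * (4 ^ m * 4 ^ m) := by positivity
    calc _ ≤ 18 * l ^ 2 * (4 ^ m * 4 ^ m) := by gcongr
      _ ≤ _ := by nlinarith
  have hB := bounded_stateAt (A := A) (p₀ := p₀) (ω := ω) (ρ := 9 * (2 * (l * 4 ^ m)))
    (H := ⌊3 * Real.log c⌋₊) (by positivity) hsingle (fun k v => Nat.le_floor (hpop k v)) k p
  have hs : (stateAt A p₀ ω k).sound := (World.good A p₀ ω k).sound
  have hcalls : (config A ω k).callId p = (stateAt A p₀ ω k).tally.calls p := by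
    rw [World.calls_eq, config, World.run_eq A p₀]
  rw [hcalls]
  set a := stateAt A p₀ ω k with ha_def
  have hlc : 0 ≤ Real.log c := by
    have := (Nat.cast_nonneg (a.ghost.picks p).card).trans (hpop k p); linarith
  -- the collisions
  have hcol : (6 / 5 : ℝ) ^ a.tally.crowd p * Real.exp (a.tally.hits p / 5) ≤ c := by
    refine (le_mul_of_one_le_right (by positivity) ?_).trans ((hv p).1.2 k).le
    split_ifs
    · have := hf k; linarith
    · exact hf k
  have hY : a.tally.hits p ≤ 5 * Real.log c := by
    have h2 : Real.exp (a.tally.hits p / 5) ≤ c :=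
      (le_mul_of_one_le_left (Real.exp_nonneg _) (one_le_pow₀ (by norm_num))).trans hcol
    have := (Real.le_log_iff_exp_le hc).2 h2
    linarith
  have hQ : (a.tally.crowd p : ℝ) ≤ 6 * Real.log c := by
    have h2 : (6 / 5 : ℝ) ^ a.tally.crowd p ≤ c :=
      (le_mul_of_one_le_right (by positivity)
        (Real.one_le_exp (div_nonneg hB.hits (by norm_num)))).trans hcol
    have h3 := mul_log_le (by norm_num) h2
    have h4 := Real.one_sub_inv_le_log_of_pos (by norm_num : (0 : ℝ) < 6 / 5)
    have h5 : (0 : ℝ) ≤ a.tally.crowd p := Nat.cast_nonneg _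
    norm_num at h4
    nlinarith
  have hS : (a.tally.halved p : ℝ) ≤ 2 * l := by
    have h2 := mul_log_le (b := 2) (c := n) (by norm_num) (by exact_mod_cast hB.pow_le)
    have h3 := Real.log_two_gt_d9
    have h4 : (0 : ℝ) ≤ a.tally.halved p := Nat.cast_nonneg _
    nlinarith
  have hk : (a.tally.load p : ℝ) ≤ 3 * a.tally.picked p +
      a.tally.crowd p * ((⌊3 * Real.log c⌋₊ : ℝ) + 2) := by exact_mod_cast hB.load
  -- the duration
  obtain ⟨T, hT1, hT2⟩ := Sound.exists_stage_le_factor hs p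
  have hR : ((a.tally.rounds p : ℝ) + T) * (3 / 1000) ≤
      Real.log c + a.tally.load p * 1000000 := by
    have h2 : (1000 / 997 : ℝ) ^ (a.tally.rounds p + T) ≤ c * 1000000 ^ a.tally.load p := by
      have h3 : (1 / 1000000 : ℝ) ^ a.tally.load p * 1000000 ^ a.tally.load p = 1 := by
        rw [← mul_pow]; norm_num
      calc (1000 / 997 : ℝ) ^ (a.tally.rounds p + T)
          = (1000 / 997 : ℝ) ^ a.tally.rounds p * (1 / 1000000) ^ a.tally.load p *
            (1000 / 997) ^ T * 1000000 ^ a.tally.load p := by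
            rw [pow_add]; linear_combination
              (-(1000 / 997 : ℝ) ^ a.tally.rounds p * (1000 / 997) ^ T) * h3
        _ ≤ duration p a * 1000000 ^ a.tally.load p := by unfold duration; gcongr
        _ ≤ _ := by have := ((hv p).2 k).le; gcongr
    have h3 := mul_log_le (by norm_num) h2
    rw [Real.log_mul (by positivity) (by positivity), Real.log_pow] at h3
    have h4 := Real.one_sub_inv_le_log_of_pos (by norm_num : (0 : ℝ) < 1000 / 997)
    have h5 := Real.log_le_self (by norm_num : (0 : ℝ) ≤ 1000000)
    have h6 : (0 : ℝ) ≤ a.tally.load p := Nat.cast_nonneg _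
    have h7 : (0 : ℝ) ≤ (a.tally.rounds p : ℝ) + T := by positivity
    norm_num at h4
    push_cast at h3
    nlinarith
  have hfin : (a.tally.calls p : ℝ) ≤ 10 * a.tally.picked p + 6 * a.tally.rounds p +
      6 * ((T : ℝ) + 1) + 2 := by
    have h2 := hB.calls
    have h3 : a.tally.calls p ≤ 10 * a.tally.picked p + 6 * a.tally.rounds p + 6 * (T + 1) + 2 := by
      omega
    exact_mod_cast h3
  have key := calls_arith hl hx (M := (m : ℝ) + 1) (by simp) hlog hY hQ (Nat.cast_nonneg _)
    (Nat.floor_le (by positivity)) hS hB.picked hk hR hfin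
  refine key.trans ?_
  -- The square comes from products of two bounds by log c ≤ 4(m + 1) l. Together with 4^m it stays
  -- below 4 · 8^m, which the probabilities 6/16^m can sum.
  have hM : ((m : ℝ) + 1) ^ 2 ≤ 4 * 2 ^ m := by exact_mod_cast sq_le_four_mul_two_pow m
  have h8 : (8 : ℝ) ^ m = 2 ^ m * 4 ^ m := by rw [← mul_pow]; norm_num
  calc 20000000000000 * (((m : ℝ) + 1) ^ 2 * 4 ^ m * l ^ 2)
      ≤ 20000000000000 * (4 * 2 ^ m * 4 ^ m * l ^ 2) := by gcongr
    _ ≤ 25000000000000 * (4 * 2 ^ m * 4 ^ m * l ^ 2) := by gcongr; norm_num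
    _ = _ := by rw [h8]; ring

/-- The completion time outside of the exceptional set. -/
lemma completionTime_le (hn : 2 ≤ n) {A : Adversary n} {p₀ : Fin n} {m : ℕ} {ω : Coins}
    {t₁ t₂ : ℝ≥0} (hA : Admissible A ω t₁ t₂) (hω : ω ∉ exceptional A p₀ m) :
    completionTime A ω ≤
      ENNReal.ofReal (8 ^ m * (300000000000000 * Real.log n ^ 2 * (t₁ + t₂))) := by
  have hl := le_two_mul_log hn
  set B : ℝ := 8 ^ m * (100000000000000 * Real.log n ^ 2) with hB
  have hB1 : 1 ≤ B := by
    have h1 : (1 : ℝ) ≤ 8 ^ m := one_le_pow₀ (by norm_num)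
    have h2 : 1 ≤ 100000000000000 * Real.log n ^ 2 := by nlinarith
    exact one_le_mul_of_one_le_of_one_le h1 h2
  refine iSup₂_le fun p hp => ?_
  refine (returnTime_le hA hp (J := ⌊B⌋₊) fun k => Nat.le_floor (callId_le hn hω k p)).trans ?_
  rw [← ENNReal.ofReal_coe_nnreal]
  refine ENNReal.ofReal_le_ofReal ?_
  push_cast
  have h3 := Nat.floor_le (by linarith : 0 ≤ B)
  calc (2 * (⌊B⌋₊ : ℝ) + 1) * ((t₁ : ℝ) + t₂) ≤ (3 * B) * (t₁ + t₂) := by gcongr; linarith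
    _ = _ := by rw [hB]; ring

theorem timeComplexityAtMost (hn : 2 ≤ n) :
    TimeComplexityAtMost n (30000000000000000 * Real.log n ^ 2) := by
  intro t₁ t₂ A hA
  have hp₀ : 0 < n := by omega
  refine (lintegral_le_of_tail (E := exceptional A ⟨0, hp₀⟩)
    (B := 300000000000000 * Real.log n ^ 2 * (t₁ + t₂)) (by positivity)
    (measure_exceptional_le hn A ⟨0, hp₀⟩) ?_).trans (ENNReal.ofReal_le_ofReal ?_)
  · filter_upwards [hA] with ω hω m hm
    exact completionTime_le hn hω hm
  · have : (0 : ℝ) ≤ Real.log n ^ 2 * (t₁ + t₂) := by positivity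
    linarith

end Renaming

end

theorem mainTheorem2 :
    ∃ C : ℝ, 0 < C ∧ ∀ n : ℕ, 2 ≤ n →
      Renaming.TimeComplexityAtMost n (C * Real.log n ^ 2) :=
  ⟨_, by norm_num, fun _ hn => Renaming.timeComplexityAtMost hn⟩
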